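/- Let $L=L_1\cup\dots\cup L_n\subset\mathbb R^3\subset S^3=\mathbb R^3\cup\{\infty\}$ be an oriented (polygonal) link whose projection $D$ to the plane $\mathbb R^2=\{z=0\}$ is regular: it has only finitely many multiple points, and these are transverse double points, none of them the image of a vertex. Let the regions, that is, the components of $(\mathbb R^2\cup\{\infty\})\setminus D$, be checkerboard coloured: each is white or black, and regions that share an edge of $D$ have different colours. Let $L_i$ be a component along which the projection alternates: travelling around $L_i$, one passes alternately over and under at the successive crossings (this holds for all $i$ if $D$ is an alternating diagram). Let $N_i$ be a closed tubular neighbourhood of $L_i$ that misses the other components. An $i$-th longitude $\lambda_i$ is a simple closed curve on $\partial N_i$ that is homologous to $L_i$ in $N_i$ and null-homologous in $S^3-L_i$. We say that a curve $J\subset S^3$ *is readable* if it meets $\mathbb R^2\cup\{\infty\}$ only finitely often and meets none of the vertical segments that join the points of $L$ to their projections in $\mathbb R^2$. (So $J$ lies in $S^3-L$, meets $\mathbb R^2\cup\{\infty\}$ only in regions, and does not slip through the gap between the two strands of a crossing.) 1. Every $i$-th longitude $\lambda_i$ is freely homotopic in $S^3-L$ to a readable simple closed curve $J$ such that, for a suitable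 base point of $J$, and in the orientation of $J$ given by $\lambda_i$, all intersections of $J$ with white regions occur before any intersections with black regions. 2. The homotopy can be taken to fix the base point when the longitude runs close to $L_i$: there is an open set $U\supset L_i$ such that, if $N_i\subset U$ and $\lambda_i\subset\partial N_i$ is an $i$-th longitude with a base point $q\in\lambda_i$ that lies neither in $\mathbb R^2\cup\{\infty\}$ nor on one of the vertical segments above, then $\lambda_i$ is homotopic in $S^3-L$, through closed curves based at $q$, to a readable simple closed curve $J$ based at $q$ on which, starting from $q$, all intersections with white regions occur before any intersections with black regions. -/

import Mathlib

open scoped unitInterval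

noncomputable section

namespace LinkProj

/-- Euclidean 3-space, written as (projection plane) × (height). -/
abbrev Space : Type := (ℝ × ℝ) × ℝ

/-- The 3-sphere, as the one-point compactification of 3-space. -/
abbrev S3 : Type := OnePoint Space

/-! ### Curves, homotopy and first homology -/

/-- A simple closed curve, parametrized from its base point `f 0 = f 1`. -/
def IsSimpleClosed {X : Type*} [TopologicalSpace X] (f : C(I, X)) : Prop :=
  f 0 = f 1 ∧ ∀ s t : I, f s = f t → s = t ∨ (s = 0 ∧ t = 1) ∨ (s = 1 ∧ t = 0)

/-- Closed curves `f` and `g` are freely homotopic inside `A` (through closed curves in `A`). -/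
def FreelyHomotopicIn {X : Type*} [TopologicalSpace X] (A : Set X) (f g : C(I, X)) : Prop :=
  ContinuousMap.HomotopicWith f g (fun k => k 0 = k 1 ∧ ∀ t, k t ∈ A)

/-- Closed curves `f` and `g` with the same base point `q` are homotopic inside `A` through closed
curves based at `q`. -/
def BasedHomotopicIn {X : Type*} [TopologicalSpace X] (A : Set X) (q : X) (f g : C(I, X)) : Prop :=
  ContinuousMap.HomotopicWith f g (fun k => k 0 = q ∧ k 1 = q ∧ ∀ t, k t ∈ A)

/-- The edge of the standard 2-simplex from the vertex `a` to the vertex `b`. -/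
def simplexEdge (a b : Fin 3) : C(I, stdSimplex ℝ (Fin 3)) where
  toFun t := ⟨(1 - (t : ℝ)) • Pi.single a 1 + (t : ℝ) • Pi.single b 1,
    convex_stdSimplex ℝ (Fin 3) (single_mem_stdSimplex ℝ a) (single_mem_stdSimplex ℝ b)
      (sub_nonneg.2 t.2.2) t.2.1 (sub_add_cancel _ _)⟩
  continuous_toFun := by
    refine Continuous.subtype_mk ?_ _
    fun_prop

/-- The boundary of a singular 2-simplex, a singular 1-chain. -/
def boundary₂ {X : Type*} [TopologicalSpace X] (s : C(stdSimplex ℝ (Fin 3), X)) : C(I, X) →₀ ℤ :=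
  Finsupp.single (s.comp (simplexEdge 1 2)) 1 - Finsupp.single (s.comp (simplexEdge 0 2)) 1
    + Finsupp.single (s.comp (simplexEdge 0 1)) 1

/-- The group of singular 1-boundaries of the subspace `A` of `X`. -/
def boundaries {X : Type*} [TopologicalSpace X] (A : Set X) : AddSubgroup (C(I, X) →₀ ℤ) :=
  AddSubgroup.closure {c | ∃ s : C(stdSimplex ℝ (Fin 3), X), (∀ p, s p ∈ A) ∧ c = boundary₂ s}

/-- The closed curves `f` and `g` represent the same class of the first homology of `A`. -/
def HomologousIn {X : Type*} [TopologicalSpace X] (A : Set X) (f g : C(I, X)) : Prop :=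
  Finsupp.single f 1 - Finsupp.single g 1 ∈ boundaries A

/-- The closed curve `f` represents zero in the first homology of `A`. -/
def NullHomologousIn {X : Type*} [TopologicalSpace X] (A : Set X) (f : C(I, X)) : Prop :=
  Finsupp.single f 1 ∈ boundaries A

/-! ### Links -/

/-- An oriented polygonal link in 3-space with components indexed by `Fin n`. The component `i` is
run through by the periodic curve `curve i`, with vertices at the integers, straight edges in
between, and period the number of edges. -/
structure PolyLink (n : ℕ) where
  /-- number of edges of each component -/
  edges : Fin n → ℕ
  edges_pos : ∀ i, 0 < edges i
  /-- periodic parametrization of each component -/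
  curve : Fin n → C(ℝ, Space)
  periodic : ∀ i s, curve i (s + edges i) = curve i s
  straight : ∀ i (k : ℤ), ∀ t ∈ Set.Icc (0 : ℝ) 1,
    curve i (k + t) = (1 - t) • curve i k + t • curve i (k + 1)
  embedded : ∀ i j s u, curve i s = curve j u → i = j ∧ ∃ k : ℤ, u = s + k * edges i

namespace PolyLink

variable {n : ℕ} (L : PolyLink n)

/-- The component `L_i` as a subset of the 3-sphere. -/
def component (i : Fin n) : Set S3 := {x | ∃ s, x = ((L.curve i s : Space) : S3)}

/-- The link as a subset of the 3-sphere. -/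
def carrier : Set S3 := ⋃ i, L.component i

/-- The component `L_i` as an oriented closed curve, run through once. -/
def componentLoop (i : Fin n) : C(I, S3) where
  toFun t := ((L.curve i ((t : ℝ) * L.edges i) : Space) : S3)
  continuous_toFun := OnePoint.continuous_coe.comp (by fun_prop)

/-- The strands at `(i, s)` and `(j, u)` cross: these are different points of the link with the
same image in the projection plane. -/
def Cross (i : Fin n) (s : ℝ) (j : Fin n) (u : ℝ) : Prop :=
  (L.curve i s).1 = (L.curve j u).1 ∧ L.curve i s ≠ L.curve j u

/-- Travelling along the component `i`, one is at a crossing at time `s`. -/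
def AtCrossing (i : Fin n) (s : ℝ) : Prop := ∃ j u, L.Cross i s j u

/-- Travelling along the component `i`, one passes over another strand at time `s`. -/
def PassesOver (i : Fin n) (s : ℝ) : Prop :=
  ∃ j u, L.Cross i s j u ∧ (L.curve j u).2 < (L.curve i s).2

/-- The projection to the plane is regular: there are only finitely many multiple points, they are
double points, and none of them is the image of a vertex. (Since the edges are straight, the two
strands at a double point then cross transversally.) -/
structure IsRegular : Prop where
  finite : {x : ℝ × ℝ | ∃ i s, (L.curve i s).1 = x ∧ L.AtCrossing i s}.Finite
  double : ∀ i s j u k v, L.Cross i s j u → L.Cross i s k v → L.curve j u = L.curve k v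
  vertex : ∀ i (k : ℤ), ¬ L.AtCrossing i k

/-- The projection alternates along the component `i`: travelling around this component, one
passes alternately over and under. -/
def AlternatesAlong (i : Fin n) : Prop :=
  ∀ s s' : ℝ, s < s' → L.AtCrossing i s → L.AtCrossing i s' →
    (∀ r, s < r → r < s' → ¬ L.AtCrossing i r) → (L.PassesOver i s ↔ ¬ L.PassesOver i s')

/-! ### Regions and checkerboard colourings -/

end PolyLink

/-- The projection sphere: the plane of height zero together with the point at infinity. -/
def projSphere : Set S3 := {x | x = OnePoint.infty ∨ ∃ p : ℝ × ℝ, x = (((p, (0 : ℝ)) : Space) : S3)}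

/-- The two colours. -/
inductive Colour
  | white
  | black

namespace PolyLink

variable {n : ℕ} (L : PolyLink n)

/-- The image in the projection plane of the point at time `s` of the component `i`. -/
def shadowPt (i : Fin n) (s : ℝ) : S3 := ((((L.curve i s).1, (0 : ℝ)) : Space) : S3)

/-- The projection of the link, as a subset of the projection sphere. -/
def shadow : Set S3 := {x | ∃ i s, x = L.shadowPt i s}

/-- The regions of the projection; the unbounded one contains the point at infinity. -/
def IsRegion (R : Set S3) : Prop :=
  ∃ x ∈ projSphere \ L.shadow, R = connectedComponentIn (projSphere \ L.shadow) x

/-- Two different regions are adjacent if they lie along a common edge of the projection, that is,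
if their closures share a point of the projection that is not a crossing. -/
def Adjacent (R R' : Set S3) : Prop :=
  R ≠ R' ∧ ∃ i s, ¬ L.AtCrossing i s ∧ L.shadowPt i s ∈ closure R ∩ closure R'

/-- `col` (of which only the values on regions matter) is a checkerboard colouring. -/
def IsCheckerboard (col : Set S3 → Colour) : Prop :=
  ∀ R R', L.IsRegion R → L.IsRegion R' → L.Adjacent R R' → col R ≠ col R'

/-- The union of the vertical segments that join the points of the link to their images in the
projection plane. It contains the link and its projection. -/
def curtain : Set S3 :=
  {x | ∃ i s z, z ∈ Set.uIcc 0 (L.curve i s).2 ∧ x = ((((L.curve i s).1, z) : Space) : S3)}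

/-- The curve `J` can be read through the regions: it meets the projection sphere finitely often
and never slips between a strand of the link and the image of this strand in the projection plane.
So `J` misses the link, meets the projection sphere only inside regions, and is determined up to
homotopy by its base point and the word of the regions it passes through. (Without this condition,
`J` could run through the gap between the two strands of a crossing without meeting a region.) -/
def IsReadable (J : C(I, S3)) : Prop :=
  (∀ t, J t ∉ L.curtain) ∧ {t | J t ∈ projSphere}.Finite

/-- Starting at its base point, `J` meets all white regions before any black region. -/
def WhiteBeforeBlack (col : Set S3 → Colour) (J : C(I, S3)) : Prop :=
  ∀ R R', L.IsRegion R → L.IsRegion R' → col R = Colour.white → col R' = Colour.black →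
    ∀ s t : I, J s ∈ R → J t ∈ R' → s < t

/-! ### Tubular neighbourhoods and longitudes -/

end PolyLink

/-- The solid torus (circle) × (closed unit disc). -/
abbrev SolidTorus : Type := Circle × Metric.closedBall (0 : ℂ) 1

namespace PolyLink

variable {n : ℕ} (L : PolyLink n)

/-- The image of `h` is a closed tubular neighbourhood of the component `i`: an embedded solid
torus with core `L_i` which misses the other components. -/
def IsTube (i : Fin n) (h : C(SolidTorus, S3)) : Prop :=
  Function.Injective h ∧ {x | ∃ p : SolidTorus, (p.2 : ℂ) = 0 ∧ h p = x} = L.component i ∧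
    ∀ j, j ≠ i → Disjoint (Set.range h) (L.component j)

/-- `l` is a longitude of the component `i` on the boundary of the tubular neighbourhood `h`:
a simple closed curve on the boundary torus, homologous to `L_i` in the tubular neighbourhood and
null-homologous in the complement of `L_i`. -/
def IsLongitude (i : Fin n) (h : C(SolidTorus, S3)) (l : C(I, S3)) : Prop :=
  IsSimpleClosed l ∧ (∀ t, ∃ p : SolidTorus, ‖(p.2 : ℂ)‖ = 1 ∧ h p = l t) ∧
    HomologousIn (Set.range h) l (L.componentLoop i) ∧ NullHomologousIn (L.component i)ᶜ l

end PolyLink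

end LinkProj

end

/-!
Near the component `L_i`, points are described by a time `s` and a displacement `w ∈ ℂ`, of which
the real part is measured along a planar field transverse to the projection (pointing along the
other strand at crossings), and the imaginary part vertically (`TransverseField.tube`). After the
tubular neighbourhood is shrunk, a longitude becomes a loop in such a tube that runs around once and
winds some number `m` of times around `L_i` (`IsLongitude.exists_loop`). Loops in the tube with the
same `m` are homotopic off the link (`IsThin.exists_loop_homotopy`), so it suffices to find one of
them that can be deformed to a curve with the required properties.

The readable curves (`Track`) follow `L_i` alternately at a great height and at a great depth, so
that they are above the plane where `L_i` passes over and below the plane where `L_i` passes under.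
By alternation, they change their level exactly once between consecutive crossings, `2c` times in
all if `L_i` passes under `c` times. At each change the curve makes a half turn around `L_i` in one
of the two directions, and it crosses the plane to the left or to the right of `L_i`. It is
obtained by a vertical deformation from a curve in the tube, and this deformation avoids the link
(`Track.basedHomotopicIn`).

At successive changes the curve goes alternately up and down, and the colours to the left and to the
right of `L_i` are interchanged at the crossing in between (`TransverseField.col_cross`). Therefore
the direction of a half turn alone decides the colour of the region through which the curve passes
(`LevelChanges.exists_white_side`). With the first `k` half turns in the direction of the
white regions and the others in the opposite direction, the white regions are met first, and the
winding number is `±(k - c)`. So every `m` with `|m| ≤ c` occurs (`IsRegular.exists_track`).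

The bound `|m| ≤ c` comes from the linking number zero of a longitude and `L_i`. Linking numbers are
winding numbers of a function on the 3-sphere with zero set `L_i` (`linkFun`), a product of the
`2 × 2` matrices `‖u‖ + u·σ` along the vertices; logarithmic increments are additive on
singular chains, which connects them with homology (`pathChange_of_homologous`). The linking number
of the longitude is `m` plus that of a vertical pushoff of `L_i`
(`TransverseField.exists_torus_constants`, `TransverseField.exists_meridian`). The latter is at most
`c` in absolute value, as the pushoff can be raised to a great height, where it is unlinked from
`L_i`, by passing it through `L_i` at the undercrossings (`IsRegular.norm_logChange_pushoff_le`).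
-/

open scoped unitInterval

noncomputable section

namespace LinkProj

/-! ### Logarithmic increments of nonvanishing functions -/

open Complex in
theorem exists_continuousOn_log {E : Type*} [NormedAddCommGroup E] [NormedSpace ℝ E] {C : Set E}
    (hC : Convex ℝ C) {g : E → ℂ} (hg : ContinuousOn g C) (h0 : ∀ x ∈ C, g x ≠ 0) :
    ∃ f : E → ℂ, ContinuousOn f C ∧ ∀ x ∈ C, exp (f x) = g x := by
  classical
  rcases C.eq_empty_or_nonempty with rfl | hne
  · exact ⟨fun _ => 0, continuousOn_empty _, by simp⟩
  have : ContractibleSpace C := hC.contractibleSpace hne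
  have : LocallyPathConnectedSpace C := hC.locallyPathConnectedSpace
  obtain ⟨x₀, hx₀⟩ := hne
  obtain ⟨f, ⟨-, hf⟩, -⟩ := isCoveringMapOn_exp.existsUnique_continuousMap_lifts
    (⟨C.domRestrict g, continuousOn_iff_continuous_domRestrict.mp hg⟩ : C(C, ℂ))
    (a₀ := ⟨x₀, hx₀⟩) (e₀ := log (g x₀)) (exp_log (h0 _ hx₀)) (fun x => h0 _ x.2)
  obtain ⟨F, hF⟩ : ∃ F : E → ℂ, ∀ z : C, F z = f z :=
    ⟨fun z ↦ if hz : z ∈ C then f ⟨z, hz⟩ else 0, by simp⟩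
  refine ⟨F, ?_, fun x hx => ?_⟩
  · rw [continuousOn_iff_continuous_domRestrict]
    convert! map_continuous f
    ext z
    exact hF z
  · rw [hF ⟨x, hx⟩]
    exact congrFun hf ⟨x, hx⟩

/-- Two continuous logarithms of the same function on a preconnected set differ by a constant. -/
theorem log_sub_log_const {X : Type*} [TopologicalSpace X] {C : Set X} (hC : IsPreconnected C)
    {f g : X → ℂ} (hf : ContinuousOn f C) (hg : ContinuousOn g C)
    (h : ∀ x ∈ C, Complex.exp (f x) = Complex.exp (g x)) {x y : X} (hx : x ∈ C) (hy : y ∈ C) :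
    f x - g x = f y - g y := by
  have hT : ∀ x ∈ C, (f x - g x) ∈ Set.range (fun k : ℤ => (k : ℂ) * (2 * Real.pi * Complex.I)) :=
      by
    intro x hx
    obtain ⟨k, hk⟩ := Complex.exp_eq_exp_iff_exists_int.1 (h x hx)
    exact ⟨k, by simp [hk]⟩
  have hd : IsDiscrete (Set.range (fun k : ℤ => (k : ℂ) * (2 * Real.pi * Complex.I))) := by
    refine ⟨?_⟩
    have hpi : (2 * (Real.pi : ℂ) * Complex.I) ≠ 0 := by simp [Real.pi_ne_zero]
    have he : Topology.IsEmbedding (fun k : ℤ => (k : ℂ) * (2 * Real.pi * Complex.I)) :=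
      ((Homeomorph.mulRight₀ _ hpi).isEmbedding).comp
        (Complex.isometry_intCast.isEmbedding)
    exact he.toHomeomorph.symm.isEmbedding.discreteTopology
  exact hC.constant_of_mapsTo hd (hf.sub hg) hT hx hy

/-- The increment along `[a, b]` of a continuous logarithm of the nonvanishing function `c`. -/
def logChange (c : ℝ → ℂ) (a b : ℝ) : ℂ :=
  open Classical in
  if h : ∃ f : ℝ → ℂ, ContinuousOn f (Set.Icc a b) ∧ ∀ s ∈ Set.Icc a b, Complex.exp (f s) = c s
  then h.choose b - h.choose a else 0

theorem logChange_eq {c f : ℝ → ℂ} {a b : ℝ} (hab : a ≤ b) (hf : ContinuousOn f (Set.Icc a b))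
    (h : ∀ s ∈ Set.Icc a b, Complex.exp (f s) = c s) : logChange c a b = f b - f a := by
  have hex : ∃ f : ℝ → ℂ, ContinuousOn f (Set.Icc a b) ∧
    ∀ s ∈ Set.Icc a b, Complex.exp (f s) = c s := ⟨f, hf, h⟩
  unfold logChange
  rw [dif_pos hex]
  have := log_sub_log_const isPreconnected_Icc hex.choose_spec.1 hf
    (fun x hx => (hex.choose_spec.2 x hx).trans (h x hx).symm)
    (Set.left_mem_Icc.2 hab) (Set.right_mem_Icc.2 hab)
  linear_combination -this

theorem exists_log_Icc {c : ℝ → ℂ} {a b : ℝ} (hc : ContinuousOn c (Set.Icc a b))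
    (h0 : ∀ s ∈ Set.Icc a b, c s ≠ 0) : ∃ f : ℝ → ℂ, ContinuousOn f (Set.Icc a b) ∧
      ∀ s ∈ Set.Icc a b, Complex.exp (f s) = c s :=
  exists_continuousOn_log (convex_Icc a b) hc h0

theorem logChange_congr {c d : ℝ → ℂ} {a b : ℝ} (hab : a ≤ b) (h : ∀ s ∈ Set.Icc a b, c s = d s) :
    logChange c a b = logChange d a b := by
  by_cases hex : ∃ f : ℝ → ℂ, ContinuousOn f (Set.Icc a b) ∧
    ∀ s ∈ Set.Icc a b, Complex.exp (f s) = c s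
  · obtain ⟨f, hf, hf'⟩ := hex
    rw [logChange_eq hab hf hf', logChange_eq hab hf (fun s hs => (hf' s hs).trans (h s hs))]
  · have hex' : ¬ ∃ f : ℝ → ℂ, ContinuousOn f (Set.Icc a b) ∧
      ∀ s ∈ Set.Icc a b, Complex.exp (f s) = d s := fun ⟨f, hf, hf'⟩ =>
        hex ⟨f, hf, fun s hs => (hf' s hs).trans (h s hs).symm⟩
    rw [logChange, logChange, dif_neg hex, dif_neg hex']

theorem logChange_add {c : ℝ → ℂ} {a b d : ℝ} (hab : a ≤ b) (hbd : b ≤ d)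
    (hc : ContinuousOn c (Set.Icc a d)) (h0 : ∀ s ∈ Set.Icc a d, c s ≠ 0) :
    logChange c a b + logChange c b d = logChange c a d := by
  obtain ⟨f, hf, h⟩ := exists_log_Icc hc h0
  rw [logChange_eq (hab.trans hbd) hf h,
    logChange_eq hab (hf.mono (Set.Icc_subset_Icc_right hbd))
      (fun s hs => h s (Set.Icc_subset_Icc_right hbd hs)),
    logChange_eq hbd (hf.mono (Set.Icc_subset_Icc_left hab))
      (fun s hs => h s (Set.Icc_subset_Icc_left hab hs))]
  ring

theorem logChange_mul {c d : ℝ → ℂ} {a b : ℝ} (hab : a ≤ b)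
    (hc : ContinuousOn c (Set.Icc a b)) (h0 : ∀ s ∈ Set.Icc a b, c s ≠ 0)
    (hd : ContinuousOn d (Set.Icc a b)) (h0' : ∀ s ∈ Set.Icc a b, d s ≠ 0) :
    logChange (fun s => c s * d s) a b = logChange c a b + logChange d a b := by
  obtain ⟨f, hf, h⟩ := exists_log_Icc hc h0
  obtain ⟨g, hg, h'⟩ := exists_log_Icc hd h0'
  rw [logChange_eq hab hf h, logChange_eq hab hg h', logChange_eq (f := fun s => f s + g s) hab
    (hf.add hg) (fun s hs => by rw [Complex.exp_add, h s hs, h' s hs])]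
  ring

theorem logChange_slit {c : ℝ → ℂ} {a b : ℝ} (hab : a ≤ b)
    (hc : ContinuousOn c (Set.Icc a b)) (h0 : ∀ s ∈ Set.Icc a b, c s ∈ Complex.slitPlane) :
    logChange c a b = Complex.log (c b) - Complex.log (c a) :=
  logChange_eq hab (hc.clog h0)
    (fun s hs => Complex.exp_log (Complex.slitPlane_ne_zero (h0 s hs)))

theorem logChange_neg {c : ℝ → ℂ} {a b : ℝ} (hab : a ≤ b) (hc : ContinuousOn c (Set.Icc a b))
    (h0 : ∀ s ∈ Set.Icc a b, c s ≠ 0) :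
    logChange (fun s => - c s) a b = logChange c a b := by
  obtain ⟨f, hf, h⟩ := exists_log_Icc hc h0
  rw [logChange_eq hab hf h, logChange_eq (f := fun s => f s + Real.pi * Complex.I) hab
    (hf.add continuousOn_const) (fun s hs => by
      rw [Complex.exp_add, h s hs, Complex.exp_pi_mul_I]; ring)]
  ring

/-- The logarithmic increment of a closed curve is invariant under homotopy. -/
theorem logChange_homotopy {H : ℝ × ℝ → ℂ} {a b : ℝ} (hab : a ≤ b)
    (hH : ContinuousOn H (Set.Icc 0 1 ×ˢ Set.Icc a b))
    (h0 : ∀ x ∈ Set.Icc (0 : ℝ) 1 ×ˢ Set.Icc a b, H x ≠ 0)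
    (hcl : ∀ t ∈ Set.Icc (0 : ℝ) 1, H (t, a) = H (t, b)) :
    logChange (fun s => H (0, s)) a b = logChange (fun s => H (1, s)) a b := by
  obtain ⟨f, hf, h⟩ := exists_continuousOn_log ((convex_Icc (0 : ℝ) 1).prod (convex_Icc a b)) hH h0
  have ha := Set.left_mem_Icc.2 hab
  have hb := Set.right_mem_Icc.2 hab
  have hz : (0 : ℝ) ∈ Set.Icc (0 : ℝ) 1 := by simp
  have ho : (1 : ℝ) ∈ Set.Icc (0 : ℝ) 1 := by simp
  have hsl : ∀ t ∈ Set.Icc (0 : ℝ) 1,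
      logChange (fun s => H (t, s)) a b = f (t, b) - f (t, a) := fun t ht =>
    logChange_eq (f := fun s => f (t, s)) hab
      (hf.comp (by fun_prop) (fun s hs => ⟨ht, hs⟩)) (fun s hs => h _ ⟨ht, hs⟩)
  rw [hsl 0 hz, hsl 1 ho]
  refine log_sub_log_const (C := Set.Icc (0 : ℝ) 1) (f := fun t => f (t, b))
    (g := fun t => f (t, a)) isPreconnected_Icc
    (hf.comp (by fun_prop) (fun s hs => ⟨hs, hb⟩)) (hf.comp (by fun_prop) (fun s hs => ⟨hs, ha⟩))
    (fun t ht => ?_) hz ho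
  rw [h _ ⟨ht, hb⟩, h _ ⟨ht, ha⟩, hcl t ht]

/-- The logarithmic increment over a period does not depend on where the period starts. -/
theorem logChange_period {c : ℝ → ℂ} {E : ℝ} (hE : 0 ≤ E) (hc : Continuous c) (h0 : ∀ s, c s ≠ 0)
    (hp : ∀ s, c (s + E) = c s) (a b : ℝ) : logChange c a (a + E) = logChange c b (b + E) := by
  obtain ⟨f, hf, h⟩ := exists_continuousOn_log (convex_univ (E := ℝ) (𝕜 := ℝ)) hc.continuousOn
    (fun s _ => h0 s)
  have hf' : Continuous f := continuousOn_univ.1 hf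
  rw [logChange_eq (by linarith) hf'.continuousOn (fun s _ => h s trivial),
    logChange_eq (by linarith) hf'.continuousOn (fun s _ => h s trivial)]
  refine log_sub_log_const (C := Set.univ) (f := fun s => f (s + E)) (g := f) isPreconnected_univ
    (by fun_prop) hf (fun s _ => ?_) trivial trivial
  rw [h _ trivial, h _ trivial, hp]

theorem log_neg_of_im_pos {z : ℂ} (h : 0 < z.im) :
    Complex.log (-z) = Complex.log z - Real.pi * Complex.I := by
  apply Complex.ext
  · simp [Complex.log_re]
  · simp [Complex.log_im, Complex.arg_neg_eq_arg_sub_pi_of_im_pos h]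

theorem log_neg_of_im_neg {z : ℂ} (h : z.im < 0) :
    Complex.log (-z) = Complex.log z + Real.pi * Complex.I := by
  apply Complex.ext
  · simp [Complex.log_re]
  · simp [Complex.log_im, Complex.arg_neg_eq_arg_add_pi_of_im_neg h]

/-- Of two curves from one open half plane (upper or lower) to the other, one through the positive
and one through the negative reals, the logarithmic increments differ by a full turn. -/
theorem logChange_sub_of_two_sides {u v : ℝ → ℂ} {a b κ : ℝ} (hab : a ≤ b) (hκ : κ = 1 ∨ κ = -1)
    (hv : ContinuousOn v (Set.Icc a b)) (hu : ContinuousOn u (Set.Icc a b))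
    (hvs : ∀ s ∈ Set.Icc a b, v s ∈ Complex.slitPlane)
    (hus : ∀ s ∈ Set.Icc a b, -u s ∈ Complex.slitPlane) (ha : u a = v a) (hb : u b = v b)
    (hia : κ * (v a).im < 0) (hib : 0 < κ * (v b).im) :
    logChange v a b - logChange u a b = κ * (2 * Real.pi * Complex.I) := by
  have hu0 : ∀ s ∈ Set.Icc a b, u s ≠ 0 := fun s hs =>
    neg_ne_zero.1 (Complex.slitPlane_ne_zero (hus s hs))
  rw [← logChange_neg hab hu hu0, logChange_slit hab hv hvs,
      logChange_slit (c := fun s => -u s) hab hu.neg hus, ha, hb]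
  rcases hκ with rfl | rfl
  · rw [log_neg_of_im_pos (z := v b) (by linarith), log_neg_of_im_neg (z := v a) (by linarith)]
    push_cast; ring
  · rw [log_neg_of_im_neg (z := v b) (by linarith), log_neg_of_im_pos (z := v a) (by linarith)]
    push_cast; ring

/-- A closed curve that meets the negative real axis exactly once, crossing it there, turns around
the origin once. -/
theorem logChange_of_cross {c : ℝ → ℂ} {a b τ ε κ : ℝ} (haτ : a < τ) (hτb : τ < b)
    (hκ : κ = 1 ∨ κ = -1) (hc : ContinuousOn c (Set.Icc a b))
    (hs : ∀ s ∈ Set.Icc a b, s ≠ τ → c s ∈ Complex.slitPlane) (hcl : c a = c b)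
    (hre : (c τ).re < 0) (hε : 0 < ε)
    (hl : ∀ s ∈ Set.Icc a b, τ - ε < s → s < τ → 0 < κ * (c s).im)
    (hr : ∀ s ∈ Set.Icc a b, τ < s → s < τ + ε → κ * (c s).im < 0) :
    logChange c a b = κ * (2 * Real.pi * Complex.I) := by
  have hτ : Set.Icc a b ∈ nhds τ := Icc_mem_nhds haτ hτb
  have hct : ContinuousAt c τ := hc.continuousAt hτ
  have hev : ∀ᶠ s in nhds τ, (c s).re < 0 :=
    (Complex.continuous_re.continuousAt.comp hct).eventually (gt_mem_nhds hre)
  obtain ⟨η, hη, hball⟩ := Metric.eventually_nhds_iff.1 (hev.and hτ)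
  set d := min (η / 2) (ε / 2) with hd
  have hd0 : 0 < d := by positivity
  have hdη : d < η := by have := min_le_left (η / 2) (ε / 2); linarith
  have hdε : d < ε := by have := min_le_right (η / 2) (ε / 2); linarith
  have hm : ∀ s ∈ Set.Icc (τ - d) (τ + d), (c s).re < 0 ∧ s ∈ Set.Icc a b := fun s hs =>
    hball (by rw [Real.dist_eq, abs_lt]; constructor <;> linarith [hs.1, hs.2])
  have h1 := (hm (τ - d) ⟨le_rfl, by linarith⟩).2
  have h2 := (hm (τ + d) ⟨by linarith, le_rfl⟩).2
  have h0 : ∀ s ∈ Set.Icc a b, c s ≠ 0 := fun s hs' => by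
    by_cases h : s = τ
    · rintro h'
      rw [← h, h'] at hre
      simp at hre
    · exact Complex.slitPlane_ne_zero (hs s hs' h)
  have hsub1 : Set.Icc a (τ - d) ⊆ Set.Icc a b := Set.Icc_subset_Icc_right h1.2
  have hsub2 : Set.Icc (τ - d) (τ + d) ⊆ Set.Icc a b := fun s hs => (hm s hs).2
  have hsub3 : Set.Icc (τ + d) b ⊆ Set.Icc a b := Set.Icc_subset_Icc_left h2.1
  have hsub4 : Set.Icc a (τ + d) ⊆ Set.Icc a b := Set.Icc_subset_Icc_right h2.2
  rw [← logChange_add (b := τ + d) h2.1 h2.2 hc h0,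
    ← logChange_add (b := τ - d) h1.1 (by linarith) (hc.mono hsub4) (fun s hs => h0 s (hsub4 hs)),
    logChange_slit h1.1 (hc.mono hsub1) (fun s hs' => hs s (hsub1 hs') (by linarith [hs'.2])),
    logChange_slit h2.2 (hc.mono hsub3) (fun s hs' => hs s (hsub3 hs') (by linarith [hs'.1])),
    ← logChange_neg (by linarith) (hc.mono hsub2) (fun s hs => h0 s (hsub2 hs)),
    logChange_slit (c := fun s => -c s) (by linarith) (hc.mono hsub2).neg
      (fun s hs' => Or.inl (by simpa using (hm s hs').1)), hcl]
  have i1 := hl (τ - d) h1 (by linarith) (by linarith)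
  have i2 := hr (τ + d) h2 (by linarith) (by linarith)
  rcases hκ with rfl | rfl
  · rw [log_neg_of_im_neg (z := c (τ + d)) (by linarith),
      log_neg_of_im_pos (z := c (τ - d)) (by linarith)]
    push_cast; ring
  · rw [log_neg_of_im_pos (z := c (τ + d)) (by linarith),
      log_neg_of_im_neg (z := c (τ - d)) (by linarith)]
    push_cast; ring

/-- The logarithmic increment of a nonvanishing function along a path in a convex set depends only on
the endpoints of the path. -/
theorem logChange_comp_convex {E : Type*} [NormedAddCommGroup E] [NormedSpace ℝ E] {C : Set E}
    (hC : Convex ℝ C) {g : E → ℂ} (hg : ContinuousOn g C) (h0 : ∀ x ∈ C, g x ≠ 0)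
    {k k' : ℝ → E} {a b a' b' : ℝ} (hab : a ≤ b) (hab' : a' ≤ b')
    (hk : ContinuousOn k (Set.Icc a b)) (hkC : ∀ s ∈ Set.Icc a b, k s ∈ C)
    (hk' : ContinuousOn k' (Set.Icc a' b')) (hkC' : ∀ s ∈ Set.Icc a' b', k' s ∈ C)
    (h1 : k a = k' a') (h2 : k b = k' b') :
    logChange (fun s => g (k s)) a b = logChange (fun s => g (k' s)) a' b' := by
  obtain ⟨f, hf, h⟩ := exists_continuousOn_log hC hg h0
  rw [logChange_eq (f := fun s => f (k s)) hab (hf.comp hk hkC) (fun s hs => h _ (hkC s hs)),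
    logChange_eq (f := fun s => f (k' s)) hab' (hf.comp hk' hkC') (fun s hs => h _ (hkC' s hs)),
    h1, h2]

/-! ### Logarithmic increments and singular homology -/

/-- The increment of `log ∘ G` along the path `f`. -/
def pathChange {X : Type*} [TopologicalSpace X] (G : X → ℂ) (f : C(I, X)) : ℂ :=
  logChange (fun s => G (f (Set.projIcc 0 1 zero_le_one s))) 0 1

theorem simplexEdge_zero (a b : Fin 3) : (simplexEdge a b 0).1 = Pi.single a 1 := by
  simp [simplexEdge]

theorem simplexEdge_one (a b : Fin 3) : (simplexEdge a b 1).1 = Pi.single b 1 := by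
  simp [simplexEdge]

/-- A nonvanishing function has a continuous logarithm on a singular simplex, so its increments
along the edges of the simplex cancel. -/
theorem pathChange_boundary₂ {X : Type*} [TopologicalSpace X] {A : Set X} {G : X → ℂ}
    (hG : ContinuousOn G A) (h0 : ∀ x ∈ A, G x ≠ 0) (s : C(stdSimplex ℝ (Fin 3), X))
    (hs : ∀ p, s p ∈ A) :
    pathChange G (s.comp (simplexEdge 1 2)) - pathChange G (s.comp (simplexEdge 0 2)) +
      pathChange G (s.comp (simplexEdge 0 1)) = 0 := by
  classical
  let C : Set (Fin 3 → ℝ) := stdSimplex ℝ (Fin 3)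
  let g : (Fin 3 → ℝ) → ℂ := fun x => if hx : x ∈ C then G (s ⟨x, hx⟩) else 0
  have hgC : ∀ x : C, g x.1 = G (s x) := fun x => dif_pos x.2
  have hg : ContinuousOn g C := by
    rw [continuousOn_iff_continuous_domRestrict]
    have : C.domRestrict g = fun x => G (s x) := funext hgC
    rw [this]
    exact hG.comp_continuous s.continuous hs
  obtain ⟨f, hf, h⟩ := exists_continuousOn_log (convex_stdSimplex ℝ (Fin 3)) hg
    (fun x hx => by rw [show g x = _ from hgC ⟨x, hx⟩]; exact h0 _ (hs _))
  have key : ∀ a b : Fin 3, pathChange G (s.comp (simplexEdge a b)) =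
      f (Pi.single b 1) - f (Pi.single a 1) := by
    intro a b
    have h1 : Set.projIcc (0 : ℝ) 1 zero_le_one 1 = 1 :=
      Set.projIcc_right _
    have h2 : Set.projIcc (0 : ℝ) 1 zero_le_one 0 = 0 :=
      Set.projIcc_left _
    unfold pathChange
    rw [logChange_eq (f := fun t => f (simplexEdge a b (Set.projIcc 0 1 zero_le_one t)).1)
        zero_le_one]
    · simp only [h1, h2, simplexEdge_zero, simplexEdge_one]
    · refine Continuous.continuousOn (hf.comp_continuous ?_ fun t => Subtype.prop _)
      exact continuous_subtype_val.comp ((map_continuous _).comp continuous_projIcc)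
    · intro t _
      exact (h _ (Subtype.prop _)).trans (hgC _)
  rw [key, key, key]
  ring

/-- A nonvanishing function on `A` assigns to each singular 1-chain its logarithmic increment. -/
def chainChange {X : Type*} [TopologicalSpace X] (G : X → ℂ) : (C(I, X) →₀ ℤ) →+ ℂ :=
  Finsupp.liftAddHom fun f => (zmultiplesHom ℂ) (pathChange G f)

theorem chainChange_single {X : Type*} [TopologicalSpace X] (G : X → ℂ) (f : C(I, X)) :
    chainChange G (Finsupp.single f 1) = pathChange G f := by
  simp [chainChange]

theorem chainChange_boundaries {X : Type*} [TopologicalSpace X] {A : Set X} {G : X → ℂ}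
    (hG : ContinuousOn G A) (h0 : ∀ x ∈ A, G x ≠ 0) {c : C(I, X) →₀ ℤ} (hc : c ∈ boundaries A) :
    chainChange G c = 0 := by
  have hle : boundaries A ≤ (chainChange G).ker := by
    refine (AddSubgroup.closure_le _).2 ?_
    rintro _ ⟨s, hs, rfl⟩
    simp only [SetLike.mem_coe, AddMonoidHom.mem_ker, boundary₂, map_add, map_sub,
      chainChange_single]
    exact pathChange_boundary₂ hG h0 s hs
  exact hle hc

theorem pathChange_of_nullHomologous {X : Type*} [TopologicalSpace X] {A : Set X} {G : X → ℂ}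
    (hG : ContinuousOn G A) (h0 : ∀ x ∈ A, G x ≠ 0) {f : C(I, X)} (hf : NullHomologousIn A f) :
    pathChange G f = 0 := by
  rw [← chainChange_single, chainChange_boundaries hG h0 hf]

theorem pathChange_of_homologous {X : Type*} [TopologicalSpace X] {A : Set X} {G : X → ℂ}
    (hG : ContinuousOn G A) (h0 : ∀ x ∈ A, G x ≠ 0) {f g : C(I, X)} (hf : HomologousIn A f g) :
    pathChange G f = pathChange G g := by
  have := chainChange_boundaries hG h0 hf
  rwa [map_sub, chainChange_single, chainChange_single, sub_eq_zero] at this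

/-! ### A complex function vanishing exactly on a closed polygon -/

/-- The Euclidean length of a vector of 3-space. -/
def len (u : Space) : ℝ := √(u.1.1 ^ 2 + u.1.2 ^ 2 + u.2 ^ 2)

/-- The horizontal part of a vector of 3-space as a complex number. -/
def horiz (u : Space) : ℂ := ⟨u.1.1, u.1.2⟩

/-- The hermitian matrix `‖u‖ + u·σ` (with `σ` the Pauli matrices), which is of rank one with image
the spinors pointing in the direction `u`. -/
def spin (u : Space) : Matrix (Fin 2) (Fin 2) ℂ :=
  !![((len u + u.2 : ℝ) : ℂ), star (horiz u); horiz u, ((len u - u.2 : ℝ) : ℂ)]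

open Classical in
/-- A spinor in the direction `u`, normalised so that its squared norm is `2 ‖u‖`. -/
def spinor (u : Space) : Fin 2 → ℂ :=
  if len u + u.2 = 0 then ![0, (√(2 * len u) : ℝ)]
  else ![(√(len u + u.2) : ℝ), horiz u / (√(len u + u.2) : ℝ)]

theorem len_sq (u : Space) : len u ^ 2 = u.1.1 ^ 2 + u.1.2 ^ 2 + u.2 ^ 2 :=
  Real.sq_sqrt (by positivity)

theorem len_nonneg (u : Space) : 0 ≤ len u := Real.sqrt_nonneg _

theorem abs_height_le_len (u : Space) : |u.2| ≤ len u :=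
  Real.abs_le_sqrt (by nlinarith [sq_nonneg u.1.1, sq_nonneg u.1.2])

theorem len_add_height_nonneg (u : Space) : 0 ≤ len u + u.2 := by
  have := abs_height_le_len u
  have := neg_abs_le u.2
  linarith

theorem len_add_height_pos {u : Space} (h : u.1 ≠ 0 ∨ 0 < u.2) : 0 < len u + u.2 := by
  refine lt_of_le_of_ne (len_add_height_nonneg u) fun h0 => ?_
  have h1 := len_sq u
  have h2 : len u = -u.2 := by linarith
  rw [h2] at h1
  have h3 : u.1.1 ^ 2 + u.1.2 ^ 2 = 0 := by linarith
  rcases h with h | h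
  · apply h
    ext
    · simpa using (by nlinarith [sq_nonneg u.1.1, sq_nonneg u.1.2] : u.1.1 ^ 2 = 0)
    · simpa using (by nlinarith [sq_nonneg u.1.1, sq_nonneg u.1.2] : u.1.2 ^ 2 = 0)
  · linarith [len_nonneg u]

theorem continuous_len : Continuous len := by unfold len; fun_prop

theorem continuous_horiz : Continuous horiz := by
  have : horiz = fun u : Space => (u.1.1 : ℂ) + u.1.2 * Complex.I := by
    funext u; apply Complex.ext <;> simp [horiz]
  rw [this]; fun_prop

theorem continuous_spin : Continuous spin := by
  have := continuous_len
  have := continuous_horiz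
  refine continuous_matrix fun i j => ?_
  fin_cases i <;> fin_cases j <;> simp [spin] <;> fun_prop

theorem normSq_horiz (u : Space) :
    horiz u * star (horiz u) = ((len u - u.2 : ℝ) : ℂ) * ((len u + u.2 : ℝ) : ℂ) := by
  have h : (len u - u.2) * (len u + u.2) = Complex.normSq (horiz u) := by
    rw [Complex.normSq_apply]; simp only [horiz]; linear_combination len_sq u
  rw [← Complex.ofReal_mul, h]
  exact Complex.mul_conj _

/-- The spin matrix is the projection onto its spinor, up to a factor. -/
theorem spin_eq (u : Space) : spin u = Matrix.vecMulVec (spinor u) (star (spinor u)) := by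
  unfold spinor
  split_ifs with h
  · have h1 : u.1 = 0 ∧ u.2 ≤ 0 := by
      by_contra hc
      have : u.1 ≠ 0 ∨ 0 < u.2 := by
        rw [not_and_or, not_le] at hc; exact hc
      exact (len_add_height_pos this).ne' h
    have h2 : horiz u = 0 := by apply Complex.ext <;> simp [horiz, h1.1]
    have h3 : len u - u.2 = √(2 * len u) * √(2 * len u) := by
      rw [Real.mul_self_sqrt (by linarith [len_nonneg u])]; linarith
    ext i j
    fin_cases i <;> fin_cases j <;> simp [spin, Matrix.vecMulVec_apply, h2, -Complex.ofReal_add,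
      -Complex.ofReal_sub, h, h3]
  · have h0 : 0 < len u + u.2 := lt_of_le_of_ne (len_add_height_nonneg u) (Ne.symm h)
    have hs : √(len u + u.2) * √(len u + u.2) = len u + u.2 := Real.mul_self_sqrt h0.le
    have hsc : ((√(len u + u.2) : ℝ) : ℂ) * ((√(len u + u.2) : ℝ) : ℂ) = ((len u + u.2 : ℝ) : ℂ) :=
        by
      rw [← Complex.ofReal_mul, hs]
    have hne : ((√(len u + u.2) : ℝ) : ℂ) ≠ 0 := by
      rw [Complex.ofReal_ne_zero]; exact (Real.sqrt_pos.2 h0).ne'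
    have hn := normSq_horiz u
    have hstar : star ((√(len u + u.2) : ℝ) : ℂ) = ((√(len u + u.2) : ℝ) : ℂ) :=
        Complex.conj_ofReal _
    ext i j
    fin_cases i <;> fin_cases j <;>
      simp only [spin, Matrix.vecMulVec_apply, Fin.zero_eta, Fin.mk_one, Matrix.cons_val_zero,
        Matrix.cons_val_one, Matrix.of_apply, Matrix.cons_val', Matrix.cons_val_fin_one,
        Pi.star_apply, star_div₀, hstar]
    · rw [hsc]
    · field_simp
    · field_simp
    · rw [div_mul_div_comm, hsc, hn, mul_div_assoc, div_self, mul_one]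
      rw [← hsc]; exact mul_ne_zero hne hne

/-- The hermitian product of the spinors in two directions. -/
def spinProduct (u v : Space) : ℂ := star (spinor u) ⬝ᵥ spinor v

/-- The euclidean inner product of 3-space. -/
def dot3 (u v : Space) : ℝ := u.1.1 * v.1.1 + u.1.2 * v.1.2 + u.2 * v.2

theorem normSq_spinProduct (u v : Space) :
    Complex.normSq (spinProduct u v) = 2 * (len u * len v + dot3 u v) := by
  have hu := spin_eq u
  have hv := spin_eq v
  have eu : ∀ i j, spinor u i * star (spinor u j) = spin u i j := fun i j => by
    rw [hu]; simp [Matrix.vecMulVec_apply]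
  have ev : ∀ i j, spinor v i * star (spinor v j) = spin v i j := fun i j => by
    rw [hv]; simp [Matrix.vecMulVec_apply]
  have key : spinProduct u v * star (spinProduct u v) =
      spin u 0 0 * spin v 0 0 + spin u 1 0 * spin v 0 1 + spin u 0 1 * spin v 1 0 +
        spin u 1 1 * spin v 1 1 := by
    simp only [← eu, ← ev, spinProduct, dotProduct, Fin.sum_univ_two, Pi.star_apply, star_add,
      star_mul', star_star]
    ring
  have h2 : ((Complex.normSq (spinProduct u v) : ℝ) : ℂ) =
      ((2 * (len u * len v + dot3 u v) : ℝ) : ℂ) := by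
    rw [← Complex.mul_conj]
    refine key.trans ?_
    apply Complex.ext <;> simp [spin, dot3, horiz] <;> ring
  exact_mod_cast h2

/-- Spinors are orthogonal only if their directions are opposite. -/
theorem spinProduct_ne_zero {u v : Space}
    (h : ∀ a b : ℝ, 0 ≤ a → 0 ≤ b → a + b = 1 → a • u + b • v ≠ 0) : spinProduct u v ≠ 0 := by
  intro h0
  have h1 : len u * len v + dot3 u v = 0 := by
    have := normSq_spinProduct u v
    rw [h0, Complex.normSq_zero] at this
    linarith
  have hu : u ≠ 0 := by simpa using h 1 0 zero_le_one le_rfl (by norm_num)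
  have hv : v ≠ 0 := by simpa using h 0 1 le_rfl zero_le_one (by norm_num)
  have pos : ∀ u : Space, u ≠ 0 → 0 < len u := fun u hu => by
    refine lt_of_le_of_ne (len_nonneg u) fun h0 => hu ?_
    have h1 := len_sq u
    rw [← h0] at h1
    ext
    · simpa using (by nlinarith [sq_nonneg u.1.1, sq_nonneg u.1.2, sq_nonneg u.2] : u.1.1 ^ 2 = 0)
    · simpa using (by nlinarith [sq_nonneg u.1.1, sq_nonneg u.1.2, sq_nonneg u.2] : u.1.2 ^ 2 = 0)
    · simpa using (by nlinarith [sq_nonneg u.1.1, sq_nonneg u.1.2, sq_nonneg u.2] : u.2 ^ 2 = 0)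
  have pu := pos u hu
  have pv := pos v hv
  have hsq : (len v * u.1.1 + len u * v.1.1) ^ 2 + (len v * u.1.2 + len u * v.1.2) ^ 2 +
      (len v * u.2 + len u * v.2) ^ 2 = 0 := by
    have e1 := len_sq u
    have e2 := len_sq v
    unfold dot3 at h1
    linear_combination (-len v ^ 2) * e1 - len u ^ 2 * e2 + 2 * len u * len v * h1
  refine h (len v / (len u + len v)) (len u / (len u + len v)) (by positivity) (by positivity)
    (by field_simp; ring) ?_
  have hne : len u + len v ≠ 0 := by positivity
  have q1 := sq_nonneg (len v * u.1.1 + len u * v.1.1)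
  have q2 := sq_nonneg (len v * u.1.2 + len u * v.1.2)
  have q3 := sq_nonneg (len v * u.2 + len u * v.2)
  have r1 : len v * u.1.1 + len u * v.1.1 = 0 := pow_eq_zero_iff two_ne_zero |>.1 (by linarith)
  have r2 : len v * u.1.2 + len u * v.1.2 = 0 := pow_eq_zero_iff two_ne_zero |>.1 (by linarith)
  have r3 : len v * u.2 + len u * v.2 = 0 := pow_eq_zero_iff two_ne_zero |>.1 (by linarith)
  ext
  · simp only [Prod.fst_add, Prod.smul_fst, smul_eq_mul, Prod.fst_zero]
    field_simp; linarith
  · simp only [Prod.fst_add, Prod.smul_fst, smul_eq_mul, Prod.fst_zero, Prod.snd_add,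
      Prod.smul_snd, Prod.snd_zero]
    field_simp; linarith
  · simp only [Prod.snd_add, Prod.smul_snd, smul_eq_mul, Prod.snd_zero]
    field_simp; linarith

/-- The product of the spin matrices of the first `k` vectors of a sequence. -/
def spinProd (v : ℕ → Space) : ℕ → Matrix (Fin 2) (Fin 2) ℂ
  | 0 => 1
  | k + 1 => spinProd v k * spin (v k)

theorem spinProd_succ (v : ℕ → Space) (k : ℕ) : spinProd v (k + 1) =
    (∏ j ∈ Finset.range k, spinProduct (v j) (v (j + 1))) •
      Matrix.vecMulVec (spinor (v 0)) (star (spinor (v k))) := by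
  induction k with
  | zero => simp [spinProd, spin_eq]
  | succ k ih =>
    rw [spinProd, ih, spin_eq, Matrix.smul_mul, Matrix.vecMulVec_mul_vecMulVec,
      Finset.prod_range_succ, mul_smul, Matrix.vecMulVec_smul]
    rfl

theorem trace_spinProd (v : ℕ → Space) {m : ℕ} (hm : 0 < m) (hv : v m = v 0) :
    (spinProd v m).trace = ∏ j ∈ Finset.range m, spinProduct (v j) (v (j + 1)) := by
  obtain ⟨k, rfl⟩ : ∃ k, m = k + 1 := ⟨m - 1, by omega⟩
  rw [spinProd_succ, Matrix.trace_smul, Finset.prod_range_succ, hv, Matrix.trace_vecMulVec,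
    smul_eq_mul, dotProduct_comm]
  rfl

/-- The function `tr ∏ (‖vⱼ - x‖ + (vⱼ - x)·σ)`, which vanishes exactly on the closed polygon with
the `m` vertices `vⱼ`. Its argument is half the solid angle under which the polygon is seen. -/
def polyFun (v : ℕ → Space) (m : ℕ) (x : Space) : ℂ := (spinProd (fun j => v j - x) m).trace

theorem continuous_spinProd {X : Type*} [TopologicalSpace X] {v : X → ℕ → Space}
    (hv : ∀ j, Continuous fun x => v x j) (m : ℕ) : Continuous fun x => spinProd (v x) m := by
  induction m with
  | zero => exact continuous_const
  | succ k ih => exact ih.matrix_mul (continuous_spin.comp (hv k))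

theorem continuous_polyFun (v : ℕ → Space) (m : ℕ) : Continuous (polyFun v m) :=
  (continuous_spinProd (fun j => by fun_prop) m).matrix_trace

theorem polyFun_eq (v : ℕ → Space) {m : ℕ} (hm : 0 < m) (hv : v m = v 0) (x : Space) :
    polyFun v m x = ∏ j ∈ Finset.range m, spinProduct (v j - x) (v (j + 1) - x) :=
  trace_spinProd (fun j => v j - x) hm (by rw [hv])

theorem spinProduct_sub_ne_zero {u v x : Space}
    (h : ∀ t ∈ Set.Icc (0 : ℝ) 1, x ≠ (1 - t) • u + t • v) : spinProduct (u - x) (v - x) ≠ 0 := by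
  refine spinProduct_ne_zero fun a b ha hb hab h0 => ?_
  refine h b ⟨hb, by linarith⟩ ?_
  have : x = (a + b) • x := by rw [hab, one_smul]
  have ha' : a = 1 - b := by linarith
  rw [this, ← ha', ← sub_eq_zero, ← neg_eq_zero, ← h0]
  module

theorem polyFun_ne_zero (v : ℕ → Space) {m : ℕ} (hm : 0 < m) (hv : v m = v 0) {x : Space}
    (h : ∀ j < m, ∀ t ∈ Set.Icc (0 : ℝ) 1, x ≠ (1 - t) • v j + t • v (j + 1)) :
    polyFun v m x ≠ 0 := by
  rw [polyFun_eq v hm hv]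
  exact Finset.prod_ne_zero_iff.2 fun j hj => spinProduct_sub_ne_zero (h j (Finset.mem_range.1 hj))

/-- The hermitian product of the spinors `(‖u‖ + u₃, u₁ + i u₂)`, which differs from `spinProduct`
by a positive factor where these do not vanish. -/
def edgeFun (u v : Space) : ℂ :=
  ((len u + u.2 : ℝ) : ℂ) * ((len v + v.2 : ℝ) : ℂ) + star (horiz u) * horiz v

theorem continuous_edgeFun {X : Type*} [TopologicalSpace X] {u v : X → Space} (hu : Continuous u)
    (hv : Continuous v) : Continuous fun x => edgeFun (u x) (v x) := by
  have := continuous_len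
  have := continuous_horiz
  unfold edgeFun
  fun_prop

theorem spinProduct_eq_edgeFun {u v : Space} (hu : 0 < len u + u.2) (hv : 0 < len v + v.2) :
    spinProduct u v = (((√(len u + u.2) * √(len v + v.2))⁻¹ : ℝ) : ℂ) * edgeFun u v := by
  have hnu : ((√(len u + u.2) : ℝ) : ℂ) ≠ 0 := by
    rw [Complex.ofReal_ne_zero]; exact (Real.sqrt_pos.2 hu).ne'
  have hnv : ((√(len v + v.2) : ℝ) : ℂ) ≠ 0 := by
    rw [Complex.ofReal_ne_zero]; exact (Real.sqrt_pos.2 hv).ne'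
  have hsu : ((√(len u + u.2) : ℝ) : ℂ) ^ 2 = ((len u + u.2 : ℝ) : ℂ) := by
    rw [← Complex.ofReal_pow, Real.sq_sqrt hu.le]
  have hsv : ((√(len v + v.2) : ℝ) : ℂ) ^ 2 = ((len v + v.2 : ℝ) : ℂ) := by
    rw [← Complex.ofReal_pow, Real.sq_sqrt hv.le]
  have hstar : star ((√(len u + u.2) : ℝ) : ℂ) = ((√(len u + u.2) : ℝ) : ℂ) := Complex.conj_ofReal _
  unfold spinProduct edgeFun spinor
  rw [if_neg hu.ne', if_neg hv.ne', ← hsu, ← hsv]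
  simp only [dotProduct, Fin.sum_univ_two, Pi.star_apply, Matrix.cons_val_zero, Matrix.cons_val_one,
    star_div₀, hstar, Complex.ofReal_inv, Complex.ofReal_mul]
  field_simp

/-- The planar determinant. -/
def det2 (a b : ℝ × ℝ) : ℝ := a.1 * b.2 - a.2 * b.1

theorem edgeFun_im (u v : Space) : (edgeFun u v).im = det2 u.1 v.1 := by
  simp [edgeFun, horiz, det2]; ring

/-- The growth of `‖u‖ + u₃` in the vertical direction. -/
theorem len_add_height_strictMono (y : ℝ × ℝ) (hy : y ≠ 0) {a b : ℝ} (hab : a < b) :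
    len (y, a) + a < len (y, b) + b := by
  have h1 := len_sq (y, a)
  have h2 := len_sq (y, b)
  have h3 := len_add_height_pos (u := (y, a)) (Or.inl hy)
  have h4 := len_add_height_pos (u := (y, b)) (Or.inl hy)
  simp only at h1 h2 h3 h4
  by_contra hc
  rw [not_lt] at hc
  have h5 : 0 < y.1 ^ 2 + y.2 ^ 2 := by
    have : y.1 ≠ 0 ∨ y.2 ≠ 0 := by
      by_contra h; push Not at h; exact hy (Prod.ext h.1 h.2)
    rcases this with h | h <;> positivity
  have h6 : (len (y, a) - a) * (len (y, a) + a) = (len (y, b) - b) * (len (y, b) + b) := by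
    nlinarith
  have h7 : len (y, b) - b < len (y, a) - a := by linarith
  have h8 : 0 < len (y, a) - a := by
    refine pos_of_mul_pos_left ?_ h3.le
    nlinarith
  nlinarith [mul_pos (sub_pos.2 h7) h4, mul_nonneg h8.le (sub_nonneg.2 hc)]

theorem len_smul (c : ℝ) (u : Space) : len (c • u) = |c| * len u := by
  unfold len
  rw [← Real.sqrt_sq_eq_abs, ← Real.sqrt_mul (sq_nonneg c)]
  congr 1
  simp only [Prod.smul_fst, Prod.smul_snd, smul_eq_mul]
  ring

theorem horiz_real_smul (c : ℝ) (u : Space) : horiz (c • u) = c * horiz u := by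
  apply Complex.ext <;> simp [horiz]

theorem edgeFun_re_eq_zero (u v : Space) {t : ℝ} (ht : t ∈ Set.Icc (0 : ℝ) 1) :
    (edgeFun (u - ((1 - t) • u + t • v)) (v - ((1 - t) • u + t • v))).re = 0 := by
  have h1 : u - ((1 - t) • u + t • v) = (-t) • (v - u) := by module
  have h2 : v - ((1 - t) • u + t • v) = (1 - t) • (v - u) := by module
  have h3 : |-t| = t := by rw [abs_neg, abs_of_nonneg ht.1]
  have h4 : |1 - t| = 1 - t := abs_of_nonneg (by linarith [ht.2])
  have h5 := len_sq (v - u)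
  rw [h1, h2]
  simp only [edgeFun, len_smul, horiz_real_smul, h3, h4]
  simp [horiz] at h5 ⊢
  linear_combination (t * (1 - t)) * h5

/-- Above the interior of an edge, the real part of `edgeFun` decreases with the height. -/
theorem edgeFun_re_strictAnti {u v : Space} {y e : ℝ × ℝ} {t : ℝ} (ht : t ∈ Set.Ioo (0 : ℝ) 1)
    (he : e ≠ 0) (hu : u.1 = y - t • e) (hv : v.1 = y + (1 - t) • e) {a b : ℝ} (hab : a < b) :
    (edgeFun (u - (y, b)) (v - (y, b))).re < (edgeFun (u - (y, a)) (v - (y, a))).re := by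
  have e1 : ∀ h : ℝ, u - (y, h) = ((-t) • e, u.2 - h) := fun h => by
    ext <;> simp [hu]
  have e2 : ∀ h : ℝ, v - (y, h) = ((1 - t) • e, v.2 - h) := fun h => by
    ext <;> simp [hv]
  have n1 : (-t) • e ≠ 0 := smul_ne_zero (by linarith [ht.1]) he
  have n2 : (1 - t) • e ≠ 0 := smul_ne_zero (by linarith [ht.2]) he
  have m1 := len_add_height_strictMono _ n1 (show u.2 - b < u.2 - a by linarith)
  have m2 := len_add_height_strictMono _ n2 (show v.2 - b < v.2 - a by linarith)
  have p1 := len_add_height_pos (u := ((-t) • e, u.2 - b)) (Or.inl n1)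
  have p2 := len_add_height_pos (u := ((1 - t) • e, v.2 - b)) (Or.inl n2)
  simp only at p1 p2
  rw [e1, e1, e2, e2]
  simp only [edgeFun, Complex.add_re, Complex.mul_re, Complex.ofReal_re, Complex.ofReal_im,
    horiz, mul_zero, sub_zero]
  have := mul_lt_mul'' m1 m2 p1.le p2.le
  linarith

theorem edgeFun_re_sign {u v : Space} {t : ℝ} (ht : t ∈ Set.Ioo (0 : ℝ) 1) (he : v.1 ≠ u.1)
    {h : ℝ} {x : Space} (hx : x = (((1 - t) • u + t • v).1, h)) :
    (h < ((1 - t) • u + t • v).2 → 0 < (edgeFun (u - x) (v - x)).re) ∧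
    (((1 - t) • u + t • v).2 < h → (edgeFun (u - x) (v - x)).re < 0) := by
  subst hx
  have h0 := edgeFun_re_eq_zero u v ⟨ht.1.le, ht.2.le⟩
  have hm := fun a b hab => edgeFun_re_strictAnti (u := u) (v := v)
    (y := ((1 - t) • u + t • v).1) (e := v.1 - u.1) ht (sub_ne_zero.2 he)
    (by simp only [Prod.fst_add, Prod.smul_fst]; module)
    (by simp only [Prod.fst_add, Prod.smul_fst]; module) (a := a) (b := b) hab
  have h1 : ((1 - t) • u + t • v : Space) =
    (((1 - t) • u + t • v).1, ((1 - t) • u + t • v).2) := rfl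
  rw [h1] at h0
  exact ⟨fun hlt => by have := hm _ _ hlt; rwa [h0] at this,
    fun hlt => by have := hm _ _ hlt; rwa [h0] at this⟩

/-- `polyFun`, normalised so that it extends continuously by `1` to the point at infinity. -/
def hatFun (v : ℕ → Space) (m : ℕ) : S3 → ℂ :=
  fun x => OnePoint.elim x 1
    fun y => polyFun v m y / ((2 * √(1 + len y ^ 2) : ℝ) : ℂ) ^ m

theorem hatFun_coe (v : ℕ → Space) (m : ℕ) (y : Space) :
    hatFun v m (y : S3) = polyFun v m y / ((2 * √(1 + len y ^ 2) : ℝ) : ℂ) ^ m := rfl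

theorem hatFun_infty (v : ℕ → Space) (m : ℕ) : hatFun v m OnePoint.infty = 1 := rfl

theorem hatFun_coe_ne_zero {v : ℕ → Space} {m : ℕ} {y : Space} (h : polyFun v m y ≠ 0) :
    hatFun v m (y : S3) ≠ 0 := by
  rw [hatFun_coe]
  have : 0 < 2 * √(1 + len y ^ 2) := by positivity
  exact div_ne_zero h (pow_ne_zero _ (by exact_mod_cast this.ne'))

theorem spin_smul {c : ℝ} (hc : 0 ≤ c) (u : Space) : spin (c • u) = (c : ℂ) • spin u := by
  have h := horiz_real_smul c u
  ext i j
  fin_cases i <;> fin_cases j <;> simp [spin, len_smul, abs_of_nonneg hc, h] <;> ring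

theorem spinProd_smul {c : ℝ} (hc : 0 ≤ c) (v : ℕ → Space) (m : ℕ) :
    spinProd (fun j => c • v j) m = (c : ℂ) ^ m • spinProd v m := by
  induction m with
  | zero => simp [spinProd]
  | succ k ih => rw [spinProd, ih, spin_smul hc, spinProd, Matrix.smul_mul, Matrix.mul_smul,
      smul_smul, pow_succ]

theorem trace_spinProd_const (u : Space) {m : ℕ} (hm : 0 < m) :
    (spinProd (fun _ => u) m).trace = ((2 * len u : ℝ) : ℂ) ^ m := by
  rw [trace_spinProd _ hm rfl]
  have : spinProduct u u = ((2 * len u : ℝ) : ℂ) := by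
    have h1 : (spin u).trace = spinProduct u u := by
      rw [spin_eq, Matrix.trace_vecMulVec, dotProduct_comm]; rfl
    rw [← h1, Matrix.trace_fin_two]
    simp [spin]; ring
  simp [this]

/-- The trace formula in projective coordinates, in which infinity is the sphere `c = 0`. -/
theorem polyFun_div (v : ℕ → Space) (m : ℕ) (x : Space) :
    polyFun v m x / ((2 * √(1 + len x ^ 2) : ℝ) : ℂ) ^ m =
      (spinProd (fun j => (√(1 + len x ^ 2))⁻¹ • v j - (√(1 + len x ^ 2))⁻¹ • x) m).trace / 2 ^ m :=
          by
  have hN : 0 < √(1 + len x ^ 2) := by positivity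
  simp only [← smul_sub]
  rw [spinProd_smul (inv_nonneg.2 hN.le), Matrix.trace_smul, polyFun, smul_eq_mul]
  push_cast
  rw [mul_pow, inv_pow]
  have : ((√(1 + len x ^ 2) : ℝ) : ℂ) ≠ 0 := by exact_mod_cast hN.ne'
  field_simp

/-- The growth of `polyFun` at infinity. -/
theorem tendsto_polyFun_div (v : ℕ → Space) {m : ℕ} (hm : 0 < m) :
    Filter.Tendsto (fun x : Space => polyFun v m x / ((2 * √(1 + len x ^ 2) : ℝ) : ℂ) ^ m)
      (Filter.cocompact Space) (nhds 1) := by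
  -- infinity corresponds to the compact part `c = 0` of the half sphere of projective coordinates
  let K : Set (ℝ × Space) := {p | p.1 ^ 2 + len p.2 ^ 2 = 1 ∧ 0 ≤ p.1}
  let T : ℝ × Space → ℂ := fun p => (spinProd (fun j => p.1 • v j - p.2) m).trace / 2 ^ m
  have hT : Continuous T :=
    (continuous_spinProd (fun j => by fun_prop) m).matrix_trace.div_const _
  have hK : IsCompact K := by
    refine Metric.isCompact_of_isClosed_isBounded ?_ ?_
    · have := continuous_len
      exact (isClosed_eq (by fun_prop) continuous_const).inter
        (isClosed_le continuous_const continuous_fst)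
    · refine (Metric.isBounded_closedBall (x := (0 : ℝ × Space)) (r := 1)).subset ?_
      rintro ⟨c, d⟩ ⟨h1, h2⟩
      simp only at h1 h2
      have h3 := len_sq d
      rw [mem_closedBall_zero_iff]
      simp only [Prod.norm_def, Real.norm_eq_abs, max_le_iff]
      refine ⟨?_, ⟨?_, ?_⟩, ?_⟩ <;> apply abs_le_one_iff_mul_self_le_one.2 <;>
        nlinarith [sq_nonneg d.1.1, sq_nonneg d.1.2, sq_nonneg d.2, sq_nonneg c]
  rw [Metric.tendsto_nhds]
  intro ε hε
  let B : Set (ℝ × Space) := K ∩ {p | ε ≤ dist (T p) 1}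
  have hB : IsCompact B := hK.inter_right (isClosed_le continuous_const (by fun_prop))
  have hpos : ∀ p ∈ B, 0 < p.1 := by
    rintro ⟨c, d⟩ ⟨⟨h1, h2⟩, h3⟩
    refine lt_of_le_of_ne h2 fun h0 => ?_
    simp only at h0 h1
    subst h0
    have hl : len d = 1 := by
      have := len_nonneg d
      nlinarith
    have : T (0, d) = 1 := by
      have hd : len (-d) = 1 := by
        have := len_smul (-1) d
        simpa [hl] using this
      simp only [T, zero_smul, zero_sub, trace_spinProd_const (-d) hm, hd]
      simp
    simp only [Set.mem_ofPred_eq, this, dist_self] at h3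
    linarith
  obtain ⟨c₀, hc₀, hle⟩ : ∃ c₀ > 0, ∀ p ∈ B, c₀ ≤ p.1 := by
    rcases B.eq_empty_or_nonempty with hE | hne
    · exact ⟨1, one_pos, by simp [hE]⟩
    · obtain ⟨p, hp, hmin⟩ := hB.exists_isMinOn hne continuous_fst.continuousOn
      exact ⟨p.1, hpos p hp, fun q hq => hmin hq⟩
  have hco : ∀ᶠ x in Filter.cocompact Space, x ∉ Metric.closedBall (0 : Space) c₀⁻¹ :=
    (isCompact_closedBall (0 : Space) c₀⁻¹).compl_mem_cocompact
  filter_upwards [hco] with x hx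
  rw [polyFun_div]
  by_contra hge
  rw [not_lt] at hge
  set N := √(1 + len x ^ 2) with hN
  have hNsq : N ^ 2 = 1 + len x ^ 2 := Real.sq_sqrt (by positivity)
  have hN0 : 0 < N := by positivity
  have hmem : (N⁻¹, N⁻¹ • x) ∈ B := by
    refine ⟨⟨?_, inv_nonneg.2 hN0.le⟩, hge⟩
    rw [len_smul, abs_of_pos (inv_pos.2 hN0), mul_pow, inv_pow, hNsq]
    have : 1 + len x ^ 2 ≠ 0 := by positivity
    field_simp
  have h1 : N ≤ c₀⁻¹ := by
    have := hle _ hmem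
    exact (le_inv_comm₀ hc₀ hN0).1 this
  apply hx
  rw [mem_closedBall_zero_iff]
  have h3 := len_sq x
  have hN1 : ∀ a : ℝ, a ^ 2 ≤ len x ^ 2 → ‖a‖ ≤ c₀⁻¹ := fun a ha => by
    rw [Real.norm_eq_abs]
    exact (abs_le_of_sq_le_sq (by nlinarith) hN0.le).trans h1
  simp only [Prod.norm_def, max_le_iff]
  refine ⟨⟨hN1 _ ?_, hN1 _ ?_⟩, hN1 _ ?_⟩ <;>
    nlinarith [sq_nonneg x.1.1, sq_nonneg x.1.2, sq_nonneg x.2]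

theorem continuous_hatFun (v : ℕ → Space) {m : ℕ} (hm : 0 < m) : Continuous (hatFun v m) := by
  rw [OnePoint.continuous_iff]
  constructor
  · have h := tendsto_polyFun_div v hm
    rw [Filter.coclosedCompact_eq_cocompact]
    exact h
  · have h1 := continuous_polyFun v m
    have h2 := continuous_len
    refine h1.div (by fun_prop) fun y => ?_
    have : 0 < 2 * √(1 + len y ^ 2) := by positivity
    exact pow_ne_zero _ (by exact_mod_cast this.ne')

/-! ### Local structure of a regular projection -/

theorem exists_smul_of_det2_eq_zero {a b : ℝ × ℝ} (ha : a ≠ 0) (h : det2 a b = 0) :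
    ∃ c : ℝ, b = c • a := by
  have h0 : 0 < a.1 ^ 2 + a.2 ^ 2 := by
    have : a.1 ≠ 0 ∨ a.2 ≠ 0 := by
      by_contra h; push Not at h; exact ha (Prod.ext h.1 h.2)
    rcases this with h | h <;> positivity
  unfold det2 at h
  refine ⟨(a.1 * b.1 + a.2 * b.2) / (a.1 ^ 2 + a.2 ^ 2), ?_⟩
  ext
  · simp only [Prod.smul_fst, smul_eq_mul]
    field_simp
    linear_combination -a.2 * h
  · simp only [Prod.smul_snd, smul_eq_mul]
    field_simp
    linear_combination a.1 * h

namespace PolyLink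

variable {n : ℕ} (L : PolyLink n)

/-- The period of the component `i`, as a real number. -/
def period (i : Fin n) : ℝ := L.edges i

theorem period_pos (i : Fin n) : 0 < L.period i := Nat.cast_pos.2 (L.edges_pos i)

theorem curve_add_period (i : Fin n) (s : ℝ) : L.curve i (s + L.period i) = L.curve i s :=
  L.periodic i s

theorem curve_add_int_mul (i : Fin n) (s : ℝ) (m : ℤ) :
    L.curve i (s + m * L.period i) = L.curve i s := by
  have h : Function.Periodic (L.curve i) (L.period i) := L.periodic i
  exact h.int_mul m s

theorem curve_eq_iff {i : Fin n} {s u : ℝ} :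
    L.curve i s = L.curve i u ↔ ∃ m : ℤ, u = s + m * L.period i :=
  ⟨fun h => (L.embedded i i s u h).2, fun ⟨m, hm⟩ => by rw [hm, curve_add_int_mul]⟩

/-- The direction of the edge that starts at the last vertex up to the time `s`. -/
def dir (i : Fin n) (s : ℝ) : Space := L.curve i (⌊s⌋ + 1) - L.curve i ⌊s⌋

theorem dir_add_int_mul (i : Fin n) (s : ℝ) (m : ℤ) :
    L.dir i (s + m * L.period i) = L.dir i s := by
  have h : ⌊s + m * L.period i⌋ = ⌊s⌋ + m * L.edges i := by
    rw [period, show s + (m : ℝ) * (L.edges i : ℝ) = s + ((m * L.edges i : ℤ) : ℝ) by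
      push_cast; ring,
      Int.floor_add_intCast]
  unfold dir
  rw [h]
  have e1 : ((⌊s⌋ + m * L.edges i : ℤ) : ℝ) + 1 = (⌊s⌋ + 1 : ℝ) + m * L.period i := by
    rw [period]; push_cast; ring
  have e2 : ((⌊s⌋ + m * L.edges i : ℤ) : ℝ) = (⌊s⌋ : ℝ) + m * L.period i := by
    rw [period]; push_cast; ring
  rw [e1, e2, curve_add_int_mul, curve_add_int_mul]

theorem curve_on_edge (i : Fin n) (k : ℤ) {s : ℝ} (hs : s ∈ Set.Icc (k : ℝ) (k + 1)) :
    L.curve i s = L.curve i k + (s - k) • (L.curve i (k + 1) - L.curve i k) := by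
  have := L.straight i k (s - k) ⟨by linarith [hs.1], by linarith [hs.2]⟩
  rw [add_sub_cancel] at this
  rw [this]
  module

theorem curve_forward (i : Fin n) (s : ℝ) {t : ℝ} (h1 : s ≤ t) (h2 : t ≤ ⌊s⌋ + 1) :
    L.curve i t = L.curve i s + (t - s) • L.dir i s := by
  have hf := Int.floor_le s
  rw [L.curve_on_edge i ⌊s⌋ (s := t) ⟨by linarith, h2⟩,
    L.curve_on_edge i ⌊s⌋ (s := s) ⟨hf, by linarith⟩, dir]
  module

theorem curve_backward (i : Fin n) (s : ℝ) {t : ℝ} (h1 : t ≤ s) (h2 : (⌈s⌉ : ℝ) - 1 ≤ t) :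
    L.curve i t = L.curve i s + (t - s) • L.dir i ((⌈s⌉ - 1 : ℤ) : ℝ) := by
  have hf := Int.le_ceil s
  have e : ((⌈s⌉ - 1 : ℤ) : ℝ) = (⌈s⌉ : ℝ) - 1 := by push_cast; ring
  rw [L.curve_on_edge i (⌈s⌉ - 1) (s := t) ⟨by rw [e]; linarith, by rw [e]; linarith⟩,
    L.curve_on_edge i (⌈s⌉ - 1) (s := s) ⟨by rw [e]; linarith, by rw [e]; linarith⟩, dir,
    Int.floor_intCast]
  module

theorem lt_floor_add_one_of_ne {s : ℝ} (hs : ∀ k : ℤ, s ≠ k) :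
    (⌊s⌋ : ℝ) < s ∧ s < ⌊s⌋ + 1 :=
  ⟨lt_of_le_of_ne (Int.floor_le s) (hs _).symm, Int.lt_floor_add_one s⟩

/-- Away from the vertices, the components are straight. -/
theorem curve_near (i : Fin n) {s : ℝ} (hs : ∀ k : ℤ, s ≠ k) :
    ∀ᶠ t in nhds s, L.curve i t = L.curve i s + (t - s) • L.dir i s := by
  obtain ⟨h1, h2⟩ := lt_floor_add_one_of_ne hs
  filter_upwards [Icc_mem_nhds h1 h2] with t ht
  rw [L.curve_on_edge i ⌊s⌋ (s := t) ht,
    L.curve_on_edge i ⌊s⌋ (s := s) ⟨h1.le, h2.le⟩, dir]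
  module

variable {L}

theorem Cross.symm {i k : Fin n} {s u : ℝ} (h : L.Cross i s k u) : L.Cross k u i s :=
  ⟨h.1.symm, h.2.symm⟩

theorem Cross.atCrossing {i k : Fin n} {s u : ℝ} (h : L.Cross i s k u) : L.AtCrossing i s :=
  ⟨k, u, h⟩

theorem Cross.height_ne {i k : Fin n} {s u : ℝ} (h : L.Cross i s k u) :
    (L.curve i s).2 ≠ (L.curve k u).2 := fun h' => h.2 (Prod.ext h.1 h')

theorem cross_add_int_mul {i k : Fin n} {s u : ℝ} (m : ℤ) :
    L.Cross i (s + m * L.period i) k u ↔ L.Cross i s k u := by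
  simp only [Cross, curve_add_int_mul]

theorem atCrossing_add_int_mul {i : Fin n} {s : ℝ} (m : ℤ) :
    L.AtCrossing i (s + m * L.period i) ↔ L.AtCrossing i s := by
  simp only [AtCrossing, cross_add_int_mul]

theorem passesOver_add_int_mul {i : Fin n} {s : ℝ} (m : ℤ) :
    L.PassesOver i (s + m * L.period i) ↔ L.PassesOver i s := by
  simp only [PassesOver, cross_add_int_mul, curve_add_int_mul]

namespace IsRegular

theorem ne_int_of_cross (hreg : L.IsRegular) {i k : Fin n} {s u : ℝ} (h : L.Cross i s k u) (m : ℤ) :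
    s ≠ m := by
  rintro rfl
  exact hreg.vertex i m h.atCrossing

/-- Strands do not overlap in the projection. -/
theorem not_overlap (hreg : L.IsRegular) {i k : Fin n} {f g : ℝ → ℝ} {ε : ℝ} (hε : 0 < ε)
    (h : ∀ t ∈ Set.Ioo 0 ε, L.Cross i (f t) k (g t))
    (hinj : Set.InjOn (fun t => (L.curve i (f t)).1) (Set.Ioo 0 ε)) : False := by
  refine (Set.Ioo_infinite hε).image hinj (hreg.finite.subset ?_)
  rintro _ ⟨t, ht, rfl⟩
  exact ⟨i, f t, rfl, (h t ht).atCrossing⟩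

theorem dir_ne_zero (hreg : L.IsRegular) (i : Fin n) (s : ℝ) : (L.dir i s).1 ≠ 0 := by
  intro h0
  refine hreg.vertex i ⌊s⌋ ⟨i, ⌊s⌋ + 1 / 2, ?_, ?_⟩
  · have h := L.curve_on_edge i ⌊s⌋ (s := ⌊s⌋ + 1 / 2) ⟨by linarith, by linarith⟩
    rw [h]
    rw [dir] at h0
    simp only [Prod.fst_add, Prod.smul_fst, h0]
    simp
  · intro h
    obtain ⟨m, hm⟩ := L.curve_eq_iff.1 h
    rw [period] at hm
    have h2 : ((2 * m * L.edges i : ℤ) : ℝ) = ((1 : ℤ) : ℝ) := by push_cast; linarith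
    have h3 : 2 * m * (L.edges i : ℤ) = 1 := by exact_mod_cast h2
    have h4 : (2 : ℤ) ∣ 1 := ⟨m * L.edges i, by rw [← h3]; ring⟩
    norm_num at h4

/-- The projection does not backtrack. -/
theorem dir_not_opposite (hreg : L.IsRegular) (i : Fin n) (s : ℝ) {c : ℝ} (hc : 0 < c) :
    (L.dir i ((⌈s⌉ - 1 : ℤ) : ℝ)).1 ≠ -c • (L.dir i s).1 := by
  intro h
  have hfl := Int.lt_floor_add_one s
  have hce := Int.ceil_lt_add_one s
  have hE := L.period_pos i
  set ε := min (min (s - (⌈s⌉ - 1)) ((⌊s⌋ + 1 - s) / c)) (L.period i / (1 + c)) with hεd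
  have hε : 0 < ε := lt_min (lt_min (by linarith) (div_pos (by linarith) hc)) (by positivity)
  have h1 : ε ≤ s - (⌈s⌉ - 1) := (min_le_left _ _).trans (min_le_left _ _)
  have h2 : ε ≤ (⌊s⌋ + 1 - s) / c := (min_le_left _ _).trans (min_le_right _ _)
  have h3 : ε ≤ L.period i / (1 + c) := min_le_right _ _
  rw [le_div_iff₀ hc] at h2
  rw [le_div_iff₀ (by positivity)] at h3
  have hb : ∀ t ∈ Set.Ioo 0 ε, L.curve i (s - t) = L.curve i s +
      (-t) • L.dir i ((⌈s⌉ - 1 : ℤ) : ℝ) := by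
    intro t ht
    rw [L.curve_backward i s (t := s - t) (by linarith [ht.1]) (by linarith [ht.2])]
    module
  have hf : ∀ t ∈ Set.Ioo 0 ε, L.curve i (s + c * t) = L.curve i s + (c * t) • L.dir i s := by
    intro t ht
    have := mul_pos hc ht.1
    have := mul_lt_mul_of_pos_left ht.2 hc
    rw [L.curve_forward i s (t := s + c * t) (by linarith) (by linarith)]
    module
  refine hreg.not_overlap (i := i) (k := i) (f := fun t => s - t) (g := fun t => s + c * t) hε
    (fun t ht => ⟨?_, fun heq => ?_⟩) ?_
  · rw [hb t ht, hf t ht]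
    simp only [Prod.fst_add, Prod.smul_fst, h]
    module
  · obtain ⟨m, hm⟩ := L.curve_eq_iff.1 heq
    have h4 : (1 + c) * t = m * L.period i := by linarith
    have h5 : 0 < m * L.period i := by rw [← h4]; have := ht.1; positivity
    have h6 : m * L.period i < L.period i := by
      rw [← h4]; nlinarith [ht.2]
    have h7 : (0 : ℝ) < m := pos_of_mul_pos_left h5 hE.le
    have h8 : (m : ℝ) < 1 := by
      by_contra hc'
      rw [not_lt] at hc'
      nlinarith
    have h9 : (0 : ℤ) < m := by exact_mod_cast h7
    have h10 : m < (1 : ℤ) := by exact_mod_cast h8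
    omega
  · intro t ht t' ht' heq
    simp only at heq
    rw [hb t ht, hb t' ht'] at heq
    simp only [Prod.fst_add, Prod.smul_fst, add_right_inj] at heq
    have := smul_left_injective ℝ (hreg.dir_ne_zero i ((⌈s⌉ - 1 : ℤ) : ℝ)) heq
    linarith

/-- Strands cross transversally in the projection. -/
theorem det2_ne_zero (hreg : L.IsRegular) {i k : Fin n} {s u : ℝ} (h : L.Cross i s k u) :
    det2 (L.dir i s).1 (L.dir k u).1 ≠ 0 := by
  intro h0
  have hi := hreg.dir_ne_zero i s
  have hk := hreg.dir_ne_zero k u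
  obtain ⟨c, hc⟩ := exists_smul_of_det2_eq_zero hi h0
  have hc0 : c ≠ 0 := fun h' => hk (by rw [hc, h', zero_smul])
  have e1 := L.curve_near i (hreg.ne_int_of_cross h)
  have e2 := L.curve_near k (hreg.ne_int_of_cross h.symm)
  have t1 : Filter.Tendsto (fun t => s + c * t) (nhds 0) (nhds s) := by
    have : Continuous fun t : ℝ => s + c * t := by fun_prop
    simpa using this.tendsto 0
  have t2 : Filter.Tendsto (fun t => u + t) (nhds 0) (nhds u) := by
    have : Continuous fun t : ℝ => u + t := by fun_prop
    simpa using this.tendsto 0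
  have e3 : ∀ᶠ t in nhds (0 : ℝ), L.curve i (s + c * t) ≠ L.curve k (u + t) := by
    have c1 : Continuous fun t : ℝ => L.curve i (s + c * t) := by fun_prop
    have c2 : Continuous fun t : ℝ => L.curve k (u + t) := by fun_prop
    exact (isOpen_ne_fun c1 c2).mem_nhds (by simpa using h.2)
  obtain ⟨ε, hε, hball⟩ := Metric.eventually_nhds_iff.1
    ((t1.eventually e1).and ((t2.eventually e2).and e3))
  have hball' : ∀ t ∈ Set.Ioo 0 ε, _ := fun t (ht : t ∈ Set.Ioo 0 ε) =>
    hball (show dist t 0 < ε by rw [Real.dist_eq, sub_zero, abs_of_pos ht.1]; exact ht.2)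
  refine hreg.not_overlap (i := i) (k := k) (f := fun t => s + c * t) (g := fun t => u + t) hε
    (fun t ht => ?_) ?_
  · obtain ⟨g1, g2, g3⟩ := hball' t ht
    refine ⟨?_, g3⟩
    rw [g1, g2]
    simp only [Prod.fst_add, Prod.smul_fst, h.1, hc]
    module
  · intro t ht t' ht' heq
    simp only at heq
    rw [(hball' t ht).1, (hball' t' ht').1] at heq
    simp only [Prod.fst_add, Prod.smul_fst, add_right_inj, add_sub_cancel_left] at heq
    have := smul_left_injective ℝ hi heq
    exact mul_left_cancel₀ hc0 this

theorem finite_crossings (hreg : L.IsRegular) (i : Fin n) (a b : ℝ) :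
    {s | s ∈ Set.Icc a b ∧ L.AtCrossing i s}.Finite := by
  have hE := L.period_pos i
  have hfin : ∀ s₀ : ℝ, {s | s ∈ Set.Icc a b ∧ ∃ m : ℤ, s = s₀ + m * L.period i}.Finite := by
    intro s₀
    refine ((Set.finite_Icc ⌈(a - s₀) / L.period i⌉ ⌊(b - s₀) / L.period i⌋).image
      (fun m : ℤ => s₀ + m * L.period i)).subset ?_
    rintro s ⟨hs, m, rfl⟩
    refine ⟨m, ⟨Int.ceil_le.2 ?_, Int.le_floor.2 ?_⟩, rfl⟩
    · rw [div_le_iff₀ hE]; linarith [hs.1]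
    · rw [le_div_iff₀ hE]; linarith [hs.2]
  refine Set.Finite.of_finite_fibers (fun s => (L.curve i s).1) (hreg.finite.subset ?_) ?_
  · rintro _ ⟨s, hs, rfl⟩
    exact ⟨i, s, rfl, hs.2⟩
  · rintro x ⟨s₀, hs₀, rfl⟩
    by_cases hex : ∃ s₁, L.Cross i s₀ i s₁
    · obtain ⟨s₁, h1⟩ := hex
      refine ((hfin s₀).union (hfin s₁)).subset ?_
      rintro s ⟨hs, hx⟩
      by_cases heq : L.curve i s₀ = L.curve i s
      · exact Or.inl ⟨hs.1, L.curve_eq_iff.1 heq⟩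
      · have : L.Cross i s₀ i s := ⟨hx.symm, heq⟩
        exact Or.inr ⟨hs.1, L.curve_eq_iff.1 (hreg.double _ _ _ _ _ _ h1 this)⟩
    · refine (hfin s₀).subset ?_
      rintro s ⟨hs, hx⟩
      refine ⟨hs.1, L.curve_eq_iff.1 ?_⟩
      by_contra heq
      exact hex ⟨s, hx.symm, heq⟩

end IsRegular

end PolyLink

/-! ### Transverse planar fields along a component -/

theorem det2_smul_right (a b : ℝ × ℝ) (c : ℝ) : det2 a (c • b) = c * det2 a b := by
  simp [det2]; ring

theorem det2_smul_left (a b : ℝ × ℝ) (c : ℝ) : det2 (c • a) b = c * det2 a b := by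
  simp [det2]; ring

theorem det2_add_left (a a' b : ℝ × ℝ) : det2 (a + a') b = det2 a b + det2 a' b := by
  simp [det2]; ring

theorem det2_sub_left (a a' b : ℝ × ℝ) : det2 (a - a') b = det2 a b - det2 a' b := by
  simp [det2]; ring

theorem det2_self (a : ℝ × ℝ) : det2 a a = 0 := by
  simp [det2]; ring

theorem det2_swap (a b : ℝ × ℝ) : det2 b a = -det2 a b := by
  simp [det2]; ring

theorem abs_det2_le (a b : ℝ × ℝ) : |det2 a b| ≤ 2 * ‖a‖ * ‖b‖ := by
  have h1 : |a.1| ≤ ‖a‖ := norm_fst_le a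
  have h2 : |a.2| ≤ ‖a‖ := norm_snd_le a
  have h3 : |b.1| ≤ ‖b‖ := norm_fst_le b
  have h4 : |b.2| ≤ ‖b‖ := norm_snd_le b
  have h5 := abs_sub (a.1 * b.2) (a.2 * b.1)
  rw [abs_mul, abs_mul] at h5
  have h6 := mul_le_mul h1 h4 (abs_nonneg _) (norm_nonneg a)
  have h7 := mul_le_mul h2 h3 (abs_nonneg _) (norm_nonneg a)
  unfold det2
  linarith

theorem continuous_det2 {X : Type*} [TopologicalSpace X] {f g : X → ℝ × ℝ} (hf : Continuous f)
    (hg : Continuous g) : Continuous fun x => det2 (f x) (g x) := by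
  unfold det2; fun_prop

/-- Two vectors that are not opposite lie on the same side of some line. -/
theorem exists_det2_pos {a b : ℝ × ℝ} (ha : a ≠ 0) (hb : b ≠ 0)
    (hab : ∀ c : ℝ, 0 < c → a ≠ -c • b) :
    ∃ v, 0 < det2 a v ∧ 0 < det2 b v := by
  have pos : ∀ a : ℝ × ℝ, a ≠ 0 → 0 < a.1 ^ 2 + a.2 ^ 2 := fun a ha => by
    have : a.1 ≠ 0 ∨ a.2 ≠ 0 := by
      by_contra h; push Not at h; exact ha (Prod.ext h.1 h.2)
    rcases this with h | h <;> positivity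
  have pa := pos a ha
  have pb := pos b hb
  set A := √(a.1 ^ 2 + a.2 ^ 2) with hA
  set B := √(b.1 ^ 2 + b.2 ^ 2) with hB
  have hA0 : 0 < A := Real.sqrt_pos.2 pa
  have hB0 : 0 < B := Real.sqrt_pos.2 pb
  have hA2 : A ^ 2 = a.1 ^ 2 + a.2 ^ 2 := Real.sq_sqrt pa.le
  have hB2 : B ^ 2 = b.1 ^ 2 + b.2 ^ 2 := Real.sq_sqrt pb.le
  have key : 0 < A * B + (a.1 * b.1 + a.2 * b.2) := by
    by_contra hc
    rw [not_lt] at hc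
    have hid : (A * B) ^ 2 = (a.1 * b.1 + a.2 * b.2) ^ 2 + det2 a b ^ 2 := by
      rw [mul_pow, hA2, hB2, det2]; ring
    have hAB := mul_pos hA0 hB0
    have hdet : det2 a b = 0 := by
      have : det2 a b ^ 2 ≤ 0 := by nlinarith
      exact pow_eq_zero_iff two_ne_zero |>.1 (le_antisymm this (sq_nonneg _))
    obtain ⟨c, hc'⟩ := exists_smul_of_det2_eq_zero ha hdet
    have hcneg : c < 0 := by
      by_contra hcn
      rw [not_lt] at hcn
      have h1 : b.1 = c * a.1 := by rw [hc']; simp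
      have h2 : b.2 = c * a.2 := by rw [hc']; simp
      rw [h1, h2] at hc
      nlinarith [mul_nonneg hcn pa.le]
    refine hab (-c⁻¹) (by simpa using hcneg) ?_
    rw [hc', neg_neg, smul_smul, inv_mul_cancel₀ hcneg.ne, one_smul]
  refine ⟨(-(B * a.2 + A * b.2), B * a.1 + A * b.1), ?_, ?_⟩
  · have : det2 a (-(B * a.2 + A * b.2), B * a.1 + A * b.1) =
        A * (A * B + (a.1 * b.1 + a.2 * b.2)) := by
      simp only [det2]; linear_combination -B * hA2
    rw [this]; positivity
  · have : det2 b (-(B * a.2 + A * b.2), B * a.1 + A * b.1) =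
        B * (A * B + (a.1 * b.1 + a.2 * b.2)) := by
      simp only [det2]; linear_combination -A * hB2
    rw [this]; positivity

namespace PolyLink

variable {n : ℕ} {L : PolyLink n}

theorem IsRegular.dir_parallel (hreg : L.IsRegular) {i k k' : Fin n} {s u u' : ℝ}
    (h : L.Cross i s k u) (h' : L.Cross i s k' u') : L.dir k' u' = L.dir k u := by
  obtain ⟨rfl, m, rfl⟩ := L.embedded _ _ _ _ (hreg.double _ _ _ _ _ _ h h')
  exact L.dir_add_int_mul k u m

theorem IsRegular.exists_local_direction (hreg : L.IsRegular) (i : Fin n) (s₀ : ℝ) :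
    ∃ v : ℝ × ℝ, 0 < det2 (L.dir i ((⌈s₀⌉ - 1 : ℤ) : ℝ)).1 v ∧ 0 < det2 (L.dir i s₀).1 v ∧
      ∀ k u, L.Cross i s₀ k u → ∃ a : ℝ, v = a • (L.dir k u).1 := by
  by_cases hc : L.AtCrossing i s₀
  · obtain ⟨k, u, h⟩ := hc
    have hd := hreg.det2_ne_zero h
    refine ⟨det2 (L.dir i s₀).1 (L.dir k u).1 • (L.dir k u).1, ?_, ?_, fun k' u' h' => ?_⟩
    · have hfl := lt_floor_add_one_of_ne (hreg.ne_int_of_cross h)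
      have : ⌈s₀⌉ - 1 = ⌊s₀⌋ := by
        have : ⌈s₀⌉ = ⌊s₀⌋ + 1 := Int.ceil_eq_iff.2 ⟨by push_cast; linarith [hfl.1], by
          push_cast; linarith [hfl.2]⟩
        omega
      have h2 : L.dir i ((⌊s₀⌋ : ℤ) : ℝ) = L.dir i s₀ := by simp [dir]
      rw [this, h2, det2_smul_right]
      exact mul_self_pos.2 hd
    · rw [det2_smul_right]
      exact mul_self_pos.2 hd
    · exact ⟨_, by rw [hreg.dir_parallel h h']⟩
  · obtain ⟨v, h1, h2⟩ := exists_det2_pos (hreg.dir_ne_zero i ((⌈s₀⌉ - 1 : ℤ) : ℝ))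
      (hreg.dir_ne_zero i s₀) (fun c hc => hreg.dir_not_opposite i s₀ hc)
    exact ⟨v, h1, h2, fun k u h => absurd h.atCrossing hc⟩

/-- Near a given time there is a constant transverse field; if it is the time of a crossing, the
field can be chosen parallel to the other strand there. -/
theorem IsRegular.exists_local_field (hreg : L.IsRegular) (i : Fin n) (s₀ : ℝ) :
    ∃ δ > 0, ∃ c > 0, ∃ v : ℝ × ℝ,
      (∀ s s', s₀ - 2 * δ ≤ s → s ≤ s' → s' ≤ s₀ + 2 * δ →
        c * (s' - s) ≤ det2 ((L.curve i s').1 - (L.curve i s).1) v) ∧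
      (∀ r, L.AtCrossing i r → |r - s₀| < δ → r = s₀) ∧
      ∀ k u, L.Cross i s₀ k u → ∃ a : ℝ, v = a • (L.dir k u).1 := by
  obtain ⟨v, h1, h2, h3⟩ := hreg.exists_local_direction i s₀
  have hfin : {s | (s ∈ Set.Icc (s₀ - 1) (s₀ + 1) ∧ L.AtCrossing i s) ∧ s ≠ s₀}.Finite :=
    (hreg.finite_crossings i (s₀ - 1) (s₀ + 1)).subset (fun s hs => hs.1)
  have hnh := hfin.isClosed.isOpen_compl.mem_nhds (x := s₀) (by simp)
  obtain ⟨ε, hε, hball⟩ := Metric.mem_nhds_iff.1 hnh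
  have hfl := Int.lt_floor_add_one s₀
  have hce := Int.ceil_lt_add_one s₀
  set δ := min (min ((⌊s₀⌋ + 1 - s₀) / 2) ((s₀ - (⌈s₀⌉ - 1)) / 2)) (min ε 1) with hδ
  have d1 : δ ≤ (⌊s₀⌋ + 1 - s₀) / 2 := (min_le_left _ _).trans (min_le_left _ _)
  have d2 : δ ≤ (s₀ - (⌈s₀⌉ - 1)) / 2 := (min_le_left _ _).trans (min_le_right _ _)
  have d3 : δ ≤ ε := (min_le_right _ _).trans (min_le_left _ _)
  have d4 : δ ≤ 1 := (min_le_right _ _).trans (min_le_right _ _)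
  have d0 : 0 < δ := lt_min (lt_min (by linarith) (by linarith)) (lt_min hε one_pos)
  set c := min (det2 (L.dir i ((⌈s₀⌉ - 1 : ℤ) : ℝ)).1 v) (det2 (L.dir i s₀).1 v) with hc
  have c1 : c ≤ det2 (L.dir i ((⌈s₀⌉ - 1 : ℤ) : ℝ)).1 v := min_le_left _ _
  have c2 : c ≤ det2 (L.dir i s₀).1 v := min_le_right _ _
  have hfw : ∀ t, s₀ ≤ t → t ≤ s₀ + 2 * δ → det2 ((L.curve i t).1 - (L.curve i s₀).1) v =
      (t - s₀) * det2 (L.dir i s₀).1 v := fun t ht ht' => by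
    rw [L.curve_forward i s₀ ht (by linarith), ← det2_smul_left]
    simp
  have hbw : ∀ t, t ≤ s₀ → s₀ - 2 * δ ≤ t → det2 ((L.curve i t).1 - (L.curve i s₀).1) v =
      (t - s₀) * det2 (L.dir i ((⌈s₀⌉ - 1 : ℤ) : ℝ)).1 v := fun t ht ht' => by
    rw [L.curve_backward i s₀ ht (by linarith), ← det2_smul_left]
    simp
  refine ⟨δ, d0, c, lt_min h1 h2, v, fun s s' hs hss' hs' => ?_, fun r hr hlt => ?_, h3⟩
  · have hsplit : det2 ((L.curve i s').1 - (L.curve i s).1) v =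
        det2 ((L.curve i s').1 - (L.curve i s₀).1) v -
          det2 ((L.curve i s).1 - (L.curve i s₀).1) v := by
      rw [← det2_sub_left]; congr 1; abel
    rw [hsplit]
    rcases le_total s s₀ with h | h <;> rcases le_total s' s₀ with h' | h'
    · rw [hbw s h hs, hbw s' h' (by linarith)]; nlinarith
    · rw [hbw s h hs, hfw s' h' hs']; nlinarith
    · have : s = s' := by linarith
      subst this; simp
    · rw [hfw s h (by linarith), hfw s' h' hs']; nlinarith
  · by_contra hne
    have hmem : r ∈ Metric.ball s₀ ε := by
      rw [Metric.mem_ball, Real.dist_eq]; linarith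
    have hlt' := abs_lt.1 hlt
    exact hball hmem ⟨⟨⟨by linarith [hlt'.1], by linarith [hlt'.2]⟩, hr⟩, hne⟩

/-- A periodic planar field along the component `i` which is transverse to the projection, so
firmly that nearby points of the plane lie on only one of the lines `p s + ℝ n s` with `s` near a
given parameter, and which at the crossings points along the other strand. -/
structure TransverseField (L : PolyLink n) (i : Fin n) where
  /-- the field -/
  vec : ℝ → ℝ × ℝ
  continuous_vec : Continuous vec
  vec_add_period : ∀ s, vec (s + L.period i) = vec s
  /-- the modulus of monotonicity -/
  slope : ℝ
  /-- the range of parameters in which monotonicity holds -/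
  window : ℝ
  /-- the distance from the component up to which monotonicity holds -/
  radius : ℝ
  slope_pos : 0 < slope
  window_pos : 0 < window
  radius_pos : 0 < radius
  mono : ∀ y s s', s ≤ s' → s' ≤ s + window → ‖y - (L.curve i s').1‖ ≤ radius →
    slope * (s' - s) ≤ det2 (y - (L.curve i s).1) (vec s) - det2 (y - (L.curve i s').1) (vec s')
  parallel : ∀ s k u, L.Cross i s k u → ∃ a : ℝ, vec s = a • (L.dir k u).1

/-- The distance from `s` to the multiples of the period. -/
def periodDist (L : PolyLink n) (i : Fin n) (s : ℝ) : ℝ := ‖(s : AddCircle (L.period i))‖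

theorem periodDist_lipschitz (i : Fin n) (s s' : ℝ) :
    |L.periodDist i s - L.periodDist i s'| ≤ |s - s'| := by
  unfold periodDist
  refine (abs_norm_sub_norm_le _ _).trans ?_
  rw [← AddCircle.coe_sub]
  simpa using (QuotientAddGroup.norm_mk_le_norm (S := AddSubgroup.zmultiples (L.period i))
      (m := s - s'))

theorem exists_of_periodDist_lt {i : Fin n} {s δ : ℝ} (h : L.periodDist i s < δ) :
    ∃ m : ℤ, |s - m * L.period i| < δ := by
  rw [periodDist, AddCircle.norm_eq] at h
  refine ⟨round ((L.period i)⁻¹ * s), ?_⟩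
  exact h

theorem periodDist_le (i : Fin n) (s : ℝ) : L.periodDist i s ≤ |s| := by
  simpa [periodDist] using (QuotientAddGroup.norm_mk_le_norm
      (S := AddSubgroup.zmultiples (L.period i)) (m := s))

theorem periodDist_add_int_mul (i : Fin n) (s : ℝ) (m : ℤ) :
    L.periodDist i (s + m * L.period i) = L.periodDist i s := by
  unfold periodDist
  rw [AddCircle.coe_add, ← zsmul_eq_mul, AddCircle.coe_zsmul, AddCircle.coe_period, smul_zero,
    add_zero]

theorem exists_int_mem_Icc (L : PolyLink n) (i : Fin n) (s : ℝ) :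
    ∃ m : ℤ, s + m * L.period i ∈ Set.Icc 0 (L.period i) := by
  have hE := L.period_pos i
  refine ⟨-⌊s / L.period i⌋, ?_, ?_⟩
  · have := Int.floor_le (s / L.period i)
    rw [le_div_iff₀ hE] at this
    push_cast; linarith
  · have := Int.lt_floor_add_one (s / L.period i)
    rw [div_lt_iff₀ hE] at this
    push_cast; linarith

/-- The local fields are summed with Lipschitz weights. This keeps the monotonicity because the
points to which it applies are close to the component, so that the variation of the weights
contributes little. -/
theorem IsRegular.exists_transverseField (hreg : L.IsRegular) (i : Fin n) :
    Nonempty (L.TransverseField i) := by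
  have hE := L.period_pos i
  choose δ hδ c hc v hmono hcr hpar using hreg.exists_local_field i
  obtain ⟨T, hT, hcov⟩ := (isCompact_Icc (a := (0 : ℝ)) (b := L.period i)).elim_nhds_subcover
    (fun x => Metric.ball x (δ x)) (fun x _ => Metric.ball_mem_nhds x (hδ x))
  let b : ℝ → ℝ → ℝ := fun x s => max 0 (δ x - L.periodDist i (s - x))
  have hb0 : ∀ x s, 0 ≤ b x s := fun x s => le_max_left _ _
  have hblip : ∀ x s s', |b x s - b x s'| ≤ |s - s'| := fun x s s' => by
    refine (abs_max_sub_max_le_max _ _ _ _).trans ?_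
    rw [sub_self, abs_zero, max_eq_right (abs_nonneg _)]
    have := periodDist_lipschitz (L := L) i (s' - x) (s - x)
    rw [show s' - x - (s - x) = -(s - s') by ring, abs_neg] at this
    rw [show δ x - L.periodDist i (s - x) - (δ x - L.periodDist i (s' - x)) =
      L.periodDist i (s' - x) - L.periodDist i (s - x) by ring]
    exact this
  have hbper : ∀ x s (m : ℤ), b x (s + m * L.period i) = b x s := fun x s m => by
    simp only [b]
    rw [show s + m * L.period i - x = (s - x) + m * L.period i by ring, periodDist_add_int_mul]
  have hbpos : ∀ x s, 0 < b x s → ∃ m : ℤ, |s - x - m * L.period i| < δ x := fun x s h => by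
    refine exists_of_periodDist_lt ?_
    by_contra hle
    rw [not_lt] at hle
    simp only [b] at h
    rw [max_eq_left (by linarith)] at h
    exact lt_irrefl _ h
  let N : ℝ → ℝ × ℝ := fun s => ∑ x ∈ T, b x s • v x
  have hNper : ∀ s (m : ℤ), N (s + m * L.period i) = N s := fun s m => by simp only [N, hbper]
  have hbcont : ∀ x, Continuous (b x) := fun x =>
    (LipschitzWith.of_dist_le_mul (K := 1) fun s s' => by
      simpa [Real.dist_eq] using hblip x s s').continuous
  have hNcont : Continuous N := by
    have := hbcont
    fun_prop
  -- a Lipschitz constant for the field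
  let K : ℝ := ∑ x ∈ T, ‖v x‖
  have hK0 : 0 ≤ K := Finset.sum_nonneg fun x _ => norm_nonneg _
  have hNlip : ∀ s s', ‖N s - N s'‖ ≤ K * |s - s'| := fun s s' => by
    simp only [N, K]
    rw [← Finset.sum_sub_distrib, Finset.sum_mul]
    refine (norm_sum_le _ _).trans (Finset.sum_le_sum fun x _ => ?_)
    rw [← sub_smul, norm_smul, Real.norm_eq_abs, mul_comm]
    exact mul_le_mul_of_nonneg_left (hblip x s s') (norm_nonneg _)
  have hTne : T.Nonempty := by
    rw [Finset.nonempty_iff_ne_empty]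
    rintro rfl
    simpa using hcov (Set.left_mem_Icc.2 hE.le)
  -- a uniform slope and a uniform range
  obtain ⟨w, hw, hwle⟩ : ∃ w > 0, ∀ x ∈ T, w ≤ δ x := by
    refine ⟨T.inf' hTne δ, ?_, fun x hx => Finset.inf'_le _ hx⟩
    rw [gt_iff_lt, Finset.lt_inf'_iff]
    exact fun x _ => hδ x
  let M : ℝ → ℝ := fun s => ∑ x ∈ T, b x s * c x
  have hMcont : Continuous M := by
    have := hbcont
    fun_prop
  have hMpos : ∀ s ∈ Set.Icc 0 (L.period i), 0 < M s := fun s hs => by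
    have := hcov hs
    simp only [Set.mem_iUnion, exists_prop] at this
    obtain ⟨x, hx, hsx⟩ := this
    refine Finset.sum_pos' (fun x _ => mul_nonneg (hb0 x s) (hc x).le) ⟨x, hx, ?_⟩
    refine mul_pos (lt_max_of_lt_right ?_) (hc x)
    have := periodDist_le (L := L) i (s - x)
    rw [Metric.mem_ball, Real.dist_eq] at hsx
    linarith
  obtain ⟨M₀, hM₀, hMle⟩ : ∃ M₀ > 0, ∀ s, M₀ ≤ M s := by
    obtain ⟨s₁, hs₁, hmin⟩ := (isCompact_Icc (a := (0 : ℝ)) (b := L.period i)).exists_isMinOn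
      ⟨0, Set.left_mem_Icc.2 hE.le⟩ hMcont.continuousOn
    refine ⟨M s₁, hMpos s₁ hs₁, fun s => ?_⟩
    obtain ⟨m, hm⟩ := L.exists_int_mem_Icc i s
    have : M (s + m * L.period i) = M s := by simp only [M, hbper]
    rw [← this]
    exact hmin hm
  have hslope : ∀ s s', s ≤ s' → s' ≤ s + w →
      M₀ * (s' - s) ≤ det2 ((L.curve i s').1 - (L.curve i s).1) (N s) := by
    intro s s' hss' hs'
    have hsum : det2 ((L.curve i s').1 - (L.curve i s).1) (N s) =
        ∑ x ∈ T, b x s * det2 ((L.curve i s').1 - (L.curve i s).1) (v x) := by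
      simp only [N, det2, Prod.fst_sum, Prod.snd_sum, Finset.mul_sum, ← Finset.sum_sub_distrib]
      refine Finset.sum_congr rfl fun x _ => ?_
      simp only [Prod.smul_fst, Prod.smul_snd, smul_eq_mul]
      ring
    rw [hsum]
    refine (mul_le_mul_of_nonneg_right (hMle s) (sub_nonneg.2 hss')).trans ?_
    simp only [M]
    rw [Finset.sum_mul]
    refine Finset.sum_le_sum fun x hx => ?_
    rcases (hb0 x s).eq_or_lt with h0 | hpos
    · rw [← h0]; simp
    · rw [mul_assoc]
      refine mul_le_mul_of_nonneg_left ?_ hpos.le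
      obtain ⟨m, hm⟩ := hbpos x s hpos
      have hm' := abs_lt.1 hm
      have hwx := hwle x hx
      have := hmono x (s + (-m : ℤ) * L.period i) (s' + (-m : ℤ) * L.period i)
        (by push_cast; linarith [hm'.1, hδ x]) (by linarith) (by push_cast; linarith [hm'.2])
      rw [curve_add_int_mul, curve_add_int_mul] at this
      linarith
  refine ⟨⟨N, hNcont, fun s => by simpa using hNper s 1, M₀ / 2, w, M₀ / (4 * (K + 1)),
    by positivity, hw, by positivity, ?_, ?_⟩⟩
  · intro y s s' hss' hs' hy
    have h1 := hslope s s' hss' hs'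
    have h2 := abs_det2_le (y - (L.curve i s').1) (N s - N s')
    have h3 := hNlip s s'
    rw [abs_sub_comm, abs_of_nonneg (sub_nonneg.2 hss')] at h3
    have h4 : 2 * ‖y - (L.curve i s').1‖ * ‖N s - N s'‖ ≤
        2 * (M₀ / (4 * (K + 1))) * (K * (s' - s)) := by gcongr
    have h5 : 2 * (M₀ / (4 * (K + 1))) * (K * (s' - s)) ≤ M₀ / 2 * (s' - s) := by
      have : 2 * (M₀ / (4 * (K + 1))) * (K * (s' - s)) =
          M₀ / 2 * (s' - s) * (K / (K + 1)) := by field_simp; ring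
      rw [this]
      refine mul_le_of_le_one_right ?_ ((div_le_one (by linarith)).2 (by linarith))
      have := sub_nonneg.2 hss'
      positivity
    have h6 := neg_abs_le (det2 (y - (L.curve i s').1) (N s - N s'))
    have h7 : det2 (y - (L.curve i s).1) (N s) - det2 (y - (L.curve i s').1) (N s') =
        det2 ((L.curve i s').1 - (L.curve i s).1) (N s) +
          det2 (y - (L.curve i s').1) (N s - N s') := by
      simp only [det2, Prod.fst_sub, Prod.snd_sub]; ring
    rw [h7]
    linarith
  · intro s k u hcross
    have hmem : N s ∈ Submodule.span ℝ {(L.dir k u).1} := by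
      refine Submodule.sum_mem _ fun x hx => ?_
      rcases (hb0 x s).eq_or_lt with h0 | hpos
      · rw [← h0, zero_smul]; exact Submodule.zero_mem _
      · refine Submodule.smul_mem _ _ ?_
        obtain ⟨m, hm⟩ := hbpos x s hpos
        have hcx : L.Cross i (s + (-m : ℤ) * L.period i) k u := (cross_add_int_mul _).2 hcross
        have hsx : s + (-m : ℤ) * L.period i = x := by
          refine hcr x _ hcx.atCrossing ?_
          rw [show s + ((-m : ℤ) : ℝ) * L.period i - x = s - x - m * L.period i by push_cast; ring]
          exact hm
        obtain ⟨a, ha⟩ := hpar x k u (hsx ▸ hcx)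
        exact Submodule.mem_span_singleton.2 ⟨a, ha.symm⟩
    obtain ⟨a, ha⟩ := Submodule.mem_span_singleton.1 hmem
    exact ⟨a, ha.symm⟩

end PolyLink

/-! ### The tube around a component -/

namespace PolyLink

variable {n : ℕ} {L : PolyLink n} {i : Fin n}

namespace TransverseField

variable (N : L.TransverseField i)

/-- The point with parameters `s`, `ξ` of the planar strip along the projection. -/
def plane (s ξ : ℝ) : ℝ × ℝ := (L.curve i s).1 + ξ • N.vec s

/-- The point with parameters `s`, `w` of the tube around the component: `w` is displaced from the
component by `Re w` in the direction of the field, and by `Im w` vertically. -/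
def tube (s : ℝ) (w : ℂ) : Space := (N.plane s w.re, (L.curve i s).2 + w.im)

theorem vec_add_int_mul (s : ℝ) (m : ℤ) : N.vec (s + m * L.period i) = N.vec s := by
  have h : Function.Periodic N.vec (L.period i) := N.vec_add_period
  exact h.int_mul m s

theorem plane_add_int_mul (s ξ : ℝ) (m : ℤ) : N.plane (s + m * L.period i) ξ = N.plane s ξ := by
  simp only [plane, vec_add_int_mul, curve_add_int_mul]

theorem tube_add_int_mul (s : ℝ) (w : ℂ) (m : ℤ) :
    N.tube (s + m * L.period i) w = N.tube s w := by
  simp only [tube, plane_add_int_mul, curve_add_int_mul]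

theorem plane_zero (s : ℝ) : N.plane s 0 = (L.curve i s).1 := by simp [plane]

theorem tube_zero (s : ℝ) : N.tube s 0 = L.curve i s := by simp [tube, plane_zero]

theorem continuous_plane {X : Type*} [TopologicalSpace X] {f g : X → ℝ} (hf : Continuous f)
    (hg : Continuous g) : Continuous fun x => N.plane (f x) (g x) := by
  have := N.continuous_vec
  unfold plane
  fun_prop

theorem continuous_tube {X : Type*} [TopologicalSpace X] {f : X → ℝ} {g : X → ℂ}
    (hf : Continuous f) (hg : Continuous g) : Continuous fun x => N.tube (f x) (g x) := by
  have := N.continuous_plane hf (Complex.continuous_re.comp hg)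
  unfold tube
  exact this.prodMk (by fun_prop)

theorem det2_plane (s ξ : ℝ) : det2 (N.plane s ξ - (L.curve i s).1) (N.vec s) = 0 := by
  simp [plane, det2]; ring

/-- The function `s ↦ det (y - p s, n s)` is strictly decreasing near `y`. -/
theorem det2_lt {y : ℝ × ℝ} {s s' : ℝ} (h : s < s') (h1 : s' ≤ s + N.window)
    (h2 : ‖y - (L.curve i s').1‖ ≤ N.radius) :
    det2 (y - (L.curve i s').1) (N.vec s') < det2 (y - (L.curve i s).1) (N.vec s) := by
  have := N.mono y s s' h.le h1 h2
  have := mul_pos N.slope_pos (sub_pos.2 h)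
  linarith

theorem eq_of_det2_eq_zero {y : ℝ × ℝ} {s s' : ℝ} (h : |s' - s| ≤ N.window)
    (h1 : ‖y - (L.curve i s).1‖ ≤ N.radius) (h2 : ‖y - (L.curve i s').1‖ ≤ N.radius)
    (h3 : det2 (y - (L.curve i s).1) (N.vec s) = 0)
    (h4 : det2 (y - (L.curve i s').1) (N.vec s') = 0) : s = s' := by
  have h' := abs_le.1 h
  rcases lt_trichotomy s s' with hlt | heq | hlt
  · have := N.det2_lt hlt (by linarith) h2; linarith
  · exact heq
  · have := N.det2_lt hlt (by linarith) h1; linarith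

theorem vec_ne_zero (s : ℝ) : N.vec s ≠ 0 := by
  intro h0
  have hw := N.window_pos
  have := N.mono (L.curve i (s + N.window)).1 s (s + N.window) (by linarith) le_rfl
    (by rw [sub_self, norm_zero]; exact N.radius_pos.le)
  rw [h0, sub_self] at this
  have h2 := mul_pos N.slope_pos hw
  simp [det2] at this
  linarith

theorem plane_injective {s ξ ξ' : ℝ} (h : N.plane s ξ = N.plane s ξ') : ξ = ξ' :=
  smul_left_injective ℝ (N.vec_ne_zero s) (add_left_cancel h)

theorem tube_injective {s : ℝ} {w w' : ℂ} (h : N.tube s w = N.tube s w') : w = w' :=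
  Complex.ext (N.plane_injective (congrArg Prod.fst h)) (add_left_cancel (congrArg Prod.snd h))

/-- A function of the parameters that is small where both vanish is bounded by the constants of
the field nearby. -/
theorem eventually_radius {X : Type*} [TopologicalSpace X] {x₀ : X} {f : X → ℝ × ℝ} {g : X → ℝ}
    (hf : ContinuousAt f x₀) (hg : ContinuousAt g x₀) (h0 : f x₀ = (L.curve i (g x₀)).1) :
    ∀ᶠ x in nhds x₀, ‖f x - (L.curve i (g x)).1‖ ≤ N.radius := by
  have hc : ContinuousAt (fun x => ‖f x - (L.curve i (g x)).1‖) x₀ := by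
    have : ContinuousAt (fun x => (L.curve i (g x)).1) x₀ :=
      (continuous_fst.continuousAt).comp ((L.curve i).continuous.continuousAt.comp hg)
    exact (hf.sub this).norm
  have hlt : ‖f x₀ - (L.curve i (g x₀)).1‖ < N.radius := by
    rw [h0, sub_self, norm_zero]; exact N.radius_pos
  exact (hc.eventually (gt_mem_nhds hlt)).mono fun _ h => h.le

/-- Near `(s₀, s₁)` with `s₁` a translate of `s₀` by periods, points of the strip with the same
position have parameters that differ by this translation. -/
theorem eventually_unique {X : Type*} [TopologicalSpace X] {x₀ : X} {a b ξ η : X → ℝ}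
    (ha : ContinuousAt a x₀) (hb : ContinuousAt b x₀) (hξ : ContinuousAt ξ x₀) (hξ0 : ξ x₀ = 0)
    {m : ℤ} (hm : b x₀ = a x₀ + m * L.period i) :
    ∀ᶠ x in nhds x₀, N.plane (a x) (ξ x) = N.plane (b x) (η x) → b x = a x + m * L.period i := by
  have hw : ∀ᶠ x in nhds x₀, |(b x - m * L.period i) - a x| ≤ N.window := by
    have hc : ContinuousAt (fun x => |(b x - m * L.period i) - a x|) x₀ :=
      ((hb.sub continuousAt_const).sub ha).abs
    have hlt : |(b x₀ - m * L.period i) - a x₀| < N.window := by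
      rw [hm]; simpa using N.window_pos
    exact (hc.eventually (gt_mem_nhds hlt)).mono fun _ h => h.le
  have hp : ContinuousAt (fun x => N.plane (a x) (ξ x)) x₀ := by
    have := N.continuous_plane (X := ℝ × ℝ) continuous_fst continuous_snd
    exact this.continuousAt.comp (ha.prodMk hξ)
  have h1 := N.eventually_radius hp ha (by rw [hξ0, plane_zero])
  have h2 := N.eventually_radius hp hb (by rw [hξ0, plane_zero, hm, curve_add_int_mul])
  filter_upwards [hw, h1, h2] with x hwx h1x h2x heq
  have e : b x = (b x - m * L.period i) + m * L.period i := by ring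
  have hc : L.curve i (b x) = L.curve i (b x - m * L.period i) := by
    conv_lhs => rw [e]
    exact L.curve_add_int_mul i _ m
  have hv : N.vec (b x) = N.vec (b x - m * L.period i) := by
    conv_lhs => rw [e]
    exact N.vec_add_int_mul _ m
  have := N.eq_of_det2_eq_zero (y := N.plane (a x) (ξ x)) hwx h1x (by rw [← hc]; exact h2x)
    (N.det2_plane _ _) (by rw [← hc, ← hv, heq]; exact N.det2_plane _ _)
  linarith

/-- A thin strip meets the projection of the link only in the projection of its core, and along the
lines through the crossings. -/
theorem exists_strip_radius (hreg : L.IsRegular) {g : ℝ} (hg : 0 < g) :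
    ∃ r > 0, ∀ s k u ξ, |ξ| ≤ r → N.plane s ξ = (L.curve k u).1 →
      (k = i ∧ ξ = 0 ∧ ∃ m : ℤ, u = s + m * L.period i) ∨
      ∃ u₀, L.Cross i s k u₀ ∧ |u - u₀| < g := by
  have hloc : ∀ k, ∀ y ∈ Set.Icc 0 (L.period i) ×ˢ Set.Icc 0 (L.period k),
      ∀ᶠ z : ℝ × (ℝ × ℝ) in nhds ((0 : ℝ), y), N.plane z.2.1 z.1 = (L.curve k z.2.2).1 →
        (k = i ∧ z.1 = 0 ∧ ∃ m : ℤ, z.2.2 = z.2.1 + m * L.period i) ∨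
        ∃ u₀, L.Cross i z.2.1 k u₀ ∧ |z.2.2 - u₀| < g := by
    rintro k ⟨s₀, u₀⟩ -
    by_cases hp : (L.curve i s₀).1 = (L.curve k u₀).1
    · by_cases heq : L.curve i s₀ = L.curve k u₀
      · obtain ⟨rfl, m, hm⟩ := L.embedded _ _ _ _ heq
        have := N.eventually_unique (x₀ := ((0 : ℝ), (s₀, u₀))) (a := fun z => z.2.1)
          (b := fun z => z.2.2) (ξ := fun z => z.1) (η := fun _ => 0) (by fun_prop) (by fun_prop)
          (by fun_prop) rfl (m := m) hm
        filter_upwards [this] with z hz hz'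
        have h := hz (by rw [hz', plane_zero])
        refine Or.inl ⟨rfl, ?_, m, h⟩
        rw [h, curve_add_int_mul, ← N.plane_zero] at hz'
        exact N.plane_injective hz'
      · have hcr : L.Cross i s₀ k u₀ := ⟨hp, heq⟩
        obtain ⟨a, ha⟩ := N.parallel _ _ _ hcr
        have hst : ∀ᶠ z : ℝ × (ℝ × ℝ) in nhds ((0 : ℝ), (s₀, u₀)),
            L.curve k z.2.2 = L.curve k u₀ + (z.2.2 - u₀) • L.dir k u₀ :=
          (show ContinuousAt (fun z : ℝ × (ℝ × ℝ) => z.2.2) ((0 : ℝ), (s₀, u₀)) by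
            fun_prop).eventually (L.curve_near k (hreg.ne_int_of_cross hcr.symm))
        have hy : ContinuousAt (fun z : ℝ × (ℝ × ℝ) => (L.curve k z.2.2).1)
          ((0 : ℝ), (s₀, u₀)) := by fun_prop
        have h1 := N.eventually_radius (g := fun z => z.2.1) hy (by fun_prop) hp.symm
        have h2 := N.eventually_radius (g := fun z => s₀) hy (by fun_prop) hp.symm
        have h3 : ∀ᶠ z : ℝ × (ℝ × ℝ) in nhds ((0 : ℝ), (s₀, u₀)), |s₀ - z.2.1| < N.window :=
          (show ContinuousAt (fun z : ℝ × (ℝ × ℝ) => |s₀ - z.2.1|) ((0 : ℝ), (s₀, u₀)) by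
            fun_prop).eventually (gt_mem_nhds (by simpa using N.window_pos))
        have h4 : ∀ᶠ z : ℝ × (ℝ × ℝ) in nhds ((0 : ℝ), (s₀, u₀)), |z.2.2 - u₀| < g :=
          (show ContinuousAt (fun z : ℝ × (ℝ × ℝ) => |z.2.2 - u₀|) ((0 : ℝ), (s₀, u₀)) by
            fun_prop).eventually (gt_mem_nhds (by simpa using hg))
        filter_upwards [hst, h1, h2, h3, h4] with z hz h1z h2z h3z h4z hz'
        have hs : z.2.1 = s₀ := by
          refine N.eq_of_det2_eq_zero (y := (L.curve k z.2.2).1) h3z.le h1z h2z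
            (by rw [← hz']; exact N.det2_plane _ _) ?_
          rw [hz, ha, hp]
          simp [det2]; ring
        exact Or.inr ⟨u₀, hs ▸ hcr, h4z⟩
    · have hne : ∀ᶠ z : ℝ × (ℝ × ℝ) in nhds ((0 : ℝ), (s₀, u₀)),
          N.plane z.2.1 z.1 ≠ (L.curve k z.2.2).1 := by
        refine (isOpen_ne_fun (N.continuous_plane (by fun_prop) (by fun_prop))
          (by fun_prop)).mem_nhds ?_
        simpa [plane_zero] using hp
      filter_upwards [hne] with z hz hz'
      exact absurd hz' hz
  have hall : ∀ᶠ ξ in nhds (0 : ℝ), ∀ k, ∀ y ∈ Set.Icc 0 (L.period i) ×ˢ Set.Icc 0 (L.period k),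
      N.plane y.1 ξ = (L.curve k y.2).1 →
        (k = i ∧ ξ = 0 ∧ ∃ m : ℤ, y.2 = y.1 + m * L.period i) ∨
        ∃ u₀, L.Cross i y.1 k u₀ ∧ |y.2 - u₀| < g := by
    refine Filter.eventually_all.2 fun k => ?_
    exact (isCompact_Icc.prod isCompact_Icc).eventually_forall_of_forall_eventually
      (P := fun (ξ : ℝ) (y : ℝ × ℝ) => N.plane y.1 ξ = (L.curve k y.2).1 →
        (k = i ∧ ξ = 0 ∧ ∃ m : ℤ, y.2 = y.1 + m * L.period i) ∨
        ∃ u₀, L.Cross i y.1 k u₀ ∧ |y.2 - u₀| < g) (hloc k)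
  obtain ⟨ε, hε, hball⟩ := Metric.eventually_nhds_iff.1 hall
  refine ⟨ε / 2, half_pos hε, fun s k u ξ hξ heq => ?_⟩
  obtain ⟨a, ha⟩ := L.exists_int_mem_Icc i s
  obtain ⟨b, hb⟩ := L.exists_int_mem_Icc k u
  rcases hball (show dist ξ 0 < ε by rw [Real.dist_eq, sub_zero]; linarith) k
    (s + a * L.period i, u + b * L.period k) ⟨ha, hb⟩
    (by simp only [plane_add_int_mul, curve_add_int_mul, heq]) with ⟨rfl, h0, m, hm⟩ | ⟨u₀, h1, h2⟩
  · refine Or.inl ⟨rfl, h0, m + a - b, ?_⟩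
    simp only at hm
    push_cast
    linarith
  · refine Or.inr ⟨u₀ - b * L.period k, ?_, ?_⟩
    · have h3 : L.Cross i s k u₀ := (cross_add_int_mul a).1 h1
      have h4 := (cross_add_int_mul (L := L) (-b)).2 h3.symm
      have e : u₀ + ((-b : ℤ) : ℝ) * L.period k = u₀ - b * L.period k := by push_cast; ring
      rw [e] at h4
      exact h4.symm
    · simp only at h2
      rwa [show u - (u₀ - b * L.period k) = u + b * L.period k - u₀ by ring]

/-- A thin tube meets the link only in its core. -/
theorem exists_tube_radius : ∃ r > 0, ∀ s k u w, ‖w‖ ≤ r → N.tube s w = L.curve k u → w = 0 := by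
  have hloc : ∀ k, ∀ y ∈ Set.Icc 0 (L.period i) ×ˢ Set.Icc 0 (L.period k),
      ∀ᶠ z : ℂ × (ℝ × ℝ) in nhds ((0 : ℂ), y), N.tube z.2.1 z.1 = L.curve k z.2.2 → z.1 = 0 := by
    rintro k ⟨s₀, u₀⟩ -
    by_cases heq : L.curve i s₀ = L.curve k u₀
    · obtain ⟨rfl, m, hm⟩ := L.embedded _ _ _ _ heq
      have := N.eventually_unique (x₀ := ((0 : ℂ), (s₀, u₀))) (a := fun z => z.2.1)
        (b := fun z => z.2.2) (ξ := fun z => z.1.re) (η := fun _ => 0) (by fun_prop) (by fun_prop)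
        (by fun_prop) rfl (m := m) hm
      filter_upwards [this] with z hz hz'
      have h := hz (by rw [plane_zero, ← hz']; rfl)
      rw [h, curve_add_int_mul, ← N.tube_zero] at hz'
      exact N.tube_injective hz'
    · have hne : ∀ᶠ z : ℂ × (ℝ × ℝ) in nhds ((0 : ℂ), (s₀, u₀)),
          N.tube z.2.1 z.1 ≠ L.curve k z.2.2 := by
        refine (isOpen_ne_fun (N.continuous_tube (by fun_prop) (by fun_prop))
          (by fun_prop)).mem_nhds ?_
        simpa [tube_zero] using heq
      filter_upwards [hne] with z hz hz'
      exact absurd hz' hz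
  have hall : ∀ᶠ w in nhds (0 : ℂ), ∀ k, ∀ y ∈ Set.Icc 0 (L.period i) ×ˢ Set.Icc 0 (L.period k),
      N.tube y.1 w = L.curve k y.2 → w = 0 := by
    refine Filter.eventually_all.2 fun k => ?_
    exact (isCompact_Icc.prod isCompact_Icc).eventually_forall_of_forall_eventually
      (P := fun (w : ℂ) (y : ℝ × ℝ) => N.tube y.1 w = L.curve k y.2 → w = 0) (hloc k)
  obtain ⟨ε, hε, hball⟩ := Metric.eventually_nhds_iff.1 hall
  refine ⟨ε / 2, half_pos hε, fun s k u w hw heq => ?_⟩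
  obtain ⟨a, ha⟩ := L.exists_int_mem_Icc i s
  obtain ⟨b, hb⟩ := L.exists_int_mem_Icc k u
  exact hball (show dist w 0 < ε by rw [dist_zero_right]; linarith) k
    (s + a * L.period i, u + b * L.period k) ⟨ha, hb⟩
    (by simp only [tube_add_int_mul, curve_add_int_mul, heq])

/-- A thin tube is embedded. -/
theorem exists_embedded_radius : ∃ r > 0, ∀ s s' w w', ‖w‖ ≤ r → ‖w'‖ ≤ r →
    N.tube s w = N.tube s' w' → w = w' ∧ ∃ m : ℤ, s' = s + m * L.period i := by
  have hloc : ∀ y ∈ Set.Icc 0 (L.period i) ×ˢ Set.Icc 0 (L.period i),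
      ∀ᶠ z : (ℂ × ℂ) × (ℝ × ℝ) in nhds ((0 : ℂ × ℂ), y), N.tube z.2.1 z.1.1 = N.tube z.2.2 z.1.2 →
        z.1.1 = z.1.2 ∧ ∃ m : ℤ, z.2.2 = z.2.1 + m * L.period i := by
    rintro ⟨s₀, u₀⟩ -
    by_cases heq : L.curve i s₀ = L.curve i u₀
    · obtain ⟨m, hm⟩ := L.curve_eq_iff.1 heq
      have := N.eventually_unique (x₀ := ((0 : ℂ × ℂ), (s₀, u₀))) (a := fun z => z.2.1)
        (b := fun z => z.2.2) (ξ := fun z => z.1.1.re) (η := fun z => z.1.2.re) (by fun_prop)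
        (by fun_prop) (by fun_prop) rfl (m := m) hm
      filter_upwards [this] with z hz hz'
      have h := hz (congrArg Prod.fst hz')
      rw [h, tube_add_int_mul] at hz'
      exact ⟨N.tube_injective hz', m, h⟩
    · have hne : ∀ᶠ z : (ℂ × ℂ) × (ℝ × ℝ) in nhds ((0 : ℂ × ℂ), (s₀, u₀)),
          N.tube z.2.1 z.1.1 ≠ N.tube z.2.2 z.1.2 := by
        refine (isOpen_ne_fun (N.continuous_tube (by fun_prop) (by fun_prop))
          (N.continuous_tube (by fun_prop) (by fun_prop))).mem_nhds ?_
        simpa [tube_zero] using heq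
      filter_upwards [hne] with z hz hz'
      exact absurd hz' hz
  have hall : ∀ᶠ w in nhds (0 : ℂ × ℂ), ∀ y ∈ Set.Icc 0 (L.period i) ×ˢ Set.Icc 0 (L.period i),
      N.tube y.1 w.1 = N.tube y.2 w.2 →
        w.1 = w.2 ∧ ∃ m : ℤ, y.2 = y.1 + m * L.period i :=
    (isCompact_Icc.prod isCompact_Icc).eventually_forall_of_forall_eventually
      (P := fun (w : ℂ × ℂ) (y : ℝ × ℝ) => N.tube y.1 w.1 = N.tube y.2 w.2 →
        w.1 = w.2 ∧ ∃ m : ℤ, y.2 = y.1 + m * L.period i) hloc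
  obtain ⟨ε, hε, hball⟩ := Metric.eventually_nhds_iff.1 hall
  refine ⟨ε / 2, half_pos hε, fun s s' w w' hw hw' heq => ?_⟩
  obtain ⟨a, ha⟩ := L.exists_int_mem_Icc i s
  obtain ⟨b, hb⟩ := L.exists_int_mem_Icc i s'
  obtain ⟨h1, m, h2⟩ := hball (y := (w, w')) (by
      rw [dist_zero_right, Prod.norm_def]; exact max_lt (by linarith) (by linarith))
    (s + a * L.period i, s' + b * L.period i) ⟨ha, hb⟩
    (by simp only [tube_add_int_mul, heq])
  refine ⟨h1, m + a - b, ?_⟩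
  simp only at h2
  push_cast
  linarith

/-- The tube of any radius contains a neighbourhood of the component. -/
theorem exists_nbhd_subset_tube {r : ℝ} (hr : 0 < r) : ∃ ε > 0, ∀ s₀ (x : Space),
    ‖x - L.curve i s₀‖ < ε → ∃ s w, ‖w‖ ≤ r ∧ N.tube s w = x := by
  have hE := L.period_pos i
  -- uniform continuity of the component
  have huc : ∀ ε > 0, ∃ d > 0, ∀ s s', |s' - s| ≤ d → ‖L.curve i s' - L.curve i s‖ ≤ ε := by
    intro ε hε
    have hloc : ∀ y ∈ Set.Icc 0 (L.period i), ∀ᶠ z : ℝ × ℝ in nhds ((0 : ℝ), y),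
        ‖L.curve i (z.2 + z.1) - L.curve i z.2‖ ≤ ε := by
      intro y _
      have hc : Continuous fun z : ℝ × ℝ => ‖L.curve i (z.2 + z.1) - L.curve i z.2‖ := by fun_prop
      exact (hc.continuousAt.eventually (gt_mem_nhds (by simpa using hε))).mono fun _ h => h.le
    have hall := (isCompact_Icc (a := (0 : ℝ))
      (b := L.period i)).eventually_forall_of_forall_eventually
      (P := fun d y => ‖L.curve i (y + d) - L.curve i y‖ ≤ ε) hloc
    obtain ⟨d, hd, hball⟩ := Metric.eventually_nhds_iff.1 hall
    refine ⟨d / 2, half_pos hd, fun s s' h => ?_⟩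
    obtain ⟨m, hm⟩ := L.exists_int_mem_Icc i s
    have := hball (show dist (s' - s) 0 < d by rw [Real.dist_eq, sub_zero]; linarith) _ hm
    rw [curve_add_int_mul, show s + m * L.period i + (s' - s) = s' + m * L.period i by ring,
      curve_add_int_mul] at this
    exact this
  -- the field is bounded, and bounded away from zero
  obtain ⟨ν, hν, hνle⟩ : ∃ ν > 0, ∀ s, ν ≤ ‖N.vec s‖ := by
    obtain ⟨s₁, -, hmin⟩ := (isCompact_Icc (a := (0 : ℝ)) (b := L.period i)).exists_isMinOn
      ⟨0, Set.left_mem_Icc.2 hE.le⟩ N.continuous_vec.norm.continuousOn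
    refine ⟨‖N.vec s₁‖, norm_pos_iff.2 (N.vec_ne_zero s₁), fun s => ?_⟩
    obtain ⟨m, hm⟩ := L.exists_int_mem_Icc i s
    rw [← N.vec_add_int_mul s m]
    exact hmin hm
  obtain ⟨M, hM, hMle⟩ : ∃ M > 0, ∀ s, ‖N.vec s‖ ≤ M := by
    obtain ⟨s₁, -, hmax⟩ := (isCompact_Icc (a := (0 : ℝ)) (b := L.period i)).exists_isMaxOn
      ⟨0, Set.left_mem_Icc.2 hE.le⟩ N.continuous_vec.norm.continuousOn
    refine ⟨‖N.vec s₁‖, norm_pos_iff.2 (N.vec_ne_zero s₁), fun s => ?_⟩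
    obtain ⟨m, hm⟩ := L.exists_int_mem_Icc i s
    rw [← N.vec_add_int_mul s m]
    exact hmax hm
  have hr2 : 0 < r / 2 := half_pos hr
  obtain ⟨d₁, hd₁, hd₁le⟩ := huc (min (N.radius / 2) (min (r / 4) (ν * (r / 2) / 2)))
    (lt_min (half_pos N.radius_pos) (lt_min (by positivity) (by positivity)))
  set d := min d₁ N.window with hd
  have hd0 : 0 < d := lt_min hd₁ N.window_pos
  have hdw : d ≤ N.window := min_le_right _ _
  set ε := min (min (N.radius / 2) (r / 4)) (min (ν * (r / 2) / 2) (N.slope * d / (4 * M)))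
    with hεd
  have hε : 0 < ε := by
    have := N.slope_pos
    have := N.radius_pos
    refine lt_min (lt_min ?_ ?_) (lt_min ?_ ?_) <;> positivity
  have ε1 : ε ≤ N.radius / 2 := (min_le_left _ _).trans (min_le_left _ _)
  have ε2 : ε ≤ r / 4 := (min_le_left _ _).trans (min_le_right _ _)
  have ε3 : ε ≤ ν * (r / 2) / 2 := (min_le_right _ _).trans (min_le_left _ _)
  have ε4 : ε ≤ N.slope * d / (4 * M) := (min_le_right _ _).trans (min_le_right _ _)
  rw [le_div_iff₀ (by positivity)] at ε4
  refine ⟨ε, hε, fun s₀ x hx => ?_⟩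
  have hcl : ∀ s, |s - s₀| ≤ d → ‖x - L.curve i s‖ ≤ N.radius ∧ ‖x - L.curve i s‖ ≤ r / 2 ∧
      ‖x - L.curve i s‖ ≤ ν * (r / 2) := by
    intro s hs
    have h1 := hd₁le s₀ s (hs.trans (min_le_left _ _))
    have h2 : ‖x - L.curve i s‖ ≤ ‖x - L.curve i s₀‖ + ‖L.curve i s - L.curve i s₀‖ := by
      rw [show x - L.curve i s = (x - L.curve i s₀) - (L.curve i s - L.curve i s₀) by abel]
      exact norm_sub_le _ _
    have h3 : ‖L.curve i s - L.curve i s₀‖ ≤ N.radius / 2 := h1.trans (min_le_left _ _)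
    have h4 : ‖L.curve i s - L.curve i s₀‖ ≤ r / 4 :=
      h1.trans ((min_le_right _ _).trans (min_le_left _ _))
    have h5 : ‖L.curve i s - L.curve i s₀‖ ≤ ν * (r / 2) / 2 :=
      h1.trans ((min_le_right _ _).trans (min_le_right _ _))
    exact ⟨by linarith, by linarith, by linarith⟩
  have hcl1 : ∀ s, |s - s₀| ≤ d → ‖x.1 - (L.curve i s).1‖ ≤ N.radius := fun s hs =>
    (norm_fst_le (x - L.curve i s)).trans (hcl s hs).1
  have hg0 : |det2 (x.1 - (L.curve i s₀).1) (N.vec s₀)| ≤ 2 * ε * M := by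
    refine (abs_det2_le _ _).trans ?_
    have h1 : ‖x.1 - (L.curve i s₀).1‖ ≤ ε := (norm_fst_le (x - L.curve i s₀)).trans hx.le
    have h2 := hMle s₀
    gcongr
  have hg0' := abs_le.1 hg0
  have hsd : 0 < N.slope * d := mul_pos N.slope_pos hd0
  have hleft : 0 ≤ det2 (x.1 - (L.curve i (s₀ - d)).1) (N.vec (s₀ - d)) := by
    have := N.mono x.1 (s₀ - d) s₀ (by linarith) (by linarith) (hcl1 s₀ (by simpa using hd0.le))
    nlinarith
  have hright : det2 (x.1 - (L.curve i (s₀ + d)).1) (N.vec (s₀ + d)) ≤ 0 := by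
    have := N.mono x.1 s₀ (s₀ + d) (by linarith) (by linarith)
      (hcl1 (s₀ + d) (by rw [add_sub_cancel_left, abs_of_pos hd0]))
    nlinarith
  have hcont : Continuous fun s => det2 (x.1 - (L.curve i s).1) (N.vec s) :=
    continuous_det2 (by fun_prop) N.continuous_vec
  obtain ⟨s, hs, hs0⟩ := intermediate_value_Icc' (show s₀ - d ≤ s₀ + d by linarith)
    hcont.continuousOn ⟨hright, hleft⟩
  simp only at hs0
  have hsd : |s - s₀| ≤ d := abs_le.2 ⟨by linarith [hs.1], by linarith [hs.2]⟩
  have hs0' : det2 (N.vec s) (x.1 - (L.curve i s).1) = 0 := by rw [det2_swap, hs0, neg_zero]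
  obtain ⟨ξ, hξ⟩ := exists_smul_of_det2_eq_zero (N.vec_ne_zero s) hs0'
  have hξr : |ξ| ≤ r / 2 := by
    have h1 : ‖x.1 - (L.curve i s).1‖ ≤ ν * (r / 2) :=
      (norm_fst_le (x - L.curve i s)).trans (hcl s hsd).2.2
    rw [hξ, norm_smul, Real.norm_eq_abs] at h1
    have h2 := mul_le_mul_of_nonneg_left (hνle s) (abs_nonneg ξ)
    by_contra hlt
    rw [not_le] at hlt
    nlinarith
  have hηr : |x.2 - (L.curve i s).2| ≤ r / 2 :=
    (norm_snd_le (x - L.curve i s)).trans (hcl s hsd).2.1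
  refine ⟨s, ⟨ξ, x.2 - (L.curve i s).2⟩, ?_, ?_⟩
  · refine (Complex.norm_le_abs_re_add_abs_im _).trans ?_
    simp only
    linarith
  · ext1
    · simp only [tube, plane]
      rw [← hξ]; abel
    · simp only [tube]; ring

end TransverseField

end PolyLink

/-! ### The linking function of a component -/

namespace PolyLink

variable {n : ℕ} (L : PolyLink n)

/-- The vertices of the component `i`. -/
def vert (i : Fin n) (j : ℕ) : Space := L.curve i (j : ℝ)

/-- A function on the 3-sphere which vanishes only on the component `i`. The winding number of its
composition with a closed curve is the linking number with this component. -/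
def linkFun (i : Fin n) : S3 → ℂ := hatFun (L.vert i) (L.edges i)

theorem vert_edges (i : Fin n) : L.vert i (L.edges i) = L.vert i 0 := by
  have := L.curve_add_period i 0
  simpa [vert, period] using this

theorem segment_vert (i : Fin n) (j : ℕ) {t : ℝ} (ht : t ∈ Set.Icc (0 : ℝ) 1) :
    (1 - t) • L.vert i j + t • L.vert i (j + 1) = L.curve i (j + t) := by
  have := L.straight i j t ht
  simp only [vert]
  push_cast at this ⊢
  rw [this]

theorem continuous_linkFun (i : Fin n) : Continuous (L.linkFun i) :=
  continuous_hatFun _ (L.edges_pos i)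

theorem linkFun_ne_zero {i : Fin n} {x : Space} (h : ∀ s, x ≠ L.curve i s) :
    L.linkFun i (x : S3) ≠ 0 := by
  refine hatFun_coe_ne_zero (polyFun_ne_zero _ (L.edges_pos i) (L.vert_edges i) fun j _ t ht => ?_)
  rw [L.segment_vert i j ht]
  exact h _

theorem linkFun_ne_zero' {i : Fin n} {x : S3} (h : x ∉ L.component i) : L.linkFun i x ≠ 0 := by
  induction x using OnePoint.rec with
  | infty => rw [linkFun, hatFun_infty]; exact one_ne_zero
  | coe x => exact L.linkFun_ne_zero fun s hs => h ⟨s, by rw [hs]⟩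

/-- Near the interior of an edge, and off the vertical lines through the vertices, the linking
function is the function of this edge up to a nonvanishing factor. -/
theorem linkFun_factor {i : Fin n} {k : ℕ} (hk : k < L.edges i) {C : Set Space}
    (h1 : ∀ x ∈ C, ∀ j : ℕ, x.1 ≠ (L.vert i j).1)
    (h2 : ∀ x ∈ C, ∀ j < L.edges i, j ≠ k → ∀ t ∈ Set.Icc (0 : ℝ) 1, x ≠ L.curve i (j + t)) :
    ∃ G : Space → ℂ, ContinuousOn G C ∧ (∀ x ∈ C, G x ≠ 0) ∧ ∀ x ∈ C,
      L.linkFun i (x : S3) = edgeFun (L.vert i k - x) (L.vert i (k + 1) - x) * G x := by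
  have hpos : ∀ x ∈ C, ∀ j, 0 < len (L.vert i j - x) + (L.vert i j - x).2 := fun x hx j =>
    len_add_height_pos (Or.inl (by
      rw [Prod.fst_sub]; exact sub_ne_zero.2 (h1 x hx j).symm))
  have hq : ∀ x ∈ C, ∀ j, √(len (L.vert i j - x) + (L.vert i j - x).2) *
      √(len (L.vert i (j + 1) - x) + (L.vert i (j + 1) - x).2) ≠ 0 := fun x hx j =>
    mul_ne_zero (Real.sqrt_pos.2 (hpos x hx j)).ne' (Real.sqrt_pos.2 (hpos x hx (j + 1))).ne'
  have hlen := continuous_len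
  have hcq : ∀ j, ContinuousOn (fun x : Space =>
      (((√(len (L.vert i j - x) + (L.vert i j - x).2) *
        √(len (L.vert i (j + 1) - x) + (L.vert i (j + 1) - x).2))⁻¹ : ℝ) : ℂ)) C := fun j => by
    refine Complex.continuous_ofReal.comp_continuousOn (ContinuousOn.inv₀ ?_ fun x hx => hq x hx j)
    fun_prop
  have hcs : ∀ j, ContinuousOn (fun x : Space =>
      spinProduct (L.vert i j - x) (L.vert i (j + 1) - x)) C := fun j => by
    refine ((hcq j).mul (continuous_edgeFun (u := fun x => L.vert i j - x)
      (v := fun x => L.vert i (j + 1) - x) (by fun_prop) (by fun_prop)).continuousOn).congr ?_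
    intro x hx
    exact spinProduct_eq_edgeFun (hpos x hx j) (hpos x hx (j + 1))
  have hN : ∀ x : Space, ((2 * √(1 + len x ^ 2) : ℝ) : ℂ) ^ L.edges i ≠ 0 := fun x => by
    have : 0 < 2 * √(1 + len x ^ 2) := by positivity
    exact pow_ne_zero _ (by exact_mod_cast this.ne')
  refine ⟨fun x => (((√(len (L.vert i k - x) + (L.vert i k - x).2) *
        √(len (L.vert i (k + 1) - x) + (L.vert i (k + 1) - x).2))⁻¹ : ℝ) : ℂ) *
      (∏ j ∈ (Finset.range (L.edges i)).erase k,
        spinProduct (L.vert i j - x) (L.vert i (j + 1) - x)) /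
      ((2 * √(1 + len x ^ 2) : ℝ) : ℂ) ^ L.edges i, ?_, fun x hx => ?_, fun x hx => ?_⟩
  · refine ((hcq k).mul (continuousOn_finsetProd _ fun j _ => hcs j)).div ?_ fun x _ => hN x
    fun_prop
  · refine div_ne_zero (mul_ne_zero ?_ (Finset.prod_ne_zero_iff.2 fun j hj => ?_)) (hN x)
    · rw [Complex.ofReal_ne_zero]; exact inv_ne_zero (hq x hx k)
    · rw [Finset.mem_erase, Finset.mem_range] at hj
      refine spinProduct_sub_ne_zero fun t ht => ?_
      rw [L.segment_vert i j ht]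
      exact h2 x hx j hj.2 hj.1 t ht
  · rw [linkFun, hatFun_coe, polyFun_eq _ (L.edges_pos i) (L.vert_edges i),
      ← Finset.mul_prod_erase _ _ (Finset.mem_range.2 hk),
      spinProduct_eq_edgeFun (hpos x hx k) (hpos x hx (k + 1))]
    ring

theorem eq_of_curve_eq_edge {i : Fin n} {j k : ℕ} (hj : j < L.edges i) (hk : k < L.edges i)
    {u t : ℝ} (hu : u ∈ Set.Ioo (k : ℝ) (k + 1)) (ht : t ∈ Set.Icc (0 : ℝ) 1)
    (h : L.curve i u = L.curve i (j + t)) : j = k := by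
  obtain ⟨m, hm⟩ := L.curve_eq_iff.1 h
  have hj' : (j : ℝ) + 1 ≤ L.period i := by rw [period]; exact_mod_cast hj
  have hk' : (k : ℝ) + 1 ≤ L.period i := by rw [period]; exact_mod_cast hk
  have hE := L.period_pos i
  have hj0 : (0 : ℝ) ≤ j := Nat.cast_nonneg j
  have hk0 : (0 : ℝ) ≤ k := Nat.cast_nonneg k
  have h1 : (m : ℝ) < 1 := by
    by_contra hc; rw [not_lt] at hc
    nlinarith [hu.1, ht.2]
  have h2 : (-1 : ℝ) < m := by
    by_contra hc; rw [not_lt] at hc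
    nlinarith [hu.2, ht.1]
  have h3 : m = 0 := by
    have : m < 1 := by exact_mod_cast h1
    have : -1 < m := by exact_mod_cast h2
    omega
  rw [h3] at hm
  have h4 : (j : ℝ) < k + 1 := by push_cast at hm; linarith [hu.2, ht.1]
  have h5 : (k : ℝ) < j + 1 := by push_cast at hm; linarith [hu.1, ht.2]
  have : j < k + 1 := by exact_mod_cast h4
  have : k < j + 1 := by exact_mod_cast h5
  omega

/-- Every time that is not that of a vertex is, up to periods, in the interior of an edge. -/
theorem exists_edge {i : Fin n} {u : ℝ} (hu : ∀ k : ℤ, u ≠ k) : ∃ m : ℤ, ∃ k < L.edges i,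
    u + m * L.period i ∈ Set.Ioo (k : ℝ) (k + 1) := by
  obtain ⟨m, hm⟩ := L.exists_int_mem_Icc i u
  have hne : ∀ k : ℤ, u + m * L.period i ≠ k := fun k hk =>
    hu (k - m * L.edges i) (by rw [period] at hk; push_cast; linarith)
  have hlt : u + m * L.period i < L.edges i :=
    lt_of_le_of_ne hm.2 (by exact_mod_cast hne (L.edges i))
  refine ⟨m, ⌊u + m * L.period i⌋₊, (Nat.floor_lt hm.1).2 hlt, ?_, Nat.lt_floor_add_one _⟩
  refine lt_of_le_of_ne (Nat.floor_le hm.1) fun h => ?_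
  exact hne (⌊u + m * L.period i⌋₊ : ℤ) (by exact_mod_cast h.symm)

variable {L}

theorem IsRegular.proj_ne_vert (hreg : L.IsRegular) {i k : Fin n} {s : ℝ} (hs : ∀ k : ℤ, s ≠ k)
    (j : ℕ) : (L.curve i s).1 ≠ (L.vert k j).1 := by
  intro h
  by_cases heq : L.curve i s = L.curve k (j : ℝ)
  · obtain ⟨rfl, m, hm⟩ := L.embedded _ _ _ _ heq
    refine hs (j - m * L.edges i) ?_
    push_cast; linarith
  · exact hreg.vertex k j ⟨i, s, by simpa [vert] using h.symm, by simpa using (Ne.symm heq)⟩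

theorem IsRegular.eventually_not_atCrossing (hreg : L.IsRegular) (i : Fin n) (s₀ : ℝ) :
    ∀ᶠ s in nhds s₀, L.AtCrossing i s → s = s₀ := by
  obtain ⟨δ, hδ, -, -, -, -, h, -⟩ := hreg.exists_local_field i s₀
  filter_upwards [Metric.ball_mem_nhds s₀ hδ] with s hs hc
  exact h s hc (by rwa [Metric.mem_ball, Real.dist_eq] at hs)

/-- The strand above or below an interior point of an edge: the sign of the imaginary part of the
function of an edge tells the side of this edge. -/
theorem edgeFun_im_along {u v : Space} {y d e : ℝ × ℝ} {a τ h : ℝ} (hu : u.1 = y - a • d)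
    (hv : v.1 = y + (1 - a) • d) :
    (edgeFun (u - (y + τ • e, h)) (v - (y + τ • e, h))).im = τ * det2 d e := by
  rw [edgeFun_im]
  simp only [Prod.fst_sub, hu, hv, det2, Prod.fst_add, Prod.snd_add, Prod.smul_fst, Prod.smul_snd,
    smul_eq_mul, Prod.snd_sub]
  ring

/-- The logarithmic increments of the linking function along two paths in the vertical wall through
a strand that passes under another strand, one below and one above the other strand, differ at most
by one turn. -/
theorem IsRegular.logChange_dip (hreg : L.IsRegular) {i k : Fin n} {s₀ u δ h₀ h₁ : ℝ} (hδ : 0 < δ)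
    (hc : L.Cross i s₀ k u) (hst : ∀ s, |s - s₀| ≤ δ →
      L.curve i s = L.curve i s₀ + (s - s₀) • L.dir i s₀ ∧ (∀ k : ℤ, s ≠ k) ∧
      (L.AtCrossing i s → s = s₀) ∧ (L.curve i s).2 < h₀)
    {f g : ℝ → ℝ} (hf : Continuous f) (hg : Continuous g)
    (hfI : ∀ s, |s - s₀| ≤ δ → f s ∈ Set.Icc h₀ h₁) (hgI : ∀ s, |s - s₀| ≤ δ → g s ∈ Set.Icc h₀ h₁)
    (hl : f (s₀ - δ) = g (s₀ - δ)) (hr : f (s₀ + δ) = g (s₀ + δ))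
    (hfu : f s₀ < (L.curve k u).2) (hgu : (L.curve k u).2 < g s₀) :
    ‖logChange (fun s => L.linkFun i (((L.curve i s).1, f s) : Space)) (s₀ - δ) (s₀ + δ) -
      logChange (fun s => L.linkFun i (((L.curve i s).1, g s) : Space)) (s₀ - δ) (s₀ + δ)‖ ≤
        2 * Real.pi := by
  have hI : ∀ s ∈ Set.Icc (s₀ - δ) (s₀ + δ), |s - s₀| ≤ δ := fun s hs =>
    abs_le.2 ⟨by linarith [hs.1], by linarith [hs.2]⟩
  have hle : s₀ - δ ≤ s₀ + δ := by linarith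
  -- the vertical wall through the strand, on which the linking function is followed
  let W : ℝ × ℝ → Space := fun q => ((L.curve i s₀).1 + (q.1 - s₀) • (L.dir i s₀).1, q.2)
  let R : Set (ℝ × ℝ) := Set.Icc (s₀ - δ) (s₀ + δ) ×ˢ Set.Icc h₀ h₁
  have hR : Convex ℝ R := (convex_Icc _ _).prod (convex_Icc _ _)
  have hW : Continuous W := by fun_prop
  have hWeq : ∀ s ∈ Set.Icc (s₀ - δ) (s₀ + δ), ∀ h, W (s, h) = ((L.curve i s).1, h) := by
    intro s hs h
    simp only [W]
    rw [(hst s (hI s hs)).1]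
    rfl
  have hon : ∀ q ∈ R, ∀ s, W q = L.curve i s → k = i ∧ q.1 = s₀ ∧ L.curve i s = L.curve k u := by
    rintro ⟨s₁, h⟩ ⟨hs₁, hh⟩ s heq
    have hs := hst s₁ (hI s₁ hs₁)
    rw [hWeq s₁ hs₁] at heq
    have hne : L.curve i s₁ ≠ L.curve i s := by
      rw [← heq]
      intro h'
      have h2 := hs.2.2.2
      rw [h'] at h2
      exact absurd hh.1 (not_le.2 h2)
    have hcr : L.Cross i s₁ i s := ⟨by rw [← heq], hne⟩
    have hs₀ := hs.2.2.1 hcr.atCrossing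
    subst hs₀
    have h2 := hreg.double _ _ _ _ _ _ hcr hc
    exact ⟨(L.embedded _ _ _ _ h2).1.symm, rfl, h2⟩
  have hfc : Continuous fun s => (s, f s) := by fun_prop
  have hgc : Continuous fun s => (s, g s) := by fun_prop
  have hfR : ∀ s ∈ Set.Icc (s₀ - δ) (s₀ + δ), (s, f s) ∈ R := fun s hs => ⟨hs, hfI s (hI s hs)⟩
  have hgR : ∀ s ∈ Set.Icc (s₀ - δ) (s₀ + δ), (s, g s) ∈ R := fun s hs => ⟨hs, hgI s (hI s hs)⟩
  rw [logChange_congr hle (d := fun s => L.linkFun i (W (s, f s) : Space))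
      (fun s hs => by rw [hWeq s hs]),
    logChange_congr hle (c := fun s => L.linkFun i (((L.curve i s).1, g s) : Space))
      (d := fun s => L.linkFun i (W (s, g s) : Space)) (fun s hs => by rw [hWeq s hs])]
  have hFc : Continuous fun q => L.linkFun i (W q : Space) :=
    (L.continuous_linkFun i).comp (OnePoint.continuous_coe.comp hW)
  by_cases hki : k = i
  · subst hki
    obtain ⟨m, e, he, hu⟩ := L.exists_edge (i := k) (hreg.ne_int_of_cross hc.symm)
    have hcu : L.curve k (u + m * L.period k) = L.curve k u := L.curve_add_int_mul k u m
    obtain ⟨G, hG, hG0, hGeq⟩ := L.linkFun_factor (i := k) he (C := W '' R)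
      (by
        rintro _ ⟨⟨s₁, h⟩, ⟨hs₁, hh⟩, rfl⟩ j
        rw [hWeq s₁ hs₁]
        exact hreg.proj_ne_vert (hst s₁ (hI s₁ hs₁)).2.1 j)
      (by
        rintro _ ⟨q, hq, rfl⟩ j hj hje t ht heq
        obtain ⟨-, -, h2⟩ := hon q hq _ heq
        rw [← hcu] at h2
        exact hje (L.eq_of_curve_eq_edge hj he hu ht h2.symm))
    -- the coordinates of the edge of the other strand
    set a := u + m * L.period k - e with ha
    have ha1 : a ∈ Set.Ioo (0 : ℝ) 1 := ⟨by linarith [hu.1], by linarith [hu.2]⟩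
    set v₀ := L.vert k e with hv₀
    set v₁ := L.vert k (e + 1) with hv₁
    have hpt : (1 - a) • v₀ + a • v₁ = L.curve k u := by
      rw [L.segment_vert k e ⟨ha1.1.le, ha1.2.le⟩, ← hcu]; congr 1; rw [ha]; ring
    have hd : v₁ - v₀ = L.dir k u := by
      have h1 : L.dir k (u + m * L.period k) = v₁ - v₀ := by
        have hfl : ⌊u + m * L.period k⌋ = (e : ℤ) := Int.floor_eq_iff.2 ⟨by
          exact_mod_cast hu.1.le, by exact_mod_cast hu.2⟩
        rw [dir, hfl, hv₀, hv₁, vert, vert]; push_cast; rfl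
      rw [← h1, dir_add_int_mul]
    have hdet : det2 (L.dir k u).1 (L.dir k s₀).1 ≠ 0 := hreg.det2_ne_zero hc.symm
    have hy0 : v₀.1 = (L.curve k s₀).1 - a • (L.dir k u).1 := by
      rw [hc.1, ← hpt, ← hd]
      simp only [Prod.fst_add, Prod.smul_fst, Prod.fst_sub]; module
    have hy1 : v₁.1 = (L.curve k s₀).1 + (1 - a) • (L.dir k u).1 := by
      rw [hc.1, ← hpt, ← hd]
      simp only [Prod.fst_add, Prod.smul_fst, Prod.fst_sub]; module
    let Z : ℝ × ℝ → ℂ := fun q => edgeFun (v₀ - W q) (v₁ - W q)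
    have hZc : Continuous Z := continuous_edgeFun (by fun_prop) (by fun_prop)
    have hZim : ∀ q, (Z q).im = (q.1 - s₀) * det2 (L.dir k u).1 (L.dir k s₀).1 := fun q =>
      edgeFun_im_along hy0 hy1
    have hv01 : v₁.1 ≠ v₀.1 := by
      have := hreg.dir_ne_zero k u
      rw [← hd, Prod.fst_sub] at this
      exact sub_ne_zero.1 this
    have hZre : ∀ h, (h < (L.curve k u).2 → 0 < (Z (s₀, h)).re) ∧
        ((L.curve k u).2 < h → (Z (s₀, h)).re < 0) := fun h => by
      have := edgeFun_re_sign (h := h) ha1 hv01 (x := W (s₀, h)) (by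
        rw [hpt]; simp only [W, sub_self, zero_smul, add_zero]; rw [hc.1])
      rw [hpt] at this
      exact this
    have hslit : ∀ c : ℂ, c.im ≠ 0 → c ∈ Complex.slitPlane := fun c h => Or.inr h
    have hZf : ∀ s ∈ Set.Icc (s₀ - δ) (s₀ + δ), Z (s, f s) ∈ Complex.slitPlane := by
      intro s hs
      by_cases h : s = s₀
      · subst h; exact Or.inl ((hZre _).1 hfu)
      · refine hslit _ ?_
        rw [hZim]; exact mul_ne_zero (sub_ne_zero.2 h) hdet
    have hZg : ∀ s ∈ Set.Icc (s₀ - δ) (s₀ + δ), -Z (s, g s) ∈ Complex.slitPlane := by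
      intro s hs
      by_cases h : s = s₀
      · subst h
        exact Or.inl (by rw [Complex.neg_re]; linarith [(hZre (g s)).2 hgu])
      · refine hslit _ ?_
        rw [Complex.neg_im, hZim]; exact neg_ne_zero.2 (mul_ne_zero (sub_ne_zero.2 h) hdet)
    have hsplit : ∀ φ : ℝ → ℝ, Continuous φ → (∀ s ∈ Set.Icc (s₀ - δ) (s₀ + δ), (s, φ s) ∈ R) →
        (∀ s ∈ Set.Icc (s₀ - δ) (s₀ + δ), Z (s, φ s) ≠ 0) →
        logChange (fun s => L.linkFun k (W (s, φ s) : Space)) (s₀ - δ) (s₀ + δ) =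
          logChange (fun s => Z (s, φ s)) (s₀ - δ) (s₀ + δ) +
            logChange (fun s => G (W (s, φ s))) (s₀ - δ) (s₀ + δ) := by
      intro φ hφ hφR hφ0
      rw [← logChange_mul hle]
      · exact logChange_congr hle fun s hs => hGeq _ ⟨_, hφR s hs, rfl⟩
      · have : Continuous fun s => Z (s, φ s) := hZc.comp (by fun_prop)
        exact this.continuousOn
      · exact hφ0
      · refine hG.comp (hW.comp (by fun_prop : Continuous fun s => (s, φ s))).continuousOn ?_
        intro s hs
        exact ⟨_, hφR s hs, rfl⟩
      · intro s hs
        exact hG0 _ ⟨_, hφR s hs, rfl⟩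
    rw [hsplit f hf hfR fun s hs => Complex.slitPlane_ne_zero (hZf s hs),
      hsplit g hg hgR fun s hs => neg_ne_zero.1 (Complex.slitPlane_ne_zero (hZg s hs))]
    have hGG := logChange_comp_convex hR (g := fun q => G (W q))
      (hG.comp hW.continuousOn (Set.mapsTo_image _ _)) (fun q hq => hG0 _ ⟨q, hq, rfl⟩) hle hle
      hfc.continuousOn hfR hgc.continuousOn hgR (by rw [hl]) (by rw [hr])
    rw [hGG, add_sub_add_right_eq_sub]
    obtain ⟨κ, hκ, hκd⟩ : ∃ κ : ℝ, (κ = 1 ∨ κ = -1) ∧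
        0 < κ * det2 (L.dir k u).1 (L.dir k s₀).1 := by
      rcases lt_or_gt_of_ne hdet with h | h
      · exact ⟨-1, Or.inr rfl, by linarith⟩
      · exact ⟨1, Or.inl rfl, by linarith⟩
    have := logChange_sub_of_two_sides (v := fun s => Z (s, f s)) (u := fun s => Z (s, g s)) hle hκ
      (hZc.comp hfc).continuousOn (hZc.comp hgc).continuousOn hZf hZg (by simp only [hl])
      (by simp only [hr]) (by rw [hZim]; nlinarith) (by rw [hZim]; nlinarith)
    rw [this]
    have hκn : |κ| = 1 := by rcases hκ with h | h <;> simp [h]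
    simp [hκn, abs_of_pos Real.pi_pos]
  · have hF0 : ∀ q ∈ R, L.linkFun i (W q : Space) ≠ 0 := fun q hq =>
      L.linkFun_ne_zero fun s hs => hki (hon q hq s hs).1
    have := logChange_comp_convex hR (g := fun q => L.linkFun i (W q : Space)) hFc.continuousOn hF0
      hle hle hfc.continuousOn hfR hgc.continuousOn hgR (by rw [hl]) (by rw [hr])
    rw [this, sub_self, norm_zero]
    positivity

end PolyLink

/-! ### The linking number of a longitude of the tube -/

namespace PolyLink

variable {n : ℕ} {L : PolyLink n} {i : Fin n}

theorem logChange_self (c : ℝ → ℂ) (a : ℝ) (h : c a ≠ 0) : logChange c a a = 0 := by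
  rw [logChange_eq (f := fun _ => Complex.log (c a)) le_rfl continuousOn_const]
  · exact sub_self _
  · intro s hs
    rw [Set.Icc_self, Set.mem_singleton_iff] at hs
    rw [Complex.exp_log h, hs]

theorem exists_generic_time (hreg : L.IsRegular) (i : Fin n) {a b : ℝ} (hab : a < b) :
    ∃ s ∈ Set.Ioo a b, (∀ k : ℤ, s ≠ k) ∧ ¬ L.AtCrossing i s := by
  have h1 : ({s | s ∈ Set.Icc a b ∧ L.AtCrossing i s} ∪
      (fun k : ℤ => (k : ℝ)) '' Set.Icc ⌊a⌋ ⌈b⌉).Finite :=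
    (hreg.finite_crossings i a b).union ((Set.finite_Icc _ _).image _)
  obtain ⟨s, hs, hs'⟩ := ((Set.Ioo_infinite hab).sdiff h1).nonempty
  refine ⟨s, hs, fun k hk => hs' (Or.inr ⟨k, ⟨?_, ?_⟩, hk.symm⟩), fun h =>
    hs' (Or.inl ⟨Set.Ioo_subset_Icc_self hs, h⟩)⟩
  · refine Int.floor_le_iff.2 ?_; rw [← hk]; linarith [hs.1]
  · refine Int.le_ceil_iff.2 ?_; rw [← hk]; linarith [hs.2]

namespace TransverseField

variable (N : L.TransverseField i)

theorem det2_dir_pos (s : ℝ) : 0 < det2 (L.dir i s).1 (N.vec s) := by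
  obtain ⟨t, ht, ht1, ht2⟩ : ∃ t > 0, s + t ≤ ⌊s⌋ + 1 ∧ t ≤ N.window :=
    ⟨min (⌊s⌋ + 1 - s) N.window, lt_min (by linarith [Int.lt_floor_add_one s]) N.window_pos,
      by linarith [min_le_left (⌊s⌋ + 1 - s) N.window], min_le_right _ _⟩
  have h := N.mono (L.curve i (s + t)).1 s (s + t) (by linarith) (by linarith)
    (by rw [sub_self, norm_zero]; exact N.radius_pos.le)
  rw [L.curve_forward i s (by linarith) ht1] at h
  simp only [add_sub_cancel_left, Prod.fst_add, Prod.smul_fst, det2_smul_left, sub_self] at h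
  have h0 : det2 (0 : ℝ × ℝ) (N.vec (s + t)) = 0 := by simp [det2]
  rw [h0] at h
  have := mul_pos N.slope_pos ht
  by_contra hc
  nlinarith

theorem linkFun_tube_ne_zero {r : ℝ} (hr : ∀ s k u w, ‖w‖ ≤ r → N.tube s w = L.curve k u → w = 0)
    {s : ℝ} {w : ℂ} (hw : ‖w‖ ≤ r) (h0 : w ≠ 0) : L.linkFun i (N.tube s w : Space) ≠ 0 :=
  L.linkFun_ne_zero fun u hu => h0 (hr s i u w hw hu)

theorem continuous_linkFun_tube {X : Type*} [TopologicalSpace X] {f : X → ℝ} {g : X → ℂ}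
    (hf : Continuous f) (hg : Continuous g) :
    Continuous fun x => L.linkFun i (N.tube (f x) (g x) : Space) :=
  (L.continuous_linkFun i).comp (OnePoint.continuous_coe.comp (N.continuous_tube hf hg))

/-- On the solid torus minus its core, the logarithmic increment of the linking function along a
closed curve depends only on the numbers of times this curve runs around. -/
theorem exists_torus_constants {r : ℝ}
    (hr : ∀ s k u w, ‖w‖ ≤ r → N.tube s w = L.curve k u → w = 0) (hr0 : 0 < r) :
    ∃ A B : ℂ, ∀ (f : ℝ → ℝ) (ζ : ℝ → ℂ) (a b : ℝ) (e m : ℤ), a ≤ b →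
      ContinuousOn f (Set.Icc a b) → ContinuousOn ζ (Set.Icc a b) →
      (∀ t ∈ Set.Icc a b, (ζ t).re ≤ Real.log r) → f b = f a + e * L.period i →
      ζ b = ζ a + m * (2 * Real.pi * Complex.I) →
      logChange (fun t => L.linkFun i (N.tube (f t) (Complex.exp (ζ t)) : Space)) a b =
        e * A + m * B := by
  let Q : Set (ℝ × ℂ) := Set.univ ×ˢ {ζ : ℂ | ζ.re ≤ Real.log r}
  have hQ : Convex ℝ Q := convex_univ.prod (convex_halfSpace_re_le _)
  have hQ' : ∀ x : ℝ × ℂ, x ∈ Q ↔ x.2.re ≤ Real.log r := fun x => by simp [Q]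
  let g : ℝ × ℂ → ℂ := fun x => L.linkFun i (N.tube x.1 (Complex.exp x.2) : Space)
  have hg : Continuous g := N.continuous_linkFun_tube (by fun_prop) (by fun_prop)
  have hg0 : ∀ x ∈ Q, g x ≠ 0 := fun x hx => N.linkFun_tube_ne_zero hr
    (by rw [Complex.norm_exp]; exact (Real.le_log_iff_exp_le hr0).1 ((hQ' x).1 hx))
    (Complex.exp_ne_zero _)
  obtain ⟨F, hF, hFg⟩ := exists_continuousOn_log hQ hg.continuousOn hg0
  have hstep : ∀ v : ℝ × ℂ, v.2.re = 0 → (∀ x, g (x + v) = g x) →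
      ∃ A : ℂ, ∀ (e : ℤ), ∀ x ∈ Q, F (x + (e : ℝ) • v) = F x + e * A := by
    intro v hv hgv
    have hmem : ∀ x ∈ Q, ∀ e : ℝ, x + e • v ∈ Q := fun x hx e => by
      rw [hQ'] at hx ⊢; simpa [hv] using hx
    have hmem1 : ∀ x ∈ Q, x + v ∈ Q := fun x hx => by simpa using hmem x hx 1
    have h0 : ((0 : ℝ), (Real.log r : ℂ)) ∈ Q := (hQ' _).2 (by simp)
    set A := F ((0, (Real.log r : ℂ)) + v) - F (0, (Real.log r : ℂ)) with hA
    have hA' : ∀ x ∈ Q, F (x + v) = F x + A := by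
      intro x hx
      have := log_sub_log_const hQ.isPreconnected (f := fun x => F (x + v)) (g := F)
        (hF.comp (by fun_prop) hmem1) hF (fun x hx => by
          rw [hFg _ (hmem1 x hx), hFg x hx, hgv]) hx h0
      rw [hA]; linear_combination this
    refine ⟨A, fun e => ?_⟩
    induction e using Int.induction_on with
    | zero => intro x _; simp
    | succ k ih =>
      intro x hx
      have := hA' _ (hmem x hx ((k : ℤ) : ℝ))
      rw [ih x hx] at this
      push_cast at this ⊢
      rw [show x + ((k : ℝ) + 1) • v = x + (k : ℝ) • v + v by module, this]; ring
    | pred k ih =>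
      intro x hx
      have h1 := hA' _ (hmem x hx ((-(k : ℤ) - 1 : ℤ) : ℝ))
      have h2 := ih x hx
      push_cast at h1 h2 ⊢
      rw [show x + (-(k : ℝ) - 1) • v + v = x + (-(k : ℝ)) • v by module, h2] at h1
      linear_combination -h1
  obtain ⟨A, hA⟩ := hstep (L.period i, 0) (by simp) fun x => by
    simp only [g, Prod.fst_add, Prod.snd_add, add_zero]
    have := N.tube_add_int_mul x.1 (Complex.exp x.2) 1
    rw [Int.cast_one, one_mul] at this
    rw [this]
  obtain ⟨B, hB⟩ := hstep (0, 2 * Real.pi * Complex.I) (by simp) fun x => by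
    simp only [g, Prod.fst_add, Prod.snd_add, add_zero, Complex.exp_add, Complex.exp_two_pi_mul_I,
      mul_one]
  refine ⟨A, B, fun f ζ a b e m hab hf hζ hre hfb hζb => ?_⟩
  have hmem : ∀ t ∈ Set.Icc a b, (f t, ζ t) ∈ Q := fun t ht => (hQ' _).2 (hre t ht)
  rw [logChange_eq (f := fun t => F (f t, ζ t)) hab (hF.comp (hf.prodMk hζ) hmem)
    fun t ht => hFg _ (hmem t ht)]
  have ha := hmem a (Set.left_mem_Icc.2 hab)
  have h1 := hA e _ ha
  have h2 := hB m ((f a, ζ a) + (e : ℝ) • (L.period i, 0)) (by rw [hQ'] at ha ⊢; simpa using ha)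
  rw [h1] at h2
  have h3 : ((f a, ζ a) + (e : ℝ) • (L.period i, (0 : ℂ)) + (m : ℝ) • (0, 2 * Real.pi * Complex.I) :
      ℝ × ℂ) = (f b, ζ b) := by
    rw [hfb, hζb]
    ext1 <;> simp
  rw [h3] at h2
  linear_combination h2

/-- The linking number of a meridian with the component is one. -/
theorem exists_meridian (hreg : L.IsRegular) {r : ℝ} (hr0 : 0 < r)
    (hr : ∀ s k u w, ‖w‖ ≤ r → N.tube s w = L.curve k u → w = 0) :
    ∃ s₀ ρ, 0 < ρ ∧ ρ ≤ r ∧ logChange (fun t : ℝ => L.linkFun i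
      (N.tube s₀ (ρ * Complex.exp (t * (2 * Real.pi * Complex.I))) : Space)) 0 1 =
        2 * Real.pi * Complex.I := by
  obtain ⟨s₀, hs₀, hint, hcr⟩ := exists_generic_time hreg i (zero_lt_one' ℝ)
  obtain ⟨r', hr', hstrip⟩ := N.exists_strip_radius hreg one_pos
  set ρ := min r r' with hρ
  have hρ0 : 0 < ρ := lt_min hr0 hr'
  refine ⟨s₀, ρ, hρ0, min_le_left _ _, ?_⟩
  let C : Set ℂ := Metric.closedBall 0 ρ
  have hCn : ∀ w ∈ C, ‖w‖ ≤ ρ := fun w hw => by simpa [C] using hw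
  obtain ⟨G, hG, hG0, hGeq⟩ := L.linkFun_factor (i := i) (L.edges_pos i) (C := N.tube s₀ '' C)
    (by
      rintro _ ⟨w, hw, rfl⟩ j hj
      rcases hstrip s₀ i j w.re ((Complex.abs_re_le_norm w).trans ((hCn w hw).trans
        (min_le_right _ _))) hj with ⟨-, -, m, hm⟩ | ⟨u₀, hu₀, -⟩
      · refine hint (j - m * L.edges i) ?_
        rw [period] at hm; push_cast; linarith
      · exact hcr hu₀.atCrossing)
    (by
      rintro _ ⟨w, hw, rfl⟩ j hj hj0 t ht heq
      have h0 := hr _ _ _ _ ((hCn w hw).trans (min_le_left _ _)) heq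
      rw [h0, tube_zero] at heq
      exact hj0 (L.eq_of_curve_eq_edge hj (L.edges_pos i) (by simpa using hs₀) ht heq))
  have hCc : Continuous (N.tube s₀) := N.continuous_tube continuous_const continuous_id
  let w : ℝ → ℂ := fun t => ρ * Complex.exp (t * (2 * Real.pi * Complex.I))
  have hw : Continuous w := by fun_prop
  have harg : ∀ t : ℝ, (t * (2 * Real.pi * Complex.I) : ℂ) = ((2 * Real.pi * t : ℝ) : ℂ) *
      Complex.I :=
    fun t => by push_cast; ring
  have hwC : ∀ t, w t ∈ C := fun t => by
    simp only [C, w, mem_closedBall_zero_iff, norm_mul, harg, Complex.norm_exp_ofReal_mul_I]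
    simp [abs_of_pos hρ0]
  have hwre : ∀ t, (w t).re = ρ * Real.cos (2 * Real.pi * t) := fun t => by
    simp only [w, harg, Complex.re_ofReal_mul, Complex.exp_ofReal_mul_I_re]
  have hwim : ∀ t, (w t).im = ρ * Real.sin (2 * Real.pi * t) := fun t => by
    simp only [w, harg, Complex.im_ofReal_mul, Complex.exp_ofReal_mul_I_im]
  set v₀ := L.vert i 0 with hv₀
  set v₁ := L.vert i 1 with hv₁
  have hpt : (1 - s₀) • v₀ + s₀ • v₁ = L.curve i s₀ := by
    rw [L.segment_vert i 0 (Set.Ioo_subset_Icc_self hs₀)]; simp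
  have hd : v₁ - v₀ = L.dir i s₀ := by
    have hfl : ⌊s₀⌋ = 0 := Int.floor_eq_iff.2 ⟨by simpa using hs₀.1.le, by simpa using hs₀.2⟩
    rw [dir, hfl, hv₀, hv₁, vert, vert]; simp
  have hdet := N.det2_dir_pos s₀
  have hy0 : v₀.1 = (L.curve i s₀).1 - s₀ • (L.dir i s₀).1 := by
    rw [← hpt, ← hd]; simp only [Prod.fst_add, Prod.smul_fst, Prod.fst_sub]; module
  have hy1 : v₁.1 = (L.curve i s₀).1 + (1 - s₀) • (L.dir i s₀).1 := by
    rw [← hpt, ← hd]; simp only [Prod.fst_add, Prod.smul_fst, Prod.fst_sub]; module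
  have hv01 : v₁.1 ≠ v₀.1 := by
    have := hreg.dir_ne_zero i s₀
    rw [← hd, Prod.fst_sub] at this
    exact sub_ne_zero.1 this
  let Z : ℂ → ℂ := fun w => edgeFun (v₀ - N.tube s₀ w) (v₁ - N.tube s₀ w)
  have hZc : Continuous Z := continuous_edgeFun (by fun_prop) (by fun_prop)
  have hZim : ∀ w, (Z w).im = w.re * det2 (L.dir i s₀).1 (N.vec s₀) := fun w =>
    edgeFun_im_along hy0 hy1
  have hZre : ∀ w : ℂ, w.re = 0 → (w.im < 0 → 0 < (Z w).re) ∧ (0 < w.im → (Z w).re < 0) := by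
    intro w hw
    have := edgeFun_re_sign (h := (L.curve i s₀).2 + w.im) hs₀ hv01 (x := N.tube s₀ w) (by
      rw [hpt, tube, hw, plane_zero])
    rw [hpt] at this
    exact ⟨fun h => this.1 (by linarith), fun h => this.2 (by linarith)⟩
  have h2p := Real.two_pi_pos
  have hpi := Real.pi_pos
  have hslit : ∀ t ∈ Set.Icc (0 : ℝ) 1, t ≠ 1 / 4 → Z (w t) ∈ Complex.slitPlane := by
    intro t ht htn
    by_cases hc : Real.cos (2 * Real.pi * t) = 0
    · refine Or.inl ((hZre _ (by rw [hwre, hc, mul_zero])).1 ?_)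
      rw [hwim]
      refine mul_neg_of_pos_of_neg hρ0 ?_
      obtain ⟨k, hk⟩ := Real.cos_eq_zero_iff.1 hc
      have h4 : 4 * t = 2 * k + 1 := by
        have h5 : Real.pi * (4 * t) = Real.pi * (2 * k + 1) := by linear_combination 2 * hk
        exact mul_left_cancel₀ hpi.ne' h5
      have hk1 : (k : ℝ) < 2 := by linarith [ht.2]
      have hk0 : (-1 : ℝ) < k := by linarith [ht.1]
      have hk2 : k < 2 := by exact_mod_cast hk1
      have hk3 : -1 < k := by exact_mod_cast hk0
      have hkk : k = 0 ∨ k = 1 := by omega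
      rcases hkk with rfl | rfl
      · exact absurd (by push_cast at h4; linarith) htn
      · rw [hk, show ((2 * ((1 : ℤ) : ℝ) + 1) * Real.pi / 2) = Real.pi / 2 + Real.pi by
          push_cast; ring, Real.sin_add_pi, Real.sin_pi_div_two]
        norm_num
    · refine Or.inr ?_
      rw [hZim, hwre]
      exact mul_ne_zero (mul_ne_zero hρ0.ne' hc) hdet.ne'
  have h14 : Real.cos (2 * Real.pi * (1 / 4)) = 0 := by
    rw [show 2 * Real.pi * (1 / 4) = Real.pi / 2 by ring, Real.cos_pi_div_two]
  have h14' : Real.sin (2 * Real.pi * (1 / 4)) = 1 := by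
    rw [show 2 * Real.pi * (1 / 4) = Real.pi / 2 by ring, Real.sin_pi_div_two]
  have hre14 : (Z (w (1 / 4))).re < 0 :=
    (hZre _ (by rw [hwre, h14, mul_zero])).2 (by rw [hwim, h14']; linarith)
  have hZ0 : ∀ t ∈ Set.Icc (0 : ℝ) 1, Z (w t) ≠ 0 := by
    intro t ht
    by_cases h : t = 1 / 4
    · rw [h]; intro h0; rw [h0] at hre14; simp at hre14
    · exact Complex.slitPlane_ne_zero (hslit t ht h)
  have hw01 : w 0 = w 1 := by
    simp only [w, Complex.ofReal_zero, zero_mul, Complex.exp_zero, Complex.ofReal_one, one_mul,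
      Complex.exp_two_pi_mul_I]
  have hGw : Continuous fun t => N.tube s₀ (w t) := hCc.comp hw
  have hZw : logChange (fun t => Z (w t)) 0 1 = (1 : ℝ) * (2 * Real.pi * Complex.I) := by
    have h01 : Z (w 0) = Z (w 1) := by rw [hw01]
    refine logChange_of_cross (c := fun t => Z (w t)) (τ := 1 / 4) (ε := 1 / 4) (by norm_num)
      (by norm_num) (Or.inl rfl) (hZc.comp hw).continuousOn hslit h01 hre14 (by norm_num) ?_ ?_
    · intro t ht h1 h2
      rw [hZim, hwre, one_mul]
      refine mul_pos (mul_pos hρ0 (Real.cos_pos_of_mem_Ioo ⟨?_, ?_⟩)) hdet <;> nlinarith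
    · intro t ht h1 h2
      rw [hZim, hwre, one_mul]
      refine mul_neg_of_neg_of_pos (mul_neg_of_pos_of_neg hρ0
        (Real.cos_neg_of_pi_div_two_lt_of_lt ?_ ?_)) hdet <;> nlinarith
  have hGG := logChange_comp_convex (convex_closedBall (0 : ℂ) ρ) (g := fun w => G (N.tube s₀ w))
    (hG.comp hCc.continuousOn (Set.mapsTo_image _ _)) (fun w hw => hG0 _ ⟨w, hw, rfl⟩)
    zero_le_one (le_refl (0 : ℝ)) (k := w) (k' := fun _ => w 0) hw.continuousOn (fun t _ => hwC t)
    continuousOn_const (fun t _ => hwC 0) rfl hw01.symm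
  rw [logChange_self _ _ (hG0 _ ⟨w 0, hwC 0, rfl⟩)] at hGG
  rw [logChange_congr zero_le_one (d := fun t => Z (w t) * G (N.tube s₀ (w t)))
    fun t _ => hGeq _ ⟨w t, hwC t, rfl⟩, logChange_mul zero_le_one (c := fun t => Z (w t))
    (d := fun t => G (N.tube s₀ (w t))) (hZc.comp hw).continuousOn hZ0
        (hG.comp hGw.continuousOn fun t _ => ⟨w t, hwC t, rfl⟩)
            (fun t _ => hG0 _ ⟨w t, hwC t, rfl⟩),
    hGG, hZw]
  simp

end TransverseField

end PolyLink

/-! ### The blackboard framing -/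

namespace PolyLink

variable {n : ℕ} {L : PolyLink n} {i : Fin n}

theorem exists_height_bound (L : PolyLink n) : ∃ H, ∀ k s, (L.curve k s).2 < H := by
  have h1 : ∀ k, ∃ H, ∀ s, (L.curve k s).2 < H := by
    intro k
    obtain ⟨H, hH⟩ := (isCompact_Icc (a := (0 : ℝ)) (b := L.period k)).bddAbove_image
      (f := fun s => (L.curve k s).2) (by fun_prop : Continuous fun s =>
          (L.curve k s).2).continuousOn
    refine ⟨H + 1, fun s => ?_⟩
    obtain ⟨m, hm⟩ := L.exists_int_mem_Icc k s
    have := hH ⟨_, hm, rfl⟩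
    simp only [curve_add_int_mul] at this
    linarith
  choose H hH using h1
  refine ⟨∑ k, |H k|, fun k s => (hH k s).trans_le ((le_abs_self _).trans ?_)⟩
  exact Finset.single_le_sum (f := fun k => |H k|) (fun k _ => abs_nonneg _) (Finset.mem_univ k)

theorem linkFun_wall_ne_zero {s h : ℝ} (h1 : (L.curve i s).2 ≠ h)
    (h2 : ∀ u, L.Cross i s i u → (L.curve i u).2 ≠ h) :
    L.linkFun i (((L.curve i s).1, h) : Space) ≠ 0 := by
  refine L.linkFun_ne_zero fun u hu => ?_
  have hp : (L.curve i s).1 = (L.curve i u).1 := by rw [← hu]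
  have hz : h = (L.curve i u).2 := by rw [← hu]
  by_cases he : L.curve i s = L.curve i u
  · exact h1 (by rw [hz, he])
  · exact h2 u ⟨hp, he⟩ hz.symm

/-- Far above the link the linking function is close to one, so a pushoff of a component to a great
constant height does not link this component. -/
theorem logChange_high {H : ℝ} (hH : ∀ k s, (L.curve k s).2 < H) (a : ℝ) :
    logChange (fun s => L.linkFun i (((L.curve i s).1, H) : Space)) a (a + L.period i) = 0 := by
  have hE := L.period_pos i
  have hle : a ≤ a + L.period i := by linarith
  have h1 : ∀ᶠ x in nhds (OnePoint.infty : S3), L.linkFun i x ∈ Complex.slitPlane := by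
    refine (L.continuous_linkFun i).continuousAt.eventually
      (Complex.isOpen_slitPlane.mem_nhds ?_)
    rw [linkFun, hatFun_infty]; exact Complex.one_mem_slitPlane
  rw [OnePoint.nhds_infty_eq, Filter.eventually_sup, Filter.eventually_map] at h1
  have h1 := h1.1
  rw [Filter.coclosedCompact_eq_cocompact] at h1
  obtain ⟨K, hK, hRK⟩ := (Filter.hasBasis_cocompact (X := Space)).eventually_iff.1 h1
  obtain ⟨M, hM⟩ := hK.bddAbove_image (f := fun x : Space => x.2) continuous_snd.continuousOn
  have hhigh : ∀ x : Space, M < x.2 → L.linkFun i (x : S3) ∈ Complex.slitPlane := fun x hx =>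
    hRK fun hxK => absurd (hM ⟨x, hxK, rfl⟩) (not_le.2 hx)
  set H' := max H (M + 1) with hH'
  have hHH : H ≤ H' := le_max_left _ _
  let W : ℝ × ℝ → ℂ := fun q =>
    L.linkFun i (((L.curve i q.2).1, H + q.1 * (H' - H)) : Space)
  have hW : Continuous W := (L.continuous_linkFun i).comp
    (OnePoint.continuous_coe.comp (by fun_prop))
  have h := logChange_homotopy (H := W) hle hW.continuousOn
    (by
      rintro ⟨t, s⟩ ⟨ht, -⟩
      have : 0 ≤ t * (H' - H) := mul_nonneg ht.1 (sub_nonneg.2 hHH)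
      refine linkFun_wall_ne_zero (ne_of_lt ?_) fun u _ => ne_of_lt ?_
      · have := hH i s; linarith
      · have := hH i u; linarith)
    (by intro t _; simp only [W, curve_add_period])
  simp only [W, zero_mul, add_zero, one_mul, add_sub_cancel] at h
  rw [h, logChange_slit hle, curve_add_period, sub_self]
  · exact ((L.continuous_linkFun i).comp
      (OnePoint.continuous_coe.comp (by fun_prop))).continuousOn
  · intro s _
    refine hhigh _ ?_
    have := le_max_right H (M + 1)
    simp only; linarith

/-- The linking number of a component with its vertical pushoff is bounded by the number of its
passages under other strands. -/
theorem IsRegular.norm_logChange_pushoff_le (hreg : L.IsRegular) {ρ : ℝ} (hρ : 0 < ρ)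
    (hgap : ∀ s k u h, 0 < h → h ≤ ρ → ((L.curve i s).1, (L.curve i s).2 + h) ≠ L.curve k u)
    (a : ℝ) (T : Finset ℝ)
    (hT : ∀ s, s ∈ T ↔ s ∈ Set.Ico a (a + L.period i) ∧ L.AtCrossing i s ∧ ¬ L.PassesOver i s) :
    ‖logChange (fun s => L.linkFun i (((L.curve i s).1, (L.curve i s).2 + ρ) : Space))
      a (a + L.period i)‖ ≤ 2 * Real.pi * T.card := by
  have hE := L.period_pos i
  have hle : a ≤ a + L.period i := by linarith
  have hne : ∀ s k u, ((L.curve i s).1, (L.curve i s).2 + ρ) ≠ L.curve k u := fun s k u =>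
    hgap s k u ρ hρ le_rfl
  have hunder : ∀ s k u, L.Cross i s k u → (L.curve i s).2 < (L.curve k u).2 →
      (L.curve i s).2 + ρ < (L.curve k u).2 := fun s k u hc hlt => not_le.1 fun hle =>
    hgap s k u ((L.curve k u).2 - (L.curve i s).2) (by linarith) (by linarith)
      (Prod.ext hc.1 (add_sub_cancel _ _))
  obtain ⟨H₀, hH₀⟩ := L.exists_height_bound
  set H := H₀ + ρ with hHdef
  have hH : ∀ k s, (L.curve k s).2 + ρ < H := fun k s => by linarith [hH₀ k s]
  have hH1 : ∀ k s, (L.curve k s).2 < H := fun k s => by linarith [hH k s]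
  have hTover : ∀ s ∈ T, ∃ k u, L.Cross i s k u ∧ (L.curve i s).2 < (L.curve k u).2 := by
    intro s hs
    obtain ⟨-, ⟨k, u, hc⟩, hno⟩ := (hT s).1 hs
    refine ⟨k, u, hc, lt_of_le_of_ne (not_lt.1 fun h => hno ⟨k, u, hc, h⟩) hc.height_ne⟩
  -- a radius such that the strands through the points of `T` are straight and free of crossings
  have hev : ∀ᶠ x in nhds (0 : ℝ), ∀ σ' ∈ T,
      L.curve i (σ' + x) = L.curve i σ' + (σ' + x - σ') • L.dir i σ' ∧ (∀ k : ℤ, σ' + x ≠ k) ∧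
      (L.AtCrossing i (σ' + x) → σ' + x = σ') ∧ |(L.curve i (σ' + x)).2 - (L.curve i σ').2| <
          ρ / 2 := by
    refine (Filter.eventually_all_finset T).2 fun σ' hσ' => ?_
    obtain ⟨k, u, hc, -⟩ := hTover σ' hσ'
    have ht : Filter.Tendsto (fun x => σ' + x) (nhds 0) (nhds σ') := by
      have : Continuous fun x : ℝ => σ' + x := by fun_prop
      simpa using this.tendsto 0
    have hint := hreg.ne_int_of_cross hc
    have hne : ∀ᶠ t : ℝ in nhds σ', ∀ k : ℤ, t ≠ k := by
      have hfl := lt_floor_add_one_of_ne hint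
      filter_upwards [Ioo_mem_nhds hfl.1 hfl.2] with t ht k hk
      rw [hk] at ht
      have h1 : ⌊σ'⌋ < k := by exact_mod_cast ht.1
      have h2 : k < ⌊σ'⌋ + 1 := by exact_mod_cast ht.2
      omega
    have hz : ∀ᶠ t in nhds σ', |(L.curve i t).2 - (L.curve i σ').2| < ρ / 2 := by
      have hc : Continuous fun t => |(L.curve i t).2 - (L.curve i σ').2| := by fun_prop
      exact hc.continuousAt.eventually (gt_mem_nhds (by simpa using half_pos hρ))
    filter_upwards [ht.eventually (L.curve_near i hint), ht.eventually hne,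
      ht.eventually (hreg.eventually_not_atCrossing i σ'), ht.eventually hz] with x h1 h2 h3 h4
    exact ⟨h1, h2, h3, h4⟩
  obtain ⟨ε, hε, hball⟩ := Metric.eventually_nhds_iff.1 hev
  obtain ⟨δ, hδ, hδε, hδE⟩ : ∃ δ > 0, δ < ε ∧ 2 * δ < L.period i :=
    ⟨min (ε / 2) (L.period i / 4), by positivity,
      by linarith [min_le_left (ε / 2) (L.period i / 4)],
      by linarith [min_le_right (ε / 2) (L.period i / 4)]⟩
  have hloc : ∀ σ' ∈ T, ∀ s, |s - σ'| ≤ δ →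
      L.curve i s = L.curve i σ' + (s - σ') • L.dir i σ' ∧ (∀ k : ℤ, s ≠ k) ∧
      (L.AtCrossing i s → s = σ') ∧ |(L.curve i s).2 - (L.curve i σ').2| < ρ / 2 := by
    intro σ' hσ' s hs
    have := hball (y := s - σ') (by rw [dist_zero_right, Real.norm_eq_abs]; linarith) σ' hσ'
    simpa using this
  have hTcross : ∀ s ∈ T, L.AtCrossing i s := fun s hs => ((hT s).1 hs).2.1
  have hsep : ∀ σ' ∈ T, ∀ s, L.AtCrossing i s → L.periodDist i (s - σ') < δ →
      ∃ m : ℤ, s = σ' + m * L.period i := by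
    intro σ' hσ' s hs hd
    obtain ⟨m, hm⟩ := exists_of_periodDist_lt hd
    have h1 := (hloc σ' hσ' (s - m * L.period i)
      (by rw [show s - m * L.period i - σ' = s - σ' - m * L.period i by ring]; exact hm.le)).2.2.1
      (by
        have := (L.atCrossing_add_int_mul (i := i) (s := s) (-m)).2 hs
        push_cast at this
        rwa [neg_mul, ← sub_eq_add_neg] at this)
    exact ⟨m, by linarith⟩
  have hTmod : ∀ σ' ∈ T, ∀ σ₁ ∈ T, ∀ m : ℤ, σ₁ = σ' + m * L.period i → σ₁ = σ' := by
    intro σ' hσ' σ₁ hσ₁ m hm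
    have h1 := ((hT _).1 hσ').1
    have h2 := ((hT _).1 hσ₁).1
    have hm1 : (m : ℝ) < 1 := by
      by_contra hc; rw [not_lt] at hc; nlinarith [h1.1, h2.2]
    have hm2 : (-1 : ℝ) < m := by
      by_contra hc; rw [not_lt] at hc; nlinarith [h1.2, h2.1]
    have hm3 : m < 1 := by exact_mod_cast hm1
    have hm4 : -1 < m := by exact_mod_cast hm2
    have : m = 0 := by omega
    rw [hm, this]; simp
  -- curves at great height with a dip at each point of a set of crossings
  let q : ℝ → ℝ → ℝ := fun σ' s => min 1 (L.periodDist i (s - σ') / δ)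
  have hpd : Continuous (L.periodDist i) := by
    unfold periodDist
    exact continuous_norm.comp (AddCircle.continuous_mk' _)
  have hq : ∀ σ', Continuous (q σ') := fun σ' => by
    have : Continuous fun s => L.periodDist i (s - σ') := hpd.comp (by fun_prop)
    fun_prop
  have hq0 : ∀ σ' s, 0 ≤ q σ' s := fun σ' s =>
    le_min zero_le_one (div_nonneg (norm_nonneg _) hδ.le)
  have hq1 : ∀ σ' s, q σ' s ≤ 1 := fun σ' s => min_le_left _ _
  have hqp : ∀ σ' s (m : ℤ), q σ' (s + m * L.period i) = q σ' s := fun σ' s m => by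
    simp only [q]
    rw [show s + m * L.period i - σ' = s - σ' + m * L.period i by ring, periodDist_add_int_mul]
  have hqself : ∀ σ', q σ' σ' = 0 := fun σ' => by
    simp [q, periodDist]
  have hqone : ∀ σ' s, δ ≤ L.periodDist i (s - σ') → q σ' s = 1 := fun σ' s h =>
    min_eq_left ((one_le_div hδ).2 h)
  let low : ℝ → ℝ := fun s => (L.curve i s).2 + ρ
  have hlow : Continuous low := by fun_prop
  let ht : Finset ℝ → ℝ → ℝ := fun T' s => low s + (H - low s) * ∏ σ' ∈ T', q σ' s
  have hht : ∀ T', Continuous (ht T') := fun T' => by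
    have : Continuous fun s => ∏ σ' ∈ T', q σ' s := continuous_finsetProd _ fun σ' _ => hq σ'
    fun_prop
  have hlowp : ∀ s (m : ℤ), low (s + m * L.period i) = low s := fun s m => by
    simp only [low, curve_add_int_mul]
  have hhtp : ∀ T' s (m : ℤ), ht T' (s + m * L.period i) = ht T' s := fun T' s m => by
    simp only [ht, hlowp, hqp]
  have hprod0 : ∀ T' s, 0 ≤ ∏ σ' ∈ T', q σ' s := fun T' s =>
    Finset.prod_nonneg fun σ' _ => hq0 σ' s
  have hprod1 : ∀ T' s, ∏ σ' ∈ T', q σ' s ≤ 1 := fun T' s =>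
    Finset.prod_le_one (fun σ' _ => hq0 σ' s) fun σ' _ => hq1 σ' s
  have hhl : ∀ s, low s < H := fun s => hH i s
  have hhtlow : ∀ T' s, low s ≤ ht T' s := fun T' s => by
    have := mul_nonneg (sub_pos.2 (hhl s)).le (hprod0 T' s)
    simp only [ht]; linarith
  have hhtH : ∀ T' s, ht T' s ≤ H := fun T' s => by
    have := mul_le_mul_of_nonneg_left (hprod1 T' s) (sub_pos.2 (hhl s)).le
    simp only [ht]; linarith
  have hhtin : ∀ T' σ' s (m : ℤ), σ' ∈ T' → s = σ' + m * L.period i → ht T' s = low s := by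
    intro T' σ' s m hσ' hs
    have : q σ' s = 0 := by rw [hs, hqp, hqself]
    have : ∏ σ₁ ∈ T', q σ₁ s = 0 := Finset.prod_eq_zero hσ' this
    simp only [ht, this, mul_zero, add_zero]
  have hhtout : ∀ T' ⊆ T, ∀ s, L.AtCrossing i s → (∀ σ' ∈ T', ∀ m : ℤ, s ≠ σ' + m * L.period i) →
      ht T' s = H := by
    intro T' hT' s hs hno
    have : ∏ σ' ∈ T', q σ' s = 1 := Finset.prod_eq_one fun σ' hσ' => by
      refine hqone σ' s (not_lt.1 fun hd => ?_)
      obtain ⟨m, hm⟩ := hsep σ' (hT' hσ') s hs hd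
      exact hno σ' hσ' m hm
    simp only [ht, this, mul_one, add_sub_cancel]
  have hlow_ne : ∀ s, (L.curve i s).2 ≠ low s := fun s => by simp only [low]; linarith
  have hcne : ∀ T' ⊆ T, ∀ s, L.linkFun i (((L.curve i s).1, ht T' s) : Space) ≠ 0 := by
    intro T' hT' s
    refine linkFun_wall_ne_zero ?_ fun u hu => ?_
    · have := hhtlow T' s; simp only [low] at this; linarith
    · by_cases hin : ∃ σ' ∈ T', ∃ m : ℤ, s = σ' + m * L.period i
      · obtain ⟨σ', hσ', m, hm⟩ := hin
        rw [hhtin T' σ' s m hσ' hm]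
        intro h
        exact hne s i u (Prod.ext hu.1 h.symm)
      · push Not at hin
        rw [hhtout T' hT' s hu.atCrossing hin]
        exact (hH1 i u).ne
  let cv : Finset ℝ → ℝ → ℂ := fun T' s => L.linkFun i (((L.curve i s).1, ht T' s) : Space)
  have hcv : ∀ T', Continuous (cv T') := fun T' => by
    have := hht T'
    exact (L.continuous_linkFun i).comp (OnePoint.continuous_coe.comp (by fun_prop))
  have hcvp : ∀ T' s, cv T' (s + L.period i) = cv T' s := fun T' s => by
    have h1 := hhtp T' s 1
    rw [Int.cast_one, one_mul] at h1
    simp only [cv, curve_add_period, h1]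
  have key : ∀ T' : Finset ℝ, T' ⊆ T →
      ‖logChange (cv T') a (a + L.period i)‖ ≤ 2 * Real.pi * T'.card := by
    intro T'
    induction T' using Finset.induction_on with
    | empty =>
      intro _
      have : cv ∅ = fun s => L.linkFun i (((L.curve i s).1, H) : Space) := by
        funext s; simp only [cv, ht, Finset.prod_empty, mul_one, add_sub_cancel]
      rw [this, logChange_high hH1]; simp
    | insert σ' T' hσ' ih =>
      intro hsub
      have hσT : σ' ∈ T := hsub (Finset.mem_insert_self _ _)
      have hsub' : T' ⊆ T := fun x hx => hsub (Finset.mem_insert_of_mem hx)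
      have ih := ih hsub'
      have hper : ∀ T'' ⊆ T, logChange (cv T'') a (a + L.period i) =
          logChange (cv T'') (σ' - δ) (σ' + δ) +
            logChange (cv T'') (σ' + δ) (σ' - δ + L.period i) := by
        intro T'' hT''
        rw [logChange_period hE.le (hcv T'') (hcne T'' hT'') (hcvp T'') a (σ' - δ),
          logChange_add (by linarith) (by linarith) (hcv T'').continuousOn
            fun s _ => hcne T'' hT'' s]
      have hagree : ∀ s, δ ≤ L.periodDist i (s - σ') → ht (insert σ' T') s = ht T' s := by
        intro s hs
        simp only [ht, Finset.prod_insert hσ', hqone σ' s hs, one_mul]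
      have hfar : ∀ s ∈ Set.Icc (σ' + δ) (σ' - δ + L.period i), δ ≤ L.periodDist i (s - σ') := by
        intro s hs
        refine not_lt.1 fun hd => ?_
        obtain ⟨m, hm⟩ := exists_of_periodDist_lt hd
        have hm := abs_lt.1 hm
        have hm1 : (m : ℝ) < 1 := by
          by_contra hc; rw [not_lt] at hc; nlinarith [hs.2]
        have hm2 : (0 : ℝ) < m := by
          by_contra hc; rw [not_lt] at hc; nlinarith [hs.1]
        have hm3 : m < 1 := by exact_mod_cast hm1
        have hm4 : 0 < m := by exact_mod_cast hm2
        omega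
      obtain ⟨k, u, hc, hku⟩ := hTover σ' hσT
      have hdip := hreg.logChange_dip (i := i) (k := k) (s₀ := σ') (u := u) (δ := δ)
        (h₀ := (L.curve i σ').2 + ρ / 2) (h₁ := H) hδ hc
        (fun s hs => by
          obtain ⟨h1, h2, h3, h4⟩ := hloc σ' hσT s hs
          exact ⟨h1, h2, h3, by linarith [(abs_lt.1 h4).2]⟩)
        (hht (insert σ' T')) (hht T')
        (fun s hs => ⟨by
          have h1 := hhtlow (insert σ' T') s
          have h2 := (abs_lt.1 (hloc σ' hσT s hs).2.2.2).1
          simp only [low] at h1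
          linarith, hhtH _ _⟩)
        (fun s hs => ⟨by
          have h1 := hhtlow T' s
          have h2 := (abs_lt.1 (hloc σ' hσT s hs).2.2.2).1
          simp only [low] at h1
          linarith, hhtH _ _⟩)
        (by
          refine hagree _ ?_
          have := hfar (σ' - δ + L.period i) ⟨by linarith, le_rfl⟩
          have h2 := L.periodDist_add_int_mul i (σ' - δ - σ') 1
          rw [Int.cast_one, one_mul] at h2
          rw [← h2]
          rwa [show σ' - δ + L.period i - σ' = σ' - δ - σ' + L.period i by ring] at this)
        (hagree _ (hfar _ ⟨le_rfl, by linarith⟩))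
        (by
          rw [hhtin _ σ' σ' 0 (Finset.mem_insert_self _ _) (by simp)]
          exact hunder σ' k u hc hku)
        (by
          rw [hhtout T' hsub' σ' (hTcross _ hσT) fun σ₁ hσ₁ m hm => ?_]
          · exact hH1 k u
          · have := hTmod σ₁ (hsub' hσ₁) σ' hσT m hm
            rw [this] at hσ'
            exact hσ' hσ₁)
      have e := hper _ hsub
      have e' := hper _ hsub'
      have hrest : logChange (cv (insert σ' T')) (σ' + δ) (σ' - δ + L.period i) =
          logChange (cv T') (σ' + δ) (σ' - δ + L.period i) :=
        logChange_congr (by linarith) fun s hs => by simp only [cv, hagree s (hfar s hs)]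
      have : logChange (cv (insert σ' T')) a (a + L.period i) =
          (logChange (cv (insert σ' T')) (σ' - δ) (σ' + δ) - logChange (cv T') (σ' - δ) (σ' + δ)) +
            logChange (cv T') a (a + L.period i) := by
        rw [e, e', hrest]; ring
      rw [this, Finset.card_insert_of_notMem hσ']
      refine (norm_add_le _ _).trans ?_
      push_cast
      have hdip' : ‖logChange (cv (insert σ' T')) (σ' - δ) (σ' + δ) -
        logChange (cv T') (σ' - δ) (σ' + δ)‖ ≤ 2 * Real.pi := hdip
      linarith
  -- the vertical homotopy between the pushoff and the curve with dips at all undercrossings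
  let W : ℝ × ℝ → ℂ := fun x =>
    L.linkFun i (((L.curve i x.2).1, low x.2 + x.1 * (ht T x.2 - low x.2)) : Space)
  have hW : Continuous W := by
    have := hht T
    exact (L.continuous_linkFun i).comp (OnePoint.continuous_coe.comp (by fun_prop))
  have h := logChange_homotopy (H := W) hle hW.continuousOn
    (by
      rintro ⟨t, s⟩ ⟨ht', -⟩
      have h0 : 0 ≤ t * (ht T s - low s) := mul_nonneg ht'.1 (sub_nonneg.2 (hhtlow T s))
      refine linkFun_wall_ne_zero ?_ fun u hu => ?_
      · simp only [low] at h0 ⊢; linarith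
      · by_cases hov : L.PassesOver i s
        · obtain ⟨k, v, hkv, hlt⟩ := hov
          have heq := hreg.double _ _ _ _ _ _ hu hkv
          rw [heq]
          simp only [low] at h0 ⊢; linarith
        · have hmem : ∃ σ' ∈ T, ∃ m : ℤ, s = σ' + m * L.period i := by
            refine ⟨s + (-⌊(s - a) / L.period i⌋ : ℤ) * L.period i, (hT _).2 ⟨⟨?_, ?_⟩, ?_, ?_⟩,
              ⌊(s - a) / L.period i⌋, by push_cast; ring⟩
            · have := Int.floor_le ((s - a) / L.period i)
              rw [le_div_iff₀ hE] at this
              push_cast; linarith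
            · have := Int.lt_floor_add_one ((s - a) / L.period i)
              rw [div_lt_iff₀ hE] at this
              push_cast; linarith
            · exact (L.atCrossing_add_int_mul _).2 hu.atCrossing
            · rwa [L.passesOver_add_int_mul]
          obtain ⟨σ', hσ', m, hm⟩ := hmem
          rw [hhtin T σ' s m hσ' hm, sub_self, mul_zero, add_zero]
          intro h
          exact hne s i u (Prod.ext hu.1 h.symm))
    (by
      intro t _
      have h1 := hhtp T a 1
      have h2 := hlowp a 1
      rw [Int.cast_one, one_mul] at h1 h2
      simp only [W, curve_add_period, h1, h2])
  simp only [W, zero_mul, add_zero, one_mul, add_sub_cancel] at h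
  have hfin := key T (Finset.Subset.refl _)
  simp only [low] at h
  rw [h]
  exact hfin

end PolyLink

namespace PolyLink

variable {n : ℕ} {L : PolyLink n} {i : Fin n}

/-- A curve in the tube which runs around once along the component and does not link it winds
around it at most as often as the component passes under other strands. -/
theorem TransverseField.abs_le_of_logChange_eq_zero (N : L.TransverseField i) (hreg : L.IsRegular)
    {r : ℝ} (hr0 : 0 < r) (hr : ∀ s k u w, ‖w‖ ≤ r → N.tube s w = L.curve k u → w = 0)
    {f : ℝ → ℝ} {ζ : ℝ → ℂ} {m : ℤ} (hf : ContinuousOn f (Set.Icc 0 1))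
    (hζ : ContinuousOn ζ (Set.Icc 0 1)) (hre : ∀ t ∈ Set.Icc (0 : ℝ) 1, (ζ t).re ≤ Real.log r)
    (hf1 : f 1 = f 0 + L.period i) (hζ1 : ζ 1 = ζ 0 + m * (2 * Real.pi * Complex.I))
    (h0 : logChange (fun t => L.linkFun i (N.tube (f t) (Complex.exp (ζ t)) : Space)) 0 1 = 0)
    {a : ℝ} {T : Finset ℝ}
    (hT : ∀ s, s ∈ T ↔ s ∈ Set.Ico a (a + L.period i) ∧ L.AtCrossing i s ∧ ¬ L.PassesOver i s) :
    |m| ≤ (T.card : ℤ) := by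
  have hE := L.period_pos i
  obtain ⟨A, B, hAB⟩ := N.exists_torus_constants hr hr0
  obtain ⟨s₀, ρ, hρ0, hρr, hmer⟩ := N.exists_meridian hreg hr0 hr
  have hlogρ : Real.log ρ ≤ Real.log r := Real.log_le_log hρ0 hρr
  have hB : B = 2 * Real.pi * Complex.I := by
    have h := hAB (fun _ => s₀) (fun t => (Real.log ρ : ℂ) + t * (2 * Real.pi * Complex.I)) 0 1 0 1
      zero_le_one (by fun_prop) (by fun_prop) (fun t _ => by simpa using hlogρ) (by simp) (by simp)
    have hexp : Complex.exp (Real.log ρ : ℂ) = ρ := by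
      rw [← Complex.ofReal_exp, Real.exp_log hρ0]
    simp only [Complex.exp_add, hexp] at h
    rw [hmer] at h
    simpa using h.symm
  have hA : ‖A‖ ≤ 2 * Real.pi * T.card := by
    have h := hAB (fun t => t) (fun _ => (Real.log ρ : ℂ) + (Real.pi / 2 : ℝ) * Complex.I) a
      (a + L.period i) 1 0 (by linarith) (by fun_prop) (by fun_prop)
      (fun t _ => by simpa using hlogρ) (by simp) (by simp)
    have hexp : Complex.exp ((Real.log ρ : ℂ) + (Real.pi / 2 : ℝ) * Complex.I) =
        ρ * Complex.I := by
      rw [Complex.exp_add, ← Complex.ofReal_exp, Real.exp_log hρ0, Complex.ofReal_div,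
        Complex.ofReal_ofNat, Complex.exp_pi_div_two_mul_I]
    have htube : ∀ t, ∀ h : ℝ, N.tube t (h * Complex.I) =
        ((L.curve i t).1, (L.curve i t).2 + h) := fun t h => by simp [tube, plane_zero]
    simp only [hexp, htube, Int.cast_one, one_mul, Int.cast_zero, zero_mul, add_zero] at h
    rw [← h]
    refine hreg.norm_logChange_pushoff_le hρ0 (fun s k u h h1 h2 heq => ?_) a T hT
    rw [← htube] at heq
    have := hr _ _ _ _ (by simpa [abs_of_pos h1] using h2.trans hρr) heq
    simp [h1.ne'] at this
  have h := hAB f ζ 0 1 1 m zero_le_one hf hζ hre (by simpa using hf1) hζ1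
  rw [h0, hB] at h
  have hAm : A = -(m * (2 * Real.pi * Complex.I)) := by
    push_cast at h; linear_combination -h
  rw [hAm, norm_neg, norm_mul, Complex.norm_intCast] at hA
  have h2 : ‖(2 * Real.pi * Complex.I : ℂ)‖ = 2 * Real.pi := by
    simp [abs_of_pos Real.pi_pos]
  rw [h2, mul_comm] at hA
  have := le_of_mul_le_mul_left hA Real.two_pi_pos
  exact_mod_cast this

/-! ### The two sides of a strand -/

/-- The position `y` of the projection plane is not on the projection of the link. -/
def OffShadow (L : PolyLink n) (y : ℝ × ℝ) : Prop := ∀ k u, (L.curve k u).1 ≠ y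

/-- The region around a position of the projection plane. -/
def regionAt (L : PolyLink n) (y : ℝ × ℝ) : Set S3 :=
  connectedComponentIn (projSphere \ L.shadow) (((y, (0 : ℝ)) : Space) : S3)

theorem mem_of_offShadow {y : ℝ × ℝ} (h : L.OffShadow y) :
    (((y, (0 : ℝ)) : Space) : S3) ∈ projSphere \ L.shadow := by
  refine ⟨Or.inr ⟨y, rfl⟩, ?_⟩
  rintro ⟨k, u, hku⟩
  have := OnePoint.coe_injective hku
  exact h k u (congrArg Prod.fst this).symm

theorem offShadow_of_mem {y : ℝ × ℝ} (h : (((y, (0 : ℝ)) : Space) : S3) ∈ projSphere \ L.shadow) :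
    L.OffShadow y := fun k u hku => h.2 ⟨k, u, by rw [shadowPt, hku]⟩

theorem isRegion_regionAt {y : ℝ × ℝ} (h : L.OffShadow y) : L.IsRegion (L.regionAt y) :=
  ⟨_, mem_of_offShadow h, rfl⟩

theorem mem_regionAt {y : ℝ × ℝ} (h : L.OffShadow y) :
    (((y, (0 : ℝ)) : Space) : S3) ∈ L.regionAt y := mem_connectedComponentIn (mem_of_offShadow h)

theorem eq_regionAt {y : ℝ × ℝ} {R : Set S3} (hR : L.IsRegion R)
    (h : (((y, (0 : ℝ)) : Space) : S3) ∈ R) : R = L.regionAt y := by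
  obtain ⟨x, -, rfl⟩ := hR
  exact connectedComponentIn_eq h

theorem regionAt_eq_of_isPreconnected {C : Set (ℝ × ℝ)} (hC : IsPreconnected C)
    (h : ∀ y ∈ C, L.OffShadow y) {y y' : ℝ × ℝ} (hy : y ∈ C) (hy' : y' ∈ C) :
    L.regionAt y = L.regionAt y' := by
  have hc : Continuous fun y : ℝ × ℝ => (((y, (0 : ℝ)) : Space) : S3) :=
    OnePoint.continuous_coe.comp (by fun_prop)
  have := (hC.image _ hc.continuousOn).subset_connectedComponentIn (F := projSphere \ L.shadow)
    (Set.mem_image_of_mem _ hy) (by rintro _ ⟨z, hz, rfl⟩; exact mem_of_offShadow (h z hz))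
  exact connectedComponentIn_eq (this (Set.mem_image_of_mem _ hy'))

theorem regionAt_eq_of_path {f : ℝ → ℝ × ℝ} {a b : ℝ} (hab : a ≤ b) (hf : Continuous f)
    (h : ∀ t ∈ Set.Icc a b, L.OffShadow (f t)) : L.regionAt (f a) = L.regionAt (f b) :=
  regionAt_eq_of_isPreconnected (isPreconnected_Icc.image f hf.continuousOn)
    (by rintro _ ⟨t, ht, rfl⟩; exact h t ht) ⟨a, Set.left_mem_Icc.2 hab, rfl⟩
    ⟨b, Set.right_mem_Icc.2 hab, rfl⟩

/-- A position of the plane as a complex number. -/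
def toC (y : ℝ × ℝ) : ℂ := ⟨y.1, y.2⟩

theorem continuous_toC : Continuous toC := by
  have : toC = fun y => (y.1 : ℂ) + y.2 * Complex.I := by
    funext y; apply Complex.ext <;> simp [toC]
  rw [this]; fun_prop

theorem toC_eq_zero {y : ℝ × ℝ} : toC y = 0 ↔ y = 0 := by
  simp [toC, Complex.ext_iff, Prod.ext_iff]

/-- The winding increment (`2πi` times the winding number) of the projection of the component `k`
about a position of the projection sphere. -/
def planarChange (L : PolyLink n) (k : Fin n) : S3 → ℂ
  | none => 0
  | some x => logChange (fun s => toC ((L.curve k s).1 - x.1)) 0 (L.period k)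

theorem planarChange_coe (k : Fin n) (y : ℝ × ℝ) :
    L.planarChange k (((y, (0 : ℝ)) : Space) : S3) =
      logChange (fun s => toC ((L.curve k s).1 - y)) 0 (L.period k) := rfl

theorem planarChange_eq_of_segment (k : Fin n) {y y' : ℝ × ℝ}
    (h : ∀ t ∈ Set.Icc (0 : ℝ) 1, ∀ s, (L.curve k s).1 ≠ y + t • (y' - y)) :
    L.planarChange k (((y, (0 : ℝ)) : Space) : S3) =
      L.planarChange k (((y', (0 : ℝ)) : Space) : S3) := by
  rw [planarChange_coe, planarChange_coe]
  have := logChange_homotopy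
    (H := fun q : ℝ × ℝ => toC ((L.curve k q.2).1 - (y + q.1 • (y' - y))))
    (L.period_pos k).le (continuous_toC.comp (by fun_prop)).continuousOn
    (fun q hq h0 => h q.1 hq.1 q.2 (sub_eq_zero.1 (toC_eq_zero.1 h0)))
    (fun t _ => by
      have := L.curve_add_period k 0
      rw [zero_add] at this
      simp only [this])
  simpa using this

/-- Points far away are not encircled by the projection. -/
theorem planarChange_eq_zero (k : Fin n) {y : ℝ × ℝ} (h : ∀ s, ‖(L.curve k s).1‖ < ‖y‖) :
    L.planarChange k (((y, (0 : ℝ)) : Space) : S3) = 0 := by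
  rw [planarChange_coe]
  have := logChange_homotopy
    (H := fun q : ℝ × ℝ => toC (q.1 • (L.curve k q.2).1 - y))
    (L.period_pos k).le (continuous_toC.comp (by fun_prop)).continuousOn
    (fun q hq h0 => by
      have h1 := sub_eq_zero.1 (toC_eq_zero.1 h0)
      have h2 := h q.2
      rw [← h1, norm_smul, Real.norm_eq_abs, abs_of_nonneg hq.1.1] at h2
      have := mul_le_of_le_one_left (norm_nonneg (L.curve k q.2).1) hq.1.2
      linarith)
    (fun t _ => by
      have := L.curve_add_period k 0
      rw [zero_add] at this
      simp only [this])
  simp only [zero_smul, zero_sub, one_smul] at this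
  rw [← this]
  have h0 : toC (-y) ≠ 0 := by
    rw [Ne, toC_eq_zero, neg_eq_zero]
    intro h0
    have := h 0
    rw [h0, norm_zero] at this
    exact absurd this (not_lt.2 (norm_nonneg _))
  rw [logChange_eq (f := fun _ => Complex.log (toC (-y))) (L.period_pos k).le continuousOn_const
    fun s _ => Complex.exp_log h0, sub_self]

theorem exists_plane_bound (k : Fin n) : ∃ M, ∀ s, ‖(L.curve k s).1‖ ≤ M := by
  obtain ⟨M, hM⟩ := (isCompact_Icc (a := (0 : ℝ)) (b := L.period k)).bddAbove_image
    (f := fun s => ‖(L.curve k s).1‖) (by fun_prop : Continuous _).continuousOn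
  refine ⟨M, fun s => ?_⟩
  obtain ⟨m, hm⟩ := L.exists_int_mem_Icc k s
  have := hM ⟨_, hm, rfl⟩
  simpa only [curve_add_int_mul] using this

/-- The winding number is locally constant on the complement of the projection, also at infinity. -/
theorem eventually_planarChange (k : Fin n) {x : S3} (hx : x ∈ projSphere \ L.shadow) :
    ∀ᶠ x' in nhdsWithin x (projSphere \ L.shadow), L.planarChange k x' = L.planarChange k x := by
  obtain ⟨hx1 | ⟨y, rfl⟩, hx2⟩ := hx
  · subst hx1
    obtain ⟨M, hM⟩ := L.exists_plane_bound k
    have : ∀ᶠ x' in nhds (OnePoint.infty : S3), x' ∈ projSphere \ L.shadow →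
        L.planarChange k x' = L.planarChange k OnePoint.infty := by
      rw [OnePoint.nhds_infty_eq, Filter.eventually_sup, Filter.eventually_map,
        Filter.coclosedCompact_eq_cocompact]
      refine ⟨?_, ?_⟩
      · filter_upwards [(tendsto_norm_cocompact_atTop (E := Space)).eventually_gt_atTop M]
          with z hz hmem
        obtain ⟨h1 | ⟨y, hy⟩, -⟩ := hmem
        · exact absurd h1 (OnePoint.coe_ne_infty z)
        · have hzy := OnePoint.coe_injective hy
          rw [hy, planarChange_eq_zero]
          · rfl
          · intro s
            rw [hzy, Prod.norm_mk, norm_zero, max_eq_left (norm_nonneg _)] at hz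
            exact (hM s).trans_lt hz
      · simp
    exact eventually_nhdsWithin_iff.2 this
  · have hoff := offShadow_of_mem ⟨Or.inr ⟨y, rfl⟩, hx2⟩
    -- the projection of the component keeps a distance from `y`
    obtain ⟨ε, hε, hd⟩ : ∃ ε > 0, ∀ s, ε ≤ ‖(L.curve k s).1 - y‖ := by
      obtain ⟨s₀, -, hs₀⟩ := (isCompact_Icc (a := (0 : ℝ)) (b := L.period k)).exists_isMinOn
        ⟨0, Set.left_mem_Icc.2 (L.period_pos k).le⟩ (f := fun s => ‖(L.curve k s).1 - y‖)
        (by fun_prop : Continuous _).continuousOn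
      refine ⟨_, norm_pos_iff.2 (sub_ne_zero.2 (hoff k s₀)), fun s => ?_⟩
      obtain ⟨m, hm⟩ := L.exists_int_mem_Icc k s
      have := hs₀ hm
      simpa only [Set.mem_ofPred_eq, curve_add_int_mul] using this
    refine eventually_nhdsWithin_iff.2 ?_
    rw [OnePoint.nhds_coe_eq, Filter.eventually_map]
    filter_upwards [Metric.ball_mem_nhds _ hε] with z hz hmem
    obtain ⟨h1 | ⟨y', hy'⟩, -⟩ := hmem
    · exact absurd h1 (OnePoint.coe_ne_infty z)
    · have hzy := OnePoint.coe_injective hy'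
      rw [hy', eq_comm]
      refine planarChange_eq_of_segment k fun t ht s heq => ?_
      have h1 := hd s
      rw [heq, add_sub_cancel_left, norm_smul, Real.norm_eq_abs, abs_of_nonneg ht.1] at h1
      rw [hzy, Metric.mem_ball, dist_eq_norm, Prod.mk_sub_mk, Prod.norm_mk, sub_self, norm_zero,
        max_eq_left (norm_nonneg _)] at hz
      have := mul_le_of_le_one_left (norm_nonneg (y' - y)) ht.2
      linarith

theorem planarChange_eq_of_regionAt_eq (k : Fin n) {y y' : ℝ × ℝ} (hy : L.OffShadow y)
    (hy' : L.OffShadow y') (h : L.regionAt y = L.regionAt y') :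
    L.planarChange k (((y, (0 : ℝ)) : Space) : S3) =
      L.planarChange k (((y', (0 : ℝ)) : Space) : S3) := by
  have hsub : L.regionAt y ⊆ projSphere \ L.shadow := connectedComponentIn_subset _ _
  refine (isPreconnected_connectedComponentIn : IsPreconnected (L.regionAt y)).induction₂
    (fun a b => L.planarChange k a = L.planarChange k b) (fun x hx => ?_)
    (fun _ _ _ _ _ _ h h' => h.trans h') (fun _ _ _ _ h => h.symm) (mem_regionAt hy)
    (h.symm ▸ mem_regionAt hy' : _ ∈ L.regionAt y)
  exact ((eventually_planarChange k (hsub hx)).filter_mono (nhdsWithin_mono _ hsub)).mono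
    fun _ h => h.symm

end PolyLink

namespace PolyLink

variable {n : ℕ} {L : PolyLink n} {i : Fin n}

/-- Near a point that is neither a vertex nor a crossing, the projection of the link is contained in
a line. -/
theorem IsRegular.eventually_offShadow {k : Fin n} {u : ℝ} (hint : ∀ m : ℤ, u ≠ m)
    (hcr : ¬ L.AtCrossing k u) :
    ∀ᶠ y in nhds (L.curve k u).1, det2 (L.dir k u).1 (y - (L.curve k u).1) ≠ 0 →
      L.OffShadow y := by
  have hloc : ∀ j, ∀ v ∈ Set.Icc 0 (L.period j), ∀ᶠ z : (ℝ × ℝ) × ℝ in nhds ((L.curve k u).1, v),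
      (L.curve j z.2).1 = z.1 → det2 (L.dir k u).1 (z.1 - (L.curve k u).1) = 0 := by
    intro j v _
    by_cases hp : (L.curve j v).1 = (L.curve k u).1
    · have he : L.curve k u = L.curve j v := by
        by_contra hne
        exact hcr ⟨j, v, hp.symm, hne⟩
      obtain ⟨rfl, m, rfl⟩ := L.embedded _ _ _ _ he
      have ht : Filter.Tendsto (fun z : (ℝ × ℝ) × ℝ => z.2 - m * L.period k)
          (nhds ((L.curve k u).1, u + m * L.edges k)) (nhds u) := by
        have : Continuous fun z : (ℝ × ℝ) × ℝ => z.2 - m * L.period k := by fun_prop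
        have := this.tendsto ((L.curve k u).1, u + m * L.edges k)
        simpa [period] using this
      filter_upwards [ht.eventually (L.curve_near k hint)] with z hz hz'
      have h1 := L.curve_add_int_mul k (z.2 - m * L.period k) m
      rw [sub_add_cancel] at h1
      rw [← hz', h1, hz]
      simp only [Prod.fst_add, Prod.smul_fst, add_sub_cancel_left, det2_smul_right, det2_self,
        mul_zero]
    · have hne : ∀ᶠ z : (ℝ × ℝ) × ℝ in nhds ((L.curve k u).1, v), (L.curve j z.2).1 ≠ z.1 :=
        (isOpen_ne_fun (by fun_prop) (by fun_prop)).mem_nhds hp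
      filter_upwards [hne] with z hz hz'
      exact absurd hz' hz
  have hall : ∀ᶠ y in nhds (L.curve k u).1, ∀ j, ∀ v ∈ Set.Icc 0 (L.period j),
      (L.curve j v).1 = y → det2 (L.dir k u).1 (y - (L.curve k u).1) = 0 :=
    Filter.eventually_all.2 fun j => isCompact_Icc.eventually_forall_of_forall_eventually
      (P := fun (y : ℝ × ℝ) (v : ℝ) =>
        (L.curve j v).1 = y → det2 (L.dir k u).1 (y - (L.curve k u).1) = 0) (hloc j)
  filter_upwards [hall] with y hy h0 j v hv
  obtain ⟨m, hm⟩ := L.exists_int_mem_Icc j v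
  exact h0 (hy j _ hm (by rw [curve_add_int_mul, hv]))

theorem toC_im_div {a b : ℝ × ℝ} : (toC a / toC b).im = det2 b a / Complex.normSq (toC b) := by
  rw [Complex.div_im]
  simp only [toC, det2]
  ring

/-- The winding number about a point jumps when this point crosses the strand. -/
theorem planarChange_sub {k : Fin n} {u τ : ℝ} {e : ℝ × ℝ} (hint : ∀ m : ℤ, u ≠ m)
    (he : 0 < det2 (L.dir k u).1 e) (hτ : 0 < τ)
    (hline : ∀ s, ∀ x ∈ Set.Icc (-τ) τ, (L.curve k s).1 = (L.curve k u).1 + x • e → x = 0)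
    (hcr : ¬ L.AtCrossing k u) :
    L.planarChange k ((((L.curve k u).1 + τ • e, (0 : ℝ)) : Space) : S3) -
      L.planarChange k ((((L.curve k u).1 - τ • e, (0 : ℝ)) : Space) : S3) =
        2 * Real.pi * Complex.I := by
  have hE := L.period_pos k
  set p := (L.curve k u).1 with hp
  have he0 : e ≠ 0 := by rintro rfl; simp [det2] at he
  let a : ℝ → ℂ := fun s => toC ((L.curve k s).1 - (p + τ • e))
  let b : ℝ → ℂ := fun s => toC ((L.curve k s).1 - (p - τ • e))
  have ha : Continuous a := continuous_toC.comp (by fun_prop)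
  have hb : Continuous b := continuous_toC.comp (by fun_prop)
  have ha0 : ∀ s, a s ≠ 0 := fun s h => by
    have h1 := sub_eq_zero.1 (toC_eq_zero.1 h)
    exact hτ.ne' (hline s τ ⟨by linarith, le_rfl⟩ h1)
  have hb0 : ∀ s, b s ≠ 0 := fun s h => by
    have h1 := sub_eq_zero.1 (toC_eq_zero.1 h)
    have := hline s (-τ) ⟨le_rfl, by linarith⟩ (by rw [h1, neg_smul, sub_eq_add_neg])
    linarith
  let c : ℝ → ℂ := fun s => a s / b s
  have hc : Continuous c := ha.div hb hb0
  have hc0 : ∀ s, c s ≠ 0 := fun s => div_ne_zero (ha0 s) (hb0 s)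
  have hcp : ∀ s, c (s + L.period k) = c s := fun s => by simp only [c, a, b, curve_add_period]
  have hmul := logChange_mul (c := c) (d := b) hE.le hc.continuousOn (fun s _ => hc0 s)
    hb.continuousOn fun s _ => hb0 s
  have hcb : (fun s => c s * b s) = a := funext fun s => div_mul_cancel₀ _ (hb0 s)
  rw [hcb] at hmul
  rw [planarChange_coe, planarChange_coe]
  change logChange a 0 (L.period k) - logChange b 0 (L.period k) = _
  rw [hmul, add_sub_cancel_right]
  have hper := logChange_period hE.le hc hc0 hcp 0 (u - L.period k / 2)
  rw [zero_add] at hper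
  rw [hper]
  have hne : ∀ s ∈ Set.Icc (u - L.period k / 2) (u - L.period k / 2 + L.period k), s ≠ u →
      (L.curve k s).1 ≠ p := by
    intro s hs hsu h
    have heq : L.curve k u = L.curve k s := by
      by_contra hne
      exact hcr ⟨k, s, h.symm, hne⟩
    obtain ⟨m, hm⟩ := L.curve_eq_iff.1 heq
    have h1 : (m : ℝ) < 1 := by
      by_contra hc; rw [not_lt] at hc; nlinarith [hs.2]
    have h2 : (-1 : ℝ) < m := by
      by_contra hc; rw [not_lt] at hc; nlinarith [hs.1]
    have h3 : m < 1 := by exact_mod_cast h1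
    have h4 : -1 < m := by exact_mod_cast h2
    have h5 : m = 0 := by omega
    rw [h5] at hm
    exact hsu (by simpa using hm)
  obtain ⟨ε, hε, hnear⟩ := Metric.eventually_nhds_iff.1 (L.curve_near k hint)
  have him : ∀ s, |s - u| < ε → (c s).im * Complex.normSq (b s) =
      2 * τ * det2 (L.dir k u).1 e * (u - s) := by
    intro s hs
    have h1 := hnear (y := s) (by rwa [Real.dist_eq])
    have h2 : (L.curve k s).1 = p + (s - u) • (L.dir k u).1 := by rw [h1]; rfl
    simp only [c, a, b]
    rw [toC_im_div, div_mul_cancel₀ _ (by simpa using hb0 s), h2]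
    simp only [det2, Prod.fst_sub, Prod.fst_add, Prod.smul_fst, Prod.snd_sub, Prod.snd_add,
      Prod.smul_snd, smul_eq_mul]
    ring
  have hnsq : ∀ s, 0 < Complex.normSq (b s) := fun s => Complex.normSq_pos.2 (hb0 s)
  have key := logChange_of_cross (c := c) (a := u - L.period k / 2)
    (b := u - L.period k / 2 + L.period k) (τ := u) (ε := ε) (κ := 1) (by linarith) (by linarith)
    (Or.inl rfl) hc.continuousOn ?_ (hcp _).symm ?_ hε ?_ ?_
  · rw [key]; simp
  · intro s hs hsu
    by_contra hcs
    -- the position of the strand would be on the segment between the two points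
    rw [Complex.mem_slitPlane_iff, not_or, not_lt, not_ne_iff] at hcs
    set x := (c s).re with hx
    have hcx : c s = x := Complex.ext (by simp [hx]) (by simp [hcs.2])
    have hab : a s = x * b s := by rw [← hcx]; exact (div_mul_cancel₀ _ (hb0 s)).symm
    have hvec : (L.curve k s).1 - (p + τ • e) = x • ((L.curve k s).1 - (p - τ • e)) := by
      refine Prod.ext ?_ ?_
      · have := congrArg Complex.re hab
        simpa [a, b, toC] using this
      · have := congrArg Complex.im hab
        simpa [a, b, toC] using this
    have h1x : 0 < 1 - x := by linarith [hcs.1]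
    have hP : (L.curve k s).1 = p + (τ * ((1 + x) / (1 - x))) • e := by
      have h3 : (1 - x) • ((L.curve k s).1 - p) = (τ * (1 + x)) • e := by
        have h4 : (L.curve k s).1 - p - τ • e = x • ((L.curve k s).1 - p + τ • e) := by
          rw [sub_sub, hvec]; congr 1; abel
        rw [sub_smul, one_smul, mul_add, mul_one, add_smul]
        rw [sub_eq_iff_eq_add] at h4
        rw [smul_add, smul_smul] at h4
        rw [sub_eq_iff_eq_add]
        nth_rewrite 1 [h4]
        rw [mul_comm x τ]; abel
      have h5 : (L.curve k s).1 - p = (1 - x)⁻¹ • ((τ * (1 + x)) • e) := by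
        rw [← h3, smul_smul, inv_mul_cancel₀ h1x.ne', one_smul]
      rw [smul_smul] at h5
      rw [sub_eq_iff_eq_add] at h5
      rw [h5, add_comm]
      congr 2
      field_simp
    have hmem : τ * ((1 + x) / (1 - x)) ∈ Set.Icc (-τ) τ := by
      have h6 : (1 + x) / (1 - x) ≤ 1 := (div_le_one h1x).2 (by linarith [hcs.1])
      have h7 : -1 ≤ (1 + x) / (1 - x) := by rw [le_div_iff₀ h1x]; linarith
      constructor <;> nlinarith
    have h0 := hline s _ hmem hP
    rw [h0, zero_smul, add_zero] at hP
    exact hne s hs hsu hP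
  · have : c u = -1 := by
      have h1 : a u = -b u := by
        simp only [a, b, ← hp]
        apply Complex.ext <;> simp [toC]
      simp only [c, h1]
      rw [neg_div, div_self (hb0 u)]
    rw [this]; norm_num
  · intro s _ h1 h2
    have := him s (abs_lt.2 ⟨by linarith, by linarith⟩)
    rw [one_mul]
    have h3 : 0 < (c s).im * Complex.normSq (b s) := by
      rw [this]; exact mul_pos (by positivity) (by linarith)
    exact (pos_iff_pos_of_mul_pos h3).2 (hnsq s)
  · intro s _ h1 h2
    have := him s (abs_lt.2 ⟨by linarith, by linarith⟩)
    rw [one_mul]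
    have h3 : (c s).im * Complex.normSq (b s) < 0 := by
      rw [this]; exact mul_neg_of_pos_of_neg (by positivity) (by linarith)
    by_contra hcon
    rw [not_lt] at hcon
    have := mul_nonneg hcon (hnsq s).le
    linarith

/-- Near a point that is neither a vertex nor a crossing, the two sides of the strand lie in
different, adjacent regions. -/
theorem IsRegular.exists_half_discs (hreg : L.IsRegular) {k : Fin n} {u : ℝ}
    (hint : ∀ m : ℤ, u ≠ m) (hcr : ¬ L.AtCrossing k u) :
    ∃ ε > 0, (∀ y, ‖y - (L.curve k u).1‖ < ε → det2 (L.dir k u).1 (y - (L.curve k u).1) ≠ 0 →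
        L.OffShadow y) ∧
      ∀ y y', ‖y - (L.curve k u).1‖ < ε → ‖y' - (L.curve k u).1‖ < ε →
        0 < det2 (L.dir k u).1 (y - (L.curve k u).1) →
        det2 (L.dir k u).1 (y' - (L.curve k u).1) < 0 →
        L.Adjacent (L.regionAt y) (L.regionAt y') := by
  obtain ⟨ε, hε, hball⟩ := Metric.eventually_nhds_iff.1
    (IsRegular.eventually_offShadow (L := L) hint hcr)
  set p := (L.curve k u).1 with hp
  set d := (L.dir k u).1 with hd
  have hoff : ∀ y, ‖y - p‖ < ε → det2 d (y - p) ≠ 0 → L.OffShadow y := fun y hy h =>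
    hball (by rwa [dist_eq_norm]) h
  refine ⟨ε, hε, hoff, fun y y' hy hy' h h' => ?_⟩
  obtain ⟨e, he, -⟩ := exists_det2_pos (hreg.dir_ne_zero k u) (hreg.dir_ne_zero k u)
    (fun c hc h => by
      have h1 : (1 + c) • (L.dir k u).1 = 0 := by
        rw [add_smul, one_smul]; nth_rewrite 1 [h]; rw [neg_smul]; exact neg_add_cancel _
      rcases smul_eq_zero.1 h1 with h2 | h2
      · linarith
      · exact hreg.dir_ne_zero k u h2)
  have hdetc : ∀ c : ℝ, IsLinearMap ℝ fun v : ℝ × ℝ => c * det2 d v := fun c =>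
    ⟨fun a b => by simp only [det2, Prod.fst_add, Prod.snd_add]; ring,
      fun a b => by simp only [det2, Prod.smul_fst, Prod.smul_snd, smul_eq_mul]; ring⟩
  -- a half disc lies in one region
  have hsame : ∀ c : ℝ, ∀ z z', ‖z - p‖ < ε → ‖z' - p‖ < ε → 0 < c * det2 d (z - p) →
      0 < c * det2 d (z' - p) → L.regionAt z = L.regionAt z' := by
    intro c z z' hz hz' h1 h2
    have hC : Convex ℝ {v : ℝ × ℝ | ‖v‖ < ε ∧ 0 < c * det2 d v} := by
      have h3 : Convex ℝ (Metric.ball (0 : ℝ × ℝ) ε) := convex_ball _ _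
      have h4 : Convex ℝ {v : ℝ × ℝ | 0 < c * det2 d v} := convex_halfSpace_gt (hdetc c) 0
      have h5 := h3.inter h4
      have h6 : Metric.ball (0 : ℝ × ℝ) ε ∩ {v | 0 < c * det2 d v} =
          {v : ℝ × ℝ | ‖v‖ < ε ∧ 0 < c * det2 d v} := by ext v; simp
      rwa [h6] at h5
    have himg := hC.isPreconnected.image (fun v => v + p) (by fun_prop)
    refine regionAt_eq_of_isPreconnected himg ?_ ⟨z - p, ⟨hz, h1⟩, sub_add_cancel _ _⟩
      ⟨z' - p, ⟨hz', h2⟩, sub_add_cancel _ _⟩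
    rintro _ ⟨v, ⟨hv1, hv2⟩, rfl⟩
    refine hoff _ (by simpa using hv1) ?_
    simp only [add_sub_cancel_right]
    intro h0
    rw [h0, mul_zero] at hv2
    exact lt_irrefl _ hv2
  have he0 : 0 < ‖e‖ := norm_pos_iff.2 (by rintro rfl; simp [det2] at he)
  have hτ : ∀ τ : ℝ, |τ| < ε / ‖e‖ → ‖p + τ • e - p‖ < ε := fun τ h => by
    rw [add_sub_cancel_left, norm_smul, Real.norm_eq_abs]
    exact (lt_div_iff₀ he0).1 h
  have hdτ : ∀ τ : ℝ, det2 d (p + τ • e - p) = τ * det2 d e := fun τ => by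
    rw [add_sub_cancel_left, det2_smul_right]
  have hr : 0 < ε / ‖e‖ := div_pos hε he0
  have hplus : ∀ τ : ℝ, 0 < τ → τ < ε / ‖e‖ → L.regionAt (p + τ • e) = L.regionAt y := by
    intro τ h1 h2
    refine hsame 1 _ _ (hτ τ (by rwa [abs_of_pos h1])) hy ?_ (by linarith)
    rw [hdτ, one_mul]; positivity
  have hminus : ∀ τ : ℝ, τ < 0 → -τ < ε / ‖e‖ → L.regionAt (p + τ • e) = L.regionAt y' := by
    intro τ h1 h2
    refine hsame (-1) _ _ (hτ τ (by rwa [abs_of_neg h1])) hy' ?_ (by linarith)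
    rw [hdτ]; nlinarith
  refine ⟨fun heq => ?_, k, u, hcr, ?_, ?_⟩
  · set τ := ε / ‖e‖ / 2 with hτdef
    have hτ0 : 0 < τ := half_pos hr
    have hτr : τ < ε / ‖e‖ := half_lt_self hr
    have hline : ∀ s, ∀ x ∈ Set.Icc (-τ) τ, (L.curve k s).1 = (L.curve k u).1 + x • e → x = 0 := by
      intro s x hx hs
      by_contra hx0
      exact hoff (p + x • e) (hτ x (lt_of_le_of_lt (abs_le.2 ⟨hx.1, hx.2⟩) hτr))
        (by rw [hdτ]; exact mul_ne_zero hx0 he.ne') k s hs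
    have hjump := planarChange_sub hint he hτ0 hline hcr
    have h1 := planarChange_eq_of_regionAt_eq k (y := p + τ • e) (y' := p + (-τ) • e)
      (hoff _ (hτ τ (by rwa [abs_of_pos hτ0])) (by rw [hdτ]; positivity))
      (hoff _ (hτ (-τ) (by rwa [abs_neg, abs_of_pos hτ0]))
        (by rw [hdτ]; exact mul_ne_zero (by linarith) he.ne'))
      (by rw [hplus τ hτ0 hτr, hminus (-τ) (by linarith) (by linarith), heq])
    rw [neg_smul, ← sub_eq_add_neg] at h1
    rw [h1, sub_self] at hjump
    exact Complex.two_pi_I_ne_zero hjump.symm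
  all_goals
    rw [shadowPt]
    have hc : Continuous fun τ : ℝ => (((p + τ • e, (0 : ℝ)) : Space) : S3) :=
      OnePoint.continuous_coe.comp (by fun_prop)
    have ht := hc.tendsto 0
    rw [zero_smul, add_zero] at ht
  · refine mem_closure_of_tendsto (ht.mono_left (nhdsWithin_le_nhds (s := Set.Ioi 0))) ?_
    filter_upwards [Ioo_mem_nhdsGT hr] with τ hτ'
    rw [← hplus τ hτ'.1 hτ'.2]
    refine mem_regionAt (hoff _ (hτ τ (by rw [abs_of_pos hτ'.1]; exact hτ'.2)) ?_)
    rw [hdτ]; exact mul_ne_zero hτ'.1.ne' he.ne'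
  · refine mem_closure_of_tendsto (ht.mono_left (nhdsWithin_le_nhds (s := Set.Iio 0))) ?_
    filter_upwards [Ioo_mem_nhdsLT (neg_lt_zero.2 hr)] with τ hτ'
    rw [← hminus τ hτ'.2 (by linarith [hτ'.1])]
    refine mem_regionAt (hoff _ (hτ τ (by rw [abs_of_neg hτ'.2]; linarith [hτ'.1])) ?_)
    rw [hdτ]; exact mul_ne_zero hτ'.2.ne he.ne'

namespace TransverseField

variable (N : L.TransverseField i)

/-- The property of the half-width `r` of the planar strip along the component used for the
colours: the strip meets the projection of the link only in the projection of the component itself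
and on the crossing strands. -/
def IsStripRadius (r : ℝ) : Prop := 0 < r ∧ ∀ s ξ, ¬ L.AtCrossing i s → |ξ| ≤ r → ξ ≠ 0 →
  L.OffShadow (N.plane s ξ)

theorem regionAt_plane_eq {r : ℝ} (hr : N.IsStripRadius r) {c s s' ξ ξ' : ℝ}
    (hc : |c| = 1) (hξ : 0 < ξ) (hξr : ξ ≤ r) (hξ' : 0 < ξ') (hξr' : ξ' ≤ r) (hs : s ≤ s')
    (hcr : ∀ t ∈ Set.Icc s s', ¬ L.AtCrossing i t) :
    L.regionAt (N.plane s (c * ξ)) = L.regionAt (N.plane s' (c * ξ')) := by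
  have hc0 : c ≠ 0 := by rintro rfl; simp at hc
  have hoff : ∀ t ∈ Set.Icc s s', ∀ η, 0 < η → η ≤ r → L.OffShadow (N.plane t (c * η)) :=
    fun t ht η h0 h1 => hr.2 t _ (hcr t ht) (by rw [abs_mul, hc, one_mul, abs_of_pos h0]; exact h1)
      (mul_ne_zero hc0 h0.ne')
  have h1 := regionAt_eq_of_path (L := L) (f := fun t => N.plane t (c * ξ)) hs
    (N.continuous_plane continuous_id continuous_const) fun t ht => hoff t ht ξ hξ hξr
  have h2 := regionAt_eq_of_path (L := L) (f := fun t => N.plane s' (c * (ξ + t * (ξ' - ξ))))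
    zero_le_one (N.continuous_plane continuous_const (by fun_prop)) fun t ht => by
      refine hoff s' ⟨hs, le_rfl⟩ _ ?_ ?_
      · rcases le_total ξ ξ' with h | h
        · nlinarith [ht.1, ht.2, mul_nonneg ht.1 (sub_nonneg.2 h)]
        · nlinarith [ht.1, ht.2, mul_nonneg (sub_nonneg.2 ht.2) (sub_nonneg.2 h)]
      · rcases le_total ξ ξ' with h | h
        · nlinarith [ht.1, ht.2, mul_nonneg (sub_nonneg.2 ht.2) (sub_nonneg.2 h)]
        · nlinarith [ht.1, ht.2, mul_nonneg ht.1 (sub_nonneg.2 h)]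
  simp only [zero_mul, add_zero, one_mul, add_sub_cancel] at h2
  exact h1.trans h2

/-- The two sides of a strand of the component have different colours. -/
theorem col_sides {col : Set S3 → Colour} (hreg : L.IsRegular) (hcol : L.IsCheckerboard col)
    {r : ℝ} (hr : N.IsStripRadius r) {c s ξ ξ' : ℝ} (hc : |c| = 1) (hξ : 0 < ξ)
    (hξr : ξ ≤ r) (hξ' : 0 < ξ') (hξr' : ξ' ≤ r) (hint : ∀ k : ℤ, s ≠ k)
    (hs : ¬ L.AtCrossing i s) :
    col (L.regionAt (N.plane s (c * ξ))) ≠ col (L.regionAt (N.plane s (-c * ξ'))) := by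
  have hc' : c = 1 ∨ c = -1 := eq_or_eq_neg_of_abs_eq hc
  obtain ⟨ε, hε, hoff, hadj⟩ := hreg.exists_half_discs hint hs
  have hdet := N.det2_dir_pos s
  have hv : 0 < ‖N.vec s‖ := norm_pos_iff.2 (N.vec_ne_zero s)
  obtain ⟨η, hη, hηr, hηε⟩ : ∃ η > 0, η ≤ r ∧ η * ‖N.vec s‖ < ε := by
    refine ⟨min r (ε / ‖N.vec s‖ / 2), lt_min hr.1 (by positivity), min_le_left _ _, ?_⟩
    have h1 := min_le_right r (ε / ‖N.vec s‖ / 2)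
    calc min r (ε / ‖N.vec s‖ / 2) * ‖N.vec s‖ ≤ ε / ‖N.vec s‖ / 2 * ‖N.vec s‖ := by gcongr
      _ = ε / 2 := by field_simp
      _ < ε := by linarith
  have hpm : ∀ x, |x| = 1 → ‖N.plane s (x * η) - (L.curve i s).1‖ < ε := fun x hx => by
    rw [plane, add_sub_cancel_left, norm_smul, Real.norm_eq_abs, abs_mul, hx, one_mul,
      abs_of_pos hη]
    exact hηε
  have hdx : ∀ x, det2 (L.dir i s).1 (N.plane s (x * η) - (L.curve i s).1) =
      x * η * det2 (L.dir i s).1 (N.vec s) := fun x => by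
    rw [plane, add_sub_cancel_left, det2_smul_right]
  have hne : col (L.regionAt (N.plane s (1 * η))) ≠ col (L.regionAt (N.plane s (-1 * η))) := by
    have h1 := hadj _ _ (hpm 1 (by simp)) (hpm (-1) (by simp)) (by rw [hdx]; positivity)
      (by rw [hdx]; nlinarith [mul_pos hη hdet])
    refine hcol _ _ (isRegion_regionAt (hr.2 s _ hs ?_ ?_)) (isRegion_regionAt (hr.2 s _ hs ?_ ?_))
        h1
    · rw [one_mul, abs_of_pos hη]; exact hηr
    · rw [one_mul]; exact hη.ne'
    · rw [abs_mul, abs_of_pos hη]; simpa using hηr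
    · exact mul_ne_zero (by norm_num) hη.ne'
  have hself : ∀ t ∈ Set.Icc s s, ¬ L.AtCrossing i t := fun t ht => by
    rw [Set.Icc_self, Set.mem_singleton_iff] at ht; rwa [ht]
  rw [N.regionAt_plane_eq hr hc hξ hξr hη hηr le_rfl hself,
    N.regionAt_plane_eq hr (by rwa [abs_neg]) hξ' hξr' hη hηr le_rfl hself]
  rcases hc' with rfl | rfl
  · exact hne
  · rw [neg_neg]; exact hne.symm

/-- The colour of the region to one side of the component changes at each crossing. -/
theorem col_cross {col : Set S3 → Colour} (hreg : L.IsRegular) (hcol : L.IsCheckerboard col)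
    {r : ℝ} (hr : N.IsStripRadius r) {c s s' σ' ξ ξ' : ℝ} (hc : |c| = 1) (hξ : 0 < ξ)
    (hξr : ξ ≤ r) (hξ' : 0 < ξ') (hξr' : ξ' ≤ r) (hs : s < σ') (hs' : σ' < s')
    (hσ : L.AtCrossing i σ') (honly : ∀ t ∈ Set.Icc s s', L.AtCrossing i t → t = σ') :
    col (L.regionAt (N.plane s (c * ξ))) ≠ col (L.regionAt (N.plane s' (c * ξ'))) := by
  obtain ⟨k, u₀, hku⟩ := hσ
  obtain ⟨a, ha⟩ := N.parallel σ' k u₀ hku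
  have hv := N.vec_ne_zero σ'
  have ha0 : a ≠ 0 := by rintro rfl; exact hv (by rw [ha, zero_smul])
  have hc0 : c ≠ 0 := by rintro rfl; simp at hc
  have hint₀ := hreg.ne_int_of_cross hku.symm
  -- a point of the crossing strand in the strip, beside the crossing
  have hev : ∀ᶠ η in nhds (0 : ℝ), L.curve k (u₀ + c * η * a) = L.curve k u₀ +
      (u₀ + c * η * a - u₀) • L.dir k u₀ ∧
      (L.AtCrossing k (u₀ + c * η * a) → u₀ + c * η * a = u₀) ∧
      u₀ + c * η * a ∈ Set.Ioo (⌊u₀⌋ : ℝ) (⌊u₀⌋ + 1) ∧ |η| * ‖N.vec σ'‖ < N.radius := by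
    have ht : Filter.Tendsto (fun η : ℝ => u₀ + c * η * a) (nhds 0) (nhds u₀) := by
      have : Continuous fun η : ℝ => u₀ + c * η * a := by fun_prop
      simpa using this.tendsto 0
    have hfl := lt_floor_add_one_of_ne hint₀
    have hn : ∀ᶠ η in nhds (0 : ℝ), |η| * ‖N.vec σ'‖ < N.radius := by
      have : Continuous fun η : ℝ => |η| * ‖N.vec σ'‖ := by fun_prop
      exact this.continuousAt.eventually (gt_mem_nhds (by simpa using N.radius_pos))
    filter_upwards [ht.eventually (L.curve_near k hint₀),
      ht.eventually (hreg.eventually_not_atCrossing k u₀),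
      ht.eventually (Ioo_mem_nhds hfl.1 hfl.2), hn] with η h1 h2 h3 h4
    exact ⟨h1, h2, h3, h4⟩
  obtain ⟨η, ⟨h1, h2, h3, h4⟩, hη, hηr⟩ :=
    ((hev.filter_mono nhdsWithin_le_nhds).and (Ioc_mem_nhdsGT hr.1)).exists
        (f := nhdsWithin 0 (Set.Ioi 0))
  set u := u₀ + c * η * a with hu
  have hint : ∀ m : ℤ, u ≠ m := fun m hm => by
    rw [hm] at h3
    have h5 : ⌊u₀⌋ < m := by exact_mod_cast h3.1
    have h6 : m < ⌊u₀⌋ + 1 := by exact_mod_cast h3.2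
    omega
  have hcr : ¬ L.AtCrossing k u := fun h => by
    have := h2 h
    exact mul_ne_zero (mul_ne_zero hc0 hη.ne') ha0 (by rw [hu] at this; linarith)
  have hdir : L.dir k u = L.dir k u₀ := by
    have : ⌊u⌋ = ⌊u₀⌋ := Int.floor_eq_iff.2 ⟨h3.1.le, h3.2⟩
    rw [dir, dir, this]
  have hy : (L.curve k u).1 = N.plane σ' (c * η) := by
    rw [h1, plane, ha, hku.1, add_sub_cancel_left, smul_smul]; rfl
  obtain ⟨ε, hε, hoff, hadj⟩ := hreg.exists_half_discs hint hcr
  rw [hy, hdir] at hadj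
  have hcont : Continuous fun s => N.plane s (c * η) :=
      N.continuous_plane continuous_id continuous_const
  -- points of the strip before and after the crossing
  have hev2 : ∀ᶠ t in nhds σ', ‖N.plane t (c * η) - N.plane σ' (c * η)‖ < ε ∧
      ‖N.plane t (c * η) - (L.curve i σ').1‖ ≤ N.radius ∧
      ‖N.plane t (c * η) - (L.curve i t).1‖ ≤ N.radius := by
    have e1 : ∀ᶠ t in nhds σ', ‖N.plane t (c * η) - N.plane σ' (c * η)‖ < ε := by
      have : Continuous fun t => ‖N.plane t (c * η) - N.plane σ' (c * η)‖ := by fun_prop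
      exact this.continuousAt.eventually (gt_mem_nhds (by simpa using hε))
    have hσr : ‖N.plane σ' (c * η) - (L.curve i σ').1‖ < N.radius := by
      rw [plane, add_sub_cancel_left, norm_smul, Real.norm_eq_abs, abs_mul, hc, one_mul]
      exact h4
    have e2 : ∀ᶠ t in nhds σ', ‖N.plane t (c * η) - (L.curve i σ').1‖ < N.radius := by
      have : Continuous fun t => ‖N.plane t (c * η) - (L.curve i σ').1‖ := by fun_prop
      exact this.continuousAt.eventually (gt_mem_nhds hσr)
    have e3 : ∀ᶠ t in nhds σ', ‖N.plane t (c * η) - (L.curve i t).1‖ < N.radius := by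
      have : Continuous fun t => ‖N.plane t (c * η) - (L.curve i t).1‖ := by fun_prop
      exact this.continuousAt.eventually (gt_mem_nhds hσr)
    filter_upwards [e1, e2, e3] with t h1 h2 h3
    exact ⟨h1, h2.le, h3.le⟩
  have hdet : ∀ t, det2 (N.plane t (c * η) - (L.curve i σ').1) (N.vec σ') =
      -(a * det2 (L.dir k u₀).1 (N.plane t (c * η) - N.plane σ' (c * η))) := by
    intro t
    have h5 : N.plane t (c * η) - (L.curve i σ').1 =
        (N.plane t (c * η) - N.plane σ' (c * η)) + (c * η) • N.vec σ' := by
      simp only [plane]; abel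
    rw [h5, det2_add_left, det2_smul_left, det2_self, mul_zero, add_zero, ha, det2_smul_right,
      det2_swap]
    ring
  obtain ⟨t, ⟨⟨t1, t2, t3⟩, ht⟩⟩ := ((hev2.filter_mono nhdsWithin_le_nhds).and
    (Ioo_mem_nhdsLT (max_lt hs (sub_lt_self σ' N.window_pos)))).exists
        (f := nhdsWithin σ' (Set.Iio σ'))
  obtain ⟨t', ⟨⟨t1', t2', t3'⟩, ht'⟩⟩ := ((hev2.filter_mono nhdsWithin_le_nhds).and
    (Ioo_mem_nhdsGT (lt_min hs' (lt_add_of_pos_right σ' N.window_pos)))).exists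
      (f := nhdsWithin σ' (Set.Ioi σ'))
  have hts : s < t := (le_max_left _ _).trans_lt ht.1
  have htw : σ' - N.window < t := (le_max_right _ _).trans_lt ht.1
  have hts' : t' < s' := ht'.2.trans_le (min_le_left _ _)
  have htw' : t' < σ' + N.window := ht'.2.trans_le (min_le_right _ _)
  have hd := N.det2_lt ht.2 (by linarith) t2
  rw [N.det2_plane, hdet] at hd
  have hd' := N.det2_lt ht'.1 htw'.le t3'
  rw [N.det2_plane, hdet] at hd'
  have hnc : ∀ x ∈ Set.Icc s s', x ≠ σ' → ¬ L.AtCrossing i x := fun x hx hne h => hne (honly x hx h)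
  rw [N.regionAt_plane_eq hr hc hξ hξr hη hηr hts.le fun x hx =>
      hnc x ⟨hx.1, by linarith [hx.2, ht.2]⟩ (by linarith [hx.2, ht.2] : x < σ').ne,
    ← N.regionAt_plane_eq hr hc hη hηr hξ' hξr' hts'.le fun x hx =>
      hnc x ⟨by linarith [hx.1, ht'.1], hx.2⟩ (by linarith [hx.1, ht'.1] : σ' < x).ne']
  have hreg_t : ∀ x, x ∈ Set.Icc s s' → x ≠ σ' → L.IsRegion (L.regionAt (N.plane x (c * η))) :=
    fun x hx hne => isRegion_regionAt (hr.2 x _ (hnc x hx hne)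
      (by rw [abs_mul, hc, one_mul, abs_of_pos hη]; exact hηr) (mul_ne_zero hc0 hη.ne'))
  have hR := hreg_t t ⟨hts.le, by linarith [ht.2]⟩ ht.2.ne
  have hR' := hreg_t t' ⟨by linarith [ht'.1], hts'.le⟩ ht'.1.ne'
  rcases lt_or_gt_of_ne ha0 with h | h
  · exact (hcol _ _ hR' hR (hadj _ _ t1' t1 (by nlinarith) (by nlinarith))).symm
  · exact hcol _ _ hR hR' (hadj _ _ t1 t1' (by nlinarith) (by nlinarith))

end TransverseField

end PolyLink

/-! ### Alternation and the places where the curve changes its level -/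

namespace PolyLink

variable {n : ℕ} {L : PolyLink n} {i : Fin n}

theorem IsRegular.exists_crossing_gap (hreg : L.IsRegular) (i : Fin n) :
    ∃ g > 0, ∀ s s', L.AtCrossing i s → L.AtCrossing i s' → |s' - s| < g → s' = s := by
  have hloc : ∀ s₀ ∈ Set.Icc 0 (L.period i), ∀ᶠ z : ℝ × ℝ in nhds ((0 : ℝ), s₀),
      L.AtCrossing i z.2 → L.AtCrossing i (z.2 + z.1) → z.1 = 0 := by
    intro s₀ _
    have h1 : Filter.Tendsto (fun z : ℝ × ℝ => z.2) (nhds ((0 : ℝ), s₀)) (nhds s₀) :=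
      continuous_snd.tendsto ((0 : ℝ), s₀)
    have h2 : Filter.Tendsto (fun z : ℝ × ℝ => z.2 + z.1) (nhds ((0 : ℝ), s₀)) (nhds s₀) := by
      have : Continuous fun z : ℝ × ℝ => z.2 + z.1 := by fun_prop
      simpa using this.tendsto ((0 : ℝ), s₀)
    filter_upwards [h1.eventually (hreg.eventually_not_atCrossing i s₀),
      h2.eventually (hreg.eventually_not_atCrossing i s₀)] with z e1 e2 c1 c2
    linarith [e1 c1, e2 c2]
  obtain ⟨g, hg, hball⟩ := Metric.eventually_nhds_iff.1
    (isCompact_Icc.eventually_forall_of_forall_eventually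
      (P := fun (x s : ℝ) => L.AtCrossing i s → L.AtCrossing i (s + x) → x = 0) hloc)
  refine ⟨g, hg, fun s s' hs hs' h => ?_⟩
  obtain ⟨m, hm⟩ := L.exists_int_mem_Icc i s
  have := hball (y := s' - s) (by rwa [dist_zero_right, Real.norm_eq_abs]) _ hm
    ((L.atCrossing_add_int_mul m).2 hs)
    (by rw [show s + m * L.period i + (s' - s) = s' + m * L.period i by ring]
        exact (L.atCrossing_add_int_mul m).2 hs')
  linarith

namespace TransverseField

variable (N : L.TransverseField i)

/-- Near a crossing on the component, the vertical line through a point of a thin tube meets the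
other strand, on the same side as at the crossing. -/
theorem exists_state_radius (hreg : L.IsRegular) : ∃ r > 0, ∀ s (w : ℂ), L.AtCrossing i s → ‖w‖ ≤
    r →
    ∃ k u, (L.curve k u).1 = N.plane s w.re ∧
      (L.PassesOver i s → (L.curve k u).2 < (L.curve i s).2 + w.im) ∧
      (¬ L.PassesOver i s → (L.curve i s).2 + w.im < (L.curve k u).2) := by
  have hloc : ∀ s ∈ {s | s ∈ Set.Icc 0 (L.period i) ∧ L.AtCrossing i s}, ∀ᶠ w in nhds (0 : ℂ),
      ∃ k u, (L.curve k u).1 = N.plane s w.re ∧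
      (L.PassesOver i s → (L.curve k u).2 < (L.curve i s).2 + w.im) ∧
      (¬ L.PassesOver i s → (L.curve i s).2 + w.im < (L.curve k u).2) := by
    rintro s ⟨-, k, u₀, hku⟩
    obtain ⟨a, ha⟩ := N.parallel s k u₀ hku
    have hint₀ := hreg.ne_int_of_cross hku.symm
    have hc : Continuous fun w : ℂ => u₀ + w.re * a := by fun_prop
    have ht : Filter.Tendsto (fun w : ℂ => u₀ + w.re * a) (nhds 0) (nhds u₀) := by
      simpa using hc.tendsto 0
    have hd : Continuous fun w : ℂ => (L.curve i s).2 + w.im - (L.curve k (u₀ + w.re * a)).2 := by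
      fun_prop
    have hover : L.PassesOver i s ↔ (L.curve k u₀).2 < (L.curve i s).2 :=
      ⟨fun ⟨k', u', h, hlt⟩ => by rwa [hreg.double _ _ _ _ _ _ hku h], fun h => ⟨k, u₀, hku, h⟩⟩
    have hne := hku.height_ne
    have hsign : ∀ᶠ w in nhds (0 : ℂ),
        (L.PassesOver i s → (L.curve k (u₀ + w.re * a)).2 < (L.curve i s).2 + w.im) ∧
        (¬ L.PassesOver i s → (L.curve i s).2 + w.im < (L.curve k (u₀ + w.re * a)).2) := by
      rcases lt_or_gt_of_ne hne with h | h
      · have h0 : (L.curve i s).2 + (0 : ℂ).im - (L.curve k (u₀ + (0 : ℂ).re * a)).2 < 0 := by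
          simpa using h
        filter_upwards [hd.continuousAt.eventually (gt_mem_nhds h0)] with w hw
        exact ⟨fun ho => absurd (hover.1 ho) (not_lt.2 h.le), fun _ => by linarith⟩
      · have h0 : 0 < (L.curve i s).2 + (0 : ℂ).im - (L.curve k (u₀ + (0 : ℂ).re * a)).2 := by
          simpa using h
        filter_upwards [hd.continuousAt.eventually (lt_mem_nhds h0)] with w hw
        exact ⟨fun _ => by linarith, fun ho => absurd (hover.2 h) ho⟩
    filter_upwards [ht.eventually (L.curve_near k hint₀), hsign] with w h1 h2
    refine ⟨k, u₀ + w.re * a, ?_, h2⟩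
    rw [h1, plane, ha, hku.1, add_sub_cancel_left, smul_smul]; rfl
  obtain ⟨r, hr, hball⟩ := Metric.eventually_nhds_iff.1
    ((Filter.eventually_all_finite (hreg.finite_crossings i 0 (L.period i))).2 hloc)
  refine ⟨r / 2, half_pos hr, fun s w hs hw => ?_⟩
  obtain ⟨m, hm⟩ := L.exists_int_mem_Icc i s
  have := hball (y := w) (by rw [dist_zero_right]; linarith) _
    ⟨hm, (L.atCrossing_add_int_mul m).2 hs⟩
  simpa only [plane_add_int_mul, curve_add_int_mul, passesOver_add_int_mul] using this

theorem exists_radius_bound : ∃ r > 0, ∀ s ξ, |ξ| ≤ r →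
    ‖N.plane s ξ - (L.curve i s).1‖ ≤ N.radius := by
  have hloc : ∀ s₀ ∈ Set.Icc 0 (L.period i), ∀ᶠ z : ℝ × ℝ in nhds ((0 : ℝ), s₀),
      ‖N.plane z.2 z.1 - (L.curve i z.2).1‖ ≤ N.radius := fun s₀ _ =>
    N.eventually_radius (N.continuous_plane continuous_snd continuous_fst).continuousAt
      continuous_snd.continuousAt (N.plane_zero s₀)
  obtain ⟨r, hr, hball⟩ := Metric.eventually_nhds_iff.1
    (isCompact_Icc.eventually_forall_of_forall_eventually
      (P := fun (ξ s : ℝ) => ‖N.plane s ξ - (L.curve i s).1‖ ≤ N.radius) hloc)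
  refine ⟨r / 2, half_pos hr, fun s ξ hξ => ?_⟩
  obtain ⟨m, hm⟩ := L.exists_int_mem_Icc i s
  have := hball (y := ξ) (by rw [dist_zero_right, Real.norm_eq_abs]; linarith) _ hm
  simpa only [plane_add_int_mul, curve_add_int_mul] using this

/-- The requirements on the radius `r` of the tube; the length `g` is at most a third of the
distance of two crossings on the component. -/
structure IsThin (g r : ℝ) : Prop where
  pos : 0 < r
  tube_ne : ∀ s k u w, ‖w‖ ≤ r → N.tube s w = L.curve k u → w = 0
  embedded : ∀ s s' w w', ‖w‖ ≤ r → ‖w'‖ ≤ r → N.tube s w = N.tube s' w' →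
    w = w' ∧ ∃ m : ℤ, s' = s + m * L.period i
  /-- the planar strip meets the projection of the link only in its core and near crossings -/
  strip : ∀ s k u ξ, |ξ| ≤ r → N.plane s ξ = (L.curve k u).1 →
    (k = i ∧ ξ = 0 ∧ ∃ m : ℤ, u = s + m * L.period i) ∨ ∃ u₀, L.Cross i s k u₀ ∧ |u - u₀| < g
  near : ∀ s ξ, |ξ| ≤ r → ‖N.plane s ξ - (L.curve i s).1‖ ≤ N.radius
  /-- at a crossing, the other strand passes on the same side of the whole disc of the tube -/
  state : ∀ s (w : ℂ), L.AtCrossing i s → ‖w‖ ≤ r → ∃ k u, (L.curve k u).1 = N.plane s w.re ∧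
    (L.PassesOver i s → (L.curve k u).2 < (L.curve i s).2 + w.im) ∧
    (¬ L.PassesOver i s → (L.curve i s).2 + w.im < (L.curve k u).2)
  gap : ∀ s s', L.AtCrossing i s → L.AtCrossing i s' → |s' - s| < 3 * g → s' = s

theorem exists_isThin (hreg : L.IsRegular) : ∃ g r, N.IsThin g r := by
  obtain ⟨g, hg, hgap⟩ := hreg.exists_crossing_gap i
  obtain ⟨r₁, h₁, h₁'⟩ := N.exists_tube_radius
  obtain ⟨r₂, h₂, h₂'⟩ := N.exists_embedded_radius
  obtain ⟨r₃, h₃, h₃'⟩ := N.exists_strip_radius hreg (show 0 < g / 3 by positivity)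
  obtain ⟨r₄, h₄, h₄'⟩ := N.exists_radius_bound
  obtain ⟨r₅, h₅, h₅'⟩ := N.exists_state_radius hreg
  obtain ⟨r, hr, hr₁, hr₂, hr₃, hr₄, hr₅⟩ :
      ∃ r > 0, r ≤ r₁ ∧ r ≤ r₂ ∧ r ≤ r₃ ∧ r ≤ r₄ ∧ r ≤ r₅ :=
    ⟨min r₁ (min r₂ (min r₃ (min r₄ r₅))), by positivity, by simp, by simp, by simp, by simp,
        by simp⟩
  exact ⟨g / 3, r, hr, fun s k u w hw => h₁' s k u w (hw.trans hr₁),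
    fun s s' w w' hw hw' => h₂' s s' w w' (hw.trans hr₂) (hw'.trans hr₂),
    fun s k u ξ hξ => h₃' s k u ξ (hξ.trans hr₃), fun s ξ hξ => h₄' s ξ (hξ.trans hr₄),
    fun s w hs hw => h₅' s w hs (hw.trans hr₅), fun s s' hs hs' h => hgap s s' hs hs' (by linarith)⟩

variable {N} in
theorem IsThin.isStripRadius {g r : ℝ} (h : N.IsThin g r) : N.IsStripRadius r := by
  refine ⟨h.pos, fun s ξ hs hξ h0 k u hku => ?_⟩
  rcases h.strip s k u ξ hξ hku.symm with ⟨-, h1, -⟩ | ⟨u₀, hu₀, -⟩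
  · exact h0 h1
  · exact hs hu₀.atCrossing

end TransverseField

/-- The number of the times `time 0, …, time (P - 1)` before the time `s`. -/
def countBefore (time : ℕ → ℝ) (P : ℕ) (s : ℝ) : ℕ := ((Finset.range P).filter (time · < s)).card

/-- Times at which a curve along the component, which starts at the time `a` above (`up`) or below
the projection plane, has to change its level in order to be above the plane where the component
passes over, and below the plane where the component passes under. -/
structure LevelChanges (L : PolyLink n) (i : Fin n) (g a : ℝ) (up : Prop) where
  /-- half the number of changes; the number is even as the curve is closed -/
  half : ℕ
  /-- the times of the changes -/
  time : ℕ → ℝ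
  time_lt : ∀ j k, j < k → k < 2 * half → time j < time k
  mem : ∀ j < 2 * half, time j ∈ Set.Ioo a (a + L.period i)
  not_atCrossing : ∀ j < 2 * half, ¬ L.AtCrossing i (time j)
  ne_int : ∀ j < 2 * half, ∀ k : ℤ, time j ≠ k
  between : ∀ j, j + 1 < 2 * half → ∃ s, L.AtCrossing i s ∧ time j < s ∧ s < time (j + 1) ∧
    ∀ t ∈ Set.Icc (time j) (time (j + 1)), L.AtCrossing i t → t = s
  /-- the level at a crossing is that of the component relative to the other strand -/
  state : ∀ s ∈ Set.Icc a (a + L.period i), L.AtCrossing i s →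
    (L.PassesOver i s ↔ (up ↔ Even (countBefore time (2 * half) s)))
  apart : L.AtCrossing i a → ∀ j < 2 * half, ∀ s, L.AtCrossing i s → g ≤ |time j - s|
  /-- there are at least twice as many changes as passages under other strands -/
  card_le : ∀ T : Finset ℝ, (∀ s, s ∈ T ↔ s ∈ Set.Ico a (a + L.period i) ∧ L.AtCrossing i s ∧
    ¬ L.PassesOver i s) → T.card ≤ half

theorem card_filter_even (h : ℕ) (X : Prop) [DecidablePred fun j : ℕ => ¬ (X ↔ Even j)] :
    ((Finset.range (2 * h)).filter fun j => ¬ (X ↔ Even j)).card = h := by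
  induction h with
  | zero => simp
  | succ h ih =>
    rw [show 2 * (h + 1) = 2 * h + 1 + 1 by ring, Finset.range_add_one, Finset.range_add_one,
      Finset.filter_insert, Finset.filter_insert]
    have h1 : Even (2 * h) := even_two_mul h
    have h2 : ¬ Even (2 * h + 1) := by rw [Nat.even_add_one]; simp
    by_cases hX : X
    · rw [if_pos (by simp [hX, h2]), if_neg (by simp [hX]),
        Finset.card_insert_of_notMem (by simp), ih]
    · rw [if_neg (by simp [hX, h2]), if_pos (by simp [hX]),
        Finset.card_insert_of_notMem (by simp), ih]

/-- By alternation, the level has to change exactly once between consecutive crossings. Half of the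
crossings in a period are passed under, so there are enough changes for `card_le`. -/
theorem IsRegular.exists_levelChanges (hreg : L.IsRegular) (halt : L.AlternatesAlong i)
    {g : ℝ} (hgap : ∀ s s', L.AtCrossing i s → L.AtCrossing i s' → |s' - s| < 3 * g → s' = s)
    (a : ℝ) (up : Prop) (hup : L.AtCrossing i a → (L.PassesOver i a ↔ up)) :
    Nonempty (L.LevelChanges i g a up) := by
  classical
  have hE := L.period_pos i
  -- the crossings in one period, in their order
  have hfin : {s | s ∈ Set.Ico a (a + L.period i) ∧ L.AtCrossing i s}.Finite :=
    (hreg.finite_crossings i a (a + L.period i)).subset fun s hs =>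
      ⟨Set.Ico_subset_Icc_self hs.1, hs.2⟩
  set T := hfin.toFinset with hTdef
  have hT : ∀ s, s ∈ T ↔ s ∈ Set.Ico a (a + L.period i) ∧ L.AtCrossing i s := fun s => by
    rw [hTdef, Set.Finite.mem_toFinset]; rfl
  set P := T.card with hP
  let emb := T.orderEmbOfFin hP.symm
  let A : ℕ → ℝ := fun j => if h : j < P then emb ⟨j, h⟩ else a + L.period i
  have hA : ∀ j (h : j < P), A j = emb ⟨j, h⟩ := fun j h => dif_pos h
  have hAP : A P = a + L.period i := dif_neg (lt_irrefl P)
  have hAT : ∀ j < P, A j ∈ T := fun j h => by rw [hA j h]; exact T.orderEmbOfFin_mem hP.symm _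
  have hAcr : ∀ j < P, L.AtCrossing i (A j) := fun j h => ((hT _).1 (hAT j h)).2
  have hAI : ∀ j < P, A j ∈ Set.Ico a (a + L.period i) := fun j h => ((hT _).1 (hAT j h)).1
  have hAlt : ∀ j k, j < k → k ≤ P → A j < A k := by
    intro j k hjk hk
    rcases hk.lt_or_eq with h | h
    · rw [hA j (hjk.trans h), hA k h]
      exact emb.strictMono (Fin.mk_lt_mk.2 hjk)
    · rw [h, hAP]; exact (hAI j (by omega)).2
  have hAle : ∀ j k, j ≤ k → k ≤ P → A j ≤ A k := fun j k hjk hk => by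
    rcases hjk.lt_or_eq with h | h
    · exact (hAlt j k h hk).le
    · rw [h]
  have hAsurj : ∀ s ∈ Set.Ico a (a + L.period i), L.AtCrossing i s → ∃ j < P, A j = s := by
    intro s hs hc
    have : s ∈ Set.range emb := by
      rw [Finset.range_orderEmbOfFin]; exact (hT s).2 ⟨hs, hc⟩
    obtain ⟨j, hj⟩ := this
    exact ⟨j, j.2, by rw [hA j j.2]; exact hj⟩
  have hnone : ∀ j < P, ∀ t, A j < t → t < A (j + 1) → ¬ L.AtCrossing i t := by
    intro j hj t h1 h2 hc
    obtain ⟨k, hk, rfl⟩ := hAsurj t ⟨(hAI j hj).1.trans h1.le, h2.trans_le (by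
      rw [← hAP]; exact hAle _ _ (by omega) le_rfl)⟩ hc
    rcases le_or_gt k j with h | h
    · exact absurd (hAle k j h hj.le) (not_le.2 h1)
    · exact absurd (hAle (j + 1) k h hk.le) (not_le.2 h2)
  have hnone0 : ∀ t, a ≤ t → t < A 0 → ¬ L.AtCrossing i t := by
    intro t h1 h2 hc
    obtain ⟨k, hk, rfl⟩ := hAsurj t ⟨h1, h2.trans_le (by
      rw [← hAP]; exact hAle _ _ (by omega) le_rfl)⟩ hc
    exact absurd (hAle 0 k (by omega) hk.le) (not_le.2 h2)
  -- by alternation, the kind of passage at the `j`-th crossing depends on the parity of `j`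
  have hstate : ∀ j < P, (L.PassesOver i (A j) ↔ (L.PassesOver i (A 0) ↔ Even j)) := by
    intro j
    induction j with
    | zero => intro _; simp
    | succ j ih =>
      intro hj
      have h1 := ih (by omega)
      have h2 := halt (A j) (A (j + 1)) (hAlt _ _ (by omega) hj.le) (hAcr j (by omega)) (hAcr _ hj)
        (hnone j (by omega))
      rw [Nat.even_add_one]
      tauto
  have hPover : ∀ s, L.PassesOver i (s + L.period i) ↔ L.PassesOver i s := fun s => by
    simpa using L.passesOver_add_int_mul (i := i) (s := s) 1
  have hPcr : ∀ s, L.AtCrossing i (s + L.period i) ↔ L.AtCrossing i s := fun s => by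
    simpa using L.atCrossing_add_int_mul (i := i) (s := s) 1
  have hEven : Even P := by
    rcases Nat.eq_zero_or_pos P with h0 | h0
    · rw [h0]; exact Even.zero
    have hl : P - 1 < P := by omega
    have h1 := hstate (P - 1) hl
    have h2 := halt (A (P - 1)) (A 0 + L.period i)
      (by linarith [(hAI (P - 1) hl).2, (hAI 0 h0).1]) (hAcr _ hl)
      ((hPcr _).2 (hAcr 0 h0)) (by
        intro t h1 h2 hc
        rcases lt_or_ge t (a + L.period i) with h3 | h3
        · refine hnone (P - 1) hl t h1 ?_ hc
          rwa [show P - 1 + 1 = P by omega, hAP]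
        · refine hnone0 (t - L.period i) (by linarith) (by linarith) ?_
          rw [← hPcr, sub_add_cancel]; exact hc)
    rw [hPover] at h2
    have h3 : ¬ Even (P - 1) := by tauto
    have h4 : P = P - 1 + 1 := by omega
    rw [h4, Nat.even_add_one]; exact h3
  obtain ⟨half, hhalf⟩ := hEven
  have hhalf : P = 2 * half := by omega
  have hcard : ∀ T' : Finset ℝ, (∀ s, s ∈ T' ↔ s ∈ Set.Ico a (a + L.period i) ∧ L.AtCrossing i s ∧
      ¬ L.PassesOver i s) → T'.card ≤ half := by
    intro T' hT'
    have hsub : T' ⊆ ((Finset.range (2 * half)).filter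
        fun j => ¬ (L.PassesOver i (A 0) ↔ Even j)).image A := by
      intro s hs
      obtain ⟨h1, h2, h3⟩ := (hT' s).1 hs
      obtain ⟨j, hj, rfl⟩ := hAsurj s h1 h2
      refine Finset.mem_image.2 ⟨j, Finset.mem_filter.2 ⟨Finset.mem_range.2 (by omega), ?_⟩, rfl⟩
      rw [← hstate j hj]; exact h3
    calc T'.card ≤ _ := Finset.card_le_card hsub
      _ ≤ _ := Finset.card_image_le
      _ = half := card_filter_even half _
  -- the intervals in which the level changes; the first of them begins at the start or at the first
  -- crossing, depending on the level at the start
  obtain ⟨B, hBlt, hB0, hBP, hBnone, hBcr, hBall, hBa⟩ : ∃ B : ℕ → ℝ,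
      (∀ j k, j < k → k ≤ P → B j < B k) ∧ a ≤ B 0 ∧ B P ≤ a + L.period i ∧
      (∀ j < P, ∀ t, B j < t → t < B (j + 1) → ¬ L.AtCrossing i t) ∧
      (∀ j, 0 < j → j < P → L.AtCrossing i (B j)) ∧
      (∀ s ∈ Set.Icc a (a + L.period i), L.AtCrossing i s →
        ∃ k ≤ P, s = B k ∧ (L.PassesOver i s ↔ (up ↔ Even k))) ∧
      (L.AtCrossing i a → ∀ j ≤ P, L.AtCrossing i (B j)) := by
    by_cases hcase : 0 < P → (L.PassesOver i (A 0) ↔ up)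
    · refine ⟨A, hAlt, ?_, hAP.le, hnone, fun j _ => hAcr j, fun s hs hc => ?_, fun hc j hj => ?_⟩
      · rcases Nat.eq_zero_or_pos P with h0 | h0
        · rw [← h0, hAP]; linarith
        · exact (hAI 0 h0).1
      · rcases hs.2.lt_or_eq with h | h
        · obtain ⟨j, hj, rfl⟩ := hAsurj s ⟨hs.1, h⟩ hc
          refine ⟨j, hj.le, rfl, ?_⟩
          rw [hstate j hj, hcase (by omega)]
        · refine ⟨P, le_rfl, by rw [hAP, h], ?_⟩
          have h1 : L.AtCrossing i a := by rwa [h, hPcr] at hc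
          rw [h, hPover, hup h1, hhalf]
          simp
      · rcases hj.lt_or_eq with h | h
        · exact hAcr j h
        · rw [h, hAP, hPcr]; exact hc
    · push Not at hcase
      obtain ⟨h0, hcase⟩ := hcase
      have hca : ¬ L.AtCrossing i a := fun hc => by
        obtain ⟨j, hj, h⟩ := hAsurj a ⟨le_rfl, by linarith⟩ hc
        have h1 : A 0 ≤ A j := hAle 0 j (by omega) hj.le
        have h2 : A 0 = a := le_antisymm (by rw [← h]; exact h1) (hAI 0 h0).1
        rw [h2] at hcase
        have := hup hc
        tauto
      have haA : a < A 0 := lt_of_le_of_ne (hAI 0 h0).1 fun h => hca (by rw [h]; exact hAcr 0 h0)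
      refine ⟨fun j => if j = 0 then a else A (j - 1), ?_, by simp, ?_, ?_, ?_, ?_,
        fun hc => absurd hc hca⟩
      · intro j k hjk hk
        simp only [show k ≠ 0 by omega, if_false]
        by_cases hj : j = 0
        · simp only [hj, if_true]; exact haA.trans_le (hAle _ _ (by omega) (by omega))
        · simp only [hj, if_false]; exact hAlt _ _ (by omega) (by omega)
      · simp only [show P ≠ 0 by omega, if_false]
        exact (hAI (P - 1) (by omega)).2.le
      · intro j hj t h1 h2
        simp only [Nat.add_sub_cancel, show j + 1 ≠ 0 by omega, if_false] at h2
        by_cases hj0 : j = 0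
        · simp only [hj0, if_true] at h1 h2
          exact hnone0 t h1.le h2
        · simp only [hj0, if_false] at h1
          refine hnone (j - 1) (by omega) t h1 ?_
          rwa [show j - 1 + 1 = j by omega]
      · intro j hj0 hj
        simp only [show j ≠ 0 by omega, if_false]
        exact hAcr _ (by omega)
      · intro s hs hc
        have hs2 : s < a + L.period i := lt_of_le_of_ne hs.2 fun h => hca (by rwa [h, hPcr] at hc)
        obtain ⟨j, hj, rfl⟩ := hAsurj s ⟨hs.1, hs2⟩ hc
        refine ⟨j + 1, hj, by simp, ?_⟩
        rw [hstate j hj, Nat.even_add_one]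
        tauto
  have hBle : ∀ j k, j ≤ k → k ≤ P → B j ≤ B k := fun j k hjk hk => by
    rcases hjk.lt_or_eq with h | h
    · exact (hBlt j k h hk).le
    · rw [h]
  -- the times are taken in the middle third of these intervals
  have hτ : ∀ j, ∃ t, j < P → (t ∈ Set.Ioo (B j + (B (j + 1) - B j) / 3)
      (B (j + 1) - (B (j + 1) - B j) / 3) ∧ ∀ k : ℤ, t ≠ k) := by
    intro j
    by_cases hj : j < P
    · have hlt := hBlt j (j + 1) (by omega) hj
      obtain ⟨t, ht, h1, -⟩ := exists_generic_time hreg i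
        (show B j + (B (j + 1) - B j) / 3 < B (j + 1) - (B (j + 1) - B j) / 3 by linarith)
      exact ⟨t, fun _ => ⟨ht, h1⟩⟩
    · exact ⟨0, fun h => absurd h hj⟩
  choose τ hτ using hτ
  have hτB : ∀ j < P, B j < τ j ∧ τ j < B (j + 1) := fun j hj => by
    have hlt := hBlt j (j + 1) (by omega) hj
    have := (hτ j hj).1
    exact ⟨by linarith [this.1], by linarith [this.2]⟩
  have hcount : ∀ k ≤ P, countBefore τ (2 * half) (B k) = k := by
    intro k hk
    have : (Finset.range (2 * half)).filter (τ · < B k) = Finset.range k := by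
      ext j
      simp only [Finset.mem_filter, Finset.mem_range]
      constructor
      · rintro ⟨h1, h2⟩
        by_contra hc
        have := hBle k j (by omega) (by omega)
        linarith [(hτB j (by omega)).1]
      · intro h
        refine ⟨by omega, ?_⟩
        have := hBle (j + 1) k h hk
        linarith [(hτB j (by omega)).2]
    rw [countBefore, this, Finset.card_range]
  refine ⟨⟨half, τ, ?_, ?_, ?_, ?_, ?_, ?_, ?_, hcard⟩⟩
  · intro j k hjk hk
    have := hBle (j + 1) k hjk (by omega)
    linarith [(hτB j (by omega)).2, (hτB k (by omega)).1]
  · intro j hj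
    have h1 := hBle 0 j (by omega) (by omega)
    have h2 := hBle (j + 1) P (by omega) le_rfl
    have := hτB j (by omega)
    constructor <;> linarith
  · intro j hj
    have := hτB j (by omega)
    exact hBnone j (by omega) _ this.1 this.2
  · intro j hj
    exact (hτ j (by omega)).2
  · intro j hj
    have h1 := hτB j (by omega)
    have h2 := hτB (j + 1) (by omega)
    refine ⟨B (j + 1), hBcr _ (by omega) (by omega), h1.2, h2.1, fun t ht hc => ?_⟩
    rcases lt_trichotomy t (B (j + 1)) with h | h | h
    · exact absurd hc (hBnone j (by omega) t (by linarith [ht.1]) h)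
    · exact h
    · exact absurd hc (hBnone (j + 1) (by omega) t h (by linarith [ht.2]))
  · intro s hs hc
    obtain ⟨k, hk, rfl, h⟩ := hBall s hs hc
    rw [hcount k hk, h]
  · intro ha j hj s hs
    have hlt := hBlt j (j + 1) (by omega) (by omega)
    have hd : 3 * g ≤ B (j + 1) - B j := by
      by_contra hcon
      have := hgap _ _ (hBa ha j (by omega)) (hBa ha (j + 1) (by omega))
        (by rw [abs_of_pos (by linarith)]; linarith)
      linarith
    have h1 := (hτ j (by omega)).1
    rcases le_or_gt s (B j) with h | h
    · exact le_trans (by linarith [h1.1]) (le_abs_self _)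
    rcases lt_or_ge s (B (j + 1)) with h' | h'
    · exact absurd hs (hBnone j (by omega) s h h')
    · exact le_trans (by linarith [h1.2]) (neg_le_abs _)

end PolyLink

/-! ### The phase of the readable curve -/

/-- The continuous function which increases linearly from `0` to `1` on `[-1, 1]` and is constant
elsewhere. -/
def ramp (x : ℝ) : ℝ := max 0 (min 1 ((x + 1) / 2))

theorem continuous_ramp : Continuous ramp := by unfold ramp; fun_prop

theorem ramp_of_le {x : ℝ} (h : x ≤ -1) : ramp x = 0 :=
  max_eq_left (by linarith [min_le_right 1 ((x + 1) / 2)])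

theorem ramp_of_ge {x : ℝ} (h : 1 ≤ x) : ramp x = 1 := by
  rw [ramp, min_eq_left (by linarith), max_eq_right zero_le_one]

theorem ramp_of_abs_lt {x : ℝ} (h : |x| < 1) : ramp x = (x + 1) / 2 := by
  have := abs_lt.1 h
  rw [ramp, min_eq_right (by linarith), max_eq_right (by linarith)]

/-- The angle which starts with `φ₀`, and makes at each of the times `time j` a half turn in the
direction given by the sign `turn j`, within the interval of radius `δ` around this time. -/
def phase (φ₀ : ℝ) (P : ℕ) (time turn : ℕ → ℝ) (δ s : ℝ) : ℝ :=
  φ₀ + Real.pi * ∑ j ∈ Finset.range P, turn j * ramp ((s - time j) / δ)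

section Phase

variable {φ₀ δ s ε : ℝ} {P : ℕ} {time turn : ℕ → ℝ}

theorem continuous_phase : Continuous (phase φ₀ P time turn δ) := by
  have := continuous_ramp
  unfold phase
  fun_prop

theorem sum_signs {F : Finset ℕ} (h : ∀ j ∈ F, turn j = 1 ∨ turn j = -1) :
    ∃ N : ℤ, ∑ j ∈ F, turn j = N ∧ (Even N ↔ Even F.card) := by
  induction F using Finset.induction_on with
  | empty => exact ⟨0, by simp, by simp⟩
  | insert a F ha ih =>
    obtain ⟨N, hN, hN'⟩ := ih fun j hj => h j (Finset.mem_insert_of_mem hj)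
    rw [Finset.sum_insert ha, Finset.card_insert_of_notMem ha, hN, Nat.even_add_one]
    rcases h a (Finset.mem_insert_self _ _) with h1 | h1
    · exact ⟨N + 1, by rw [h1]; push_cast; ring, by rw [Int.even_add_one, hN']⟩
    · refine ⟨N - 1, by rw [h1]; push_cast; ring, ?_⟩
      rw [← hN', Int.even_sub_one]

theorem cos_sign_mul_pi_div_two (hε : ε = 1 ∨ ε = -1) : Real.cos (ε * (Real.pi / 2)) = 0 := by
  rcases hε with rfl | rfl <;> simp

theorem sin_sign_mul_pi_div_two (hε : ε = 1 ∨ ε = -1) : Real.sin (ε * (Real.pi / 2)) = ε := by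
  rcases hε with rfl | rfl <;> simp

theorem neg_one_zpow_of_parity {N : ℤ} {c : ℕ} (h : Even N ↔ Even c) :
    ((-1 : ℝ)) ^ N = (-1) ^ c := by
  by_cases hc : Even c
  · rw [hc.neg_one_pow, (h.2 hc).neg_one_zpow]
  · have hN : Odd N := Int.not_even_iff_odd.1 fun hN => hc (h.1 hN)
    rw [(Nat.not_even_iff_odd.1 hc).neg_one_pow, hN.neg_one_zpow]

theorem phase_eq_of_forall_ge (hδ : 0 < δ) (h : ∀ j < P, δ ≤ |s - time j|) :
    phase φ₀ P time turn δ s =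
      φ₀ + Real.pi * ∑ j ∈ (Finset.range P).filter (time · < s), turn j := by
  rw [phase, Finset.sum_filter]
  congr 2
  refine Finset.sum_congr rfl fun j hj => ?_
  have h1 := h j (Finset.mem_range.1 hj)
  split_ifs with h2
  · rw [abs_of_pos (by linarith)] at h1
    rw [ramp_of_ge ((one_le_div hδ).2 h1), mul_one]
  · rw [abs_of_nonpos (by linarith)] at h1
    rw [ramp_of_le (by rw [div_le_iff₀ hδ]; linarith), mul_zero]

/-- Outside the intervals of change the phase is vertical. -/
theorem phase_flat (hδ : 0 < δ) (hε : ε = 1 ∨ ε = -1) (ht : ∀ j, turn j = 1 ∨ turn j = -1)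
    (h : ∀ j < P, δ ≤ |s - time j|) :
    Real.cos (phase (ε * (Real.pi / 2)) P time turn δ s) = 0 ∧
      Real.sin (phase (ε * (Real.pi / 2)) P time turn δ s) =
        ε * (-1) ^ PolyLink.countBefore time P s := by
  obtain ⟨N, hN, hN'⟩ := sum_signs (F := (Finset.range P).filter (time · < s)) fun j _ => ht j
  rw [phase_eq_of_forall_ge hδ h, hN, mul_comm Real.pi, Real.cos_add_int_mul_pi,
    Real.sin_add_int_mul_pi, cos_sign_mul_pi_div_two hε, sin_sign_mul_pi_div_two hε, mul_zero,
    neg_one_zpow_of_parity hN', PolyLink.countBefore, mul_comm]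
  exact ⟨rfl, rfl⟩

/-- Within an interval of change the phase passes through the side given by the direction of the
change, and it is horizontal in the middle. -/
theorem phase_tab (hδ : 0 < δ) (hε : ε = 1 ∨ ε = -1) (ht : ∀ j, turn j = 1 ∨ turn j = -1)
    (hdisj : ∀ j k, j < k → k < P → time j + δ ≤ time k - δ) {k : ℕ} (hk : k < P)
    (hs : |s - time k| < δ) :
    (∃ y, 0 < y ∧ y ≤ 1 ∧ Real.cos (phase (ε * (Real.pi / 2)) P time turn δ s) =
      -(ε * turn k * (-1) ^ k) * y) ∧
      (Real.sin (phase (ε * (Real.pi / 2)) P time turn δ s) = 0 ↔ s = time k) := by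
  have hs' := abs_lt.1 hs
  set x := ((s - time k) / δ + 1) / 2 with hx
  have hx1 : |(s - time k) / δ| < 1 := by rw [abs_div, abs_of_pos hδ]; exact (div_lt_one hδ).2 hs
  have hx2 := abs_lt.1 hx1
  obtain ⟨N, hN, hN'⟩ := sum_signs (F := Finset.range k) fun j _ => ht j
  rw [Finset.card_range] at hN'
  have hph : phase (ε * (Real.pi / 2)) P time turn δ s =
      ε * (Real.pi / 2) + turn k * (Real.pi * x) + N * Real.pi := by
    have hsum : ∑ j ∈ Finset.range P, turn j * ramp ((s - time j) / δ) = N + turn k * x := by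
      rw [← hN, ← Finset.sum_range_add_sum_Ico _ hk.le, Finset.sum_eq_sum_Ico_succ_bot hk]
      have h1 : ∑ j ∈ Finset.range k, turn j * ramp ((s - time j) / δ) =
          ∑ j ∈ Finset.range k, turn j := by
        refine Finset.sum_congr rfl fun j hj => ?_
        have := hdisj j k (Finset.mem_range.1 hj) hk
        rw [ramp_of_ge ((one_le_div hδ).2 (by linarith)), mul_one]
      have h2 : ∑ j ∈ Finset.Ico (k + 1) P, turn j * ramp ((s - time j) / δ) = 0 := by
        refine Finset.sum_eq_zero fun j hj => ?_
        rw [Finset.mem_Ico] at hj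
        have := hdisj k j hj.1 hj.2
        rw [ramp_of_le (by rw [div_le_iff₀ hδ]; linarith), mul_zero]
      rw [h1, h2, ramp_of_abs_lt hx1, add_zero]
    rw [phase, hsum]; ring
  have hc : Real.cos (ε * (Real.pi / 2) + turn k * (Real.pi * x)) =
      -(ε * turn k) * Real.sin (Real.pi * x) := by
    rw [Real.cos_add, cos_sign_mul_pi_div_two hε, sin_sign_mul_pi_div_two hε]
    rcases ht k with h | h <;> rw [h] <;> simp
  have hsn : Real.sin (ε * (Real.pi / 2) + turn k * (Real.pi * x)) =
      ε * Real.cos (Real.pi * x) := by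
    rw [Real.sin_add, cos_sign_mul_pi_div_two hε, sin_sign_mul_pi_div_two hε]
    rcases ht k with h | h <;> rw [h] <;> simp
  rw [hph, Real.cos_add_int_mul_pi, Real.sin_add_int_mul_pi, hc, hsn, neg_one_zpow_of_parity hN']
  have hpi := Real.pi_pos
  have hx0 : 0 < x := by rw [hx]; linarith
  have hx1' : x < 1 := by rw [hx]; linarith
  refine ⟨⟨Real.sin (Real.pi * x), Real.sin_pos_of_pos_of_lt_pi (by positivity) (by nlinarith),
    Real.sin_le_one _, by ring⟩, ?_⟩
  have hne : ((-1 : ℝ) ^ k) ≠ 0 := pow_ne_zero _ (by norm_num)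
  have hεne : ε ≠ 0 := by rcases hε with rfl | rfl <;> norm_num
  rw [mul_eq_zero, or_iff_right hne, mul_eq_zero, or_iff_right hεne]
  have hxs : x = 1 / 2 ↔ s = time k := by
    rw [hx]
    constructor
    · intro h
      have h1 : (s - time k) / δ = 0 := by linarith
      rcases div_eq_zero_iff.1 h1 with h2 | h2
      · linarith
      · exact absurd h2 hδ.ne'
    · rintro rfl; simp
  rw [← hxs]
  constructor
  · intro h
    rcases lt_trichotomy x (1 / 2) with h1 | h1 | h1
    · have := Real.cos_pos_of_mem_Ioo (x := Real.pi * x) ⟨by nlinarith, by nlinarith⟩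
      linarith
    · exact h1
    · have := Real.cos_neg_of_pi_div_two_lt_of_lt (x := Real.pi * x) (by nlinarith) (by nlinarith)
      linarith
  · intro h
    rw [h, show Real.pi * (1 / 2) = Real.pi / 2 by ring, Real.cos_pi_div_two]

end Phase

/-! ### The readable curve -/

namespace PolyLink

variable {n : ℕ} {L : PolyLink n} {i : Fin n}

theorem IsRegular.passesOver_iff (hreg : L.IsRegular) {k : Fin n} {s u : ℝ}
    (h : L.Cross i s k u) : L.PassesOver i s ↔ (L.curve k u).2 < (L.curve i s).2 :=
  ⟨fun ⟨_, _, h', hlt⟩ => by rwa [hreg.double _ _ _ _ _ _ h h'], fun hlt => ⟨k, u, h, hlt⟩⟩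

/-- The data of a readable curve along the component: it starts at the point of the tube with the
parameters `start`, `disp`, on the side of the projection plane given by the sign `side`, changes
the level at the times of `changes`, where it passes the component on the side given by the signs
`turn`, and winds `turns` times around the component. At parameters of distance at least `size`
from the start and from the changes, it is the vertical translate of the component to a point of
height `height` or `-height`. -/
structure Track (N : L.TransverseField i) (g r : ℝ) where
  thin : N.IsThin g r
  start : ℝ
  disp : ℂ
  disp_ne : disp ≠ 0
  norm_disp : ‖disp‖ ≤ r
  side : ℝ
  side_sign : side = 1 ∨ side = -1
  side_pos : 0 < side * (N.tube start disp).2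
  not_mem_curtain : ((N.tube start disp : Space) : S3) ∉ L.curtain
  changes : L.LevelChanges i g start (side = 1)
  turn : ℕ → ℝ
  turn_sign : ∀ j, turn j = 1 ∨ turn j = -1
  turns : ℤ
  sum_turn : ∑ j ∈ Finset.range (2 * changes.half), turn j = 2 * turns
  height : ℝ
  lt_height : ∀ k s, |(L.curve k s).2| < height
  start_lt_height : |(N.tube start disp).2| < height
  size : ℝ
  size_pos : 0 < size
  size_le : size ≤ r
  size_window : 2 * size ≤ N.window
  changes_apart : ∀ j k, j < k → k < 2 * changes.half →
    changes.time j + size ≤ changes.time k - size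
  changes_start : ∀ j < 2 * changes.half, start + size ≤ changes.time j - size ∧
    changes.time j + size ≤ start + L.period i - size
  changes_crossing : ∀ j < 2 * changes.half, ∀ s, |s - changes.time j| ≤ size → ¬ L.AtCrossing i s
  start_crossing : ∀ s, |s - start| ≤ size → L.AtCrossing i s → s = start
  start_height : disp.re = 0 → ∀ s, |s - start| ≤ size →
    0 < side * ((N.tube start disp).2 - (L.curve i s).2)
  changes_disjoint : ∀ j < 2 * changes.half, ∀ k < 2 * changes.half, j ≠ k → ∀ x x' ξ ξ',
    |x| ≤ size → |x'| ≤ size → |ξ| ≤ size → |ξ'| ≤ size →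
    N.plane (changes.time j + x) ξ ≠ N.plane (changes.time k + x') ξ'
  start_disjoint : ∀ j < 2 * changes.half, ∀ x x' ξ, ∀ a ∈ Set.Icc (0 : ℝ) 1,
    |x| ≤ size → |x'| ≤ size → |ξ| ≤ size →
    N.plane (start + x) (a * disp.re) ≠ N.plane (changes.time j + x') ξ

namespace Track

variable {N : L.TransverseField i} {g r : ℝ} (D : Track N g r)

/-- The angle of the displacement from the component. -/
def angle (s : ℝ) : ℝ :=
  phase (D.side * (Real.pi / 2)) (2 * D.changes.half) D.changes.time D.turn D.size s

/-- The weight of the base point. -/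
def weight (s : ℝ) : ℝ := max 0 (1 - L.periodDist i (s - D.start) / D.size)

/-- The displacement of the curve close to the component from the component. -/
def shift (s : ℝ) : ℂ :=
  ((1 - D.weight s) * D.size : ℝ) * Complex.exp (D.angle s * Complex.I) + D.weight s * D.disp

/-- The height of the readable curve. -/
def level (s : ℝ) : ℝ :=
  (1 - D.weight s) * (D.height * Real.sin (D.angle s)) + D.weight s * (N.tube D.start D.disp).2

/-- The readable curve. -/
def point (s : ℝ) : Space := (N.plane s (D.shift s).re, D.level s)

theorem continuous_angle : Continuous D.angle := continuous_phase

theorem continuous_weight : Continuous D.weight := by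
  have h1 : Continuous (L.periodDist i) := by
    unfold periodDist
    exact continuous_norm.comp (AddCircle.continuous_mk' _)
  have h2 : Continuous fun s => L.periodDist i (s - D.start) := h1.comp (by fun_prop)
  unfold weight
  fun_prop

theorem continuous_shift : Continuous D.shift := by
  have := D.continuous_angle
  have := D.continuous_weight
  unfold shift
  fun_prop

theorem continuous_level : Continuous D.level := by
  have := D.continuous_angle
  have := D.continuous_weight
  unfold level
  fun_prop

theorem continuous_point : Continuous D.point :=
  (N.continuous_plane continuous_id
    (Complex.continuous_re.comp D.continuous_shift)).prodMk D.continuous_level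

theorem weight_nonneg (s : ℝ) : 0 ≤ D.weight s := le_max_left _ _

theorem weight_le_one (s : ℝ) : D.weight s ≤ 1 := by
  have : 0 ≤ L.periodDist i (s - D.start) / D.size := div_nonneg (norm_nonneg _) D.size_pos.le
  exact max_le zero_le_one (by linarith)

theorem weight_start (m : ℤ) : D.weight (D.start + m * L.period i) = 1 := by
  rw [weight, show D.start + m * L.period i - D.start = 0 + m * L.period i by ring,
    periodDist_add_int_mul]
  simp [periodDist]

theorem shift_re (s : ℝ) : (D.shift s).re =
    (1 - D.weight s) * D.size * Real.cos (D.angle s) + D.weight s * D.disp.re := by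
  rw [shift, Complex.add_re, Complex.re_ofReal_mul, Complex.re_ofReal_mul,
    Complex.exp_ofReal_mul_I_re]

theorem shift_im (s : ℝ) : (D.shift s).im =
    (1 - D.weight s) * D.size * Real.sin (D.angle s) + D.weight s * D.disp.im := by
  rw [shift, Complex.add_im, Complex.im_ofReal_mul, Complex.im_ofReal_mul,
    Complex.exp_ofReal_mul_I_im]

theorem norm_shift_le (s : ℝ) : ‖D.shift s‖ ≤ r := by
  have h0 := D.weight_nonneg s
  have h1 := D.weight_le_one s
  calc ‖D.shift s‖ ≤ (1 - D.weight s) * D.size + D.weight s * ‖D.disp‖ := by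
        refine (norm_add_le _ _).trans ?_
        rw [norm_mul, norm_mul, Complex.norm_exp_ofReal_mul_I, Complex.norm_real, Complex.norm_real,
          Real.norm_of_nonneg (mul_nonneg (by linarith) D.size_pos.le), Real.norm_of_nonneg h0,
          mul_one]
    _ ≤ (1 - D.weight s) * r + D.weight s * r := by
        exact add_le_add (mul_le_mul_of_nonneg_left D.size_le (by linarith))
          (mul_le_mul_of_nonneg_left D.norm_disp h0)
    _ = r := by ring

theorem side_mul_self : D.side * D.side = 1 := by rcases D.side_sign with h | h <;> rw [h]
    <;> norm_num

theorem near_start {s : ℝ} (hw : D.weight s ≠ 0) :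
    ∃ m : ℤ, |s - m * L.period i - D.start| < D.size := by
  have h1 : 0 < D.weight s := lt_of_le_of_ne (D.weight_nonneg s) hw.symm
  have h2 : 0 < 1 - L.periodDist i (s - D.start) / D.size := by
    rcases lt_max_iff.1 h1 with h | h
    · exact absurd h (lt_irrefl _)
    · exact h
  have h3 : L.periodDist i (s - D.start) < D.size := (div_lt_one D.size_pos).1 (by linarith)
  obtain ⟨m, hm⟩ := exists_of_periodDist_lt h3
  exact ⟨m, by rwa [show s - m * L.period i - D.start = s - D.start - m * L.period i by ring]⟩

theorem angle_start {s : ℝ} (h : s ≤ D.start + D.size) : D.angle s = D.side * (Real.pi / 2) := by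
  have : ∑ j ∈ Finset.range (2 * D.changes.half),
      D.turn j * ramp ((s - D.changes.time j) / D.size) = 0 := by
    refine Finset.sum_eq_zero fun j hj => ?_
    have := (D.changes_start j (Finset.mem_range.1 hj)).1
    rw [ramp_of_le (by rw [div_le_iff₀ D.size_pos]; linarith), mul_zero]
  rw [angle, phase, this]; ring

theorem angle_end {s : ℝ} (h : D.start + L.period i - D.size ≤ s) :
    D.angle s = D.side * (Real.pi / 2) + D.turns * (2 * Real.pi) := by
  have : ∑ j ∈ Finset.range (2 * D.changes.half),
      D.turn j * ramp ((s - D.changes.time j) / D.size) = 2 * D.turns := by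
    rw [← D.sum_turn]
    refine Finset.sum_congr rfl fun j hj => ?_
    have := (D.changes_start j (Finset.mem_range.1 hj)).2
    rw [ramp_of_ge (by rw [le_div_iff₀ D.size_pos]; linarith), mul_one]
  rw [angle, phase, this]; ring

/-- Close to the base point the curve is vertically above or below the component. -/
theorem angle_finger {s : ℝ} (hw : D.weight s ≠ 0) : Real.cos (D.angle s) = 0 ∧
    Real.sin (D.angle s) = D.side := by
  obtain ⟨m, hm⟩ := D.near_start hw
  have hm := abs_lt.1 hm
  have hE := L.period_pos i
  rcases le_or_gt s (D.start + D.size) with h | h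
  · rw [D.angle_start h]
    exact ⟨cos_sign_mul_pi_div_two D.side_sign, sin_sign_mul_pi_div_two D.side_sign⟩
  · have h1 : (0 : ℝ) < m := by
      by_contra hc; rw [not_lt] at hc; nlinarith
    have h2 : 0 < m := by exact_mod_cast h1
    have h3 : (1 : ℝ) ≤ m := by exact_mod_cast h2
    rw [D.angle_end (by nlinarith), Real.cos_add_int_mul_two_pi, Real.sin_add_int_mul_two_pi]
    exact ⟨cos_sign_mul_pi_div_two D.side_sign, sin_sign_mul_pi_div_two D.side_sign⟩

/-- The parts of the curve: close to the base point, at the changes of level, and elsewhere, where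
it is a vertical translate of a piece of the component. -/
theorem trichotomy {s : ℝ} (hs : s ∈ Set.Icc D.start (D.start + L.period i)) :
    (∃ m : ℤ, |s - m * L.period i - D.start| ≤ D.size ∧ ∃ a, 0 < a ∧ a ≤ 1 ∧
      (s - m * L.period i = D.start → a = 1) ∧
      (D.shift s).re = a * D.disp.re ∧ (D.shift s).im = (1 - a) * D.size * D.side + a * D.disp.im ∧
      D.level s = (1 - a) * (D.height * D.side) + a * (N.tube D.start D.disp).2) ∨
    (∃ j < 2 * D.changes.half, |s - D.changes.time j| ≤ D.size ∧ ∃ y, 0 < y ∧ y ≤ 1 ∧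
      (D.shift s).re = -(D.side * D.turn j * (-1) ^ j) * (D.size * y) ∧
      (D.level s = 0 ↔ s = D.changes.time j)) ∨
    (∃ e : ℝ, (e = 1 ∨ e = -1) ∧ (L.AtCrossing i s → (L.PassesOver i s ↔ e = 1)) ∧
      (D.shift s).re = 0 ∧ (D.shift s).im = D.size * e ∧ D.level s = D.height * e) := by
  by_cases hw : D.weight s = 0
  · by_cases htab : ∃ j < 2 * D.changes.half, |s - D.changes.time j| < D.size
    · right; left
      obtain ⟨j, hj, hsj⟩ := htab
      obtain ⟨⟨y, hy0, hy1, hy⟩, hsin⟩ := phase_tab D.size_pos D.side_sign D.turn_sign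
        D.changes_apart hj hsj
      refine ⟨j, hj, hsj.le, y, hy0, hy1, ?_, ?_⟩
      · rw [shift_re, hw]
        change Real.cos (D.angle s) = _ at hy
        rw [hy]; ring
      · change Real.sin (D.angle s) = 0 ↔ _ at hsin
        rw [← hsin, level, hw]
        have hH : D.height ≠ 0 := by
          have := (abs_nonneg _).trans_lt (D.lt_height i 0); exact this.ne'
        simp [hH]
    · right; right
      push Not at htab
      obtain ⟨hcos, hsin⟩ := phase_flat D.size_pos D.side_sign D.turn_sign htab
      change Real.cos (D.angle s) = 0 at hcos
      change Real.sin (D.angle s) = _ at hsin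
      refine ⟨Real.sin (D.angle s), ?_, fun hc => ?_, ?_, ?_, ?_⟩
      · rw [hsin]
        rcases neg_one_pow_eq_or ℝ (countBefore D.changes.time (2 * D.changes.half) s) with h | h
            <;>
        rcases D.side_sign with h' | h' <;> rw [h, h'] <;> norm_num
      · rw [D.changes.state s hs hc, hsin]
        by_cases he : Even (countBefore D.changes.time (2 * D.changes.half) s)
        · rw [he.neg_one_pow]; simp [he]
        · rw [(Nat.not_even_iff_odd.1 he).neg_one_pow]
          have e1 : D.side * -1 = 1 ↔ D.side = -1 := by
            constructor <;> intro h <;> linarith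
          have e2 : ¬ (D.side = 1 ∧ D.side = -1) := fun h => by linarith [h.1, h.2]
          have e3 := D.side_sign
          rw [e1]
          tauto
      · rw [shift_re, hw, hcos]; ring
      · rw [shift_im, hw]; ring
      · rw [level, hw]; ring
  · left
    obtain ⟨m, hm⟩ := D.near_start hw
    obtain ⟨hcos, hsin⟩ := D.angle_finger hw
    refine ⟨m, hm.le, D.weight s, lt_of_le_of_ne (D.weight_nonneg s) (Ne.symm hw),
      D.weight_le_one s, fun h => ?_, ?_, ?_, ?_⟩
    · rw [show s = D.start + m * L.period i by linarith, weight_start]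
    · rw [shift_re, hcos]; ring
    · rw [shift_im, hsin]
    · rw [level, hsin]

theorem height_pos : 0 < D.height := (abs_nonneg _).trans_lt (D.lt_height i 0)

theorem side_abs : |D.side| = 1 := by rcases D.side_sign with h | h <;> rw [h] <;> simp

theorem side_mul_lt_height (k : Fin n) (s : ℝ) : D.side * (L.curve k s).2 < D.height := by
  refine (le_abs_self _).trans_lt ?_
  rw [abs_mul, D.side_abs, one_mul]; exact D.lt_height k s

theorem offShadow_of_tab {s : ℝ} {j : ℕ} (hj : j < 2 * D.changes.half)
    (hs : |s - D.changes.time j| ≤ D.size) {y : ℝ} (hy0 : 0 < y) (hy1 : y ≤ 1)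
    (hre : (D.shift s).re = -(D.side * D.turn j * (-1) ^ j) * (D.size * y)) :
    |(D.shift s).re| ≤ D.size ∧ L.OffShadow (N.plane s (D.shift s).re) := by
  have h1 : |(D.shift s).re| = D.size * y := by
    have h2 : |D.turn j| = 1 := by rcases D.turn_sign j with h | h <;> rw [h] <;> simp
    have hp := mul_pos D.size_pos hy0
    rw [hre, abs_mul, abs_neg, abs_mul, abs_mul, D.side_abs, h2, abs_pow, abs_neg, abs_one, one_pow,
      abs_of_pos hp]
    ring
  have h3 : |(D.shift s).re| ≤ D.size := by rw [h1]; exact mul_le_of_le_one_right D.size_pos.le hy1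
  refine ⟨h3, D.thin.isStripRadius.2 s _ (D.changes_crossing j hj s hs) (h3.trans D.size_le) ?_⟩
  rw [← abs_pos, h1]; exact mul_pos D.size_pos hy0

/-- The position of the curve close to the base point is either off the projection of the link, or
on the component itself, or that of the base point. -/
theorem finger_cases {s a : ℝ} {m : ℤ} (hm : |s - m * L.period i - D.start| ≤ D.size)
    (ha : 0 < a) (hre : (D.shift s).re = a * D.disp.re) (ha1 : a ≤ 1) :
    s - m * L.period i = D.start ∨ L.OffShadow (N.plane s (D.shift s).re) ∨
      (D.disp.re = 0 ∧ (D.shift s).re = 0 ∧ ¬ L.AtCrossing i s) := by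
  by_cases h : s - m * L.period i = D.start
  · exact Or.inl h
  right
  have hcr : ¬ L.AtCrossing i s := fun hc => h (D.start_crossing _ hm (by
    have := (L.atCrossing_add_int_mul (i := i) (s := s) (-m)).2 hc
    push_cast at this
    rwa [neg_mul, ← sub_eq_add_neg] at this))
  by_cases h0 : D.disp.re = 0
  · exact Or.inr ⟨h0, by rw [hre, h0, mul_zero], hcr⟩
  · left
    refine D.thin.isStripRadius.2 s _ hcr ?_ (by rw [hre]; exact mul_ne_zero ha.ne' h0)
    rw [hre, abs_mul, abs_of_pos ha]
    exact (mul_le_of_le_one_left (abs_nonneg _) ha1).trans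
      ((Complex.abs_re_le_norm _).trans D.norm_disp)

theorem plane_start (m : ℤ) {s : ℝ} (h : s - m * L.period i = D.start) (ξ : ℝ) :
    N.plane s ξ = N.plane D.start ξ := by
  rw [← h]
  have := N.plane_add_int_mul s ξ (-m)
  push_cast at this
  rw [neg_mul, ← sub_eq_add_neg] at this
  exact this.symm

theorem point_start (m : ℤ) {s : ℝ} (h : s - m * L.period i = D.start) :
    D.point s = N.tube D.start D.disp := by
  have hw : D.weight s = 1 := by
    rw [show s = D.start + m * L.period i by linarith, weight_start]
  rw [point, D.plane_start m h, shift_re, level, hw]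
  simp [TransverseField.tube]

theorem side_mul_level_pos {a : ℝ} (ha0 : 0 < a) (ha1 : a ≤ 1) :
    0 < D.side * ((1 - a) * (D.height * D.side) + a * (N.tube D.start D.disp).2) := by
  have h1 := mul_pos ha0 D.side_pos
  have h2 : 0 ≤ (1 - a) * D.height := mul_nonneg (by linarith) D.height_pos.le
  have h3 := D.side_mul_self
  have : D.side * ((1 - a) * (D.height * D.side) + a * (N.tube D.start D.disp).2) =
      (1 - a) * D.height * (D.side * D.side) + a * (D.side * (N.tube D.start D.disp).2) := by ring
  rw [this, h3]; linarith

theorem point_not_mem_curtain {s : ℝ} (hs : s ∈ Set.Icc D.start (D.start + L.period i)) :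
    ((D.point s : Space) : S3) ∉ L.curtain := by
  rintro ⟨k, u, z, hz, heq⟩
  have heq := OnePoint.coe_injective heq
  have hy : N.plane s (D.shift s).re = (L.curve k u).1 := congrArg Prod.fst heq
  have hz' : D.level s = z := congrArg Prod.snd heq
  have hzabs : |z| ≤ |(L.curve k u).2| := by
    rcases Set.mem_uIcc.1 hz with h | h
    · rw [abs_of_nonneg h.1]; exact h.2.trans (le_abs_self _)
    · rw [abs_of_nonpos h.2]; exact le_trans (by linarith [h.1]) (neg_le_abs _)
  rcases D.trichotomy hs with ⟨m, hm, a, ha0, ha1, -, hre, -, hlev⟩ | ⟨j, hj, hsj, y, hy0, hy1, hre,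
      -⟩ |
    ⟨e, he, -, -, -, hlev⟩
  · rcases D.finger_cases hm ha0 hre ha1 with h | h | ⟨h0, hre0, hcr⟩
    · rw [D.point_start m h] at heq
      exact D.not_mem_curtain ⟨k, u, z, hz, by rw [heq]⟩
    · exact h k u hy.symm
    · have hk : L.curve i s = L.curve k u := by
        by_contra hne
        rw [hre0, N.plane_zero] at hy
        exact hcr ⟨k, u, hy, hne⟩
      rw [← hk] at hz
      have hpos := D.side_mul_level_pos ha0 ha1
      rw [← hlev, hz'] at hpos
      have hst := D.start_height h0 _ hm
      have hcs : L.curve i (s - m * L.period i) = L.curve i s := by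
        have := L.curve_add_int_mul i s (-m)
        push_cast at this
        rwa [neg_mul, ← sub_eq_add_neg] at this
      rw [hcs] at hst
      have hH := D.side_mul_lt_height i s
      have hgt : D.side * (L.curve i s).2 < D.side * z := by
        rw [← hz', hlev]
        have h3 := D.side_mul_self
        have : D.side * ((1 - a) * (D.height * D.side) + a * (N.tube D.start D.disp).2) -
            D.side * (L.curve i s).2 = (1 - a) * (D.height * (D.side * D.side) -
                D.side * (L.curve i s).2) +
            a * (D.side * ((N.tube D.start D.disp).2 - (L.curve i s).2)) := by ring
        rw [h3, mul_one] at this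
        have h4 : 0 ≤ (1 - a) * (D.height - D.side * (L.curve i s).2) :=
          mul_nonneg (by linarith) (by linarith)
        have h5 := mul_pos ha0 hst
        linarith
      rcases D.side_sign with h | h <;> rw [h] at hpos hgt <;>
        rcases Set.mem_uIcc.1 hz with h' | h' <;> linarith [h'.1, h'.2]
  · exact (D.offShadow_of_tab hj hsj hy0 hy1 hre).2 k u hy.symm
  · have h1 : |D.level s| = D.height := by
      rw [hlev, abs_mul, abs_of_pos D.height_pos]
      rcases he with rfl | rfl <;> simp
    rw [hz'] at h1
    have := D.lt_height k u
    linarith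

theorem level_eq_zero {s : ℝ} (hs : s ∈ Set.Icc D.start (D.start + L.period i))
    (h0 : D.level s = 0) : ∃ j < 2 * D.changes.half, s = D.changes.time j ∧ ∃ ξ, 0 < ξ ∧ ξ ≤ r ∧
      (D.shift s).re = -(D.side * D.turn j * (-1) ^ j) * ξ := by
  rcases D.trichotomy hs with ⟨m, hm, a, ha0, ha1, -, -, -, hlev⟩ | ⟨j, hj, hsj, y, hy0, hy1, hre,
      hz⟩ |
    ⟨e, he, -, -, -, hlev⟩
  · have := D.side_mul_level_pos ha0 ha1
    rw [← hlev, h0, mul_zero] at this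
    exact absurd this (lt_irrefl _)
  · exact ⟨j, hj, hz.1 h0, D.size * y, mul_pos D.size_pos hy0,
      (mul_le_of_le_one_right D.size_pos.le hy1).trans D.size_le, hre⟩
  · rw [h0] at hlev
    have := D.height_pos
    rcases he with rfl | rfl <;> linarith

theorem abs_level_finger_lt {a : ℝ} (ha0 : 0 < a) (ha1 : a ≤ 1) :
    |(1 - a) * (D.height * D.side) + a * (N.tube D.start D.disp).2| < D.height := by
  have h1 := D.start_lt_height
  refine (abs_add_le _ _).trans_lt ?_
  rw [abs_mul, abs_mul, abs_mul, D.side_abs, abs_of_pos D.height_pos, abs_of_pos ha0,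
    abs_of_nonneg (by linarith : (0 : ℝ) ≤ 1 - a)]
  nlinarith

/-- Positions with parameters close to each other are different. -/
theorem eq_of_plane_eq {s s' ξ ξ' : ℝ} (h : |s' - s| ≤ 2 * D.size) (hξ : |ξ| ≤ r) (hξ' : |ξ'| ≤ r)
    (heq : N.plane s ξ = N.plane s' ξ') : s = s' :=
  N.eq_of_det2_eq_zero (h.trans D.size_window) (D.thin.near s ξ hξ)
    (by rw [heq]; exact D.thin.near s' ξ' hξ') (N.det2_plane s ξ)
        (by rw [heq]; exact N.det2_plane s' ξ')

theorem eq_of_tab {s s' : ℝ}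
    (hs' : s' ∈ Set.Icc D.start (D.start + L.period i)) {j : ℕ} (hj : j < 2 * D.changes.half)
    (hsj : |s - D.changes.time j| ≤ D.size) {y : ℝ} (hy0 : 0 < y) (hy1 : y ≤ 1)
    (hre : (D.shift s).re = -(D.side * D.turn j * (-1) ^ j) * (D.size * y))
    (h : D.point s = D.point s') : s = s' := by
  have hplane : N.plane s (D.shift s).re = N.plane s' (D.shift s').re := congrArg Prod.fst h
  obtain ⟨hle, hoff⟩ := D.offShadow_of_tab hj hsj hy0 hy1 hre
  have hsx : s = D.changes.time j + (s - D.changes.time j) := by ring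
  rcases D.trichotomy hs' with ⟨m, hm, a, ha0, ha1, -, hre', -, -⟩ |
    ⟨k, hk, hsk, y', hy0', hy1', hre', -⟩ | ⟨e, -, -, hre', -, -⟩
  · exfalso
    refine D.start_disjoint j hj (s' - m * L.period i - D.start) (s - D.changes.time j)
      (D.shift s).re a ⟨ha0.le, ha1⟩ hm hsj hle ?_
    rw [← hsx, hplane, hre']
    have := N.plane_add_int_mul s' (a * D.disp.re) (-m)
    push_cast at this
    rw [neg_mul, ← sub_eq_add_neg] at this
    rw [add_sub_cancel, this]
  · obtain ⟨hle', -⟩ := D.offShadow_of_tab hk hsk hy0' hy1' hre'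
    by_cases hjk : j = k
    · subst hjk
      refine D.eq_of_plane_eq ?_ (hle.trans D.size_le) (hle'.trans D.size_le) hplane
      have h1 := abs_le.1 hsj
      have h2 := abs_le.1 hsk
      exact abs_le.2 ⟨by linarith, by linarith⟩
    · exfalso
      refine D.changes_disjoint j hj k hk hjk _ _ _ _ hsj hsk hle hle' ?_
      rw [add_sub_cancel, add_sub_cancel, hplane]
  · exfalso
    rw [hplane, hre', N.plane_zero] at hoff
    exact hoff i s' rfl

/-- The readable curve is simple. -/
theorem point_injective (hreg : L.IsRegular) {s s' : ℝ}
    (hs : s ∈ Set.Icc D.start (D.start + L.period i))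
    (hs' : s' ∈ Set.Icc D.start (D.start + L.period i)) (h : D.point s = D.point s') :
    ∃ m : ℤ, s' = s + m * L.period i := by
  have hplane : N.plane s (D.shift s).re = N.plane s' (D.shift s').re := congrArg Prod.fst h
  have hlevel : D.level s = D.level s' := congrArg Prod.snd h
  have hH : ∀ e : ℝ, e = 1 ∨ e = -1 → |D.height * e| = D.height := fun e he => by
    rw [abs_mul, abs_of_pos D.height_pos]
    rcases he with rfl | rfl <;> simp
  rcases D.trichotomy hs with ⟨m, hm, a, ha0, ha1, -, hre, -, hlev⟩ | ⟨j, hj, hsj, y, hy0, hy1, hre,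
      -⟩ |
    ⟨e, he, hst, hre, -, hlev⟩
  · rcases D.trichotomy hs' with ⟨m', hm', a', ha0', ha1', -, hre', -, -⟩ |
      ⟨j, hj, hsj, y, hy0, hy1, hre', -⟩ | ⟨e, he, -, -, -, hlev'⟩
    · have hsh : ∀ (t : ℝ) (m : ℤ) (ξ : ℝ), N.plane (t - m * L.period i) ξ = N.plane t ξ := by
        intro t m ξ
        have := N.plane_add_int_mul t ξ (-m)
        push_cast at this
        rwa [neg_mul, ← sub_eq_add_neg] at this
      have hr : ∀ b, 0 < b → b ≤ 1 → |b * D.disp.re| ≤ r := fun b hb0 hb1 => by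
        rw [abs_mul, abs_of_pos hb0]
        exact (mul_le_of_le_one_left (abs_nonneg _) hb1).trans
          ((Complex.abs_re_le_norm _).trans D.norm_disp)
      have := D.eq_of_plane_eq (s := s - m * L.period i) (s' := s' - m' * L.period i)
        (ξ := a * D.disp.re) (ξ' := a' * D.disp.re) (by
          have h1 := abs_le.1 hm
          have h2 := abs_le.1 hm'
          exact abs_le.2 ⟨by linarith, by linarith⟩) (hr a ha0 ha1) (hr a' ha0' ha1')
        (by rw [hsh, hsh, ← hre, ← hre', hplane])
      exact ⟨m' - m, by push_cast; linarith⟩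
    · have := D.eq_of_tab hs hj hsj hy0 hy1 hre' h.symm
      exact ⟨0, by rw [this]; simp⟩
    · exfalso
      have h1 := D.abs_level_finger_lt ha0 ha1
      rw [← hlev, hlevel, hlev', hH e he] at h1
      exact lt_irrefl _ h1
  · have := D.eq_of_tab hs' hj hsj hy0 hy1 hre h
    exact ⟨0, by rw [this]; simp⟩
  · rcases D.trichotomy hs' with ⟨m', hm', a', ha0', ha1', -, hre', -, hlev'⟩ |
      ⟨j, hj, hsj, y, hy0, hy1, hre', -⟩ | ⟨e', he', hst', hre', -, hlev'⟩
    · exfalso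
      have h1 := D.abs_level_finger_lt ha0' ha1'
      rw [← hlev', ← hlevel, hlev, hH e he] at h1
      exact lt_irrefl _ h1
    · have := D.eq_of_tab hs hj hsj hy0 hy1 hre' h.symm
      exact ⟨0, by rw [this]; simp⟩
    · rw [hre, hre', N.plane_zero, N.plane_zero] at hplane
      by_cases hc : L.curve i s = L.curve i s'
      · exact L.curve_eq_iff.1 hc
      · exfalso
        have hcr : L.Cross i s i s' := ⟨hplane, hc⟩
        have h1 := hst hcr.atCrossing
        have h2 := hst' hcr.symm.atCrossing
        rw [hreg.passesOver_iff hcr] at h1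
        rw [hreg.passesOver_iff hcr.symm] at h2
        have h3 : e = e' := by
          rw [hlev, hlev'] at hlevel
          exact mul_left_cancel₀ D.height_pos.ne' hlevel
        rw [← h3, ← h1] at h2
        rcases lt_or_gt_of_ne hcr.height_ne with h4 | h4
        · exact absurd (h2.1 h4) (not_lt.2 h4.le)
        · exact absurd (h2.2 h4) (not_lt.2 h4.le)

/-- The vertical homotopy between the curve in the tube and the readable curve misses the link. -/
theorem homotopy_not_mem (hreg : L.IsRegular) {s t : ℝ}
    (hs : s ∈ Set.Icc D.start (D.start + L.period i)) (ht : t ∈ Set.Icc (0 : ℝ) 1) (k : Fin n)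
    (u : ℝ) : (N.plane s (D.shift s).re, (1 - t) * ((L.curve i s).2 + (D.shift s).im) +
      t * D.level s) ≠ L.curve k u := by
  intro heq
  have hy : N.plane s (D.shift s).re = (L.curve k u).1 := congrArg Prod.fst heq
  have hz : (1 - t) * ((L.curve i s).2 + (D.shift s).im) + t * D.level s = (L.curve k u).2 :=
    congrArg Prod.snd heq
  have key : ∀ x y : ℝ, 0 < x → 0 < y → 0 < (1 - t) * x + t * y := by
    intro x y hx hy
    rcases ht.1.lt_or_eq with h | h
    · have := mul_pos h hy
      have := mul_nonneg (sub_nonneg.2 ht.2) hx.le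
      linarith
    · rw [← h]; linarith
  rcases D.trichotomy hs with ⟨m, hm, a, ha0, ha1, hma, hre, him, hlev⟩ |
    ⟨j, hj, hsj, y, hy0, hy1, hre, -⟩ | ⟨e, he, hst, hre, him, hlev⟩
  · have hcs : L.curve i (s - m * L.period i) = L.curve i s := by
      have := L.curve_add_int_mul i s (-m)
      push_cast at this
      rwa [neg_mul, ← sub_eq_add_neg] at this
    rcases D.finger_cases hm ha0 hre ha1 with h | h | ⟨h0, hre0, hcr⟩
    · have ha := hma h
      refine D.disp_ne (D.thin.tube_ne D.start k u _ D.norm_disp ?_)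
      rw [← heq, D.plane_start m h, hre, him, hlev, ha, ← hcs, h]
      refine Prod.ext ?_ ?_
      · simp [TransverseField.tube]
      · simp [TransverseField.tube]; ring
    · exact h k u hy.symm
    · have hk : L.curve i s = L.curve k u := by
        by_contra hne
        rw [hre0, N.plane_zero] at hy
        exact hcr ⟨k, u, hy, hne⟩
      rw [← hk] at hz
      have hst := D.start_height h0 _ hm
      have hst0 := D.start_height h0 D.start (by rw [sub_self, abs_zero]; exact D.size_pos.le)
      rw [hcs] at hst
      have hH := D.side_mul_lt_height i s
      have h3 := D.side_mul_self
      have e1 : 0 < D.side * (D.shift s).im := by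
        have h4 : (N.tube D.start D.disp).2 - (L.curve i D.start).2 = D.disp.im := by
          simp [TransverseField.tube]
        rw [h4] at hst0
        rw [him]
        have : D.side * ((1 - a) * D.size * D.side + a * D.disp.im) =
          (1 - a) * D.size * (D.side * D.side) + a * (D.side * D.disp.im) := by ring
        rw [this, h3]
        have := mul_pos ha0 hst0
        have := mul_nonneg (sub_nonneg.2 ha1) D.size_pos.le
        linarith
      have e2 : 0 < D.side * (D.level s - (L.curve i s).2) := by
        rw [hlev]
        have : D.side * ((1 - a) * (D.height * D.side) + a * (N.tube D.start D.disp).2 -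
            (L.curve i s).2) = (1 - a) * (D.height * (D.side * D.side) - D.side * (L.curve i s).2) +
            a * (D.side * ((N.tube D.start D.disp).2 - (L.curve i s).2)) := by ring
        rw [this, h3, mul_one]
        have h4 : 0 ≤ (1 - a) * (D.height - D.side * (L.curve i s).2) :=
          mul_nonneg (by linarith) (by linarith)
        have h5 := mul_pos ha0 hst
        linarith
      have h6 := key _ _ e1 e2
      have h7 : (1 - t) * (D.side * (D.shift s).im) + t * (D.side * (D.level s - (L.curve i s).2)) =
          D.side * ((1 - t) * ((L.curve i s).2 + (D.shift s).im) + t * D.level s - (L.curve i s).2)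
              := by
        ring
      rw [h7, hz, sub_self, mul_zero] at h6
      exact lt_irrefl _ h6
  · exact (D.offShadow_of_tab hj hsj hy0 hy1 hre).2 k u hy.symm
  · rw [hre, N.plane_zero] at hy
    have hee : e * e = 1 := by rcases he with rfl | rfl <;> norm_num
    have e1 : 0 < e * (D.shift s).im := by
      rw [him, show e * (D.size * e) = D.size * (e * e) by ring, hee, mul_one]; exact D.size_pos
    have e2 : 0 < e * (D.level s - (L.curve i s).2) := by
      have := abs_lt.1 (D.lt_height i s)
      rw [hlev]
      rcases he with rfl | rfl <;> linarith
    have h6 := key _ _ e1 e2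
    have h7 : (1 - t) * (e * (D.shift s).im) + t * (e * (D.level s - (L.curve i s).2)) =
        e * ((1 - t) * ((L.curve i s).2 + (D.shift s).im) + t * D.level s - (L.curve i s).2) := by
      ring
    rw [h7, hz] at h6
    by_cases hc : L.curve i s = L.curve k u
    · rw [hc, sub_self, mul_zero] at h6
      exact lt_irrefl _ h6
    · have hcr : L.Cross i s k u := ⟨hy, hc⟩
      have h8 := hst hcr.atCrossing
      rw [hreg.passesOver_iff hcr] at h8
      rcases he with rfl | rfl
      · have := h8.2 rfl; linarith
      · have := h8.1 (by linarith)
        norm_num at this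

end Track

end PolyLink

/-! ### The homotopy to the readable curve -/

section Homotopy

variable {X : Type*} [TopologicalSpace X] {A : Set X} {f g : C(I, X)}

theorem basedHomotopicIn_of {q : X} (F : C(I × I, X)) (h0 : ∀ x, F (0, x) = f x)
    (h1 : ∀ x, F (1, x) = g x) (hq : ∀ t, F (t, 0) = q ∧ F (t, 1) = q) (hA : ∀ t x, F (t, x) ∈ A) :
    BasedHomotopicIn A q f g :=
  ⟨{ toContinuousMap := F, map_zero_left := h0, map_one_left := h1,
     prop' := fun t => ⟨(hq t).1, (hq t).2, fun x => hA t x⟩ }⟩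

theorem freelyHomotopicIn_of (F : C(I × I, X)) (h0 : ∀ x, F (0, x) = f x)
    (h1 : ∀ x, F (1, x) = g x) (hq : ∀ t, F (t, 0) = F (t, 1)) (hA : ∀ t x, F (t, x) ∈ A) :
    FreelyHomotopicIn A f g :=
  ⟨{ toContinuousMap := F, map_zero_left := h0, map_one_left := h1,
     prop' := fun t => ⟨hq t, fun x => hA t x⟩ }⟩

theorem BasedHomotopicIn.freely {q : X} (h : BasedHomotopicIn A q f g) :
    FreelyHomotopicIn A f g := by
  obtain ⟨F⟩ := h
  exact ⟨{ toHomotopy := F.toHomotopy,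
           prop' := fun t => ⟨(F.prop' t).1.trans (F.prop' t).2.1.symm, (F.prop' t).2.2⟩ }⟩

end Homotopy

namespace PolyLink

variable {n : ℕ} {L : PolyLink n} {i : Fin n}

theorem coe_mem_compl_carrier {x : Space} (h : ∀ k u, x ≠ L.curve k u) :
    (x : S3) ∈ L.carrierᶜ := by
  intro hx
  obtain ⟨k, hk⟩ := Set.mem_iUnion.1 hx
  obtain ⟨u, hu⟩ := hk
  exact h k u (OnePoint.coe_injective hu)

namespace TransverseField

variable (N : L.TransverseField i)

/-- The loop in the tube with the given parameters, of which the displacement from the component is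
given by its logarithm. -/
def loop (f : C(I, ℝ)) (ζ : C(I, ℂ)) : C(I, S3) where
  toFun t := ((N.tube (f t) (Complex.exp (ζ t)) : Space) : S3)
  continuous_toFun := OnePoint.continuous_coe.comp (N.continuous_tube (by fun_prop) (by fun_prop))

variable {N} {g r : ℝ}

theorem IsThin.tube_exp_ne (h : N.IsThin g r) {ζ : ℂ} (hζ : ζ.re ≤ Real.log r) (s : ℝ) (k : Fin n)
    (u : ℝ) : N.tube s (Complex.exp ζ) ≠ L.curve k u := fun heq =>
  Complex.exp_ne_zero ζ (h.tube_ne s k u _ (by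
    rw [Complex.norm_exp]; exact (Real.le_log_iff_exp_le h.pos).1 hζ) heq)

theorem tube_add_period_exp (N : L.TransverseField i) (s : ℝ) (ζ : ℂ) (m : ℤ) :
    N.tube (s + L.period i) (Complex.exp (ζ + m * (2 * Real.pi * Complex.I))) =
      N.tube s (Complex.exp ζ) := by
  have h := N.tube_add_int_mul s (Complex.exp ζ) 1
  rw [Int.cast_one, one_mul] at h
  rw [Complex.exp_add, Complex.exp_int_mul_two_pi_mul_I, mul_one, h]

/-- Loops in the tube which wind around equally often are homotopic off the link. -/
theorem IsThin.exists_loop_homotopy (h : N.IsThin g r) {f f' : C(I, ℝ)} {ζ ζ' : C(I, ℂ)} {m : ℤ}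
    (hf : f 1 = f 0 + L.period i) (hf' : f' 1 = f' 0 + L.period i)
    (hζ : ζ 1 = ζ 0 + m * (2 * Real.pi * Complex.I))
    (hζ' : ζ' 1 = ζ' 0 + m * (2 * Real.pi * Complex.I))
    (hr : ∀ t, (ζ t).re ≤ Real.log r) (hr' : ∀ t, (ζ' t).re ≤ Real.log r) :
    ∃ F : C(I × I, S3), (∀ x, F (0, x) = N.loop f ζ x) ∧ (∀ x, F (1, x) = N.loop f' ζ' x) ∧
      (∀ t x, F (t, x) ∈ L.carrierᶜ) ∧ (∀ t, F (t, 0) = F (t, 1)) ∧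
      (f 0 = f' 0 → ζ 0 = ζ' 0 → ∀ t, F (t, 0) = N.loop f ζ 0) := by
  refine ⟨⟨fun y => ((N.tube ((1 - y.1) * f y.2 + y.1 * f' y.2)
      (Complex.exp ((1 - (y.1 : ℝ) : ℝ) * ζ y.2 + (y.1 : ℝ) * ζ' y.2)) : Space) : S3),
    OnePoint.continuous_coe.comp (N.continuous_tube (by fun_prop) (by fun_prop))⟩,
    fun x => by simp [loop], fun x => by simp [loop], fun t x => ?_, fun t => ?_, fun h1 h2 t => ?_⟩
  · refine coe_mem_compl_carrier fun k u => h.tube_exp_ne ?_ _ k u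
    rw [Complex.add_re, Complex.re_ofReal_mul, Complex.re_ofReal_mul]
    have h1 := mul_le_mul_of_nonneg_left (hr x) (sub_nonneg.2 t.2.2)
    have h2 := mul_le_mul_of_nonneg_left (hr' x) t.2.1
    linarith
  · have e1 : (1 - (t : ℝ)) * f 1 + t * f' 1 = ((1 - t) * f 0 + t * f' 0) + L.period i := by
      rw [hf, hf']; ring
    have e2 : ((1 - (t : ℝ) : ℝ) : ℂ) * ζ 1 + (t : ℝ) * ζ' 1 =
        ((1 - (t : ℝ) : ℝ) * ζ 0 + (t : ℝ) * ζ' 0) + m * (2 * Real.pi * Complex.I) := by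
      rw [hζ, hζ']; push_cast; ring
    simp only [ContinuousMap.coe_mk]
    rw [e1, e2, tube_add_period_exp]
  · simp only [ContinuousMap.coe_mk, loop, ← h1, ← h2]
    congr 2
    · ring
    · push_cast; ring_nf

end TransverseField

namespace Track

variable {N : L.TransverseField i} {g r : ℝ} (D : Track N g r)

theorem time_mem (t : I) : D.start + t * L.period i ∈ Set.Icc D.start (D.start + L.period i) := by
  have hE := L.period_pos i
  have h1 := mul_nonneg t.2.1 hE.le
  have h2 := mul_le_of_le_one_left hE.le t.2.2
  exact ⟨by linarith, by linarith⟩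

/-- The readable curve as a loop. -/
def readableLoop : C(I, S3) where
  toFun t := ((D.point (D.start + t * L.period i) : Space) : S3)
  continuous_toFun := OnePoint.continuous_coe.comp (D.continuous_point.comp (by fun_prop))

theorem readableLoop_zero : D.readableLoop 0 = ((N.tube D.start D.disp : Space) : S3) := by
  have := D.point_start 0 (s := D.start + (0 : I) * L.period i) (by simp)
  simp only [readableLoop, ContinuousMap.coe_mk, this]

theorem readableLoop_one : D.readableLoop 1 = ((N.tube D.start D.disp : Space) : S3) := by
  have := D.point_start 1 (s := D.start + (1 : I) * L.period i) (by simp)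
  simp only [readableLoop, ContinuousMap.coe_mk, this]

theorem isSimpleClosed (hreg : L.IsRegular) : IsSimpleClosed D.readableLoop := by
  refine ⟨by rw [readableLoop_zero, readableLoop_one], fun s t h => ?_⟩
  have hE := L.period_pos i
  obtain ⟨m, hm⟩ := D.point_injective hreg (D.time_mem s) (D.time_mem t) (OnePoint.coe_injective h)
  have h1 : (t : ℝ) = s + m := by
    have : ((t : ℝ) - s - m) * L.period i = 0 := by linarith
    rcases mul_eq_zero.1 this with h | h
    · linarith
    · exact absurd h hE.ne'
  have h2 : (m : ℝ) ≤ 1 := by linarith [t.2.2, s.2.1]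
  have h3 : (-1 : ℝ) ≤ m := by linarith [t.2.1, s.2.2]
  have h4 : m ≤ 1 := by exact_mod_cast h2
  have h5 : -1 ≤ m := by exact_mod_cast h3
  have h6 : m = 0 ∨ m = 1 ∨ m = -1 := by omega
  rcases h6 with rfl | rfl | rfl
  · left; ext; simpa using h1.symm
  · right; left
    push_cast at h1
    constructor <;> ext
    · have := t.2.2; have := s.2.1; simp only [Set.Icc.coe_zero]; linarith
    · have := t.2.2; have := s.2.1; simp only [Set.Icc.coe_one]; linarith
  · right; right
    push_cast at h1
    constructor <;> ext
    · have := t.2.1; have := s.2.2; simp only [Set.Icc.coe_one]; linarith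
    · have := t.2.1; have := s.2.2; simp only [Set.Icc.coe_zero]; linarith

/-- Where the readable curve meets the projection sphere, it changes its level. -/
theorem exists_of_mem_projSphere {t : I} (h : D.readableLoop t ∈ projSphere) :
    ∃ j < 2 * D.changes.half, D.start + t * L.period i = D.changes.time j ∧
      ∃ ξ, 0 < ξ ∧ ξ ≤ r ∧ D.readableLoop t = (((N.plane (D.changes.time j)
        (-(D.side * D.turn j * (-1) ^ j) * ξ), (0 : ℝ)) : Space) : S3) := by
  have hlev : D.level (D.start + t * L.period i) = 0 := by
    rcases h with h | ⟨p, hp⟩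
    · exact absurd h (OnePoint.coe_ne_infty _)
    · exact congrArg Prod.snd (OnePoint.coe_injective hp)
  obtain ⟨j, hj, hs, ξ, h0, h1, hre⟩ := D.level_eq_zero (D.time_mem t) hlev
  refine ⟨j, hj, hs, ξ, h0, h1, ?_⟩
  simp only [readableLoop, ContinuousMap.coe_mk, point, hlev, hre]
  rw [hs]

theorem isReadable : L.IsReadable D.readableLoop := by
  have hE := L.period_pos i
  refine ⟨fun t => D.point_not_mem_curtain (D.time_mem t), ?_⟩
  have hfin : ((fun j => (D.changes.time j - D.start) / L.period i) ''
      (Set.Iio (2 * D.changes.half))).Finite := (Set.finite_Iio _).image _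
  refine Set.Finite.of_finite_image (f := Subtype.val) (hfin.subset ?_)
    Subtype.val_injective.injOn
  rintro _ ⟨t, ht, rfl⟩
  obtain ⟨j, hj, hs, -⟩ := D.exists_of_mem_projSphere ht
  refine ⟨j, hj, ?_⟩
  simp only [← hs]
  field_simp
  ring

theorem whiteBeforeBlack {col : Set S3 → Colour}
    (hcol : ∀ j < 2 * D.changes.half, ∀ k < 2 * D.changes.half, ∀ ξ ξ', 0 < ξ → ξ ≤ r → 0 < ξ' →
      ξ' ≤ r →
      col (L.regionAt (N.plane (D.changes.time j) (-(D.side * D.turn j * (-1) ^ j) * ξ))) =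
        Colour.white →
      col (L.regionAt (N.plane (D.changes.time k) (-(D.side * D.turn k * (-1) ^ k) * ξ'))) =
        Colour.black → j < k) : L.WhiteBeforeBlack col D.readableLoop := by
  have hE := L.period_pos i
  intro R R' hR hR' hw hb s t hs ht
  have hsub : ∀ R, L.IsRegion R → R ⊆ projSphere := by
    rintro R ⟨x, -, rfl⟩
    exact (connectedComponentIn_subset _ _).trans Set.sdiff_subset
  obtain ⟨j, hj, hsj, ξ, h0, h1, e⟩ := D.exists_of_mem_projSphere (hsub R hR hs)
  obtain ⟨k, hk, htk, ξ', h0', h1', e'⟩ := D.exists_of_mem_projSphere (hsub R' hR' ht)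
  rw [e] at hs
  rw [e'] at ht
  rw [eq_regionAt hR hs] at hw
  rw [eq_regionAt hR' ht] at hb
  have hjk := D.changes.time_lt j k (hcol j hj k hk ξ ξ' h0 h1 h0' h1' hw hb) hk
  rw [← hsj, ← htk] at hjk
  have : (s : ℝ) * L.period i < t * L.period i := by linarith
  exact Subtype.coe_lt_coe.1 (lt_of_mul_lt_mul_right this hE.le)

theorem shift_start (m : ℤ) {s : ℝ} (h : s - m * L.period i = D.start) : D.shift s = D.disp := by
  rw [shift, show s = D.start + m * L.period i by linarith, weight_start]
  simp

/-- The displacement never points against the direction given by the angle, so it winds around the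
component as often as this direction. -/
theorem shift_mul_mem_slitPlane {s : ℝ} :
    D.shift s * Complex.exp (-(D.angle s * Complex.I)) ∈ Complex.slitPlane := by
  have hexp : Complex.exp (D.angle s * Complex.I) * Complex.exp (-(D.angle s * Complex.I)) = 1 := by
    rw [← Complex.exp_add, add_neg_cancel, Complex.exp_zero]
  by_cases hw : D.weight s = 0
  · rw [shift, hw]
    refine Or.inl ?_
    rw [sub_zero, one_mul, Complex.ofReal_zero, zero_mul, add_zero, mul_assoc, hexp, mul_one]
    exact D.size_pos
  · obtain ⟨hcos, hsin⟩ := D.angle_finger hw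
    have hw0 : 0 < D.weight s := lt_of_le_of_ne (D.weight_nonneg s) (Ne.symm hw)
    have hw1 := D.weight_le_one s
    have he : Complex.exp (-(D.angle s * Complex.I)) = -(D.side * Complex.I) := by
      rw [← neg_mul, ← Complex.ofReal_neg]
      apply Complex.ext
      · rw [Complex.exp_ofReal_mul_I_re, Real.cos_neg, hcos]; simp
      · rw [Complex.exp_ofReal_mul_I_im, Real.sin_neg, hsin]; simp
    rw [shift, add_mul, mul_assoc, hexp, mul_one, he]
    by_cases h0 : D.disp.re = 0
    · have h1 := D.start_height h0 D.start (by rw [sub_self, abs_zero]; exact D.size_pos.le)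
      have h4 : (N.tube D.start D.disp).2 - (L.curve i D.start).2 = D.disp.im := by
        simp [TransverseField.tube]
      rw [h4] at h1
      refine Or.inl ?_
      have h5 := mul_pos hw0 h1
      have h6 := mul_nonneg (sub_nonneg.2 hw1) D.size_pos.le
      simp
      nlinarith
    · refine Or.inr ?_
      have hside : D.side ≠ 0 := by rcases D.side_sign with h | h <;> rw [h] <;> norm_num
      simp [h0, hw, hside]

/-- A logarithm of the displacement. -/
theorem exists_log_shift {c : ℂ} (hc : Complex.exp c = D.disp) : ∃ ζ : C(I, ℂ), ζ 0 = c ∧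
    ζ 1 = ζ 0 + D.turns * (2 * Real.pi * Complex.I) ∧
    ∀ t : I, Complex.exp (ζ t) = D.shift (D.start + t * L.period i) := by
  let W : ℝ → ℂ := fun s => Complex.log (D.shift s * Complex.exp (-(D.angle s * Complex.I))) +
    D.angle s * Complex.I
  have hcs := D.continuous_shift
  have hca := D.continuous_angle
  have hW : Continuous W := by
    refine Continuous.add (Continuous.clog (by fun_prop) fun s => D.shift_mul_mem_slitPlane) ?_
    fun_prop
  have hexp : ∀ s, Complex.exp (W s) = D.shift s := fun s => by
    rw [Complex.exp_add, Complex.exp_log (Complex.slitPlane_ne_zero D.shift_mul_mem_slitPlane),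
      mul_assoc, ← Complex.exp_add, neg_add_cancel, Complex.exp_zero, mul_one]
  have h0 : Complex.exp (W D.start) = D.disp := by
    rw [hexp, D.shift_start 0 (by simp)]
  obtain ⟨k, hk⟩ := Complex.exp_eq_exp_iff_exists_int.1 (hc.trans h0.symm)
  refine ⟨⟨fun t => W (D.start + t * L.period i) + k * (2 * Real.pi * Complex.I), by fun_prop⟩,
    ?_, ?_, fun t => ?_⟩
  · simp [hk]
  · have h1 : W (D.start + L.period i) = W D.start + D.turns * (2 * Real.pi * Complex.I) := by
      have hsz := D.size_pos
      have e0 := D.angle_start (s := D.start) (by linarith)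
      have e1 := D.angle_end (s := D.start + L.period i) (by linarith)
      have e2 : Complex.exp (-(D.angle (D.start + L.period i) * Complex.I)) =
          Complex.exp (-(D.angle D.start * Complex.I)) := by
        rw [e0, e1]
        refine Complex.exp_eq_exp_iff_exists_int.2 ⟨-D.turns, ?_⟩
        push_cast; ring
      simp only [W]
      rw [e2, D.shift_start 0 (s := D.start) (by simp),
        D.shift_start 1 (s := D.start + L.period i) (by simp), e0, e1]
      push_cast; ring
    simp only [ContinuousMap.coe_mk, Set.Icc.coe_one, one_mul, Set.Icc.coe_zero, zero_mul, add_zero,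
      h1]
    ring
  · simp only [ContinuousMap.coe_mk]
    rw [Complex.exp_add, Complex.exp_int_mul_two_pi_mul_I, mul_one, hexp]

/-- The parameter along the component. -/
def times : C(I, ℝ) := ⟨fun t => D.start + t * L.period i, by fun_prop⟩

/-- The vertical homotopy from the curve in the tube to the readable curve. -/
theorem basedHomotopicIn (hreg : L.IsRegular) {ζ : C(I, ℂ)}
    (hζ : ∀ t : I, Complex.exp (ζ t) = D.shift (D.start + t * L.period i)) :
    BasedHomotopicIn L.carrierᶜ ((N.tube D.start D.disp : Space) : S3) (N.loop D.times ζ)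
      D.readableLoop := by
  have hcs := D.continuous_shift
  have hcl := D.continuous_level
  have hp : Continuous fun y : I × I => N.plane (D.start + y.2 * L.period i)
      (D.shift (D.start + y.2 * L.period i)).re :=
    N.continuous_plane (by fun_prop) (Complex.continuous_re.comp (by fun_prop))
  have hz : Continuous fun y : I × I => (1 - (y.1 : ℝ)) *
      ((L.curve i (D.start + y.2 * L.period i)).2 + (D.shift (D.start + y.2 * L.period i)).im) +
      y.1 * D.level (D.start + y.2 * L.period i) := by
    have : Continuous fun y : I × I => (D.shift (D.start + y.2 * L.period i)).im :=
      Complex.continuous_im.comp (by fun_prop)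
    fun_prop
  have hbase : ∀ (m : ℤ) (s : ℝ) (t : ℝ), s - m * L.period i = D.start →
      ((N.plane s (D.shift s).re, (1 - t) * ((L.curve i s).2 + (D.shift s).im) + t * D.level s) :
        Space) = N.tube D.start D.disp := by
    intro m s t h
    have h1 := D.point_start m h
    have h2 : D.level s = (N.tube D.start D.disp).2 := congrArg Prod.snd h1
    have h3 : L.curve i s = L.curve i D.start := by
      rw [← h]
      have := L.curve_add_int_mul i s (-m)
      push_cast at this
      rw [neg_mul, ← sub_eq_add_neg] at this
      exact this.symm
    rw [h2, D.shift_start m h, D.plane_start m h, h3]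
    refine Prod.ext rfl ?_
    simp only [TransverseField.tube]; ring
  refine basedHomotopicIn_of ⟨fun y => (((N.plane (D.start + y.2 * L.period i)
      (D.shift (D.start + y.2 * L.period i)).re, (1 - (y.1 : ℝ)) *
      ((L.curve i (D.start + y.2 * L.period i)).2 + (D.shift (D.start + y.2 * L.period i)).im) +
      y.1 * D.level (D.start + y.2 * L.period i)) : Space) : S3),
      OnePoint.continuous_coe.comp (hp.prodMk hz)⟩ ?_ ?_ ?_ ?_
  · intro x
    simp [TransverseField.loop, times, hζ, TransverseField.tube]
  · intro x
    simp [readableLoop, point]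
  · intro t
    constructor
    · simp only [ContinuousMap.coe_mk]
      rw [hbase 0 _ _ (by simp)]
    · simp only [ContinuousMap.coe_mk]
      rw [hbase 1 _ _ (by simp)]
  · intro t x
    exact coe_mem_compl_carrier fun k u => D.homotopy_not_mem hreg (D.time_mem x) t.2 k u

end Track

end PolyLink

namespace PolyLink

variable {n : ℕ} {L : PolyLink n} {i : Fin n}

theorem colour_iff_of_ne {a b : Colour} (h : a ≠ b) : a = Colour.white ↔ ¬ b = Colour.white := by
  cases a <;> cases b <;> simp_all

/-- The colours at the changes of level: the side of the white region alternates. -/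
theorem LevelChanges.exists_white_side {N : L.TransverseField i} {g r a : ℝ} {up : Prop}
    (C : L.LevelChanges i g a up) {col : Set S3 → Colour} (hreg : L.IsRegular)
    (hcol : L.IsCheckerboard col) (hr : N.IsStripRadius r) :
    ∃ v : ℝ, (v = 1 ∨ v = -1) ∧ ∀ j < 2 * C.half, ∀ c, |c| = 1 → ∀ ξ, 0 < ξ → ξ ≤ r →
      (col (L.regionAt (N.plane (C.time j) (c * ξ))) = Colour.white ↔ c * (-1) ^ j = v) := by
  have hr0 := hr.1
  have hself : ∀ j < 2 * C.half, ∀ t ∈ Set.Icc (C.time j) (C.time j), ¬ L.AtCrossing i t := by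
    intro j hj t ht
    rw [Set.Icc_self, Set.mem_singleton_iff] at ht
    rw [ht]; exact C.not_atCrossing j hj
  obtain ⟨v, hv, hvw⟩ : ∃ v : ℝ, (v = 1 ∨ v = -1) ∧
      (col (L.regionAt (N.plane (C.time 0) (1 * r))) = Colour.white ↔ 1 = v) := by
    by_cases h : col (L.regionAt (N.plane (C.time 0) (1 * r))) = Colour.white
    · exact ⟨1, Or.inl rfl, fun _ => rfl, fun _ => h⟩
    · exact ⟨-1, Or.inr rfl, by simp only [h, false_iff]; norm_num⟩
  refine ⟨v, hv, fun j => ?_⟩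
  induction j with
  | zero =>
    intro hj c hc ξ h0 h1
    rw [pow_zero, mul_one, N.regionAt_plane_eq hr hc h0 h1 hr0 le_rfl le_rfl (hself 0 hj)]
    rcases eq_or_eq_neg_of_abs_eq hc with rfl | rfl
    · exact hvw
    · have := N.col_sides hreg hcol hr (c := 1) (by simp) hr0 le_rfl hr0 le_rfl (C.ne_int 0 hj)
        (C.not_atCrossing 0 hj)
      rw [colour_iff_of_ne this.symm, hvw]
      rcases hv with rfl | rfl <;> norm_num
  | succ j ih =>
    intro hj c hc ξ h0 h1
    obtain ⟨s, hs, hs1, hs2, honly⟩ := C.between j hj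
    have := N.col_cross hreg hcol hr hc h0 h1 h0 h1 hs1 hs2 hs honly
    rw [colour_iff_of_ne this.symm, ih (by omega) c hc ξ h0 h1, pow_succ]
    have hx : c * (-1) ^ j = 1 ∨ c * (-1) ^ j = -1 := by
      rcases eq_or_eq_neg_of_abs_eq hc with rfl | rfl <;>
        rcases neg_one_pow_eq_or ℝ j with h | h <;> rw [h] <;> norm_num
    rw [← mul_assoc]
    rcases hx with h | h <;> rcases hv with rfl | rfl <;> rw [h] <;> norm_num

theorem eventually_forall_norm_le {X : Type*} [NormedAddCommGroup X] {p : X → Prop}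
    (h : ∀ᶠ x in nhds (0 : X), p x) :
    ∀ᶠ δ in nhdsWithin (0 : ℝ) (Set.Ioi 0), ∀ x, ‖x‖ ≤ δ → p x := by
  obtain ⟨ε, hε, hball⟩ := Metric.eventually_nhds_iff.1 h
  filter_upwards [Ioo_mem_nhdsGT hε] with δ hδ x hx
  exact hball (by rw [dist_zero_right]; exact hx.trans_lt hδ.2)

/-- There is a readable curve with any given starting point close to the component and any given
small number of turns, which meets the white regions first. -/
theorem IsRegular.exists_track (hreg : L.IsRegular) {col : Set S3 → Colour}
    (hcol : L.IsCheckerboard col) (halt : L.AlternatesAlong i) {N : L.TransverseField i} {g r : ℝ}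
    (thin : N.IsThin g r) {start : ℝ} {disp : ℂ} (hd : disp ≠ 0) (hdr : ‖disp‖ ≤ r)
    (hz : (N.tube start disp).2 ≠ 0) (hc : ((N.tube start disp : Space) : S3) ∉ L.curtain) {m : ℤ}
    (hm : ∀ T : Finset ℝ, (∀ s, s ∈ T ↔ s ∈ Set.Ico start (start + L.period i) ∧
      L.AtCrossing i s ∧ ¬ L.PassesOver i s) → |m| ≤ (T.card : ℤ)) :
    ∃ D : Track N g r, D.start = start ∧ D.disp = disp ∧ D.turns = m ∧
      L.WhiteBeforeBlack col D.readableLoop := by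
  have hE := L.period_pos i
  have hr0 := thin.pos
  obtain ⟨ε, hε, hεz⟩ : ∃ ε : ℝ, (ε = 1 ∨ ε = -1) ∧ 0 < ε * (N.tube start disp).2 := by
    rcases lt_or_gt_of_ne hz with h | h
    · exact ⟨-1, Or.inr rfl, by linarith⟩
    · exact ⟨1, Or.inl rfl, by linarith⟩
  have hcurt : ∀ k u, (L.curve k u).1 = N.plane start disp.re →
      (N.tube start disp).2 ∉ Set.uIcc 0 (L.curve k u).2 := by
    intro k u h hmem
    refine hc ⟨k, u, _, hmem, ?_⟩
    rw [h]; rfl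
  have hup : L.AtCrossing i start → (L.PassesOver i start ↔ ε = 1) := by
    intro hcr
    obtain ⟨k, u, h1, h2, h3⟩ := thin.state start disp hcr hdr
    have h4 := hcurt k u h1
    change _ → _ < (N.tube start disp).2 at h2
    change _ → (N.tube start disp).2 < _ at h3
    rw [Set.mem_uIcc] at h4
    push Not at h4
    constructor
    · intro ho
      rcases hε with h | h
      · exact h
      · rw [h] at hεz
        have := h4.2 (h2 ho).le
        linarith
    · intro h
      rw [h] at hεz
      by_contra ho
      have := h4.1 (by linarith)
      linarith [h3 ho]
  obtain ⟨C⟩ := hreg.exists_levelChanges halt thin.gap start (ε = 1) hup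
  -- the number of turns is bounded by half the number of changes
  have hmC : |m| ≤ (C.half : ℤ) := by
    have hfin : {s | s ∈ Set.Ico start (start + L.period i) ∧ L.AtCrossing i s ∧
        ¬ L.PassesOver i s}.Finite :=
      (hreg.finite_crossings i start (start + L.period i)).subset fun s hs =>
        ⟨Set.Ico_subset_Icc_self hs.1, hs.2.1⟩
    have hT : ∀ s, s ∈ hfin.toFinset ↔ s ∈ Set.Ico start (start + L.period i) ∧
        L.AtCrossing i s ∧ ¬ L.PassesOver i s := fun s => by
      rw [Set.Finite.mem_toFinset]; rfl
    exact (hm _ hT).trans (by exact_mod_cast C.card_le _ hT)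
  -- the direction of the changes: white first, with the total number of turns `m`
  obtain ⟨v, hv, hvw⟩ := C.exists_white_side hreg hcol thin.isStripRadius
  set κ : ℝ := -(ε * v) with hκ
  have hκ1 : κ = 1 ∨ κ = -1 := by
    rcases hε with h | h <;> rcases hv with h' | h' <;> rw [hκ, h, h'] <;> norm_num
  obtain ⟨k, hk, hkm⟩ : ∃ k : ℕ, k ≤ 2 * C.half ∧ ((k : ℝ) - C.half) = κ * m := by
    have h1 := abs_le.1 hmC
    rcases hκ1 with h | h
    · refine ⟨(C.half + m).toNat, by omega, ?_⟩
      have h2 : (((C.half + m).toNat : ℤ) : ℝ) = ((C.half + m : ℤ) : ℝ) := by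
        rw [Int.toNat_of_nonneg (by omega)]
      rw [h]; push_cast at h2 ⊢; linarith
    · refine ⟨(C.half - m).toNat, by omega, ?_⟩
      have h2 : (((C.half - m).toNat : ℤ) : ℝ) = ((C.half - m : ℤ) : ℝ) := by
        rw [Int.toNat_of_nonneg (by omega)]
      rw [h]; push_cast at h2 ⊢; linarith
  let turn : ℕ → ℝ := fun j => if j < k then κ else -κ
  have hκκ : κ * κ = 1 := by rcases hκ1 with h | h <;> rw [h] <;> norm_num
  have hturn : ∀ j, turn j = 1 ∨ turn j = -1 := fun j => by
    simp only [turn]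
    split_ifs
    · exact hκ1
    · rcases hκ1 with h | h <;> rw [h] <;> norm_num
  have hsum : ∑ j ∈ Finset.range (2 * C.half), turn j = 2 * m := by
    rw [← Finset.sum_range_add_sum_Ico _ hk]
    have h1 : ∑ j ∈ Finset.range k, turn j = k * κ := by
      rw [Finset.sum_congr rfl (g := fun _ => κ) fun j hj => if_pos (Finset.mem_range.1 hj)]
      simp
    have h2 : ∑ j ∈ Finset.Ico k (2 * C.half), turn j = (2 * C.half - k) * -κ := by
      rw [Finset.sum_congr rfl (g := fun _ => -κ) fun j hj =>
        if_neg (not_lt.2 (Finset.mem_Ico.1 hj).1)]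
      simp [Nat.cast_sub hk]
    rw [h1, h2]
    have : κ * ((k : ℝ) - C.half) = m := by rw [hkm, ← mul_assoc, hκκ, one_mul]
    linear_combination 2 * this
  -- a height greater than that of all points of the link and of the base point
  obtain ⟨H, hH, hHs⟩ : ∃ H, (∀ k s, |(L.curve k s).2| < H) ∧ |(N.tube start disp).2| < H := by
    have h1 : ∀ k, ∃ M, ∀ s, |(L.curve k s).2| ≤ M := by
      intro k
      obtain ⟨M, hM⟩ := (isCompact_Icc (a := (0 : ℝ)) (b := L.period k)).bddAbove_image
        (f := fun s => |(L.curve k s).2|) (by fun_prop : Continuous _).continuousOn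
      refine ⟨M, fun s => ?_⟩
      obtain ⟨m, hm⟩ := L.exists_int_mem_Icc k s
      have := hM ⟨_, hm, rfl⟩
      simpa only [curve_add_int_mul] using this
    choose M hM using h1
    refine ⟨∑ k, |M k| + |(N.tube start disp).2| + 1, fun k s => ?_, ?_⟩
    · have h2 := Finset.single_le_sum (f := fun k => |M k|) (fun k _ => abs_nonneg _)
        (Finset.mem_univ k)
      have h3 := (hM k s).trans (le_abs_self _)
      have h4 := abs_nonneg (N.tube start disp).2
      linarith
    · have : 0 ≤ ∑ k, |M k| := Finset.sum_nonneg fun k _ => abs_nonneg _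
      linarith
  -- all remaining conditions hold for all small sizes
  have hnot : ∀ (P : ℕ → Prop), (∀ j < 2 * C.half, P j) ↔ ∀ j ∈ Finset.range (2 * C.half), P j :=
    fun P => by simp
  have e1 : ∀ᶠ δ in nhdsWithin (0 : ℝ) (Set.Ioi 0), 0 < δ ∧ δ ≤ r ∧ 2 * δ ≤ N.window := by
    filter_upwards [Ioo_mem_nhdsGT (show (0 : ℝ) < min r (N.window / 2) from
      lt_min hr0 (half_pos N.window_pos))] with δ hδ
    exact ⟨hδ.1, hδ.2.le.trans (min_le_left _ _),
      by linarith [hδ.2.le.trans (min_le_right r (N.window / 2))]⟩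
  have e2 : ∀ᶠ δ in nhdsWithin (0 : ℝ) (Set.Ioi 0), ∀ j < 2 * C.half,
      (∀ k < 2 * C.half, j < k → C.time j + δ ≤ C.time k - δ) ∧
      start + δ ≤ C.time j - δ ∧ C.time j + δ ≤ start + L.period i - δ := by
    have hlt : ∀ {a b : ℝ}, a < b → ∀ᶠ δ in nhdsWithin (0 : ℝ) (Set.Ioi 0), a + δ ≤ b - δ := by
      intro a b h
      filter_upwards [Ioo_mem_nhdsGT (show (0 : ℝ) < (b - a) / 2 by linarith)] with δ hδ
      linarith [hδ.2]
    simp only [hnot]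
    refine (Filter.eventually_all_finset _).2 fun j hj => ?_
    rw [Finset.mem_range] at hj
    have h1 : ∀ᶠ δ in nhdsWithin (0 : ℝ) (Set.Ioi 0), ∀ k ∈ Finset.range (2 * C.half), j < k →
        C.time j + δ ≤ C.time k - δ := by
      refine (Filter.eventually_all_finset _).2 fun k hk => ?_
      rw [Finset.mem_range] at hk
      by_cases hjk : j < k
      · exact (hlt (C.time_lt j k hjk hk)).mono fun δ h _ => h
      · exact Filter.Eventually.of_forall fun δ h => absurd h hjk
    filter_upwards [h1, hlt (C.mem j hj).1, hlt (C.mem j hj).2] with δ a1 a2 a3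
    exact ⟨a1, a2, a3⟩
  have e3 : ∀ᶠ δ in nhdsWithin (0 : ℝ) (Set.Ioi 0), ∀ j < 2 * C.half,
      ∀ x, ‖x‖ ≤ δ → ¬ L.AtCrossing i (C.time j + x) := by
    simp only [hnot]
    refine (Filter.eventually_all_finset _).2 fun j hj => eventually_forall_norm_le ?_
    have ht : Filter.Tendsto (fun x => C.time j + x) (nhds 0) (nhds (C.time j)) := by
      have : Continuous fun x : ℝ => C.time j + x := by fun_prop
      simpa using this.tendsto 0
    filter_upwards [ht.eventually (hreg.eventually_not_atCrossing i (C.time j))] with x hx hcr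
    have := hx hcr
    rw [this] at hcr
    exact C.not_atCrossing j (Finset.mem_range.1 hj) hcr
  have hts : Filter.Tendsto (fun x => start + x) (nhds 0) (nhds start) := by
    have : Continuous fun x : ℝ => start + x := by fun_prop
    simpa using this.tendsto 0
  have e4 : ∀ᶠ δ in nhdsWithin (0 : ℝ) (Set.Ioi 0), ∀ x, ‖x‖ ≤ δ →
      (L.AtCrossing i (start + x) → start + x = start) ∧
      (disp.re = 0 → 0 < ε * ((N.tube start disp).2 - (L.curve i (start + x)).2)) := by
    refine eventually_forall_norm_le ?_
    have h1 : ∀ᶠ x in nhds (0 : ℝ), disp.re = 0 →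
        0 < ε * ((N.tube start disp).2 - (L.curve i (start + x)).2) := by
      by_cases h0 : disp.re = 0
      · have h2 : 0 < ε * ((N.tube start disp).2 - (L.curve i start).2) := by
          have h3 := hcurt i start (by rw [h0, N.plane_zero])
          rw [Set.mem_uIcc] at h3
          push Not at h3
          rcases hε with h | h <;> rw [h] at hεz ⊢
          · have := h3.1 (by linarith); linarith
          · by_contra hcon
            have := h3.2 (by linarith); linarith
        have hcont : Continuous fun x =>
            ε * ((N.tube start disp).2 - (L.curve i (start + x)).2) := by fun_prop
        have h4 := hcont.continuousAt.eventually (lt_mem_nhds (show 0 < ε *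
          ((N.tube start disp).2 - (L.curve i (start + 0)).2) by rwa [add_zero]))
        exact h4.mono fun x h _ => h
      · exact Filter.Eventually.of_forall fun x h => absurd h h0
    filter_upwards [hts.eventually (hreg.eventually_not_atCrossing i start), h1] with x a1 a2
    exact ⟨a1, a2⟩
  have e5 : ∀ᶠ δ in nhdsWithin (0 : ℝ) (Set.Ioi 0), ∀ j < 2 * C.half, ∀ k < 2 * C.half, j ≠ k →
      ∀ x : (ℝ × ℝ) × (ℝ × ℝ), ‖x‖ ≤ δ →
      N.plane (C.time j + x.1.1) x.2.1 ≠ N.plane (C.time k + x.1.2) x.2.2 := by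
    simp only [hnot]
    refine (Filter.eventually_all_finset _).2 fun j hj => (Filter.eventually_all_finset _).2
      fun k hk => ?_
    rw [Finset.mem_range] at hj hk
    by_cases hjk : j = k
    · exact Filter.Eventually.of_forall fun δ h => absurd hjk h
    refine (eventually_forall_norm_le (X := (ℝ × ℝ) × (ℝ × ℝ)) (p := fun x =>
      N.plane (C.time j + x.1.1) x.2.1 ≠ N.plane (C.time k + x.1.2) x.2.2) ?_).mono fun δ h _ => h
    refine (isOpen_ne_fun (N.continuous_plane (by fun_prop) (by fun_prop))
      (N.continuous_plane (by fun_prop) (by fun_prop))).mem_nhds ?_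
    simp only [Set.mem_ofPred_eq, Prod.fst_zero, Prod.snd_zero, add_zero, N.plane_zero]
    intro heq
    by_cases hcv : L.curve i (C.time j) = L.curve i (C.time k)
    · obtain ⟨m, hm⟩ := L.curve_eq_iff.1 hcv
      have h1 := C.mem j hj
      have h2 := C.mem k hk
      have hm1 : (m : ℝ) < 1 := by
        by_contra hc; rw [not_lt] at hc; nlinarith [h1.1, h2.2]
      have hm2 : (-1 : ℝ) < m := by
        by_contra hc; rw [not_lt] at hc; nlinarith [h1.2, h2.1]
      have hm3 : m < 1 := by exact_mod_cast hm1
      have hm4 : -1 < m := by exact_mod_cast hm2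
      have hm5 : m = 0 := by omega
      rw [hm5] at hm
      rcases lt_or_gt_of_ne hjk with h | h
      · have := C.time_lt j k h hk; simp at hm; linarith
      · have := C.time_lt k j h hj; simp at hm; linarith
    · exact C.not_atCrossing j hj ⟨i, C.time k, heq, hcv⟩
  have e6 : ∀ᶠ δ in nhdsWithin (0 : ℝ) (Set.Ioi 0), ∀ j < 2 * C.half,
      ∀ x : (ℝ × ℝ) × ℝ, ‖x‖ ≤ δ → ∀ a ∈ Set.Icc (0 : ℝ) 1,
      N.plane (start + x.1.1) (a * disp.re) ≠ N.plane (C.time j + x.1.2) x.2 := by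
    simp only [hnot]
    refine (Filter.eventually_all_finset _).2 fun j hj => ?_
    rw [Finset.mem_range] at hj
    refine eventually_forall_norm_le (X := (ℝ × ℝ) × ℝ) (p := fun x => ∀ a ∈ Set.Icc (0 : ℝ) 1,
      N.plane (start + x.1.1) (a * disp.re) ≠ N.plane (C.time j + x.1.2) x.2) ?_
    refine isCompact_Icc.eventually_forall_of_forall_eventually
      (P := fun (x : (ℝ × ℝ) × ℝ) (a : ℝ) =>
        N.plane (start + x.1.1) (a * disp.re) ≠ N.plane (C.time j + x.1.2) x.2) fun a ha => ?_
    refine (isOpen_ne_fun (N.continuous_plane (by fun_prop) (by fun_prop))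
      (N.continuous_plane (by fun_prop) (by fun_prop))).mem_nhds ?_
    simp only [Set.mem_ofPred_eq, Prod.fst_zero, Prod.snd_zero, add_zero, N.plane_zero]
    intro heq
    have ha' : |a * disp.re| ≤ r := by
      rw [abs_mul, abs_of_nonneg ha.1]
      exact (mul_le_of_le_one_left (abs_nonneg _) ha.2).trans
        ((Complex.abs_re_le_norm _).trans hdr)
    rcases thin.strip start i (C.time j) _ ha' heq with ⟨-, -, m, hm⟩ | ⟨u₀, hu₀, hlt⟩
    · have h1 := C.mem j hj
      have hm1 : (m : ℝ) < 1 := by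
        by_contra hc; rw [not_lt] at hc; nlinarith [h1.2]
      have hm2 : (0 : ℝ) < m := by
        by_contra hc; rw [not_lt] at hc; nlinarith [h1.1]
      have hm3 : m < 1 := by exact_mod_cast hm1
      have hm4 : 0 < m := by exact_mod_cast hm2
      omega
    · have := C.apart hu₀.atCrossing j hj u₀ hu₀.symm.atCrossing
      linarith
  obtain ⟨δ, ⟨hδ0, hδr, hδw⟩, h2, h3, h4, h5, h6⟩ :=
    (e1.and (e2.and (e3.and (e4.and (e5.and e6))))).exists
  let D : Track N g r :=
    { thin := thin, start := start, disp := disp, disp_ne := hd, norm_disp := hdr, side := ε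
      side_sign := hε, side_pos := hεz, not_mem_curtain := hc, changes := C, turn := turn
      turn_sign := hturn, turns := m, sum_turn := hsum, height := H, lt_height := hH
      start_lt_height := hHs, size := δ, size_pos := hδ0, size_le := hδr, size_window := hδw
      changes_apart := fun j k hjk hk => (h2 j (hjk.trans hk)).1 k hk hjk
      changes_start := fun j hj => (h2 j hj).2
      changes_crossing := fun j hj s hs => by
        have := h3 j hj (s - C.time j) hs
        rwa [add_sub_cancel] at this
      start_crossing := fun s hs => by
        have := (h4 (s - start) hs).1
        rwa [add_sub_cancel] at this
      start_height := fun h0 s hs => by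
        have := (h4 (s - start) hs).2 h0
        rwa [add_sub_cancel] at this
      changes_disjoint := fun j hj k hk hjk x x' ξ ξ' hx hx' hξ hξ' =>
        h5 j hj k hk hjk ((x, x'), (ξ, ξ')) (norm_prod_le_iff.2
          ⟨norm_prod_le_iff.2 ⟨hx, hx'⟩, norm_prod_le_iff.2 ⟨hξ, hξ'⟩⟩)
      start_disjoint := fun j hj x x' ξ a ha hx hx' hξ =>
        h6 j hj ((x, x'), ξ) (norm_prod_le_iff.2 ⟨norm_prod_le_iff.2 ⟨hx, hx'⟩, hξ⟩) a ha }
  refine ⟨D, rfl, rfl, rfl, D.whiteBeforeBlack ?_⟩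
  -- the component is passed on the white side exactly at the first `k` changes
  have hcolour : ∀ j < 2 * C.half, ∀ ξ, 0 < ξ → ξ ≤ r →
      (col (L.regionAt (N.plane (C.time j) (-(ε * turn j * (-1) ^ j) * ξ))) = Colour.white ↔
        j < k) := by
    intro j hj ξ h0 h1
    have hpow : ((-1 : ℝ) ^ j) * (-1) ^ j = 1 := by rw [← mul_pow]; norm_num
    rw [hvw j hj _ ?_ ξ h0 h1]
    · have h7 : -(ε * turn j * (-1) ^ j) * (-1) ^ j = -(ε * turn j) := by
        linear_combination -(ε * turn j) * hpow
      rw [h7]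
      by_cases hjk : j < k
      · simp only [turn, if_pos hjk, hjk, iff_true, hκ]
        rcases hε with h | h <;> rw [h] <;> ring
      · simp only [turn, if_neg hjk, hjk, iff_false, hκ]
        rcases hε with h | h <;> rcases hv with h' | h' <;> rw [h, h'] <;> norm_num
    · have ht : |turn j| = 1 := by rcases hturn j with h | h <;> rw [h] <;> simp
      have he : |ε| = 1 := by rcases hε with h | h <;> rw [h] <;> simp
      rw [abs_neg, abs_mul, abs_mul, ht, he, abs_pow, abs_neg, abs_one, one_pow]; norm_num
  intro j hj l hl ξ ξ' a0 a1 b0 b1 hw hb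
  have hjk := (hcolour j hj ξ a0 a1).1 hw
  have hlk : ¬ l < k := fun h => by
    have hb' : col (L.regionAt (N.plane (C.time l) (-(ε * turn l * (-1) ^ l) * ξ'))) =
      Colour.black := hb
    rw [(hcolour l hl ξ' b0 b1).2 h] at hb'
    exact Colour.noConfusion hb'
  omega

/-- A loop in a thin tube which runs around once along the component and does not link it is
homotopic to a readable curve that meets the white regions first. -/
theorem IsRegular.exists_readable (hreg : L.IsRegular) {col : Set S3 → Colour}
    (hcol : L.IsCheckerboard col) (halt : L.AlternatesAlong i) {N : L.TransverseField i} {g r : ℝ}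
    (thin : N.IsThin g r) {f : C(I, ℝ)} {ζ : C(I, ℂ)} {m : ℤ} (hf : f 1 = f 0 + L.period i)
    (hζ : ζ 1 = ζ 0 + m * (2 * Real.pi * Complex.I)) (hr : ∀ t, (ζ t).re ≤ Real.log r)
    (hlink : pathChange (L.linkFun i) (N.loop f ζ) = 0) :
    (N.loop f ζ 0 ∉ projSphere → N.loop f ζ 0 ∉ L.curtain → ∃ J : C(I, S3), IsSimpleClosed J ∧
      L.IsReadable J ∧ L.WhiteBeforeBlack col J ∧
      BasedHomotopicIn L.carrierᶜ (N.loop f ζ 0) (N.loop f ζ) J) ∧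
    ∃ J : C(I, S3), IsSimpleClosed J ∧ L.IsReadable J ∧ L.WhiteBeforeBlack col J ∧
      FreelyHomotopicIn L.carrierᶜ (N.loop f ζ) J := by
  have hbound : ∀ (a : ℝ) (T : Finset ℝ), (∀ s, s ∈ T ↔ s ∈ Set.Ico a (a + L.period i) ∧
      L.AtCrossing i s ∧ ¬ L.PassesOver i s) → |m| ≤ (T.card : ℤ) := by
    intro a T hT
    refine N.abs_le_of_logChange_eq_zero hreg thin.pos thin.tube_ne
      (f := fun t => f (Set.projIcc 0 1 zero_le_one t))
          (ζ := fun t => ζ (Set.projIcc 0 1 zero_le_one t))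
      (by fun_prop) (by fun_prop) (fun t _ => hr _) ?_ ?_ hlink hT
    · simpa using hf
    · simpa using hζ
  have hlogr : ∀ {s : ℝ} {z : ℂ} {D : Track N g r}, Complex.exp z = D.shift s →
      z.re ≤ Real.log r := by
    intro s z D h
    refine (Real.le_log_iff_exp_le thin.pos).2 ?_
    rw [← Complex.norm_exp, h]
    exact D.norm_shift_le s
  refine ⟨fun h1 h2 => ?_, ?_⟩
  · obtain ⟨D, hD1, hD2, hD3, hD4⟩ := hreg.exists_track hcol halt thin (start := f 0)
      (disp := Complex.exp (ζ 0)) (m := m) (Complex.exp_ne_zero _)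
      (by rw [Complex.norm_exp]; exact (Real.le_log_iff_exp_le thin.pos).1 (hr 0))
      (fun h0 => h1 (Or.inr ⟨(N.tube (f 0) (Complex.exp (ζ 0))).1, by
        simp only [TransverseField.loop, ContinuousMap.coe_mk]
        rw [← h0]⟩)) h2 (hbound _)
    obtain ⟨ζ', hζ0, hζ1, hζ'⟩ := D.exists_log_shift hD2.symm
    rw [hD3] at hζ1
    obtain ⟨F, hF0, hF1, hFA, hFc, hFb⟩ := thin.exists_loop_homotopy (f' := D.times) (ζ' := ζ') hf
      (by simp [Track.times]) hζ hζ1 hr fun t => hlogr (hζ' t)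
    have hb := hFb (by simp [Track.times, hD1]) hζ0.symm
    have hq : ((N.tube D.start D.disp : Space) : S3) = N.loop f ζ 0 := by
      rw [hD1, hD2]; rfl
    have hJ := D.basedHomotopicIn hreg hζ'
    rw [hq] at hJ
    refine ⟨D.readableLoop, D.isSimpleClosed hreg, D.isReadable, hD4, ?_⟩
    exact (basedHomotopicIn_of F hF0 hF1 (fun t => ⟨hb t, (hFc t).symm.trans (hb t)⟩) hFA).trans hJ
  · -- a base point on the vertical line through a point of the component
    obtain ⟨s, -, hint, hs⟩ := exists_generic_time hreg i (zero_lt_one' ℝ)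
    obtain ⟨η, hη0, hηr, hη1, hη2⟩ : ∃ η : ℝ, η ≠ 0 ∧ |η| ≤ r ∧ (L.curve i s).2 + η ≠ 0 ∧
        (L.curve i s).2 + η ∉ Set.uIcc 0 (L.curve i s).2 := by
      have h0 := thin.pos
      rcases le_or_gt 0 (L.curve i s).2 with h | h
      · refine ⟨r, h0.ne', (abs_of_pos h0).le, by linarith, ?_⟩
        rw [Set.uIcc_of_le h]
        exact fun h' => by linarith [h'.2]
      · refine ⟨-r, by linarith, by rw [abs_neg, abs_of_pos h0], by linarith, ?_⟩
        rw [Set.uIcc_of_ge h.le]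
        exact fun h' => by linarith [h'.1]
    have htube : N.tube s (η * Complex.I) = ((L.curve i s).1, (L.curve i s).2 + η) := by
      simp [TransverseField.tube, N.plane_zero]
    obtain ⟨D, -, -, hD3, hD4⟩ := hreg.exists_track hcol halt thin (start := s)
      (disp := η * Complex.I) (m := m) (by simpa using hη0) (by simpa using hηr)
      (by rw [htube]; exact hη1) (by
        rw [htube]
        rintro ⟨k, u, z, hz, heq⟩
        have heq := OnePoint.coe_injective heq
        have hp : (L.curve i s).1 = (L.curve k u).1 := (Prod.ext_iff.1 heq).1
        have hz' : (L.curve i s).2 + η = z := (Prod.ext_iff.1 heq).2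
        by_cases hcu : L.curve i s = L.curve k u
        · rw [← hcu, ← hz'] at hz
          exact hη2 hz
        · exact hs ⟨k, u, hp, hcu⟩) (hbound _)
    obtain ⟨ζ', -, hζ1, hζ'⟩ := D.exists_log_shift (Complex.exp_log D.disp_ne)
    rw [hD3] at hζ1
    obtain ⟨F, hF0, hF1, hFA, hFc, -⟩ := thin.exists_loop_homotopy (f' := D.times) (ζ' := ζ') hf
      (by simp [Track.times]) hζ hζ1 hr fun t => hlogr (hζ' t)
    refine ⟨D.readableLoop, D.isSimpleClosed hreg, D.isReadable, hD4, ?_⟩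
    exact (freelyHomotopicIn_of F hF0 hF1 hFc hFA).trans (D.basedHomotopicIn hreg hζ').freely

end PolyLink

/-! ### Longitudes as loops in a thin tube -/

/-- On a compact set, a map to a Hausdorff space is continuous as soon as its composition with a
parametrization is. -/
theorem continuousOn_range_of_comp {K X Y : Type*} [TopologicalSpace K] [TopologicalSpace X]
    [TopologicalSpace Y] [CompactSpace K] [T2Space X] {p : K → X} (hp : Continuous p) {φ : K → Y}
    (hφ : Continuous φ) {G : X → Y} (hG : ∀ k, G (p k) = φ k) : ContinuousOn G (Set.range p) := by
  rw [continuousOn_iff_continuous_domRestrict]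
  have hq : Topology.IsQuotientMap (Set.rangeFactorization p) :=
    .of_surjective_continuous Set.rangeFactorization_surjective
      (hp.subtype_mk _)
  rw [hq.continuous_iff]
  have : (Set.range p).domRestrict G ∘ Set.rangeFactorization p = φ := funext hG
  rwa [this]

theorem pathChange_of_freelyHomotopicIn {X : Type*} [TopologicalSpace X] {A : Set X} {G : X → ℂ}
    (hG : ContinuousOn G A) (h0 : ∀ x ∈ A, G x ≠ 0) {f g : C(I, X)}
    (h : FreelyHomotopicIn A f g) : pathChange G f = pathChange G g := by
  obtain ⟨F⟩ := h
  have hc : Continuous fun y : ℝ × ℝ =>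
      F (Set.projIcc 0 1 zero_le_one y.1, Set.projIcc 0 1 zero_le_one y.2) :=
    (map_continuous F).comp (by fun_prop)
  have hA : ∀ t x, F (t, x) ∈ A := fun t x => (F.prop' t).2 x
  have hcl : ∀ t, F (t, 0) = F (t, 1) := fun t => (F.prop' t).1
  have := logChange_homotopy (a := 0) (b := 1) zero_le_one (H := fun y : ℝ × ℝ =>
      G (F (Set.projIcc 0 1 zero_le_one y.1, Set.projIcc 0 1 zero_le_one y.2)))
    (hG.comp_continuous hc fun y => hA _ _).continuousOn (fun y _ => h0 _ (hA _ _))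
    (fun t _ => by 
      simp only [Set.projIcc_left, Set.projIcc_right]
      exact congrArg G (hcl _))
  simpa [pathChange] using this

namespace PolyLink

variable {n : ℕ} {L : PolyLink n} {i : Fin n}

/-- `2πi` times the fraction of a period, so that `exp` of it is a function on the component. -/
def timeAngle (L : PolyLink n) (i : Fin n) (s : ℝ) : ℂ := s / L.period i * (2 * Real.pi * Complex.I)

theorem exp_timeAngle_eq_iff {s s' : ℝ} : Complex.exp (L.timeAngle i s) =
    Complex.exp (L.timeAngle i s') ↔
    ∃ m : ℤ, s = s' + m * L.period i := by
  have hE : (L.period i : ℂ) ≠ 0 := by exact_mod_cast (L.period_pos i).ne'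
  rw [Complex.exp_eq_exp_iff_exists_int]
  refine exists_congr fun m => ?_
  unfold timeAngle
  rw [← add_mul, mul_left_inj' Complex.two_pi_I_ne_zero, div_add' _ _ _ hE, div_left_inj' hE]
  exact_mod_cast Iff.rfl

namespace TransverseField

variable (N : L.TransverseField i)

/-- The closed tube of radius `r` around the component, in the 3-sphere. -/
def thickTube (r : ℝ) : Set S3 := {x | ∃ s w, ‖w‖ ≤ r ∧ ((N.tube s w : Space) : S3) = x}

theorem exists_isOpen_subset_thickTube {r : ℝ} (hr : 0 < r) :
    ∃ U : Set S3, IsOpen U ∧ L.component i ⊆ U ∧ U ⊆ N.thickTube r := by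
  obtain ⟨ε, hε, h⟩ := N.exists_nbhd_subset_tube hr
  refine ⟨(fun x : Space => (x : S3)) '' ⋃ s, Metric.ball (L.curve i s) ε, ?_, ?_, ?_⟩
  · exact OnePoint.isOpenEmbedding_coe.isOpenMap _ (isOpen_iUnion fun _ => Metric.isOpen_ball)
  · rintro _ ⟨s, rfl⟩
    exact ⟨_, Set.mem_iUnion.2 ⟨s, Metric.mem_ball_self hε⟩, rfl⟩
  · rintro _ ⟨x, hx, rfl⟩
    obtain ⟨s₀, hs₀⟩ := Set.mem_iUnion.1 hx
    obtain ⟨s, w, hw, hx⟩ := h s₀ x (by rwa [← dist_eq_norm])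
    exact ⟨s, w, hw, by rw [hx]⟩

variable {N} {g r : ℝ}

/-- The angle and the displacement are continuous coordinates of a thin tube. -/
theorem IsThin.exists_coordinates (thin : N.IsThin g r) : ∃ A W : S3 → ℂ,
    ContinuousOn A (N.thickTube r) ∧ ContinuousOn W (N.thickTube r) ∧ ∀ s w, ‖w‖ ≤ r →
      A (N.tube s w : Space) = Complex.exp (L.timeAngle i s) ∧ W (N.tube s w : Space) = w := by
  classical
  let A : S3 → ℂ := fun x => if h : x ∈ N.thickTube r then Complex.exp (L.timeAngle i h.choose)
      else 1
  let W : S3 → ℂ := fun x => if h : x ∈ N.thickTube r then h.choose_spec.choose else 1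
  have key : ∀ s w, ‖w‖ ≤ r →
      A (N.tube s w : Space) = Complex.exp (L.timeAngle i s) ∧ W (N.tube s w : Space) = w := by
    intro s w hw
    have hx : ((N.tube s w : Space) : S3) ∈ N.thickTube r := ⟨s, w, hw, rfl⟩
    obtain ⟨h1, h2⟩ := hx.choose_spec.choose_spec
    obtain ⟨h3, h4⟩ := thin.embedded _ _ _ _ hw h1 (OnePoint.coe_injective h2.symm)
    simp only [A, W, dif_pos hx]
    exact ⟨exp_timeAngle_eq_iff.2 h4, h3.symm⟩
  let p : Set.Icc 0 (L.period i) × Metric.closedBall (0 : ℂ) r → S3 :=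
    fun y => ((N.tube y.1 y.2 : Space) : S3)
  have hp : Continuous p :=
    OnePoint.continuous_coe.comp (N.continuous_tube (by fun_prop) (by fun_prop))
  have hr : N.thickTube r = Set.range p := by
    ext x
    constructor
    · rintro ⟨s, w, hw, rfl⟩
      obtain ⟨m, hm⟩ := L.exists_int_mem_Icc i s
      refine ⟨(⟨_, hm⟩, ⟨w, mem_closedBall_zero_iff.2 hw⟩), ?_⟩
      simp only [p, N.tube_add_int_mul]
    · rintro ⟨y, rfl⟩
      exact ⟨_, _, mem_closedBall_zero_iff.1 y.2.2, rfl⟩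
  refine ⟨A, W, ?_, ?_, key⟩
  · rw [hr]
    exact continuousOn_range_of_comp hp (φ := fun y => Complex.exp (L.timeAngle i y.1))
      (by unfold timeAngle; fun_prop) fun y => (key _ _ (mem_closedBall_zero_iff.1 y.2.2)).1
  · rw [hr]
    exact continuousOn_range_of_comp hp (φ := fun y => (y.2 : ℂ)) (by fun_prop)
      fun y => (key _ _ (mem_closedBall_zero_iff.1 y.2.2)).2

/-- A loop in a thin tube which misses the component and runs around once has a time along the
component and a logarithm of the displacement. -/
theorem IsThin.exists_eq_loop (thin : N.IsThin g r) {A W : S3 → ℂ}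
    (hA : ContinuousOn A (N.thickTube r)) (hW : ContinuousOn W (N.thickTube r))
    (hAW : ∀ s w, ‖w‖ ≤ r → A (N.tube s w : Space) = Complex.exp (L.timeAngle i s) ∧
      W (N.tube s w : Space) = w)
    {l : C(I, S3)} (hcl : l 0 = l 1) (hl : ∀ t, l t ∈ N.thickTube r)
    (hli : ∀ t, l t ∉ L.component i) (hdeg : pathChange A l = 2 * Real.pi * Complex.I) :
    ∃ (f : C(I, ℝ)) (ζ : C(I, ℂ)) (m : ℤ), f 1 = f 0 + L.period i ∧
      ζ 1 = ζ 0 + m * (2 * Real.pi * Complex.I) ∧ (∀ t, (ζ t).re ≤ Real.log r) ∧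
      N.loop f ζ = l := by
  have hE := L.period_pos i
  have hEc : (L.period i : ℂ) ≠ 0 := by exact_mod_cast hE.ne'
  choose s w hw hx using hl
  have hW0 : ∀ t, W (l t) = w t := fun t => by rw [← hx t]; exact (hAW _ _ (hw t)).2
  have hA0 : ∀ t, A (l t) = Complex.exp (L.timeAngle i (s t)) := fun t => by
    rw [← hx t]; exact (hAW _ _ (hw t)).1
  have hw0 : ∀ t, w t ≠ 0 := fun t h => hli t ⟨s t, by rw [← hx t, h, N.tube_zero]⟩
  have hlc : Continuous fun t => l (Set.projIcc 0 1 zero_le_one t) :=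
    (map_continuous l).comp continuous_projIcc
  have hlT : ∀ t, l t ∈ N.thickTube r := fun t => ⟨s t, w t, hw t, hx t⟩
  obtain ⟨a, ha, ha'⟩ := exists_log_Icc (a := 0) (b := 1)
    (hA.comp_continuous hlc fun t => hlT _).continuousOn
    (fun t _ => (hA0 _).trans_ne (Complex.exp_ne_zero _))
  obtain ⟨z, hz, hz'⟩ := exists_log_Icc (a := 0) (b := 1)
    (hW.comp_continuous hlc fun t => hlT _).continuousOn
    (fun t _ => (hW0 _).trans_ne (hw0 _))
  have hac : Continuous fun t : I => a t := ha.comp_continuous continuous_subtype_val fun t => t.2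
  have hzc : Continuous fun t : I => z t := hz.comp_continuous continuous_subtype_val fun t => t.2
  have ha1 : ∀ t : I, Complex.exp (a t) = Complex.exp (L.timeAngle i (s t)) := fun t => by
    rw [ha' t t.2, Function.comp_apply, Set.projIcc_val, hA0]
  have hz1 : ∀ t : I, Complex.exp (z t) = w t := fun t => by
    rw [hz' t t.2, Function.comp_apply, Set.projIcc_val, hW0]
  -- the time: the logarithm of the angle is purely imaginary
  let f : C(I, ℝ) := ⟨fun t => (a t).im / (2 * Real.pi) * L.period i,
    ((Complex.continuous_im.comp hac).div_const _).mul_const _⟩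
  have hfa : ∀ t : I, a t = L.timeAngle i (f t) := by
    intro t
    obtain ⟨k, hk⟩ := Complex.exp_eq_exp_iff_exists_int.1 (ha1 t)
    have hre : (a t).re = 0 := by
      rw [hk]; unfold timeAngle
      have : (s t : ℂ) / L.period i = ((s t / L.period i : ℝ) : ℂ) := by push_cast; rfl
      rw [this]
      simp
    have hpi := Real.pi_ne_zero
    refine Complex.ext ?_ ?_
    · rw [hre]
      have : L.timeAngle i (f t) = ((f t / L.period i * (2 * Real.pi) : ℝ) : ℂ) * Complex.I := by
        unfold timeAngle; push_cast; ring
      rw [this, Complex.re_ofReal_mul, Complex.I_re, mul_zero]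
    · have : L.timeAngle i (f t) = ((f t / L.period i * (2 * Real.pi) : ℝ) : ℂ) * Complex.I := by
        unfold timeAngle; push_cast; ring
      rw [this, Complex.im_ofReal_mul, Complex.I_im, mul_one]
      simp only [f, ContinuousMap.coe_mk]
      field_simp
  let ζ : C(I, ℂ) := ⟨fun t => z t, hzc⟩
  obtain ⟨m, hm⟩ : ∃ m : ℤ, z (1 : I) = z (0 : I) + m * (2 * Real.pi * Complex.I) := by
    refine Complex.exp_eq_exp_iff_exists_int.1 ?_
    rw [hz1, hz1, ← hW0, ← hW0, hcl]
  refine ⟨f, ζ, m, ?_, hm, fun t => ?_, ?_⟩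
  · have h1 : pathChange A l = a 1 - a 0 := logChange_eq zero_le_one ha ha'
    have h2 := hfa 0
    have h3 := hfa 1
    rw [hdeg, show a 1 = _ from h3, show a 0 = _ from h2] at h1
    unfold timeAngle at h1
    rw [← sub_mul, eq_comm, mul_eq_right₀ Complex.two_pi_I_ne_zero, ← sub_div,
        div_eq_one_iff_eq hEc] at h1
    have h4 : f 1 - f 0 = L.period i := by exact_mod_cast h1
    linarith
  · refine (Real.le_log_iff_exp_le thin.pos).2 ?_
    rw [← Complex.norm_exp, show Complex.exp (ζ t) = w t from hz1 t]
    exact hw t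
  · ext1 t
    obtain ⟨k, hk⟩ := exp_timeAngle_eq_iff.1 ((congrArg Complex.exp (hfa t)).symm.trans (ha1 t))
    rw [← hx t]
    simp only [loop, ContinuousMap.coe_mk]
    rw [show Complex.exp (ζ t) = w t from hz1 t, hk, N.tube_add_int_mul]

end TransverseField

/-- The shrinking of a solid torus towards its core. -/
def shrink : C(I × SolidTorus, SolidTorus) where
  toFun y := (y.2.1, ⟨(y.1 : ℝ) • (y.2.2 : ℂ), mem_closedBall_zero_iff.2 (by
    rw [norm_smul, Real.norm_of_nonneg y.1.2.1]
    exact mul_le_one₀ y.1.2.2 (norm_nonneg _) (mem_closedBall_zero_iff.1 y.2.2.2))⟩)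
  continuous_toFun := by
    refine Continuous.prodMk (by fun_prop) (Continuous.subtype_mk (by fun_prop) _)

theorem shrink_one (p : SolidTorus) : shrink (1, p) = p := by
  refine Prod.ext rfl (Subtype.ext ?_)
  simp [shrink]

theorem shrink_core {p : SolidTorus} (hp : (p.2 : ℂ) = 0) (t : I) : shrink (t, p) = p := by
  refine Prod.ext rfl (Subtype.ext ?_)
  simp [shrink, hp]

variable {h : C(SolidTorus, S3)}

theorem IsTube.mem_component_iff (hh : L.IsTube i h) {p : SolidTorus} :
    h p ∈ L.component i ↔ (p.2 : ℂ) = 0 := by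
  rw [← hh.2.1]
  refine ⟨?_, fun hp => ⟨p, hp, rfl⟩⟩
  rintro ⟨q, hq, hqp⟩
  rwa [← hh.1 hqp]

theorem IsTube.mem_compl_carrier (hh : L.IsTube i h) {p : SolidTorus} (hp : (p.2 : ℂ) ≠ 0) :
    h p ∈ L.carrierᶜ := by
  intro hx
  obtain ⟨k, hk⟩ := Set.mem_iUnion.1 hx
  by_cases hki : k = i
  · subst hki
    exact hp (hh.mem_component_iff.1 hk)
  · exact Set.disjoint_left.1 (hh.2.2 k hki) ⟨p, rfl⟩ hk

theorem IsTube.exists_shrink (hh : L.IsTube i h) {U : Set S3} (hU : IsOpen U)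
    (hi : L.component i ⊆ U) : ∃ t : I, t ≠ 0 ∧ ∀ p, h (shrink (t, p)) ∈ U := by
  have hev : ∀ᶠ t in nhds (0 : I), ∀ p ∈ (Set.univ : Set SolidTorus), h (shrink (t, p)) ∈ U := by
    refine isCompact_univ.eventually_forall_of_forall_eventually fun p _ => ?_
    refine (((map_continuous h).comp (map_continuous shrink)).isOpen_preimage _ hU).mem_nhds ?_
    refine hi (hh.mem_component_iff.2 ?_)
    simp [shrink]
  have hne : (nhdsWithin (0 : I) (Set.Ioi 0)).NeBot := nhdsGT_neBot_of_exists_gt ⟨1, zero_lt_one⟩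
  obtain ⟨t, ht, ht0⟩ := ((hev.filter_mono
    (nhdsWithin_le_nhds (s := Set.Ioi (0 : I)))).and self_mem_nhdsWithin).exists
  exact ⟨t, (ne_of_gt ht0), fun p => ht p trivial⟩

/-- Shrinking the tubular neighbourhood turns a longitude into a loop in a thin tube which runs
around once and does not link the component. -/
theorem IsLongitude.exists_loop (hh : L.IsTube i h) {l : C(I, S3)} (hl : L.IsLongitude i h l)
    {N : L.TransverseField i} {g r : ℝ} (thin : N.IsThin g r) {t : I} (ht : t ≠ 0)
    (hT : ∀ p, h (shrink (t, p)) ∈ N.thickTube r) :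
    ∃ (f : C(I, ℝ)) (ζ : C(I, ℂ)) (m : ℤ), f 1 = f 0 + L.period i ∧
      ζ 1 = ζ 0 + m * (2 * Real.pi * Complex.I) ∧ (∀ x, (ζ x).re ≤ Real.log r) ∧
      pathChange (L.linkFun i) (N.loop f ζ) = 0 ∧ FreelyHomotopicIn L.carrierᶜ l (N.loop f ζ) ∧
      (t = 1 → N.loop f ζ = l) := by
  obtain ⟨hls, hlb, hlh, hln⟩ := hl
  have : Nonempty SolidTorus := ⟨(1, ⟨0, by simp⟩)⟩
  have hinv : ∀ p, Function.invFun h (h p) = p := Function.leftInverse_invFun hh.1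
  have hinvc : ContinuousOn (Function.invFun h) (Set.range h) :=
    continuousOn_range_of_comp (map_continuous h) continuous_id hinv
  choose p hp hpl using hlb
  have hpc : Continuous p := by
    have : p = fun x => Function.invFun h (l x) := funext fun x => by rw [← hpl, hinv]
    rw [this]
    exact hinvc.comp_continuous (map_continuous l) fun x => ⟨p x, hpl x⟩
  have hp0 : ∀ x, ((p x).2 : ℂ) ≠ 0 := fun x h0 => by
    have := hp x
    rw [h0, norm_zero] at this
    exact zero_ne_one this
  have hpcl : p 0 = p 1 := hh.1 (by rw [hpl, hpl, hls.1])
  have hs0 : ∀ c : I, c ≠ 0 → ∀ x, ((shrink (c, p x)).2 : ℂ) ≠ 0 := fun c hc x =>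
    smul_ne_zero (fun h0 => hc (Subtype.ext h0)) (hp0 x)
  let l' : C(I, S3) := ⟨fun x => h (shrink (t, p x)), by fun_prop⟩
  have hfree : FreelyHomotopicIn L.carrierᶜ l l' := by
    have hc : ∀ x : I, unitInterval.symm (x * unitInterval.symm t) ≠ 0 := by
      intro x h0
      have h1 := congrArg Subtype.val h0
      have h2 : 0 < (t : ℝ) := lt_of_le_of_ne t.2.1 fun h => ht (Subtype.ext h.symm)
      have h3 := x.2.2
      have h4 := t.2.2
      simp only [unitInterval.coe_symm_eq, Set.Icc.coe_mul, Set.Icc.coe_zero] at h1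
      nlinarith
    refine freelyHomotopicIn_of
      ⟨fun y => h (shrink (unitInterval.symm (y.1 * unitInterval.symm t), p y.2)), by fun_prop⟩
      (fun x => ?_) (fun x => ?_) (fun x => ?_) fun x y => hh.mem_compl_carrier (hs0 _ (hc x) y)
    · simp [shrink_one, hpl]
    · simp [l']
    · simp [hpcl]
  obtain ⟨A, W, hA, hW, hAW⟩ := thin.exists_coordinates
  have hdeg : pathChange A l' = 2 * Real.pi * Complex.I := by
    let G : S3 → ℂ := fun x => A (h (shrink (t, Function.invFun h x)))
    have hGc : ContinuousOn G (Set.range h) :=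
      continuousOn_range_of_comp (map_continuous h) (φ := fun q => A (h (shrink (t, q))))
        (hA.comp_continuous (by fun_prop) hT) fun q => by simp only [G, hinv]
    have hG0 : ∀ x ∈ Set.range h, G x ≠ 0 := by
      rintro _ ⟨q, rfl⟩
      obtain ⟨s, w, hw, hx⟩ := hT q
      simp only [G, hinv, ← hx, (hAW s w hw).1]
      exact Complex.exp_ne_zero _
    have h1 : pathChange A l' = pathChange G l := by
      unfold pathChange
      congr 1
      funext s
      simp only [G, ← hpl, hinv]
      rfl
    rw [h1, pathChange_of_homologous hGc hG0 hlh]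
    have hE : (L.period i : ℂ) ≠ 0 := by exact_mod_cast (L.period_pos i).ne'
    unfold pathChange
    rw [logChange_eq (f := fun s => s * (2 * Real.pi * Complex.I)) zero_le_one (by fun_prop)]
    · simp
    · intro s hs
      have hmem : L.componentLoop i ⟨s, hs⟩ ∈ L.component i := ⟨_, rfl⟩
      have hmem' := hmem
      rw [← hh.2.1] at hmem'
      obtain ⟨q, hq, hqx⟩ := hmem'
      rw [Set.projIcc_of_mem zero_le_one hs]
      simp only [G]
      rw [← hqx, hinv, shrink_core hq, hqx]
      have := (hAW (s * L.period i) 0 (by simpa using thin.pos.le)).1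
      rw [N.tube_zero] at this
      refine Eq.trans ?_ this.symm
      unfold timeAngle
      push_cast
      rw [mul_div_cancel_right₀ _ hE]
  obtain ⟨f, ζ, m, hf, hζ, hr, hloop⟩ := thin.exists_eq_loop hA hW hAW (l := l')
    (by simp [l', hpcl]) (fun x => hT _)
    (fun x hx => hs0 t ht x (hh.mem_component_iff.1 hx)) hdeg
  refine ⟨f, ζ, m, hf, hζ, hr, ?_, by rwa [hloop], fun h1 => ?_⟩
  · have hlink : ∀ x ∈ (L.component i)ᶜ, L.linkFun i x ≠ 0 := fun x hx => L.linkFun_ne_zero' hx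
    have hlink' : ∀ x ∈ L.carrierᶜ, L.linkFun i x ≠ 0 := fun x hx =>
      hlink x fun h => hx (Set.mem_iUnion.2 ⟨i, h⟩)
    rw [hloop, ← pathChange_of_freelyHomotopicIn (L.continuous_linkFun i).continuousOn hlink' hfree]
    exact pathChange_of_nullHomologous (L.continuous_linkFun i).continuousOn hlink hln
  · rw [hloop]
    ext1 x
    simp only [l', ContinuousMap.coe_mk, h1, shrink_one, hpl]

end PolyLink

end LinkProj
end
theorem lemma2p1 {n : ℕ} (L : LinkProj.PolyLink n) (hreg : L.IsRegular)
    (col : Set LinkProj.S3 → LinkProj.Colour) (hcol : L.IsCheckerboard col)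
    (i : Fin n) (halt : L.AlternatesAlong i) :
    (∀ (h : C(LinkProj.SolidTorus, LinkProj.S3)) (l : C(unitInterval, LinkProj.S3)),
      L.IsTube i h → L.IsLongitude i h l →
        ∃ J : C(unitInterval, LinkProj.S3), LinkProj.IsSimpleClosed J ∧ L.IsReadable J ∧
          L.WhiteBeforeBlack col J ∧ LinkProj.FreelyHomotopicIn L.carrierᶜ l J) ∧
    (∃ U : Set LinkProj.S3, IsOpen U ∧ L.component i ⊆ U ∧
      ∀ (h : C(LinkProj.SolidTorus, LinkProj.S3)) (l : C(unitInterval, LinkProj.S3)),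
        L.IsTube i h → Set.range h ⊆ U → L.IsLongitude i h l →
        l 0 ∉ LinkProj.projSphere → l 0 ∉ L.curtain →
          ∃ J : C(unitInterval, LinkProj.S3), LinkProj.IsSimpleClosed J ∧ L.IsReadable J ∧
            L.WhiteBeforeBlack col J ∧
            LinkProj.BasedHomotopicIn L.carrierᶜ (l 0) l J) := by
  obtain ⟨N⟩ := hreg.exists_transverseField i
  obtain ⟨g, r, thin⟩ := N.exists_isThin hreg
  obtain ⟨U, hU, hiU, hUT⟩ := N.exists_isOpen_subset_thickTube thin.pos
  refine ⟨fun h l hh hl => ?_, U, hU, hiU, fun h l hh hhU hl h1 h2 => ?_⟩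
  · obtain ⟨t, ht, htU⟩ := hh.exists_shrink hU hiU
    obtain ⟨f, ζ, m, hf, hζ, hr, hlink, hfree, -⟩ :=
      hl.exists_loop hh thin ht fun p => hUT (htU p)
    obtain ⟨J, hJ1, hJ2, hJ3, hJ4⟩ := (hreg.exists_readable hcol halt thin hf hζ hr hlink).2
    exact ⟨J, hJ1, hJ2, hJ3, hfree.trans hJ4⟩
  · obtain ⟨f, ζ, m, hf, hζ, hr, hlink, -, hloop⟩ :=
      hl.exists_loop hh thin one_ne_zero fun p => hUT (hhU ⟨_, rfl⟩)
    have := (hreg.exists_readable hcol halt thin hf hζ hr hlink).1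
    rw [hloop rfl] at this
    exact this h1 h2
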